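/- **Setting.** Let $0<\sigma<R$ and let $\Phi$ be an even pair potential with hard core $\sigma$ and finite range: $\Phi\in C^2((\sigma,\infty))$, $\Phi(q)=0$ for $|q|>R$, $\Phi(q)\to+\infty$ as $q\downarrow\sigma$. Particles on the line, with phase points $x_i=(q_i,p_i)$, are labelled from left to right by $-n_1,\dots,-1,1,\dots,n_2$; neighbours satisfy $\sigma+q_i<q_{i+1}$ ("allowed" configurations; all others are forbidden), and only neighbours interact, so that the energy is $\sum_i p_i^2/2+\sum_{(i,i+1)}\Phi(q_i-q_{i+1})$, where $i,i+1$ denote consecutive labels. Let $X(t,x)$ be the Hamiltonian flow and let $S^*_{n}(t)f(x)=f(X(-t,x))$ on allowed configurations and $0$ on forbidden ones; for a block $Z$ of consecutive particles, $S^*_{|Z|}(t,Z)$ is this operator for the isolated subsystem $Z$, acting on the variables of $Z$. For $s_1+s_2\ge1$ the cluster-particle cumulants are $$\mathfrak A_{1+n_1+n_2}(t)=\sum_{\mathrm P}(-1)^{|\mathrm P|-1}\prod_{Z\in \mathrm P}S^*_{|Z|}(t,Z),$$ where $\mathrm P$ runs over the partitions of $(-(n_1+s_1),\dots,s_2+n_2)$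 into nonempty consecutive blocks such that $\{-s_1,\dots,s_2\}$ lies in one block. $L^1_\alpha$ is the space of double sequences $f=\{f_{n_1+n_2}(x_{-n_1},\dots,x_{n_2})\}_{n_1,n_2\ge0}$ of integrable functions that vanish on forbidden configurations, with norm $\|f\|=\sum_{n_1,n_2}\alpha^{n_1+n_2}\int|f_{n_1+n_2}|<\infty$. The BBGKY hierarchy is, for $n_1+n_2\ge 1$, $$\frac{d}{dt}F_{n_1+n_2}=\mathcal L^*F_{n_1+n_2}+\int dx_{-(n_1+1)}\,\Phi'(q_{l}-q_{-(n_1+1)})\,\partial_{p_{l}}F_{(n_1+1)+n_2}+\int dx_{n_2+1}\,\Phi'(q_{r}-q_{n_2+1})\,\partial_{p_{r}}F_{n_1+(n_2+1)},$$ where $l$ and $r$ are the leftmost and the rightmost of the $n_1+n_2$ particles and $\mathcal L^*=-\sum_j p_j\partial_{q_j}+\sum_{(j,j+1)}\Phi'(q_j-q_{j+1})(\partial_{p_j}-\partial_{p_{j+1}})$; the component without particles is constant in time. A *weak solution* with initial data $F^0$ is a norm-continuous curve $F:\mathbb R\to L^1_\alpha$ with $F(0)=F^0$ and $\frac{d}{dt}(b,F(t))=(\mathcal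 B^+b,F(t))$ for all $t$ and all finite sequences $b$ of bounded $C^1$ functions on the allowed phase spaces for which $\mathcal B^+b$ is bounded; here $(b,F)=\sum_{n_1,n_2}\int b_{n_1+n_2}F_{n_1+n_2}$, $\mathcal B^+=\mathcal L+[\mathcal L,\mathfrak a^+_-]+[\mathcal L,\mathfrak a^+_+]$ is the adjoint of the right-hand side, $\mathcal L=-\mathcal L^*$, and $\mathfrak a^+_-$, $\mathfrak a^+_+$ forget the leftmost, respectively the rightmost, particle: $(\mathfrak a^+_-b)_{n_1+n_2}=b_{(n_1-1)+n_2}(x_{-(n_1-1)},\dots,x_{n_2})$ and $(\mathfrak a^+_+b)_{n_1+n_2}=b_{n_1+(n_2-1)}(x_{-n_1},\dots,x_{n_2-1})$ (and $0$ for $n_1=0$, respectively $n_2=0$). A *strong solution* is a curve of finite sequences of $C^1$ functions with compact supports in the allowed phase spaces for which the hierarchy holds pointwise and in the norm of $L^1_\alpha$. **Theorem.** Let $\alpha>2$. 1. For all $t\in\mathbb R$, $s_1+s_2\ge1$, $n_1,n_2\ge 0$, and all integrable $f$ that vanish on forbidden configurations, $\|\mathfrak A_{1+n_1+n_2}(t)f\|_{L^1}\le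 2^{n_1+n_2}\|f\|_{L^1}$. 2. Let $F^0\in L^1_\alpha$ (for instance a sequence of non-negative functions). Then the series $$F_{s_1+s_2}(t,x_{-s_1},\dots,x_{s_2})=\sum_{n_1,n_2\ge0}\int dx_{-(n_1+s_1)}\cdots dx_{-(s_1+1)}\,dx_{s_2+1}\cdots dx_{s_2+n_2}\;\mathfrak A_{1+n_1+n_2}(t)F^0_{n_1+s_1+s_2+n_2},\qquad s_1+s_2\ge1,$$ converges absolutely for almost all $(x_{-s_1},\dots,x_{s_2})$; together with the constant component without particles it belongs to $L^1_\alpha$ for all $t\in\mathbb R$, it satisfies $\|F(t)\|\le(1-\tfrac2\alpha)^{-2}\|F^0\|$, and it is the unique weak solution of the Cauchy problem for the BBGKY hierarchy with initial data $F^0$. 3. If $F^0$ is a finite sequence of continuously differentiable functions with compact supports in the allowed phase spaces, then this series is a strong solution, and the only one. -/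

import Mathlib

open MeasureTheory Filter Topology

noncomputable section

namespace TopologicalParticles

/-- The phase point `x = (q, p)` of one particle on the line. -/
abbrev Pt : Type := ℝ × ℝ

/-- Phase points of `n` particles listed from left to right.  For a system of `n₁ + n₂` particles with
labels `-n₁, …, -1, 1, …, n₂`, position `i < n₁` of the list is the particle `-(n₁ - i)` and
position `i ≥ n₁` is the particle `i - n₁ + 1`. -/
abbrev Phase (n : ℕ) : Type := Fin n → Pt

/-- Double sequences `f = {f_{n₁+n₂}(x_{-n₁}, …, x_{n₂})}` of functions. -/
abbrev DoubleSeq : Type := (n₁ n₂ : ℕ) → Phase (n₁ + n₂) → ℝ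

/-! ### The potential and the Hamiltonian dynamics -/

/-- Short-range pair potential (an even function of `q`) with a hard core of length `σ`: it is of class `C²`
at distances larger than `σ`, it vanishes at distances larger than `R`, and it becomes `+∞` at the
hard core. -/
structure IsPotential (σ R : ℝ) (Φ : ℝ → ℝ) : Prop where
  core_pos : 0 < σ
  core_lt : σ < R
  even : ∀ q, Φ (-q) = Φ q
  smooth : ContDiffOn ℝ 2 Φ (Set.Ioi σ)
  range : ∀ q, R < |q| → Φ q = 0
  core : Tendsto Φ (𝓝[>] σ) atTop

/-- The phase points with an allowed configuration: neighbours `i, i + 1` satisfy `σ + q_i < q_{i+1}`.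
(The configurations with a contact `σ + q_i = q_{i+1}` have infinite energy and form a null set.) -/
def Allowed (σ : ℝ) (n : ℕ) : Set (Phase n) :=
  {x | ∀ i j : Fin n, (i : ℕ) + 1 = j → σ + (x i).1 < (x j).1}

/-- The right-hand side of the Hamilton equations for the energy
`∑ p_i² / 2 + ∑ Φ(q_i - q_{i+1})`. -/
def hamiltonField (Φ : ℝ → ℝ) {n : ℕ} (x : Phase n) : Phase n := fun j =>
  ((x j).2,
    (∑ i : Fin n, if (i : ℕ) + 1 = j then deriv Φ ((x i).1 - (x j).1) else 0)
      - ∑ k : Fin n, if (j : ℕ) + 1 = k then deriv Φ ((x j).1 - (x k).1) else 0)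

/-- `γ` is a global solution of the Hamilton equations, inside the allowed phase space. -/
def IsTrajectory (σ : ℝ) (Φ : ℝ → ℝ) {n : ℕ} (γ : ℝ → Phase n) : Prop :=
  ∀ t, γ t ∈ Allowed σ n ∧ HasDerivAt γ (hamiltonField Φ (γ t)) t

open Classical in
/-- `flow σ Φ t x = X(t, x)`: the value at time `t` of the solution of the Hamilton equations with initial
data `x` (and `x` itself if there is no such solution, e.g. if `x` is forbidden). -/
def flow (σ : ℝ) (Φ : ℝ → ℝ) {n : ℕ} (t : ℝ) (x : Phase n) : Phase n :=
  if h : ∃ γ : ℝ → Phase n, IsTrajectory σ Φ γ ∧ γ 0 = x then Classical.choose h t else x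

/-! ### Groups of operators and their cumulants -/

/-- The operator `S*_{|X|}(t, X)` of the group of the Liouville equation for the subsystem `X` of `m` of the
`N` particles (those listed by `ι`), acting on functions of all `N` particles: the phase points of the
particles of `X` are transported along the dynamics of the isolated subsystem `X`, the others are
kept, and the result is `0` where the configuration of `X` is forbidden. -/
def groupOp (σ : ℝ) (Φ : ℝ → ℝ) {m N : ℕ} (ι : Fin m ↪o Fin N) (t : ℝ) (f : Phase N → ℝ) :
    Phase N → ℝ :=
  Set.indicator {x | (x ∘ ι) ∈ Allowed σ m}
    (fun x => f (Function.extend ι (flow σ Φ (-t) (x ∘ ι)) x))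

/-- `∏_{X_i ∈ P} S*_{|X_i|}(t, X_i)` for an ordered partition of the ordered set of `N` particles into
nonempty consecutive blocks. -/
def prodGroupOp (σ : ℝ) (Φ : ℝ → ℝ) {N : ℕ} (P : Composition N) (t : ℝ) (f : Phase N → ℝ) :
    Phase N → ℝ :=
  (List.finRange P.length).foldr (fun i g => groupOp σ Φ (P.embedding i) t g) f

/-- The ordered partitions of the particles `-(n₁+s₁), …, -(s₁+1), {-s₁, …, s₂}, s₂+1, …, s₂+n₂` in
which the cluster `{-s₁, …, s₂}` belongs entirely to one of the blocks. -/
def clusterPartitions (n₁ s₁ s₂ n₂ : ℕ) : Finset (Composition ((n₁ + s₁) + (s₂ + n₂))) :=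
  Finset.univ.filter fun P => ∀ i j : Fin ((n₁ + s₁) + (s₂ + n₂)),
    n₁ ≤ (i : ℕ) → (i : ℕ) < n₁ + (s₁ + s₂) → n₁ ≤ (j : ℕ) → (j : ℕ) < n₁ + (s₁ + s₂) →
      P.index i = P.index j

/-- The cumulant `𝔄_{1+n₁+n₂}(t, -(n₁+s₁), …, -(s₁+1), {-s₁, …, s₂}, s₂+1, …, s₂+n₂)`
of the groups of operators. -/
def cumulant (σ : ℝ) (Φ : ℝ → ℝ) (n₁ s₁ s₂ n₂ : ℕ) (t : ℝ)
    (f : Phase ((n₁ + s₁) + (s₂ + n₂)) → ℝ) : Phase ((n₁ + s₁) + (s₂ + n₂)) → ℝ :=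
  fun x => ∑ P ∈ clusterPartitions n₁ s₁ s₂ n₂, (-1 : ℝ) ^ (P.length - 1) * prodGroupOp σ Φ P t f x

/-! ### The space `L¹_α` -/

/-- Membership in `L¹_α`: the components are integrable, vanish on forbidden configurations, and the norm is
finite. -/
structure MemL1 (σ α : ℝ) (f : DoubleSeq) : Prop where
  integrable : ∀ n₁ n₂, Integrable (f n₁ n₂)
  forbidden : ∀ n₁ n₂, ∀ x ∉ Allowed σ (n₁ + n₂), f n₁ n₂ x = 0
  summable : Summable fun n : ℕ × ℕ => α ^ (n.1 + n.2) * ∫ x, |f n.1 n.2 x|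

/-- The norm of `L¹_α`. -/
def normL1 (α : ℝ) (f : DoubleSeq) : ℝ :=
  ∑' n : ℕ × ℕ, α ^ (n.1 + n.2) * ∫ x, |f n.1 n.2 x|

/-! ### The series -/

/-- The particle list `(y, x, z)`: particles `y` to the left and `z` to the right of `x`. -/
def join {n₁ s₁ s₂ n₂ : ℕ} (y : Phase n₁) (x : Phase (s₁ + s₂)) (z : Phase n₂) :
    Phase ((n₁ + s₁) + (s₂ + n₂)) :=
  fun i => Fin.append (Fin.append y x) z (Fin.cast (by omega) i)

/-- The integrand of the `(n₁, n₂)`-term of the series for the component `s₁ + s₂`, as a function of the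
additional particles. -/
def seriesIntegrand (σ : ℝ) (Φ : ℝ → ℝ) (F₀ : DoubleSeq) (t : ℝ) {s₁ s₂ : ℕ} (x : Phase (s₁ + s₂))
    (n₁ n₂ : ℕ) (w : Phase n₁ × Phase n₂) : ℝ :=
  cumulant σ Φ n₁ s₁ s₂ n₂ t (F₀ (n₁ + s₁) (s₂ + n₂)) (join w.1 x w.2)

/-- The sequence of reduced distribution functions given by the cumulant series for `s₁ + s₂ ≥ 1`; the
component without particles, a number, is constant in time. -/
def series (σ : ℝ) (Φ : ℝ → ℝ) (F₀ : DoubleSeq) (t : ℝ) : DoubleSeq := fun s₁ s₂ x =>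
  if s₁ + s₂ = 0 then F₀ s₁ s₂ x
  else ∑' n : ℕ × ℕ, ∫ w : Phase n.1 × Phase n.2, seriesIntegrand σ Φ F₀ t x n.1 n.2 w

/-! ### The BBGKY hierarchy -/

/-- `∂f/∂q_j` -/
def dq {n : ℕ} (j : Fin n) (f : Phase n → ℝ) (x : Phase n) : ℝ :=
  fderiv ℝ f x (Pi.single j ((1 : ℝ), (0 : ℝ)))

/-- `∂f/∂p_j` -/
def dp {n : ℕ} (j : Fin n) (f : Phase n → ℝ) (x : Phase n) : ℝ :=
  fderiv ℝ f x (Pi.single j ((0 : ℝ), (1 : ℝ)))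

/-- The Liouville operator `ℒ*_n = ∑ ℒ*(j) + ∑ ℒ*_int(j, j+1)`. -/
def liouvilleStar (Φ : ℝ → ℝ) {n : ℕ} (f : Phase n → ℝ) (x : Phase n) : ℝ :=
  (∑ j : Fin n, -((x j).2 * dq j f x))
    + ∑ i : Fin n, ∑ j : Fin n,
        if (i : ℕ) + 1 = j then deriv Φ ((x i).1 - (x j).1) * (dp i f x - dp j f x) else 0

/-- The phase point `(x_{-(n₁+1)}, x_{-n₁}, …, x_{n₂})`, with `y = x_{-(n₁+1)}`. -/
def addLeft {n₁ n₂ : ℕ} (y : Pt) (x : Phase (n₁ + n₂)) : Phase ((n₁ + 1) + n₂) :=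
  fun i => (Fin.cons y x : Phase (n₁ + n₂ + 1)) (Fin.cast (by omega) i)

/-- The phase point `(x_{-n₁}, …, x_{n₂}, x_{n₂+1})`, with `y = x_{n₂+1}`. -/
def addRight {n₁ n₂ : ℕ} (x : Phase (n₁ + n₂)) (y : Pt) : Phase (n₁ + (n₂ + 1)) :=
  fun i => (Fin.snoc x y : Phase (n₁ + n₂ + 1)) (Fin.cast (by omega) i)

/-- `([𝔞₋, ℒ*] F)_{n₁+n₂}`; it involves the leftmost of the `n₁ + n₂` particles and is `0` if there is
no particle. -/
def leftTerm (Φ : ℝ → ℝ) (F : DoubleSeq) : DoubleSeq := fun n₁ n₂ x =>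
  ∑ j : Fin (n₁ + n₂), if (j : ℕ) = 0 then
    ∫ y : Pt, deriv Φ ((x j).1 - y.1) *
      dp (Fin.cast (by omega) j.succ : Fin ((n₁ + 1) + n₂)) (F (n₁ + 1) n₂) (addLeft y x)
  else 0

/-- `([𝔞₊, ℒ*] F)_{n₁+n₂}`; it involves the rightmost of the `n₁ + n₂` particles and is `0` if there is
no particle. -/
def rightTerm (Φ : ℝ → ℝ) (F : DoubleSeq) : DoubleSeq := fun n₁ n₂ x =>
  ∑ j : Fin (n₁ + n₂), if (j : ℕ) + 1 = n₁ + n₂ then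
    ∫ y : Pt, deriv Φ ((x j).1 - y.1) *
      dp (Fin.cast (by omega) j.castSucc : Fin (n₁ + (n₂ + 1))) (F n₁ (n₂ + 1)) (addRight x y)
  else 0

/-- The right-hand side `ℒ*F + [𝔞₋, ℒ*]F + [𝔞₊, ℒ*]F` of the BBGKY hierarchy. -/
def bbgky (Φ : ℝ → ℝ) (F : DoubleSeq) : DoubleSeq := fun n₁ n₂ x =>
  liouvilleStar Φ (F n₁ n₂) x + leftTerm Φ F n₁ n₂ x + rightTerm Φ F n₁ n₂ x

/-! ### Strong solutions -/

/-- Finite sequences of continuously differentiable functions with compact supports in the allowed phase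
space. -/
structure FiniteSmooth (σ : ℝ) (f : DoubleSeq) : Prop where
  finite : {n : ℕ × ℕ | f n.1 n.2 ≠ 0}.Finite
  smooth : ∀ n₁ n₂, ContDiff ℝ 1 (f n₁ n₂)
  compact : ∀ n₁ n₂, HasCompactSupport (f n₁ n₂)
  support : ∀ n₁ n₂, tsupport (f n₁ n₂) ⊆ Allowed σ (n₁ + n₂)

/-- Strong (classical) solutions of the Cauchy problem for the BBGKY hierarchy: curves of finite sequences of
continuously differentiable functions with compact supports for which the equations hold pointwise
and in the norm of `L¹_α`. -/
structure IsStrongSolution (σ : ℝ) (Φ : ℝ → ℝ) (α : ℝ) (F₀ : DoubleSeq) (F : ℝ → DoubleSeq) :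
    Prop where
  smooth : ∀ t, FiniteSmooth σ (F t)
  initial : F 0 = F₀
  pointwise : ∀ t n₁ n₂ x, HasDerivAt (fun τ => F τ n₁ n₂ x) (bbgky Φ (F t) n₁ n₂ x) t
  norm : ∀ t, Tendsto (fun h : ℝ => normL1 α (h⁻¹ • (F (t + h) - F t) - bbgky Φ (F t)))
    (𝓝[≠] 0) (𝓝 0)

/-! ### Weak solutions -/

/-- The operator `𝔞⁺₋` adjoint to `𝔞₋`: it forgets the leftmost particle. -/
def creationLeft (b : DoubleSeq) : DoubleSeq
  | 0, _ => fun _ => 0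
  | n₁ + 1, n₂ => fun x => b n₁ n₂ fun i => x (Fin.cast (by omega) i.succ)

/-- The operator `𝔞⁺₊` adjoint to `𝔞₊`: it forgets the rightmost particle. -/
def creationRight (b : DoubleSeq) : DoubleSeq
  | _, 0 => fun _ => 0
  | n₁, n₂ + 1 => fun x => b n₁ n₂ fun i => x (Fin.cast (by omega) i.castSucc)

/-- The direct sum of the operators `ℒ = -ℒ*`. -/
def liouville (Φ : ℝ → ℝ) (b : DoubleSeq) : DoubleSeq := fun n₁ n₂ x =>
  -liouvilleStar Φ (b n₁ n₂) x

/-- The operator `ℒ + [ℒ, 𝔞⁺₋] + [ℒ, 𝔞⁺₊]` formally adjoint to the right-hand side of the BBGKY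
hierarchy. -/
def dualBbgky (Φ : ℝ → ℝ) (b : DoubleSeq) : DoubleSeq :=
  liouville Φ b
    + (liouville Φ (creationLeft b) - creationLeft (liouville Φ b))
    + (liouville Φ (creationRight b) - creationRight (liouville Φ b))

/-- The functional `(b, F) = ∑ ∫ b_{n₁+n₂} F_{n₁+n₂}`. -/
def pairing (b F : DoubleSeq) : ℝ := ∑' n : ℕ × ℕ, ∫ x, b n.1 n.2 x * F n.1 n.2 x

/-- Test sequences: finite sequences of bounded continuously differentiable functions on the allowed phase
space whose image under the adjoint operator is bounded, so that both `(b, F)` and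
`(dualBbgky Φ b, F)` are defined for every `F` in `L¹_α`. -/
structure IsTest (σ : ℝ) (Φ : ℝ → ℝ) (b : DoubleSeq) : Prop where
  finite : {n : ℕ × ℕ | b n.1 n.2 ≠ 0}.Finite
  smooth : ∀ n₁ n₂, ContDiffOn ℝ 1 (b n₁ n₂) (Allowed σ (n₁ + n₂))
  bounded : ∀ n₁ n₂, ∃ C : ℝ, ∀ x ∈ Allowed σ (n₁ + n₂), |b n₁ n₂ x| ≤ C
  dual_bounded : ∀ n₁ n₂, ∃ C : ℝ, ∀ x ∈ Allowed σ (n₁ + n₂), |dualBbgky Φ b n₁ n₂ x| ≤ C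

/-- Weak (generalized) solutions of the Cauchy problem for the BBGKY hierarchy: continuous curves in `L¹_α`
that satisfy the equations after pairing with an arbitrary test sequence. -/
structure IsWeakSolution (σ : ℝ) (Φ : ℝ → ℝ) (α : ℝ) (F₀ : DoubleSeq) (F : ℝ → DoubleSeq) :
    Prop where
  mem : ∀ t, MemL1 σ α (F t)
  initial : ∀ n₁ n₂, F 0 n₁ n₂ =ᵐ[volume] F₀ n₁ n₂
  continuous : ∀ t₀, Tendsto (fun t => normL1 α (F t - F t₀)) (𝓝 t₀) (𝓝 0)
  weak : ∀ b, IsTest σ Φ b → ∀ t,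
    HasDerivAt (fun τ => pairing b (F τ)) (pairing (dualBbgky Φ b) (F t)) t

end TopologicalParticles

end

open TopologicalParticles

/-! Let `𝔞₋` and `𝔞₊` be integration over the leftmost and over the rightmost particle. Everything
rests on one formula: the cumulant series is `F(t) = (1 - 𝔞₋)⁻¹ (1 - 𝔞₊)⁻¹ S(t) (1 - 𝔞₋)(1 - 𝔞₊)
F⁰`, where `S(t)` transports each component along its own Hamiltonian flow. So the change of unknown
`D = (1 - 𝔞₋)(1 - 𝔞₊) F` turns the hierarchy into decoupled Liouville equations. In the code these
operators are `reduceInv`, `transport` and `expand`, and the formula is `series_eq_expand`.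

Why the formula holds: in the integral over the additional particles, every block that does not
contain the cluster is a measure-preserving change of the integration variables and drops out
(`exists_blocksMap_cluster`). A term then depends only on the numbers `l₁`, `l₂` of particles left
out by the block of the cluster. For fixed `l₁`, `l₂` the signs sum over all subsets of the
remaining cuts, which gives zero unless `l₁, l₂ ≤ 1` (`sum_powerset_neg_one_pow_mul`). The four
surviving terms are those of `(1 - 𝔞₋)(1 - 𝔞₊)`.

Dynamics: energy conservation keeps neighbours away from the hard core, so near each allowed point
the motion agrees with the global flow of a Lipschitz `C¹` field whose force is continued linearly
across the core (`exists_flow_near`). Since the Liouville operator has zero integral on test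
functions, the flow preserves Lebesgue measure (`measurePreserving_flow`). Hence every product of
groups is an isometry of `L¹`, and the bound of the cumulant is the number `2 ^ (n₁ + n₂)` of
partitions.

Weak solutions: with the adjoints `𝔞⁺₋`, `𝔞⁺₊`, the operator `𝓑⁺` satisfies `𝓑⁺ (1 - 𝔞⁺₋)(1 - 𝔞⁺₊) =
(1 - 𝔞⁺₋)(1 - 𝔞⁺₊) ℒ` (`dualBbgky_creationInv`), because a commutator `[ℒ, 𝔞⁺]` is a force acting on
the outermost remaining particle only. Every test sequence is `(1 - 𝔞⁺₋)(1 - 𝔞⁺₊) c` with `c` and `ℒ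
c` bounded, which yields the weak equation. Conversely, for any weak solution the components of `D`
solve the Liouville equation weakly; testing with transported functions gives `D(t) = S(t) D(0)`,
hence uniqueness.

Strong solutions: for finite smooth data all sums are finite and can be differentiated under the
integral. The duality of the hierarchy with `𝓑⁺` carries the intertwining relation over to the
hierarchy itself (`FinSmooth.bbgky_expand`), and every strong solution is weak, hence unique. -/

namespace GlobalODE

/-! ### Global flows of Lipschitz `C¹` vector fields and their smooth dependence on the initial
point -/

open Set Metric
open scoped NNReal ContDiff Manifold

variable {E : Type*} [NormedAddCommGroup E] [NormedSpace ℝ E]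

/-- `ψ` is a global flow of the vector field `v`. -/
structure IsFlow (v : E → E) (ψ : ℝ → E → E) : Prop where
  zero : ∀ x, ψ 0 x = x
  deriv : ∀ t x, HasDerivAt (fun s => ψ s x) (v (ψ t x)) t

/-- On the ball of radius `‖v x‖ / K` about `x` the field is bounded by `2 ‖v x‖`, so
Picard–Lindelöf gives the existence time `1 / (2 K)`, the same for all `x`. This uniformity is what
makes solutions global. -/
theorem exists_local_solution [CompleteSpace E] {v : E → E} {K : ℝ≥0} (hK : 0 < K)
    (hv : LipschitzWith K v) (x : E) :
    ∃ γ : ℝ → E, γ 0 = x ∧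
      ∀ t ∈ Ioo (-(1 / (2 * K) : ℝ)) (1 / (2 * K)), HasDerivAt γ (v (γ t)) t := by
  have hK' : (0 : ℝ) < K := hK
  have hτ : (0 : ℝ) < 1 / (2 * K) := by positivity
  have key : IsPicardLindelof (fun _ => v) (tmin := -(1 / (2 * K) : ℝ)) (tmax := 1 / (2 * K))
      ⟨0, by constructor <;> linarith⟩ x (‖v x‖₊ / K) 0 (2 * ‖v x‖₊) K := by
    apply IsPicardLindelof.of_time_independent
    · intro y hy
      have h1 := hv.dist_le_mul y x
      rw [mem_closedBall] at hy
      have h2 : (K : ℝ) * dist y x ≤ ‖v x‖ := by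
        calc (K : ℝ) * dist y x ≤ K * (‖v x‖ / K) := by gcongr; simpa using hy
          _ = ‖v x‖ := by field_simp
      have h3 : ‖v y‖ ≤ ‖v y - v x‖ + ‖v x‖ := by
        simpa using norm_add_le (v y - v x) (v x)
      rw [dist_eq_norm] at h1
      push_cast
      linarith
    · exact hv.lipschitzOnWith
    · simp only [sub_zero, zero_sub, neg_neg, max_self]
      push_cast
      simp only [sub_zero]
      apply le_of_eq
      field_simp
  obtain ⟨γ, h0, hγ⟩ := key.exists_eq_forall_mem_Icc_hasDerivWithinAt₀
  exact ⟨γ, h0, fun t ht => (hγ t (Ioo_subset_Icc_self ht)).hasDerivAt (Icc_mem_nhds ht.1 ht.2)⟩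

/-- The space is regarded as a manifold over itself, where local integral curves of a uniform length
extend to global ones. -/
theorem exists_isFlow [CompleteSpace E] {v : E → E} {K : ℝ≥0} (hK : 0 < K)
    (hv : LipschitzWith K v) (hc : ContDiff ℝ 1 v) : ∃ ψ : ℝ → E → E, IsFlow v ψ := by
  have hK' : (0 : ℝ) < K := hK
  have hsec : ContMDiff 𝓘(ℝ, E) 𝓘(ℝ, E).tangent 1
      (fun x => (⟨x, v x⟩ : TangentBundle 𝓘(ℝ, E) E)) :=
    contMDiff_vectorSpace_iff_contDiff.2 hc
  have hloc : ∀ x : E, ∃ γ : ℝ → E, γ 0 = x ∧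
      IsMIntegralCurveOn (I := 𝓘(ℝ, E)) γ v (Ioo (-(1 / (2 * K) : ℝ)) (1 / (2 * K))) := by
    intro x
    obtain ⟨γ, h0, hγ⟩ := exists_local_solution hK hv x
    exact ⟨γ, h0, fun t ht => ((hγ t ht).hasFDerivAt.hasMFDerivAt).hasMFDerivWithinAt⟩
  choose γ h0 hγ using fun x : E =>
    exists_isMIntegralCurve_of_isMIntegralCurveOn (I := 𝓘(ℝ, E)) hsec
      (ε := 1 / (2 * K)) (by positivity) hloc x
  refine ⟨fun t x => γ x t, h0, fun t x => ?_⟩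
  have : HasFDerivAt (γ x) ((1 : ℝ →L[ℝ] ℝ).smulRight (v (γ x t)) : ℝ →L[ℝ] E) t :=
    (hγ x t).hasFDerivAt
  exact hasDerivAt_iff_hasFDerivAt.2 this

namespace IsFlow

variable {v : E → E} {ψ : ℝ → E → E} {K : ℝ≥0}

theorem eq_of_hasDerivAt (h : IsFlow v ψ) (hv : LipschitzWith K v) {γ : ℝ → E}
    (hγ : ∀ t, HasDerivAt γ (v (γ t)) t) (t : ℝ) : γ t = ψ t (γ 0) := by
  have := ODE_solution_unique_univ (v := fun _ => v) (s := fun _ => univ) (K := K)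
    (f := γ) (g := fun s => ψ s (γ 0)) (t₀ := 0) (fun _ => hv.lipschitzOnWith)
    (fun t => ⟨hγ t, trivial⟩) (fun t => ⟨h.deriv t _, trivial⟩) (h.zero _).symm
  exact congrFun this t

theorem add (h : IsFlow v ψ) (hv : LipschitzWith K v) (s t : ℝ) (x : E) :
    ψ (s + t) x = ψ s (ψ t x) := by
  have := h.eq_of_hasDerivAt hv (γ := fun s => ψ (s + t) x)
    (fun s => (h.deriv (s + t) x).comp_add_const s t) s
  simpa using this

theorem reverse (h : IsFlow v ψ) : IsFlow (fun x => -v x) (fun t => ψ (-t)) where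
  zero x := by simp [h.zero]
  deriv t x := by
    have := (h.deriv (-t) x).scomp t (hasDerivAt_neg t)
    simpa [Function.comp_def] using this

theorem continuous_time (h : IsFlow v ψ) (x : E) : Continuous fun t => ψ t x :=
  continuous_iff_continuousAt.2 fun t => (h.deriv t x).continuousAt

theorem dist_le (h : IsFlow v ψ) (hv : LipschitzWith K v) {t : ℝ} (ht : 0 ≤ t) (x y : E) :
    dist (ψ t x) (ψ t y) ≤ dist x y * Real.exp (K * t) := by
  have := dist_le_of_trajectories_ODE (v := fun _ => v) (K := K) (f := fun s => ψ s x)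
    (g := fun s => ψ s y) (a := 0) (b := t) (δ := dist x y) (fun _ => hv)
    (h.continuous_time x).continuousOn (fun s _ => (h.deriv s x).hasDerivWithinAt)
    (h.continuous_time y).continuousOn (fun s _ => (h.deriv s y).hasDerivWithinAt)
    (by simp [h.zero]) t ⟨ht, le_rfl⟩
  simpa using this

theorem dist_le' (h : IsFlow v ψ) (hv : LipschitzWith K v) (t : ℝ) (x y : E) :
    dist (ψ t x) (ψ t y) ≤ dist x y * Real.exp (K * |t|) := by
  rcases le_total 0 t with ht | ht
  · simpa [abs_of_nonneg ht] using h.dist_le hv ht x y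
  · have := h.reverse.dist_le hv.neg (t := -t) (by linarith) x y
    simpa [abs_of_nonpos ht] using this

theorem continuous (h : IsFlow v ψ) (hv : LipschitzWith K v) :
    Continuous fun p : ℝ × E => ψ p.1 p.2 := by
  rw [continuous_iff_continuousAt]
  rintro ⟨t, x⟩
  rw [ContinuousAt, tendsto_iff_dist_tendsto_zero]
  have hb : ∀ p : ℝ × E, dist (ψ p.1 p.2) (ψ t x) ≤
      dist p.2 x * Real.exp (K * |p.1|) + dist (ψ p.1 x) (ψ t x) := fun p =>
    (dist_triangle _ (ψ p.1 x) _).trans (add_le_add (h.dist_le' hv _ _ _) le_rfl)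
  refine squeeze_zero (fun _ => dist_nonneg) hb ?_
  have hc : Continuous fun p : ℝ × E =>
      dist p.2 x * Real.exp (K * |p.1|) + dist (ψ p.1 x) (ψ t x) := by
    have h1 : Continuous fun p : ℝ × E => ψ p.1 x := (h.continuous_time x).comp continuous_fst
    exact ((continuous_snd.dist continuous_const).mul (by fun_prop)).add
      (h1.dist continuous_const)
  simpa using hc.tendsto (t, x)

/-- The equation of variations along a trajectory, for short times. -/
theorem exists_variation [CompleteSpace E] (h : IsFlow v ψ) (hK : 0 < K) (hv : LipschitzWith K v)
    (hc : ContDiff ℝ 1 v) (x : E) :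
    ∃ Y : ℝ → E →L[ℝ] E, Y 0 = ContinuousLinearMap.id ℝ E ∧ ∀ t ∈ Icc (0 : ℝ) (1 / (2 * K)),
      HasDerivWithinAt Y ((fderiv ℝ v (ψ t x)).comp (Y t)) (Icc 0 (1 / (2 * K))) t := by
  have hK' : (0 : ℝ) < K := hK
  have hτ : (0 : ℝ) ≤ 1 / (2 * K) := by positivity
  have hA : ∀ t, ‖fderiv ℝ v (ψ t x)‖ ≤ K := fun t => norm_fderiv_le_of_lipschitz ℝ hv
  -- In the unit ball about the identity `‖Y‖ ≤ 2`, so the linear field is bounded by `2 K` and the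
  -- existence time is again `1 / (2 K)`.
  have key : IsPicardLindelof
      (fun t (Y : E →L[ℝ] E) => (fderiv ℝ v (ψ t x)).comp Y) (tmin := (0 : ℝ)) (tmax := 1 / (2 * K))
      ⟨0, ⟨le_rfl, hτ⟩⟩ (ContinuousLinearMap.id ℝ E) 1 0 (2 * K) K := by
    refine ⟨fun t _ => ?_, fun Y _ => ?_, fun t _ Y hY => ?_, ?_⟩
    · apply LipschitzOnWith.of_dist_le_mul
      intro Y _ Z _
      rw [dist_eq_norm, dist_eq_norm, ← ContinuousLinearMap.comp_sub]
      exact (ContinuousLinearMap.opNorm_comp_le _ _).trans (by gcongr; exact hA t)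
    · have h1 : Continuous fun t => fderiv ℝ v (ψ t x) :=
        (hc.continuous_fderiv one_ne_zero).comp (h.continuous_time x)
      exact (h1.clm_comp continuous_const).continuousOn
    · have h1 : ‖Y‖ ≤ 2 := by
        rw [mem_closedBall, dist_eq_norm] at hY
        have h2 : ‖Y‖ ≤ ‖Y - ContinuousLinearMap.id ℝ E‖ + ‖ContinuousLinearMap.id ℝ E‖ := by
          simpa using norm_add_le (Y - ContinuousLinearMap.id ℝ E) (ContinuousLinearMap.id ℝ E)
        have h3 := ContinuousLinearMap.norm_id_le (𝕜 := ℝ) (E := E)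
        push_cast at hY
        linarith
      calc ‖(fderiv ℝ v (ψ t x)).comp Y‖ ≤ ‖fderiv ℝ v (ψ t x)‖ * ‖Y‖ :=
            ContinuousLinearMap.opNorm_comp_le _ _
        _ ≤ K * 2 := by gcongr; exact hA t
        _ = ((2 * K : ℝ≥0) : ℝ) := by push_cast; ring
    · simp only [sub_zero, max_eq_left hτ]
      push_cast
      rw [sub_zero]
      apply le_of_eq
      field_simp
  exact key.exists_eq_forall_mem_Icc_hasDerivWithinAt₀

/-- The derivative is uniformly continuous near the compact set, and the mean value inequality on
balls turns this into a linearization with one `δ` for all centres. -/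
theorem exists_uniform_linearization (hc : ContDiff ℝ 1 v) {C : Set E} (hC : IsCompact C) {ε : ℝ}
    (hε : 0 < ε) : ∃ δ > 0, ∀ c ∈ C, ∀ y ∈ ball c δ, ∀ z ∈ ball c δ,
      ‖v y - v z - fderiv ℝ v c (y - z)‖ ≤ ε * ‖y - z‖ := by
  have h1 := hC.uniformContinuousAt_of_continuousAt (fderiv ℝ v)
    (fun a _ => (hc.continuous_fderiv one_ne_zero).continuousAt) (dist_mem_uniformity hε)
  obtain ⟨δ, hδ, h2⟩ := Metric.mem_uniformity_dist.1 h1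
  refine ⟨δ, hδ, fun c hc' y hy z hz => ?_⟩
  refine (convex_ball c δ).norm_image_sub_le_of_norm_fderiv_le' (𝕜 := ℝ) (f := v)
    (fun w _ => (hc.differentiable one_ne_zero) w) (fun w hw => ?_) hz hy
  have := h2 (a := c) (b := w) (by rw [dist_comm]; exact hw) hc'
  rw [← dist_eq_norm, dist_comm]
  exact le_of_lt this

/-- The difference of the trajectories from `y` and `z` solves the equation of variations up to an
error `ε` times itself, and Gronwall compares it with `Y s (y - z)`. Both points vary, so the
derivative obtained is strict. -/
theorem hasStrictFDerivAt_short [CompleteSpace E] (h : IsFlow v ψ) (hK : 0 < K)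
    (hv : LipschitzWith K v) (hc : ContDiff ℝ 1 v) {t : ℝ} (ht : t ∈ Icc (0 : ℝ) (1 / (2 * K)))
    (x : E) : ∃ Y : E →L[ℝ] E, HasStrictFDerivAt (ψ t) Y x := by
  have hK' : (0 : ℝ) < K := hK
  set τ : ℝ := 1 / (2 * K) with hτ
  obtain ⟨Y, hY0, hY⟩ := h.exists_variation hK hv hc x
  refine ⟨Y t, ?_⟩
  set C := (fun s => ψ s x) '' Icc 0 τ
  have hC : IsCompact C := isCompact_Icc.image (h.continuous_time x)
  have hA : ∀ s, LipschitzWith K (fderiv ℝ v (ψ s x)) := fun s =>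
    (fderiv ℝ v (ψ s x)).lipschitz.weaken (norm_fderiv_le_of_lipschitz ℝ hv)
  set M := Real.exp (K * τ) with hM
  have hM1 : 1 ≤ M := Real.one_le_exp (by positivity)
  refine .of_isLittleO (Asymptotics.isLittleO_iff.2 fun ε' hε' => ?_)
  -- One factor `M` bounds the spreading of trajectories and the other the Gronwall exponential,
  -- while Gronwall divides by `K`; with this choice the final bound is exactly `ε' * ‖y - z‖`.
  set ε := ε' * K / (M * M) with hε
  have hεpos : 0 < ε := by positivity
  obtain ⟨δ, hδ, hlin⟩ := exists_uniform_linearization hc hC hεpos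
  have hball : ball x (δ / M) ×ˢ ball x (δ / M) ∈ 𝓝 (x, x) :=
    prod_mem_nhds (ball_mem_nhds _ (by positivity)) (ball_mem_nhds _ (by positivity))
  filter_upwards [hball]
  rintro ⟨y, z⟩ ⟨hy, hz⟩
  simp only at hy hz ⊢
  have hexp : ∀ s ∈ Icc 0 τ, Real.exp (K * s) ≤ M := fun s hs => by
    rw [hM]; gcongr; exact hs.2
  have hnear : ∀ w ∈ ball x (δ / M), ∀ s ∈ Icc 0 τ, ψ s w ∈ ball (ψ s x) δ := by
    intro w hw s hs
    rw [mem_ball] at hw ⊢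
    calc dist (ψ s w) (ψ s x) ≤ dist w x * Real.exp (K * s) := h.dist_le hv hs.1 _ _
      _ ≤ dist w x * M := by gcongr; exact hexp s hs
      _ < δ / M * M := by gcongr
      _ = δ := by field_simp
  have hG := dist_le_of_approx_trajectories_ODE (v := fun s => fderiv ℝ v (ψ s x)) (K := K)
    (f := fun s => ψ s y - ψ s z) (g := fun s => Y s (y - z))
    (f' := fun s => v (ψ s y) - v (ψ s z)) (g' := fun s => fderiv ℝ v (ψ s x) (Y s (y - z)))
    (a := 0) (b := τ) (δ := 0) (εf := ε * (M * ‖y - z‖)) (εg := 0) hA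
    ((h.continuous_time y).sub (h.continuous_time z)).continuousOn
    (fun s _ => ((h.deriv s y).sub (h.deriv s z)).hasDerivWithinAt)
    (fun s hs => by
      have hs' : s ∈ Icc 0 τ := ⟨hs.1, hs.2.le⟩
      rw [dist_eq_norm]
      refine (hlin _ ⟨s, hs', rfl⟩ _ (hnear y hy s hs') _ (hnear z hz s hs')).trans ?_
      gcongr
      rw [← dist_eq_norm, ← dist_eq_norm]
      refine (h.dist_le hv hs.1 y z).trans ?_
      rw [mul_comm]
      gcongr
      exact hexp s hs')
    (fun s hs => ((hY s hs).clm_apply (hasDerivWithinAt_const s _ (y - z))).continuousWithinAt)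
    (fun s hs => by
      have h1 := (hY s ⟨hs.1, hs.2.le⟩).clm_apply (hasDerivWithinAt_const s _ (y - z))
      have h2 : HasDerivWithinAt (fun s => Y s (y - z)) _ (Ici s) s := h1.mono_of_mem_nhdsWithin
        (mem_of_superset (Icc_mem_nhdsGE hs.2) (Icc_subset_Icc_left hs.1))
      simpa using h2)
    (fun s _ => by simp) (by simp [h.zero, hY0]) t ht
  rw [dist_eq_norm, gronwallBound_of_K_ne_0 hK'.ne'] at hG
  refine hG.trans ?_
  have h1 : Real.exp (K * (t - 0)) - 1 ≤ M := by
    rw [sub_zero]; linarith [hexp t ht]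
  calc _ = (ε * (M * ‖y - z‖)) / K * (Real.exp (K * (t - 0)) - 1) := by ring
    _ ≤ (ε * (M * ‖y - z‖)) / K * M := by gcongr
    _ = ε' * ‖y - z‖ := by rw [hε]; field_simp

/-- Strict differentiability at `x` says that `f - Y x` has an arbitrarily small Lipschitz constant
near `x`. This constant bounds `Y y - Y x` for nearby `y`, so the derivative is continuous. -/
theorem _root_.contDiff_one_of_hasStrictFDerivAt {F : Type*} [NormedAddCommGroup F]
    [NormedSpace ℝ F] {f : E → F} (hf : ∀ x, ∃ Y : E →L[ℝ] F, HasStrictFDerivAt f Y x) :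
    ContDiff ℝ 1 f := by
  choose Y hY using hf
  refine contDiff_one_iff_hasFDerivAt.2 ⟨Y, ?_, fun x => (hY x).hasFDerivAt⟩
  rw [continuous_iff_continuousAt]
  intro x
  rw [ContinuousAt, tendsto_iff_norm_sub_tendsto_zero, Metric.tendsto_nhds]
  intro ε hε
  have h1 := (hY x).isLittleO.def (half_pos hε)
  rw [nhds_prod_eq] at h1
  obtain ⟨s, hs, h1⟩ := mem_prod_self_iff.1 h1
  filter_upwards [eventually_mem_nhds_iff.2 hs] with y hy
  have h2 : HasFDerivAt (fun z => f z - Y x z) (Y y - Y x) y :=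
    (hY y).hasFDerivAt.sub (Y x).hasFDerivAt
  have h3 : ‖Y y - Y x‖ ≤ ε / 2 := by
    refine h2.le_of_lip' (by positivity) ?_
    filter_upwards [hy] with z hz
    have := h1 (Set.mk_mem_prod hz (mem_of_mem_nhds hy))
    simp only [Set.mem_ofPred_eq, map_sub] at this
    have e : f z - Y x z - (f y - Y x y) = f z - f y - (Y x z - Y x y) := by abel
    simpa only [e] using this
  rw [dist_zero_right, norm_norm]
  linarith

/-- A long time is split into steps shorter than `1 / (2 K)`, and the flow is the composition of the
corresponding maps. Negative times are positive times of the reversed field. -/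
theorem contDiff [CompleteSpace E] (h : IsFlow v ψ) (hK : 0 < K) (hv : LipschitzWith K v)
    (hc : ContDiff ℝ 1 v) (t : ℝ) : ContDiff ℝ 1 (ψ t) := by
  wlog ht : 0 ≤ t generalizing v ψ t
  · have := this h.reverse hv.neg hc.neg (-t) (by linarith)
    simpa using this
  have hK' : (0 : ℝ) < K := hK
  obtain ⟨n, hn⟩ := exists_nat_gt (t * (2 * K))
  have hn0 : (0 : ℝ) < n := lt_of_le_of_lt (by positivity) hn
  have hshort : ContDiff ℝ 1 (ψ (t / n)) := by
    refine contDiff_one_of_hasStrictFDerivAt fun x => h.hasStrictFDerivAt_short hK hv hc ⟨?_, ?_⟩ x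
    · positivity
    · rw [div_le_div_iff₀ hn0 (by positivity)]; linarith
  have hiter : ∀ m : ℕ, ContDiff ℝ 1 (ψ (m * (t / n))) := by
    intro m
    induction m with
    | zero =>
      have h0 : ψ 0 = fun x => x := funext h.zero
      simpa [h0] using (contDiff_fun_id : ContDiff ℝ 1 fun x : E => x)
    | succ m ih =>
      have : ψ ((m + 1 : ℕ) * (t / n)) = ψ (t / n) ∘ ψ (m * (t / n)) := by
        funext x
        rw [Function.comp_apply, ← h.add hv]
        congr 1
        push_cast
        ring
      rw [this]
      exact hshort.comp ih
  have := hiter n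
  rwa [mul_div_cancel₀ _ hn0.ne'] at this

end IsFlow

end GlobalODE

/-! ### A regularized interaction that agrees with the given one outside a neighbourhood of the core
-/

namespace TopologicalParticles

open Set
open scoped NNReal

variable {σ R : ℝ} {Φ : ℝ → ℝ} {n : ℕ}

/-! ### Extension of the force across the hard core -/

theorem hasDerivAt_ite_le {f₁ f₂ d : ℝ → ℝ} {a : ℝ} (h₁ : ∀ r, a ≤ r → HasDerivAt f₁ (d r) r)
    (h₂ : ∀ r, r ≤ a → HasDerivAt f₂ (d r) r) (ha : f₁ a = f₂ a) (r : ℝ) :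
    HasDerivAt (fun s => if a ≤ s then f₁ s else f₂ s) (d r) r := by
  rcases lt_trichotomy r a with hr | rfl | hr
  · refine (h₂ r hr.le).congr_of_eventuallyEq ?_
    filter_upwards [Iio_mem_nhds hr] with s hs
    rw [if_neg (not_le.2 hs)]
  · rw [← hasDerivWithinAt_univ, ← Iic_union_Ici (a := r)]
    refine HasDerivWithinAt.union ?_ ?_
    · refine (h₂ r le_rfl).hasDerivWithinAt.congr (fun s hs => ?_) (by simp [ha])
      rcases eq_or_lt_of_le (show s ≤ r from hs) with rfl | hs
      · simp [ha]
      · rw [if_neg (not_le.2 hs)]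
    · exact (h₁ r le_rfl).hasDerivWithinAt.congr (fun s hs => if_pos hs) (by simp)
  · refine (h₁ r hr.le).congr_of_eventuallyEq ?_
    filter_upwards [Ioi_mem_nhds hr] with s hs
    rw [if_pos (le_of_lt hs)]

namespace IsPotential

theorem deriv_neg (h : IsPotential σ R Φ) (r : ℝ) : deriv Φ (-r) = -deriv Φ r := by
  have h1 : (fun q => Φ (-q)) = Φ := funext h.even
  have h2 := deriv_comp_neg Φ r
  rw [h1] at h2
  linarith

theorem eq_zero_of_lt (h : IsPotential σ R Φ) {r : ℝ} (hr : R < r) : Φ r = 0 :=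
  h.range r (hr.trans_le (le_abs_self r))

theorem deriv_eq_zero_of_lt (h : IsPotential σ R Φ) {r : ℝ} (hr : R < r) : deriv Φ r = 0 := by
  have : Φ =ᶠ[𝓝 r] fun _ => 0 := by
    filter_upwards [Ioi_mem_nhds hr] with s hs using h.eq_zero_of_lt hs
  rw [this.deriv_eq, deriv_const]

theorem hasDerivAt (h : IsPotential σ R Φ) {r : ℝ} (hr : σ < r) : HasDerivAt Φ (deriv Φ r) r :=
  ((h.smooth.differentiableOn (by norm_num)).differentiableAt (Ioi_mem_nhds hr)).hasDerivAt

theorem contDiffOn_deriv (h : IsPotential σ R Φ) : ContDiffOn ℝ 1 (deriv Φ) (Ioi σ) :=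
  h.smooth.deriv_of_isOpen isOpen_Ioi (by norm_num)

theorem bounded_below (h : IsPotential σ R Φ) : ∃ m, 0 ≤ m ∧ ∀ r, σ < r → -m ≤ Φ r := by
  have h1 := h.core.eventually (eventually_ge_atTop 0)
  obtain ⟨ρ, hρ, h2⟩ := (mem_nhdsGT_iff_exists_Ioc_subset).1 h1
  have hc : ContinuousOn Φ (Icc ρ (R + 1)) :=
    h.smooth.continuousOn.mono fun x hx => lt_of_lt_of_le hρ hx.1
  obtain ⟨b, hb⟩ := isCompact_Icc.bddBelow_image hc
  refine ⟨|b|, abs_nonneg b, fun r hr => ?_⟩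
  rcases le_total r ρ with h3 | h3
  · have : (0 : ℝ) ≤ Φ r := h2 ⟨hr, h3⟩
    linarith [abs_nonneg b]
  · rcases le_total r (R + 1) with h4 | h4
    · have := hb ⟨r, ⟨h3, h4⟩, rfl⟩
      linarith [neg_abs_le b]
    · rw [h.eq_zero_of_lt (by linarith)]
      linarith [abs_nonneg b]

/-- A point close to the hard core at which the force has its most repulsive value among all larger
distances. -/
theorem exists_repulsive_point (h : IsPotential σ R Φ) (c : ℝ) :
    ∃ r₀, σ < r₀ ∧ (∀ r, σ < r → r ≤ r₀ → c < Φ r) ∧ deriv Φ r₀ ≤ 0 ∧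
      ∀ r, r₀ ≤ r → deriv Φ r₀ ≤ deriv Φ r := by
  have h1 := h.core.eventually (eventually_gt_atTop c)
  obtain ⟨r₁', hr₁', h2'⟩ := (mem_nhdsGT_iff_exists_Ioc_subset).1 h1
  set r₁ := min r₁' R with hr₁def
  have hr₁ : σ < r₁ := lt_min hr₁' h.core_lt
  have hr₁R : r₁ ≤ R := min_le_right _ _
  have h2 : ∀ r, σ < r → r ≤ r₁ → c < Φ r := fun r hr hr' =>
    h2' ⟨hr, hr'.trans (min_le_left _ _)⟩
  have hcont : ContinuousOn (deriv Φ) (Ioi σ) := h.contDiffOn_deriv.continuousOn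
  obtain ⟨b, hb⟩ := isCompact_Icc.bddBelow_image
    (hcont.mono fun x (hx : x ∈ Icc r₁ (R + 1)) => lt_of_lt_of_le hr₁ hx.1)
  -- A value of `Φ` this large at `ρ'` forces, by the mean value theorem, a slope below `-|b| ≤ b`
  -- at some `ρ < r₁`. As `b` bounds the derivative from below on `[r₁, R + 1]`, the minimum of the
  -- derivative over `[ρ, R + 1]` is attained to the left of `r₁`.
  have h3 := h.core.eventually (eventually_gt_atTop (Φ r₁ + (|b| + 1) * (r₁ - σ)))
  obtain ⟨ρ', ⟨hρ'1, hρ'2⟩, hρ'3⟩ : ∃ ρ', ρ' ∈ Ioo σ r₁ ∧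
      Φ r₁ + (|b| + 1) * (r₁ - σ) < Φ ρ' :=
    ((show ∀ᶠ x in 𝓝[>] σ, x ∈ Ioo σ r₁ from Ioo_mem_nhdsGT hr₁).and h3).exists
  obtain ⟨ρ, hρ, hρd⟩ := exists_deriv_eq_slope Φ hρ'2
    (h.smooth.continuousOn.mono fun x hx => lt_of_lt_of_le hρ'1 hx.1)
    (fun x hx => (h.hasDerivAt (hρ'1.trans hx.1)).differentiableAt.differentiableWithinAt)
  have hρσ : σ < ρ := hρ'1.trans hρ.1
  have hρb : deriv Φ ρ < b := by
    have h4 : deriv Φ ρ < -|b| := by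
      rw [hρd, div_lt_iff₀ (by linarith)]
      nlinarith [abs_nonneg b, mul_nonneg (abs_nonneg b) (sub_nonneg.2 hρ'1.le)]
    linarith [neg_abs_le b]
  obtain ⟨r₀, hr₀, hmin⟩ := isCompact_Icc.exists_isMinOn
    (nonempty_Icc.2 (by linarith [hρ.2] : ρ ≤ R + 1))
    (hcont.mono fun x (hx : x ∈ Icc ρ (R + 1)) => lt_of_lt_of_le hρσ hx.1)
  have hle : ∀ r, ρ ≤ r → r ≤ R + 1 → deriv Φ r₀ ≤ deriv Φ r := fun r h5 h6 => hmin ⟨h5, h6⟩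
  have hr₀lt : r₀ < r₁ := by
    by_contra hcon
    have := hb ⟨r₀, ⟨not_lt.1 hcon, hr₀.2⟩, rfl⟩
    linarith [hle ρ le_rfl (by linarith [hρ.2])]
  have hR1 : deriv Φ (R + 1) = 0 := h.deriv_eq_zero_of_lt (by linarith)
  have hneg : deriv Φ r₀ ≤ 0 := hR1 ▸ hle (R + 1) (by linarith [hρ.2]) le_rfl
  refine ⟨r₀, lt_of_lt_of_le hρσ hr₀.1, fun r hr hr' => h2 r hr (by linarith), hneg, fun r hr => ?_⟩
  rcases le_total r (R + 1) with h4 | h4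
  · exact hle r (hr₀.1.trans hr) h4
  · rw [h.deriv_eq_zero_of_lt (by linarith : R < r)]
    exact hneg

/-- Below `r₀` the potential is continued by its second-order Taylor polynomial at `r₀`. There the
slope is nonpositive, and the curvature `k` is nonnegative because the derivative of `Φ` is minimal
at `r₀` among larger distances. So the polynomial grows towards smaller distances and stays above
the barrier `c`, while its derivative is linear and hence Lipschitz. -/
theorem exists_extension (h : IsPotential σ R Φ) {m : ℝ} (hm : ∀ r, σ < r → -m ≤ Φ r) {c : ℝ}
    (hc : -m ≤ c) :
    ∃ (r₀ : ℝ) (g φ : ℝ → ℝ) (K : ℝ≥0), σ < r₀ ∧ ContDiff ℝ 1 g ∧ LipschitzWith K g ∧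
      (∀ r, HasDerivAt φ (g r) r) ∧ (∀ r, r₀ ≤ r → φ r = Φ r ∧ g r = deriv Φ r) ∧
      (∀ r, r ≤ r₀ → c < φ r) ∧ (∀ r, σ < r → r ≤ r₀ → c < Φ r) ∧ ∀ r, -m ≤ φ r := by
  obtain ⟨r₀, hr₀, hcΦ, hneg, hmin⟩ := h.exists_repulsive_point c
  have hG : ContDiffOn ℝ 1 (deriv Φ) (Ioi σ) := h.contDiffOn_deriv
  have hG' : ContinuousOn (deriv (deriv Φ)) (Ioi σ) :=
    hG.continuousOn_deriv_of_isOpen isOpen_Ioi le_rfl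
  have hGd : ∀ r, σ < r → HasDerivAt (deriv Φ) (deriv (deriv Φ) r) r := fun r hr =>
    ((hG.differentiableOn one_ne_zero).differentiableAt (Ioi_mem_nhds hr)).hasDerivAt
  set k := deriv (deriv Φ) r₀ with hk
  have hkpos : 0 ≤ k := by
    have h1 : Tendsto (slope (deriv Φ) r₀) (𝓝[>] r₀) (𝓝 k) :=
      (hasDerivAt_iff_tendsto_slope.1 (hGd r₀ hr₀)).mono_left
        (nhdsWithin_mono _ fun x hx => ne_of_gt hx)
    refine ge_of_tendsto h1 ?_
    filter_upwards [self_mem_nhdsWithin] with r hr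
    rw [slope_def_field]
    exact div_nonneg (sub_nonneg.2 (hmin r (le_of_lt hr))) (sub_nonneg.2 (le_of_lt hr))
  set d : ℝ → ℝ := fun r => deriv (deriv Φ) (max r r₀) with hd
  set g : ℝ → ℝ := fun r => if r₀ ≤ r then deriv Φ r else deriv Φ r₀ + k * (r - r₀) with hg
  set φ : ℝ → ℝ := fun r => if r₀ ≤ r then Φ r else
    Φ r₀ + deriv Φ r₀ * (r - r₀) + k / 2 * (r - r₀) ^ 2 with hφ
  have hgd : ∀ r, HasDerivAt g (d r) r := by
    refine hasDerivAt_ite_le (fun r hr => ?_) (fun r hr => ?_) (by simp)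
    · rw [hd]; simp only [max_eq_left hr]
      exact hGd r (hr₀.trans_le hr)
    · rw [hd]; simp only [max_eq_right hr]
      have := (((hasDerivAt_id r).sub_const r₀).const_mul k).const_add (deriv Φ r₀)
      simpa using this
  have hφd : ∀ r, HasDerivAt φ (g r) r := by
    refine hasDerivAt_ite_le (fun r hr => ?_) (fun r hr => ?_) (by simp)
    · rw [hg]; simp only [if_pos hr]
      exact h.hasDerivAt (hr₀.trans_le hr)
    · have e : g r = deriv Φ r₀ * 1 + k / 2 * (2 * (r - r₀)) := by
        rw [hg]
        rcases eq_or_lt_of_le hr with rfl | hr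
        · simp
        · simp only [if_neg (not_le.2 hr)]; ring
      rw [e]
      have h1 := (((hasDerivAt_id r).sub_const r₀).const_mul (deriv Φ r₀)).const_add (Φ r₀)
      have h2 := (((hasDerivAt_id r).sub_const r₀).pow 2).const_mul (k / 2)
      simpa using h1.fun_add h2
  have hdc : Continuous d := by
    rw [hd]
    exact hG'.comp_continuous (by fun_prop) fun r => lt_of_lt_of_le hr₀ (le_max_right _ _)
  have hgderiv : deriv g = d := funext fun r => (hgd r).deriv
  have hgC : ContDiff ℝ 1 g := by
    rw [contDiff_one_iff_deriv]
    exact ⟨fun r => (hgd r).differentiableAt, hgderiv ▸ hdc⟩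
  obtain ⟨B, hB⟩ := (isCompact_Icc (a := r₀) (b := R + 1)).exists_bound_of_continuousOn
    (hG'.mono fun x hx => lt_of_lt_of_le hr₀ hx.1)
  have hdB : ∀ r, ‖d r‖ ≤ |B| := by
    intro r
    rcases le_total (max r r₀) (R + 1) with h1 | h1
    · exact (hB _ ⟨le_max_right _ _, h1⟩).trans (le_abs_self B)
    · have : deriv Φ =ᶠ[𝓝 (max r r₀)] fun _ => 0 := by
        filter_upwards [Ioi_mem_nhds (by linarith : R < max r r₀)] with s hs
        exact h.deriv_eq_zero_of_lt hs
      rw [hd]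
      simp only [this.deriv_eq, deriv_const, norm_zero]
      exact abs_nonneg B
  have hlip : LipschitzWith ‖B‖₊ g :=
    lipschitzWith_of_nnnorm_deriv_le (fun r => (hgd r).differentiableAt) fun r => by
      rw [hgderiv, ← NNReal.coe_le_coe]
      simpa using hdB r
  have hφc : ∀ r, r ≤ r₀ → c < φ r := by
    intro r hr
    rw [hφ]
    rcases eq_or_lt_of_le hr with rfl | hr
    · simpa using hcΦ r hr₀ le_rfl
    · simp only [if_neg (not_le.2 hr)]
      have := hcΦ r₀ hr₀ le_rfl
      nlinarith [mul_nonneg_of_nonpos_of_nonpos hneg (sub_nonpos.2 hr.le),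
        mul_nonneg hkpos (sq_nonneg (r - r₀))]
  refine ⟨r₀, g, φ, _, hr₀, hgC, hlip, hφd, fun r hr => ?_, hφc, hcΦ, fun r => ?_⟩
  · simp [hφ, hg, hr]
  · rcases le_total r r₀ with hr | hr
    · exact hc.trans (hφc r hr).le
    · rw [hφ]; simp only [if_pos hr]
      exact hm r (hr₀.trans_le hr)

end IsPotential

/-! ### The energy -/

/-- The vector field of neighbours interacting with the force `g`, a function of the distance. -/
noncomputable def bondField (g : ℝ → ℝ) (x : Phase n) : Phase n := fun j =>
  ((x j).2, (∑ k : Fin n, if (j : ℕ) + 1 = k then g ((x k).1 - (x j).1) else 0)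
    - ∑ i : Fin n, if (i : ℕ) + 1 = j then g ((x j).1 - (x i).1) else 0)

/-- The energy of neighbours interacting with the potential `φ`. -/
noncomputable def energy (φ : ℝ → ℝ) (x : Phase n) : ℝ :=
  (∑ j : Fin n, (x j).2 ^ 2 / 2)
    + ∑ i : Fin n, ∑ j : Fin n, if (i : ℕ) + 1 = j then φ ((x j).1 - (x i).1) else 0

theorem hamiltonField_eq_bondField (h : IsPotential σ R Φ) (x : Phase n) :
    hamiltonField Φ x = bondField (deriv Φ) x := by
  funext j
  have e : ∀ a b : ℝ, deriv Φ (a - b) = -deriv Φ (b - a) := fun a b => by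
    rw [← h.deriv_neg]; congr 1; ring
  simp only [hamiltonField, bondField, Prod.mk.injEq, true_and]
  have h1 : ∀ i : Fin n, (if (i : ℕ) + 1 = j then deriv Φ ((x i).1 - (x j).1) else 0)
      = -(if (i : ℕ) + 1 = j then deriv Φ ((x j).1 - (x i).1) else 0) := fun i => by
    split_ifs <;> simp [e (x i).1]
  have h2 : ∀ k : Fin n, (if (j : ℕ) + 1 = k then deriv Φ ((x j).1 - (x k).1) else 0)
      = -(if (j : ℕ) + 1 = k then deriv Φ ((x k).1 - (x j).1) else 0) := fun k => by
    split_ifs <;> simp [e (x j).1]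
  simp only [h1, h2, Finset.sum_neg_distrib]
  ring

theorem hasDerivAt_coord {γ : ℝ → Phase n} {v : Phase n} {t : ℝ} (h : HasDerivAt γ v t)
    (j : Fin n) : HasDerivAt (fun s => (γ s j).1) (v j).1 t ∧
      HasDerivAt (fun s => (γ s j).2) (v j).2 t := by
  have h1 := (hasDerivAt_pi.1 h) j
  exact ⟨(ContinuousLinearMap.fst ℝ ℝ ℝ).hasFDerivAt.comp_hasDerivAt t h1,
    (ContinuousLinearMap.snd ℝ ℝ ℝ).hasFDerivAt.comp_hasDerivAt t h1⟩

theorem energy_eq_of_hasDerivAt {g φ : ℝ → ℝ} {γ : ℝ → Phase n}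
    (hγ : ∀ t, HasDerivAt γ (bondField g (γ t)) t)
    (hφ : ∀ t, ∀ i j : Fin n, (i : ℕ) + 1 = j →
      HasDerivAt φ (g ((γ t j).1 - (γ t i).1)) ((γ t j).1 - (γ t i).1)) (t : ℝ) :
    energy φ (γ t) = energy φ (γ 0) := by
  have key : ∀ t, HasDerivAt (fun s => energy φ (γ s)) 0 t := by
    intro t
    have h1 : HasDerivAt (fun s => ∑ j : Fin n, (γ s j).2 ^ 2 / 2)
        (∑ j : Fin n, (γ t j).2 * (bondField g (γ t) j).2) t := by
      refine HasDerivAt.fun_sum fun j _ => ?_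
      refine ((((hasDerivAt_coord (hγ t) j).2).fun_pow 2).div_const 2).congr_deriv ?_
      push_cast
      ring
    have h2 : HasDerivAt (fun s => ∑ i : Fin n, ∑ j : Fin n,
        if (i : ℕ) + 1 = j then φ ((γ s j).1 - (γ s i).1) else 0)
        (∑ i : Fin n, ∑ j : Fin n, if (i : ℕ) + 1 = j then
          g ((γ t j).1 - (γ t i).1) * ((γ t j).2 - (γ t i).2) else 0) t := by
      refine HasDerivAt.fun_sum fun i _ => HasDerivAt.fun_sum fun j _ => ?_
      by_cases hij : (i : ℕ) + 1 = j
      · simp only [if_pos hij]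
        exact (hφ t i j hij).comp t
          ((hasDerivAt_coord (hγ t) j).1.sub (hasDerivAt_coord (hγ t) i).1)
      · simp only [if_neg hij]
        exact hasDerivAt_const t 0
    refine (h1.fun_add h2).congr_deriv ?_
    simp only [bondField, mul_sub, Finset.mul_sum, Finset.sum_sub_distrib]
    rw [Finset.sum_comm (f := fun j i : Fin n =>
      (γ t j).2 * if (i : ℕ) + 1 = j then g ((γ t j).1 - (γ t i).1) else 0),
      ← Finset.sum_sub_distrib, ← Finset.sum_add_distrib, Finset.sum_eq_zero]
    intro i _
    rw [← Finset.sum_sub_distrib, ← Finset.sum_add_distrib, Finset.sum_eq_zero]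
    intro j _
    split_ifs <;> ring
  exact is_const_of_deriv_eq_zero (fun t => (key t).differentiableAt) (fun t => (key t).deriv) t 0

/-- Adding `m` to each of the `n * n` entries of the double sum, including the zero entries, makes
all of them nonnegative, so one bond is bounded by the whole sum. The kinetic energy is nonnegative.
-/
theorem bond_le_energy {φ : ℝ → ℝ} {m : ℝ} (hm0 : 0 ≤ m) {x : Phase n}
    (hm : ∀ i j : Fin n, (i : ℕ) + 1 = j → -m ≤ φ ((x j).1 - (x i).1)) {i j : Fin n}
    (hij : (i : ℕ) + 1 = j) : φ ((x j).1 - (x i).1) ≤ energy φ x + n * (n * m) := by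
  have h1 : ∀ i j : Fin n, 0 ≤ (if (i : ℕ) + 1 = j then φ ((x j).1 - (x i).1) else 0) + m := by
    intro i j
    split_ifs with h
    · linarith [hm i j h]
    · linarith
  have h2 : φ ((x j).1 - (x i).1) + m ≤
      ∑ i : Fin n, ∑ j : Fin n, ((if (i : ℕ) + 1 = j then φ ((x j).1 - (x i).1) else 0) + m) := by
    refine le_trans ?_ (Finset.single_le_sum (f := fun i : Fin n => ∑ j : Fin n,
      ((if (i : ℕ) + 1 = j then φ ((x j).1 - (x i).1) else 0) + m))
      (fun i _ => Finset.sum_nonneg fun j _ => h1 i j) (Finset.mem_univ i))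
    refine le_trans ?_ (Finset.single_le_sum (f := fun j : Fin n =>
      ((if (i : ℕ) + 1 = j then φ ((x j).1 - (x i).1) else 0) + m))
      (fun j _ => h1 i j) (Finset.mem_univ j))
    simp [hij]
  simp only [Finset.sum_add_distrib, Finset.sum_const, Finset.card_univ, Fintype.card_fin,
    nsmul_eq_mul] at h2
  have h3 : 0 ≤ ∑ j : Fin n, (x j).2 ^ 2 / 2 := Finset.sum_nonneg fun j _ => by positivity
  rw [energy]
  linarith

theorem contDiff_bondField {g : ℝ → ℝ} (hg : ContDiff ℝ 1 g) :
    ContDiff ℝ 1 (bondField g : Phase n → Phase n) := by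
  rw [contDiff_pi]
  intro j
  have hq : ∀ k : Fin n, ContDiff ℝ 1 fun x : Phase n => (x k).1 := fun k =>
    contDiff_fst.comp (contDiff_apply ℝ Pt k)
  refine ContDiff.prodMk (contDiff_snd.comp (contDiff_apply ℝ Pt j)) (ContDiff.sub ?_ ?_)
  · refine ContDiff.sum fun k _ => ?_
    split_ifs
    · exact hg.comp ((hq k).sub (hq j))
    · exact contDiff_const
  · refine ContDiff.sum fun k _ => ?_
    split_ifs
    · exact hg.comp ((hq j).sub (hq k))
    · exact contDiff_const

theorem lipschitzWith_bondField {g : ℝ → ℝ} {K : ℝ≥0} (hg : LipschitzWith K g) :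
    LipschitzWith (1 + (n * (K * 2) + n * (K * 2))) (bondField g : Phase n → Phase n) := by
  refine LipschitzWith.of_dist_le_mul fun x y => ?_
  rw [dist_pi_le_iff (by positivity)]
  intro j
  have hd : ∀ k, dist (x k) (y k) ≤ dist x y := dist_le_pi_dist x y
  have h1 : ∀ k, |(x k).1 - (y k).1| ≤ dist x y := fun k =>
    (by rw [← Real.dist_eq]; exact (le_max_left _ _ : dist (x k).1 (y k).1 ≤ dist (x k) (y k))
      : _ ≤ dist (x k) (y k)).trans (hd k)
  have h2 : ∀ k, |(x k).2 - (y k).2| ≤ dist x y := fun k =>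
    (by rw [← Real.dist_eq]; exact (le_max_right _ _ : dist (x k).2 (y k).2 ≤ dist (x k) (y k))
      : _ ≤ dist (x k) (y k)).trans (hd k)
  have hD : 0 ≤ dist x y := dist_nonneg
  have hgd : ∀ a b, |g a - g b| ≤ K * |a - b| := fun a b => by
    simpa [Real.dist_eq] using hg.dist_le_mul a b
  have hgk : ∀ k l, |g ((x k).1 - (x l).1) - g ((y k).1 - (y l).1)| ≤ K * 2 * dist x y := by
    intro k l
    refine (hgd _ _).trans ?_
    rw [mul_assoc]
    gcongr
    calc |(x k).1 - (x l).1 - ((y k).1 - (y l).1)|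
        = |((x k).1 - (y k).1) - ((x l).1 - (y l).1)| := by congr 1; ring
      _ ≤ |(x k).1 - (y k).1| + |(x l).1 - (y l).1| := abs_sub _ _
      _ ≤ 2 * dist x y := by linarith [h1 k, h1 l]
  have hs : ∀ (P : Fin n → Prop) [DecidablePred P] (a b : Fin n → Fin n),
      |(∑ k, if P k then g ((x (a k)).1 - (x (b k)).1) else 0)
        - ∑ k, if P k then g ((y (a k)).1 - (y (b k)).1) else 0| ≤ n * (K * 2 * dist x y) := by
    intro P _ a b
    rw [← Finset.sum_sub_distrib]
    refine (Finset.abs_sum_le_sum_abs _ _).trans ?_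
    refine (Finset.sum_le_card_nsmul _ _ (K * 2 * dist x y) fun k _ => ?_).trans (by simp)
    split_ifs
    · exact hgk _ _
    · simpa using by positivity
  rw [Prod.dist_eq, max_le_iff]
  constructor
  · rw [Real.dist_eq]
    refine (h2 j).trans ?_
    push_cast
    nlinarith [mul_nonneg (by positivity : (0 : ℝ) ≤ n * (K * 2) + n * (K * 2)) hD]
  · rw [Real.dist_eq]
    simp only [bondField]
    have e1 := hs (fun k => (j : ℕ) + 1 = k) (fun k => k) (fun _ => j)
    have e2 := hs (fun k => (k : ℕ) + 1 = j) (fun _ => j) (fun k => k)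
    rw [sub_sub_sub_comm]
    refine (abs_sub _ _).trans ?_
    push_cast
    nlinarith
end TopologicalParticles

/-! ### Global existence, uniqueness and smoothness of the Hamiltonian motion -/

namespace TopologicalParticles

open Set
open scoped NNReal

variable {σ R : ℝ} {Φ : ℝ → ℝ} {n : ℕ}

theorem isOpen_allowed (σ : ℝ) (n : ℕ) : IsOpen (Allowed σ n) := by
  simp only [Allowed, ofPred_forall]
  refine isOpen_iInter_of_finite fun i => isOpen_iInter_of_finite fun j =>
    isOpen_iInter_of_finite fun _ => isOpen_lt ?_ ?_ <;> fun_prop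

theorem continuousAt_energy (h : IsPotential σ R Φ) {x : Phase n} (hx : x ∈ Allowed σ n) :
    ContinuousAt (energy Φ) x := by
  unfold energy
  refine ContinuousAt.add (tendsto_finsetSum _ fun j _ =>
    (((continuous_snd.comp (continuous_apply j)).pow 2).div_const 2).continuousAt) ?_
  refine tendsto_finsetSum _ fun i _ => tendsto_finsetSum _ fun j _ => ?_
  by_cases hij : (i : ℕ) + 1 = j
  · simp only [if_pos hij]
    have h1 : ContinuousAt (fun y : Phase n => (y j).1 - (y i).1) x := by fun_prop
    exact ContinuousAt.comp (g := Φ)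
      (h.hasDerivAt (by linarith [hx i j hij])).continuousAt h1
  · simp only [if_neg hij]
    exact tendsto_const_nhds

/-- Near `x` the energy is below `energy Φ x + 1`. The barrier `c` lies above what a single bond can
reach at such an energy, so trajectories of the true and of the regularized dynamics both keep all
bonds longer than `r₀`, where the two fields coincide. Thus existence, uniqueness and `C¹`
dependence come from the regularized flow. -/
theorem exists_flow_near (h : IsPotential σ R Φ) {x : Phase n} (hx : x ∈ Allowed σ n) :
    ∃ V ∈ 𝓝 x, ∃ ψ : ℝ → Phase n → Phase n, Continuous (fun p : ℝ × Phase n => ψ p.1 p.2) ∧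
      (∀ t, ContDiff ℝ 1 (ψ t)) ∧ ∀ y ∈ V, y ∈ Allowed σ n ∧ ψ 0 y = y ∧
        IsTrajectory σ Φ (fun t => ψ t y) ∧
        ∀ γ : ℝ → Phase n, IsTrajectory σ Φ γ → γ 0 = y → ∀ t, γ t = ψ t y := by
  obtain ⟨m, hm0, hm⟩ := h.bounded_below
  -- The term `n * (n * m)` accounts for the other bonds, whose energies may be negative; the
  -- maximum with `0` ensures `-m ≤ c`.
  set c := max 0 (energy Φ x + 1 + n * (n * m)) with hc
  obtain ⟨r₀, g, φ, K, hr₀, hg1, hgK, hφg, hout, hφc, hΦc, hφm⟩ :=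
    h.exists_extension hm (c := c) ((neg_nonpos.2 hm0).trans (le_max_left _ _))
  set K' : ℝ≥0 := 1 + (n * (K * 2) + n * (K * 2))
  have hK' : 0 < K' := by positivity
  have hlip : LipschitzWith K' (bondField g : Phase n → Phase n) := lipschitzWith_bondField hgK
  have hcd : ContDiff ℝ 1 (bondField g : Phase n → Phase n) := contDiff_bondField hg1
  obtain ⟨ψ, hψ⟩ := GlobalODE.exists_isFlow hK' hlip hcd
  refine ⟨{y | energy Φ y < energy Φ x + 1} ∩ Allowed σ n,
    inter_mem ((continuousAt_energy h hx).eventually (gt_mem_nhds (by linarith)))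
      ((isOpen_allowed σ n).mem_nhds hx), ψ, hψ.continuous hlip,
    hψ.contDiff hK' hlip hcd, ?_⟩
  rintro y ⟨hyE, hyA⟩
  simp only [mem_ofPred_eq] at hyE
  have hcE : energy Φ y + n * (n * m) < c :=
    lt_of_lt_of_le (by linarith) (le_max_right _ _)
  -- a bond whose potential energy is below the barrier is long
  have hbond : ∀ z ∈ Allowed σ n, energy Φ z = energy Φ y → ∀ i j : Fin n, (i : ℕ) + 1 = j →
      r₀ < (z j).1 - (z i).1 := by
    intro z hz hzE i j hij
    have h1 := bond_le_energy (φ := Φ) hm0 (x := z)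
      (fun i j hij => hm _ (by linarith [hz i j hij])) hij
    by_contra hcon
    have := hΦc _ (by linarith [hz i j hij]) (not_lt.1 hcon)
    rw [hzE] at h1
    linarith
  have hfield : ∀ z ∈ Allowed σ n, (∀ i j : Fin n, (i : ℕ) + 1 = j → r₀ < (z j).1 - (z i).1) →
      bondField g z = hamiltonField Φ z := by
    intro z _ hz
    rw [hamiltonField_eq_bondField h]
    funext k
    simp only [bondField, Prod.mk.injEq, true_and]
    congr 1
    · refine Finset.sum_congr rfl fun j _ => ?_
      split_ifs with hij
      · exact (hout _ (hz _ _ hij).le).2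
      · rfl
    · refine Finset.sum_congr rfl fun j _ => ?_
      split_ifs with hij
      · exact (hout _ (hz _ _ hij).le).2
      · rfl
  have hyb := hbond y hyA rfl
  have hEy : energy φ y = energy Φ y := by
    simp only [energy]
    congr 1
    refine Finset.sum_congr rfl fun i _ => Finset.sum_congr rfl fun j _ => ?_
    split_ifs with hij
    · exact (hout _ (hyb i j hij).le).1
    · rfl
  have hψE : ∀ t, energy φ (ψ t y) = energy Φ y := by
    intro t
    rw [energy_eq_of_hasDerivAt (g := g) (φ := φ) (γ := fun t => ψ t y)
      (fun t => hψ.deriv t y) (fun t i j _ => hφg _) t]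
    simp only [hψ.zero, hEy]
  have hψb : ∀ t, ∀ i j : Fin n, (i : ℕ) + 1 = j → r₀ < (ψ t y j).1 - (ψ t y i).1 := by
    intro t i j hij
    have h1 := bond_le_energy (φ := φ) hm0 (x := ψ t y) (fun i j _ => hφm _) hij
    by_contra hcon
    have := hφc _ (not_lt.1 hcon)
    rw [hψE] at h1
    linarith
  have hψA : ∀ t, ψ t y ∈ Allowed σ n := fun t i j hij => by linarith [hψb t i j hij]
  refine ⟨hyA, hψ.zero y, fun t => ⟨hψA t, ?_⟩, fun γ hγ hγ0 t => ?_⟩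
  · rw [← hfield _ (hψA t) (hψb t)]
    exact hψ.deriv t y
  -- A true trajectory conserves the true energy, so it never leaves the region where the fields
  -- agree. It is therefore an integral curve of the regularized field, to which uniqueness applies.
  · have hγE : ∀ t, energy Φ (γ t) = energy Φ y := by
      intro t
      rw [energy_eq_of_hasDerivAt (g := deriv Φ) (φ := Φ) (γ := γ)
        (fun t => by rw [← hamiltonField_eq_bondField h]; exact (hγ t).2)
        (fun t i j hij => h.hasDerivAt (by linarith [(hγ t).1 i j hij])) t, hγ0]
    have := hψ.eq_of_hasDerivAt hlip (γ := γ) (fun t => by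
      rw [hfield _ (hγ t).1 (hbond _ (hγ t).1 (hγE t))]
      exact (hγ t).2) t
    rw [this, hγ0]

/-! ### The flow -/

theorem flow_of_notMem {x : Phase n} (hx : x ∉ Allowed σ n) (t : ℝ) : flow σ Φ t x = x := by
  rw [flow, dif_neg]
  rintro ⟨γ, hγ, h0⟩
  exact hx (h0 ▸ (hγ 0).1)

theorem isTrajectory_flow (h : IsPotential σ R Φ) {x : Phase n} (hx : x ∈ Allowed σ n) :
    IsTrajectory σ Φ (fun t => flow σ Φ t x) ∧ flow σ Φ 0 x = x := by
  obtain ⟨V, hV, ψ, -, -, hψ⟩ := exists_flow_near h hx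
  obtain ⟨-, h0, htr, -⟩ := hψ x (mem_of_mem_nhds hV)
  have hex : ∃ γ : ℝ → Phase n, IsTrajectory σ Φ γ ∧ γ 0 = x := ⟨_, htr, h0⟩
  have e : ∀ t, flow σ Φ t x = Classical.choose hex t := fun t => by rw [flow, dif_pos hex]
  simp only [e]
  exact Classical.choose_spec hex

theorem IsTrajectory.eq_flow (h : IsPotential σ R Φ) {γ : ℝ → Phase n}
    (hγ : IsTrajectory σ Φ γ) (t : ℝ) : γ t = flow σ Φ t (γ 0) := by
  obtain ⟨V, hV, ψ, -, -, hψ⟩ := exists_flow_near h (hγ 0).1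
  obtain ⟨hA, h0, htr, hu⟩ := hψ _ (mem_of_mem_nhds hV)
  obtain ⟨h1, h2⟩ := isTrajectory_flow h hA
  rw [hu γ hγ rfl t, ← hu _ h1 h2 t]

theorem flow_mem (h : IsPotential σ R Φ) {x : Phase n} (hx : x ∈ Allowed σ n) (t : ℝ) :
    flow σ Φ t x ∈ Allowed σ n := ((isTrajectory_flow h hx).1 t).1

theorem hasDerivAt_flow (h : IsPotential σ R Φ) {x : Phase n} (hx : x ∈ Allowed σ n) (t : ℝ) :
    HasDerivAt (fun s => flow σ Φ s x) (hamiltonField Φ (flow σ Φ t x)) t :=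
  ((isTrajectory_flow h hx).1 t).2

theorem flow_zero (h : IsPotential σ R Φ) (x : Phase n) : flow σ Φ 0 x = x := by
  by_cases hx : x ∈ Allowed σ n
  · exact (isTrajectory_flow h hx).2
  · exact flow_of_notMem hx 0

theorem flow_add (h : IsPotential σ R Φ) (s t : ℝ) (x : Phase n) :
    flow σ Φ (s + t) x = flow σ Φ s (flow σ Φ t x) := by
  by_cases hx : x ∈ Allowed σ n
  · have := IsTrajectory.eq_flow h (γ := fun s => flow σ Φ (s + t) x) (fun s =>
      ⟨flow_mem h hx _, (hasDerivAt_flow h hx (s + t)).comp_add_const s t⟩) s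
    simpa using this
  · simp only [flow_of_notMem hx]

theorem flow_neg_flow (h : IsPotential σ R Φ) (t : ℝ) (x : Phase n) :
    flow σ Φ (-t) (flow σ Φ t x) = x := by
  rw [← flow_add h, neg_add_cancel, flow_zero h]

theorem flow_flow_neg (h : IsPotential σ R Φ) (t : ℝ) (x : Phase n) :
    flow σ Φ t (flow σ Φ (-t) x) = x := by
  rw [← flow_add h, add_neg_cancel, flow_zero h]

theorem flow_mem_iff (h : IsPotential σ R Φ) (t : ℝ) (x : Phase n) :
    flow σ Φ t x ∈ Allowed σ n ↔ x ∈ Allowed σ n := by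
  refine ⟨fun hx => ?_, fun hx => flow_mem h hx t⟩
  by_contra hcon
  rw [flow_of_notMem hcon] at hx
  exact hcon hx

theorem flow_eventuallyEq (h : IsPotential σ R Φ) {x : Phase n} (hx : x ∈ Allowed σ n) :
    ∃ V ∈ 𝓝 x, ∃ ψ : ℝ → Phase n → Phase n, Continuous (fun p : ℝ × Phase n => ψ p.1 p.2) ∧
      (∀ t, ContDiff ℝ 1 (ψ t)) ∧ ∀ y ∈ V, ∀ t, flow σ Φ t y = ψ t y := by
  obtain ⟨V, hV, ψ, h1, h2, hψ⟩ := exists_flow_near h hx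
  refine ⟨V, hV, ψ, h1, h2, fun y hy t => ?_⟩
  obtain ⟨hA, h0, htr, hu⟩ := hψ y hy
  exact hu _ (isTrajectory_flow h hA).1 (isTrajectory_flow h hA).2 t

theorem continuousOn_flow (h : IsPotential σ R Φ) :
    ContinuousOn (fun p : ℝ × Phase n => flow σ Φ p.1 p.2) (univ ×ˢ Allowed σ n) := by
  rintro ⟨t, x⟩ ⟨-, hx⟩
  obtain ⟨V, hV, ψ, h1, -, h2⟩ := flow_eventuallyEq h hx
  refine (h1.continuousAt.congr ?_).continuousWithinAt
  filter_upwards [prod_mem_nhds univ_mem hV] with p hp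
  exact (h2 p.2 hp.2 p.1).symm

theorem contDiffOn_flow (h : IsPotential σ R Φ) (t : ℝ) :
    ContDiffOn ℝ 1 (flow σ Φ t) (Allowed σ n) := by
  intro x hx
  obtain ⟨V, hV, ψ, -, h1, h2⟩ := flow_eventuallyEq h hx
  refine ((h1 t).contDiffAt.congr_of_eventuallyEq ?_).contDiffWithinAt
  filter_upwards [hV] with y hy
  exact h2 y hy t

theorem continuousOn_flow_time (h : IsPotential σ R Φ) (t : ℝ) :
    ContinuousOn (flow σ Φ t) (Allowed σ n) := (contDiffOn_flow h t).continuousOn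

theorem measurable_flow (h : IsPotential σ R Φ) (t : ℝ) :
    Measurable (flow σ Φ t : Phase n → Phase n) := by
  classical
  have e : (flow σ Φ t : Phase n → Phase n) = (Allowed σ n).piecewise (flow σ Φ t) id := by
    funext x
    by_cases hx : x ∈ Allowed σ n
    · simp [hx]
    · simp [hx, flow_of_notMem hx]
  rw [e]
  exact (continuousOn_flow_time h t).measurable_piecewise continuousOn_id
    (isOpen_allowed σ n).measurableSet

/-- The flow as a bijection of the whole phase space (the identity on the forbidden
configurations). -/
noncomputable def flowEquiv (h : IsPotential σ R Φ) (n : ℕ) (t : ℝ) : Phase n ≃ᵐ Phase n where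
  toFun := flow σ Φ t
  invFun := flow σ Φ (-t)
  left_inv := flow_neg_flow h t
  right_inv := flow_flow_neg h t
  measurable_toFun := measurable_flow h t
  measurable_invFun := measurable_flow h (-t)

theorem isCompact_flow_image (h : IsPotential σ R Φ) {C : Set (Phase n)} (hC : IsCompact C)
    (hCA : C ⊆ Allowed σ n) {I : Set ℝ} (hI : IsCompact I) :
    IsCompact ((fun p : ℝ × Phase n => flow σ Φ p.1 p.2) '' (I ×ˢ C)) :=
  (hI.prod hC).image_of_continuousOn
    ((continuousOn_flow h).mono (prod_mono (subset_univ _) hCA))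

end TopologicalParticles

/-! ### The Liouville operator on compactly supported functions and its antisymmetry -/

namespace TopologicalParticles

open Set
open scoped NNReal ContDiff

variable {σ R : ℝ} {Φ : ℝ → ℝ} {n : ℕ}

/-! ### The Liouville operator as a directional derivative -/

theorem fderiv_apply_eq_sum (f : Phase n → ℝ) (x v : Phase n) :
    fderiv ℝ f x v = ∑ j, ((v j).1 * dq j f x + (v j).2 * dp j f x) := by
  have hv : v = ∑ j, ((v j).1 • (Pi.single j ((1 : ℝ), (0 : ℝ)) : Phase n)
      + (v j).2 • (Pi.single j ((0 : ℝ), (1 : ℝ)) : Phase n)) := by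
    conv_lhs => rw [← Finset.univ_sum_single v]
    refine Finset.sum_congr rfl fun j _ => ?_
    rw [← Pi.single_smul, ← Pi.single_smul, ← Pi.single_add]
    simp
  conv_lhs => rw [hv]
  simp [map_sum, map_add, map_smul, dq, dp]

/-- A bond contributes to the momentum equations of both of its ends; regrouping by bonds gives the
claim. In this form the chain and product rules apply to the operator. -/
theorem liouvilleStar_eq_fderiv (Φ : ℝ → ℝ) (f : Phase n → ℝ) (x : Phase n) :
    liouvilleStar Φ f x = -fderiv ℝ f x (hamiltonField Φ x) := by
  rw [fderiv_apply_eq_sum, liouvilleStar, Finset.sum_add_distrib, neg_add,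
    ← Finset.sum_neg_distrib]
  congr 1
  simp only [hamiltonField, sub_mul, Finset.sum_mul, Finset.sum_sub_distrib]
  rw [Finset.sum_comm (f := fun j i : Fin n =>
    (if (i : ℕ) + 1 = j then deriv Φ ((x i).1 - (x j).1) else 0) * dp j f x),
    ← Finset.sum_sub_distrib, ← Finset.sum_neg_distrib]
  refine Finset.sum_congr rfl fun i _ => ?_
  rw [← Finset.sum_sub_distrib, ← Finset.sum_neg_distrib]
  refine Finset.sum_congr rfl fun j _ => ?_
  split_ifs <;> ring

/-- Continuously differentiable functions with compact support in the allowed phase space. -/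
structure SmoothCompact (σ : ℝ) {n : ℕ} (f : Phase n → ℝ) : Prop where
  smooth : ContDiff ℝ 1 f
  compact : HasCompactSupport f
  support : tsupport f ⊆ Allowed σ n

/-- Continuous functions with compact support in the allowed phase space. -/
structure ContCompact (σ : ℝ) {n : ℕ} (f : Phase n → ℝ) : Prop where
  continuous : Continuous f
  compact : HasCompactSupport f
  support : tsupport f ⊆ Allowed σ n

theorem SmoothCompact.contCompact {f : Phase n → ℝ} (hf : SmoothCompact σ f) :
    ContCompact σ f := ⟨hf.smooth.continuous, hf.compact, hf.support⟩

theorem ContCompact.integrable {f : Phase n → ℝ} (hf : ContCompact σ f) : Integrable f :=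
  hf.continuous.integrable_of_hasCompactSupport hf.compact

theorem ContCompact.eq_zero {f : Phase n → ℝ} (hf : ContCompact σ f) {x : Phase n}
    (hx : x ∉ Allowed σ n) : f x = 0 :=
  image_eq_zero_of_notMem_tsupport fun h => hx (hf.support h)

/-- Outside `U` the product vanishes in a whole neighbourhood, since the closed support lies in `U`.
This allows multiplication by the force, which is not controlled at the core. -/
theorem continuous_mul_of_tsupport_subset {X : Type*} [TopologicalSpace X] {U : Set X}
    (hU : IsOpen U) {w h : X → ℝ} (hw : ContinuousOn w U) (hh : Continuous h)
    (hs : tsupport h ⊆ U) : Continuous fun x => w x * h x := by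
  rw [continuous_iff_continuousAt]
  intro x
  by_cases hx : x ∈ U
  · exact (hw.continuousAt (hU.mem_nhds hx)).mul hh.continuousAt
  · have : (fun x => w x * h x) =ᶠ[𝓝 x] fun _ => 0 := by
      filter_upwards [(isClosed_tsupport h).isOpen_compl.mem_nhds fun hx' => hx (hs hx')] with y hy
      rw [image_eq_zero_of_notMem_tsupport hy, mul_zero]
    exact continuousAt_const.congr this.symm

theorem ContCompact.mul_left {w h : Phase n → ℝ} (hh : ContCompact σ h)
    (hw : ContinuousOn w (Allowed σ n)) : ContCompact σ fun x => w x * h x :=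
  ⟨continuous_mul_of_tsupport_subset (isOpen_allowed σ n) hw hh.continuous hh.support,
    hh.compact.mul_left, (closure_mono (Function.support_mul_subset_right w h)).trans hh.support⟩

theorem SmoothCompact.mul_left {w h : Phase n → ℝ} (hh : SmoothCompact σ h)
    (hw : ContDiffOn ℝ 1 w (Allowed σ n)) : SmoothCompact σ fun x => w x * h x := by
  have h1 := hh.contCompact.mul_left hw.continuousOn
  refine ⟨contDiff_iff_contDiffAt.2 fun x => ?_, h1.compact, h1.support⟩
  by_cases hx : x ∈ Allowed σ n
  · exact (hw.contDiffAt ((isOpen_allowed σ n).mem_nhds hx)).mul hh.smooth.contDiffAt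
  · have : (fun x => w x * h x) =ᶠ[𝓝 x] fun _ => 0 := by
      filter_upwards [(isClosed_tsupport h).isOpen_compl.mem_nhds fun hx' => hx (hh.support hx')]
        with y hy
      rw [image_eq_zero_of_notMem_tsupport hy, mul_zero]
    exact contDiffAt_const.congr_of_eventuallyEq this

theorem SmoothCompact.fderiv_apply {h : Phase n → ℝ} (hh : SmoothCompact σ h) (v : Phase n) :
    ContCompact σ fun x => fderiv ℝ h x v := by
  have hsub : tsupport (fun x => fderiv ℝ h x v) ⊆ tsupport h :=
    (closure_mono (show Function.support _ ⊆ Function.support (fderiv ℝ h) from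
      fun x hx hx' => hx (by simp [hx']))).trans (tsupport_fderiv_subset ℝ)
  exact ⟨(hh.smooth.continuous_fderiv one_ne_zero).clm_apply continuous_const,
    hh.compact.of_isClosed_subset (isClosed_tsupport _) hsub, hsub.trans hh.support⟩

/-- The derivative along `v` of a product with a factor that is constant along `v` has zero
integral. -/
theorem integral_mul_fderiv_eq_zero {w h : Phase n → ℝ} {v : Phase n} (hh : SmoothCompact σ h)
    (hw : ContinuousOn w (Allowed σ n)) (hwv : ∀ x (s : ℝ), w (x + s • v) = w x) :
    ∫ x, w x * fderiv ℝ h x v = 0 := by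
  have h1 : Integrable fun x => w x * fderiv ℝ h x v := ((hh.fderiv_apply v).mul_left hw).integrable
  have h2 : Integrable fun x => w x * h x := (hh.contCompact.mul_left hw).integrable
  -- Integration by parts of the product `w * h` against the constant `1`. As `w` is constant along
  -- `v`, the derivative of the product is `w` times the derivative of `h`.
  have := integral_bilinear_hasLineDerivAt_right_eq_neg_left_of_integrable
    (μ := (volume : Measure (Phase n))) (B := ContinuousLinearMap.mul ℝ ℝ)
    (f := fun _ => 1) (f' := fun _ => 0) (g := fun x => w x * h x)
    (g' := fun x => w x * fderiv ℝ h x v) (v := v) (by simp) (by simpa using h1) (by simpa using h2)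
    (fun x _ => by simpa [HasLineDerivAt] using hasDerivAt_const (0 : ℝ) (1 : ℝ)) (fun x _ => ?_)
  · simpa using this
  · have h3 := ((hh.smooth.differentiable one_ne_zero x).hasFDerivAt.hasLineDerivAt v)
    rw [HasLineDerivAt] at h3 ⊢
    simp only [hwv]
    exact h3.const_mul (w x)

theorem continuousOn_force (h : IsPotential σ R Φ) {i j : Fin n} (hij : (i : ℕ) + 1 = j) :
    ContinuousOn (fun x : Phase n => deriv Φ ((x i).1 - (x j).1)) (Allowed σ n) := by
  have e : (fun x : Phase n => deriv Φ ((x i).1 - (x j).1)) =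
      fun x => -deriv Φ ((x j).1 - (x i).1) := by
    funext x
    rw [← h.deriv_neg, neg_sub]
  rw [e]
  refine ContinuousOn.neg (h.contDiffOn_deriv.continuousOn.comp ?_ fun x hx => ?_)
  · exact Continuous.continuousOn (by fun_prop)
  · have := hx i j hij
    simp only [mem_Ioi]
    linarith

theorem continuousOn_hamiltonField (h : IsPotential σ R Φ) :
    ContinuousOn (hamiltonField Φ : Phase n → Phase n) (Allowed σ n) := by
  refine continuousOn_pi.2 fun j => ContinuousOn.prodMk (Continuous.continuousOn (by fun_prop)) ?_
  refine ContinuousOn.sub ?_ ?_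
  · refine continuousOn_finsetSum _ fun i _ => ?_
    split_ifs with hij
    · exact continuousOn_force h hij
    · exact continuousOn_const
  · refine continuousOn_finsetSum _ fun i _ => ?_
    split_ifs with hij
    · exact continuousOn_force h hij
    · exact continuousOn_const

theorem SmoothCompact.liouvilleStar (h : IsPotential σ R Φ) {f : Phase n → ℝ}
    (hf : SmoothCompact σ f) : ContCompact σ (liouvilleStar Φ f) := by
  have hsub : tsupport (TopologicalParticles.liouvilleStar Φ f) ⊆ tsupport f := by
    refine (closure_mono (show Function.support _ ⊆ Function.support (fderiv ℝ f) from
      fun x hx hx' => hx ?_)).trans (tsupport_fderiv_subset ℝ)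
    rw [liouvilleStar_eq_fderiv, hx']
    simp
  refine ⟨?_, hf.compact.of_isClosed_subset (isClosed_tsupport _) hsub, hsub.trans hf.support⟩
  rw [continuous_iff_continuousAt]
  intro x
  by_cases hx : x ∈ Allowed σ n
  · have e : TopologicalParticles.liouvilleStar Φ f =
      fun x => -fderiv ℝ f x (hamiltonField Φ x) := funext (liouvilleStar_eq_fderiv Φ f)
    rw [e]
    exact (((hf.smooth.continuous_fderiv one_ne_zero).continuousAt).clm_apply
      ((continuousOn_hamiltonField h).continuousAt ((isOpen_allowed σ n).mem_nhds hx))).neg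
  · have : TopologicalParticles.liouvilleStar Φ f =ᶠ[𝓝 x] fun _ => 0 := by
      filter_upwards [(isClosed_tsupport _).isOpen_compl.mem_nhds
        fun hx' => hx (hf.support (hsub hx'))] with y hy
      exact image_eq_zero_of_notMem_tsupport hy
    exact continuousAt_const.congr this.symm

/-- The Hamiltonian field is divergence-free term by term: the velocity in direction `q_j` does not
depend on `q_j`, and the forces do not depend on the momenta. So every term is the integral of a
pure derivative. -/
theorem integral_liouvilleStar_eq_zero (h : IsPotential σ R Φ) {f : Phase n → ℝ}
    (hf : SmoothCompact σ f) : ∫ x, liouvilleStar Φ f x = 0 := by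
  have hq : ∀ j : Fin n, Integrable fun x : Phase n => (x j).2 * dq j f x := fun j =>
    ((hf.fderiv_apply _).mul_left (Continuous.continuousOn (by fun_prop))).integrable
  have hqn : ∀ j : Fin n, Integrable fun x : Phase n => -((x j).2 * dq j f x) :=
    fun j => (hq j).neg
  have hp : ∀ i j k : Fin n, (i : ℕ) + 1 = j →
      Integrable fun x : Phase n => deriv Φ ((x i).1 - (x j).1) * dp k f x := fun i j k hij =>
    ((hf.fderiv_apply _).mul_left (continuousOn_force h hij)).integrable
  have hq0 : ∀ j : Fin n, ∫ x : Phase n, (x j).2 * dq j f x = 0 := fun j =>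
    integral_mul_fderiv_eq_zero hf (Continuous.continuousOn (by fun_prop)) fun x s => by simp
  have hp0 : ∀ i j k : Fin n, (i : ℕ) + 1 = j →
      ∫ x : Phase n, deriv Φ ((x i).1 - (x j).1) * dp k f x = 0 := fun i j k hij =>
    integral_mul_fderiv_eq_zero hf (continuousOn_force h hij) fun x s => by
      have : ∀ l : Fin n, (s • (Pi.single k ((0 : ℝ), (1 : ℝ)) : Phase n) l).1 = 0 := fun l => by
        rcases eq_or_ne l k with rfl | hl
        · simp
        · simp [hl]
      simp only [Pi.add_apply, Prod.fst_add, Pi.smul_apply, this, add_zero]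
  have hterm : ∀ i j : Fin n, Integrable (fun x : Phase n => if (i : ℕ) + 1 = j then
      deriv Φ ((x i).1 - (x j).1) * (dp i f x - dp j f x) else 0) ∧
      ∫ x : Phase n, (if (i : ℕ) + 1 = j then
        deriv Φ ((x i).1 - (x j).1) * (dp i f x - dp j f x) else 0) = 0 := by
    intro i j
    by_cases hij : (i : ℕ) + 1 = j
    · simp only [if_pos hij, mul_sub]
      refine ⟨(hp i j i hij).sub (hp i j j hij), ?_⟩
      rw [integral_sub (hp i j i hij) (hp i j j hij), hp0 i j i hij, hp0 i j j hij, sub_zero]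
    · simp [hij]
  unfold liouvilleStar
  rw [integral_add (integrable_finsetSum _ fun j _ => (hqn j))
    (integrable_finsetSum _ fun i _ => integrable_finsetSum _ fun j _ => (hterm i j).1),
    integral_finsetSum _ fun j _ => (hqn j),
    integral_finsetSum _ fun i _ => integrable_finsetSum _ fun j _ => (hterm i j).1]
  simp only [integral_neg, hq0, neg_zero, Finset.sum_const_zero, zero_add]
  refine Finset.sum_eq_zero fun i _ => ?_
  rw [integral_finsetSum _ fun j _ => (hterm i j).1]
  exact Finset.sum_eq_zero fun j _ => (hterm i j).2

theorem liouvilleStar_mul {c f : Phase n → ℝ} (hc : ContDiffOn ℝ 1 c (Allowed σ n))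
    (hf : SmoothCompact σ f) (x : Phase n) :
    liouvilleStar Φ (fun x => c x * f x) x =
      c x * liouvilleStar Φ f x + liouvilleStar Φ c x * f x := by
  simp only [liouvilleStar_eq_fderiv]
  by_cases hx : x ∈ Allowed σ n
  · have hc' := (hc.differentiableOn one_ne_zero).differentiableAt
      ((isOpen_allowed σ n).mem_nhds hx)
    rw [fderiv_fun_mul hc' (hf.smooth.differentiable one_ne_zero x)]
    simp
    ring
  · have h1 : x ∉ tsupport f := fun h => hx (hf.support h)
    have h2 : fderiv ℝ f x = 0 := by
      by_contra h3
      exact h1 (tsupport_fderiv_subset ℝ (subset_tsupport _ h3))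
    have h4 : fderiv ℝ (fun x => c x * f x) x = 0 := by
      by_contra h3
      exact hx ((hf.mul_left hc).support (tsupport_fderiv_subset ℝ (subset_tsupport _ h3)))
    rw [h2, h4, image_eq_zero_of_notMem_tsupport h1]
    simp

/-- The Liouville operator is antisymmetric. -/
theorem integral_mul_liouvilleStar (h : IsPotential σ R Φ) {c f : Phase n → ℝ}
    (hc : ContDiffOn ℝ 1 c (Allowed σ n)) (hf : SmoothCompact σ f) :
    ∫ x, c x * liouvilleStar Φ f x = -∫ x, liouvilleStar Φ c x * f x := by
  have h1 := integral_liouvilleStar_eq_zero h (hf.mul_left hc)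
  simp only [liouvilleStar_mul hc hf] at h1
  have hi1 : Integrable fun x => c x * liouvilleStar Φ f x :=
    ((hf.liouvilleStar h).mul_left hc.continuousOn).integrable
  have hcL : ContinuousOn (liouvilleStar Φ c) (Allowed σ n) := by
    rw [show liouvilleStar Φ c = fun x => -fderiv ℝ c x (hamiltonField Φ x) from
      funext (liouvilleStar_eq_fderiv Φ c)]
    exact ((hc.continuousOn_fderiv_of_isOpen (isOpen_allowed σ n) le_rfl).clm_apply
      (continuousOn_hamiltonField h)).neg
  rw [integral_add hi1 (hf.contCompact.mul_left hcL).integrable] at h1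
  linarith

end TopologicalParticles

/-! ### Liouville's theorem: the flow preserves Lebesgue measure -/

namespace TopologicalParticles

open Set
open scoped NNReal ContDiff

variable {σ R : ℝ} {Φ : ℝ → ℝ} {n : ℕ}

/-! ### Transport of functions along the flow -/

theorem support_comp_flow_subset (h : IsPotential σ R Φ) (t : ℝ) (f : Phase n → ℝ) :
    Function.support (fun x => f (flow σ Φ t x)) ⊆ flow σ Φ (-t) '' tsupport f := fun x hx =>
  ⟨flow σ Φ t x, subset_tsupport f hx, flow_neg_flow h t x⟩

theorem ContCompact.tsupport_comp_flow_subset (h : IsPotential σ R Φ) {f : Phase n → ℝ}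
    (hf : ContCompact σ f) (t : ℝ) : IsCompact (flow σ Φ (-t) '' tsupport f) ∧
      tsupport (fun x => f (flow σ Φ t x)) ⊆ flow σ Φ (-t) '' tsupport f ∧
      flow σ Φ (-t) '' tsupport f ⊆ Allowed σ n := by
  have h1 : IsCompact (flow σ Φ (-t) '' tsupport f) :=
    hf.compact.isCompact.image_of_continuousOn ((continuousOn_flow_time h (-t)).mono hf.support)
  refine ⟨h1, closure_minimal (support_comp_flow_subset h t f) h1.isClosed, ?_⟩
  rintro _ ⟨x, hx, rfl⟩
  exact flow_mem h (hf.support hx) _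

theorem ContCompact.comp_flow (h : IsPotential σ R Φ) {f : Phase n → ℝ} (hf : ContCompact σ f)
    (t : ℝ) : ContCompact σ fun x => f (flow σ Φ t x) := by
  obtain ⟨h1, h2, h3⟩ := hf.tsupport_comp_flow_subset h t
  refine ⟨?_, h1.of_isClosed_subset (isClosed_tsupport _) h2, h2.trans h3⟩
  rw [continuous_iff_continuousAt]
  intro x
  by_cases hx : x ∈ Allowed σ n
  · exact ContinuousAt.comp (g := f) hf.continuous.continuousAt
      ((continuousOn_flow_time h t).continuousAt ((isOpen_allowed σ n).mem_nhds hx))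
  · have : (fun x => f (flow σ Φ t x)) =ᶠ[𝓝 x] fun _ => 0 := by
      filter_upwards [(isClosed_tsupport _).isOpen_compl.mem_nhds
        fun hx' => hx (h3 (h2 hx'))] with y hy
      exact image_eq_zero_of_notMem_tsupport (f := fun x => f (flow σ Φ t x)) hy
    exact continuousAt_const.congr this.symm

theorem SmoothCompact.comp_flow (h : IsPotential σ R Φ) {f : Phase n → ℝ}
    (hf : SmoothCompact σ f) (t : ℝ) : SmoothCompact σ fun x => f (flow σ Φ t x) := by
  have h1 := hf.contCompact.comp_flow h t
  refine ⟨contDiff_iff_contDiffAt.2 fun x => ?_, h1.compact, h1.support⟩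
  by_cases hx : x ∈ Allowed σ n
  · exact ContDiffAt.comp (g := f) x hf.smooth.contDiffAt
      ((contDiffOn_flow h t).contDiffAt ((isOpen_allowed σ n).mem_nhds hx))
  · have : (fun x => f (flow σ Φ t x)) =ᶠ[𝓝 x] fun _ => 0 := by
      filter_upwards [(isClosed_tsupport _).isOpen_compl.mem_nhds
        fun hx' => hx (h1.support hx')] with y hy
      exact image_eq_zero_of_notMem_tsupport (f := fun x => f (flow σ Φ t x)) hy
    exact contDiffAt_const.congr_of_eventuallyEq this

theorem hasDerivAt_comp_flow (h : IsPotential σ R Φ) {c : Phase n → ℝ}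
    (hc : ContDiffOn ℝ 1 c (Allowed σ n)) {x : Phase n} (hx : x ∈ Allowed σ n) (t : ℝ) :
    HasDerivAt (fun s => c (flow σ Φ s x)) (-liouvilleStar Φ c (flow σ Φ t x)) t := by
  rw [liouvilleStar_eq_fderiv, neg_neg]
  have hm := flow_mem h hx t
  exact ((hc.differentiableOn one_ne_zero).differentiableAt
    ((isOpen_allowed σ n).mem_nhds hm)).hasFDerivAt.comp_hasDerivAt t (hasDerivAt_flow h hx t)

theorem SmoothCompact.hasDerivAt_comp_flow (h : IsPotential σ R Φ) {f : Phase n → ℝ}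
    (hf : SmoothCompact σ f) (x : Phase n) (t : ℝ) :
    HasDerivAt (fun s => f (flow σ Φ s x)) (-TopologicalParticles.liouvilleStar Φ f (flow σ Φ t x))
      t := by
  by_cases hx : x ∈ Allowed σ n
  · exact TopologicalParticles.hasDerivAt_comp_flow h hf.smooth.contDiffOn hx t
  · simp only [flow_of_notMem hx, (hf.liouvilleStar h).eq_zero hx, neg_zero]
    exact hasDerivAt_const t _

/-- The generator commutes with its group: by the group law both sides are, up to sign, the
derivative at `s = 0` of `f` along the trajectory at time `s + t`. -/
theorem SmoothCompact.liouvilleStar_comp_flow (h : IsPotential σ R Φ) {f : Phase n → ℝ}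
    (hf : SmoothCompact σ f) (t : ℝ) (x : Phase n) :
    TopologicalParticles.liouvilleStar Φ (fun x => f (flow σ Φ t x)) x =
      TopologicalParticles.liouvilleStar Φ f (flow σ Φ t x) := by
  have h1 := (hf.comp_flow h t).hasDerivAt_comp_flow h x 0
  have h2 := (hf.hasDerivAt_comp_flow h x t)
  rw [← zero_add t] at h2
  have h3 := h2.comp_add_const 0 t
  simp only [zero_add, flow_zero h] at h1 h3
  have e : ∀ s, flow σ Φ t (flow σ Φ s x) = flow σ Φ (s + t) x := fun s => by
    rw [← flow_add h, add_comm]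
  simp only [e] at h1
  exact neg_injective (h1.unique h3)

theorem ContCompact.exists_bound {f : Phase n → ℝ} (hf : ContCompact σ f) :
    ∃ B, 0 ≤ B ∧ ∀ x, |f x| ≤ B := by
  obtain ⟨B, hB⟩ := hf.continuous.bounded_above_of_compact_support hf.compact
  exact ⟨B, (norm_nonneg _).trans (hB 0), hB⟩

/-- The supports of the transports of `f` during a bounded time interval lie in one compact set. -/
theorem ContCompact.exists_compact_flow (h : IsPotential σ R Φ) {f : Phase n → ℝ}
    (hf : ContCompact σ f) (T : ℝ) :
    ∃ C : Set (Phase n), IsCompact C ∧ ∀ s ∈ Icc (-T) T, ∀ x ∉ C, f (flow σ Φ s x) = 0 := by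
  refine ⟨(fun p : ℝ × Phase n => flow σ Φ p.1 p.2) '' (Icc (-T) T ×ˢ tsupport f),
    isCompact_flow_image h hf.compact.isCompact hf.support isCompact_Icc, fun s hs x hx => ?_⟩
  by_contra hne
  exact hx ⟨(-s, flow σ Φ s x),
    ⟨⟨by linarith [hs.2], by linarith [hs.1]⟩, subset_tsupport f hne⟩, flow_neg_flow h s x⟩

/-- The transports of `f` during a bounded time interval are dominated by one integrable
function. -/
theorem ContCompact.exists_dominating (h : IsPotential σ R Φ) {f : Phase n → ℝ}
    (hf : ContCompact σ f) (T : ℝ) :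
    ∃ g : Phase n → ℝ, Integrable g ∧ ∀ s ∈ Icc (-T) T, ∀ x, |f (flow σ Φ s x)| ≤ g x := by
  obtain ⟨B, hB0, hB⟩ := hf.exists_bound
  obtain ⟨C, hC, hfC⟩ := hf.exists_compact_flow h T
  refine ⟨C.indicator fun _ => B, ?_, fun s hs x => ?_⟩
  · rw [integrable_indicator_iff hC.measurableSet]
    exact integrableOn_const hC.measure_lt_top.ne
  · by_cases hx : x ∈ C
    · rw [indicator_of_mem hx]
      exact hB _
    · rw [indicator_of_notMem hx, hfC s hs x hx, abs_zero]

/-- The time derivative of the integral is minus the integral of `liouvilleStar` of the transported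
function, which is zero. -/
theorem SmoothCompact.integral_comp_flow (h : IsPotential σ R Φ) {f : Phase n → ℝ}
    (hf : SmoothCompact σ f) (t : ℝ) : ∫ x, f (flow σ Φ t x) = ∫ x, f x := by
  have key : ∀ t, HasDerivAt (fun s => ∫ x, f (flow σ Φ s x)) 0 t := by
    intro t
    obtain ⟨g, hg, hgb⟩ := (hf.liouvilleStar h).exists_dominating h (|t| + 1)
    have h1 := hasDerivAt_integral_of_dominated_loc_of_deriv_le (μ := (volume : Measure (Phase n)))
      (F := fun s x => f (flow σ Φ s x))
      (F' := fun s x => -TopologicalParticles.liouvilleStar Φ f (flow σ Φ s x)) (x₀ := t)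
      (s := Ioo (t - 1) (t + 1)) (bound := g) (Ioo_mem_nhds (by linarith) (by linarith))
      (Eventually.of_forall fun s => (hf.comp_flow h s).smooth.continuous.aestronglyMeasurable)
      (hf.comp_flow h t).contCompact.integrable
      (((hf.liouvilleStar h).comp_flow h t).continuous.neg.aestronglyMeasurable)
      (ae_of_all _ fun x s hs => ?_) hg
      (ae_of_all _ fun x s _ => hf.hasDerivAt_comp_flow h x s)
    · have h2 := h1.2
      simp only [← hf.liouvilleStar_comp_flow h t] at h2
      rwa [integral_neg, integral_liouvilleStar_eq_zero h (hf.comp_flow h t), neg_zero] at h2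
    · rw [norm_neg, Real.norm_eq_abs]
      refine hgb s ⟨?_, ?_⟩ x
      · linarith [hs.1, neg_abs_le t]
      · linarith [hs.2, le_abs_self t]
  have := is_const_of_deriv_eq_zero (fun t => (key t).differentiableAt)
    (fun t => (key t).deriv) t 0
  simpa only [flow_zero h] using this

/-- The flow maps the allowed set bijectively onto itself, so a change of variables rewrites the
invariance of `∫ g` as `∫ (|det| - 1) g = 0` for all test functions `g` supported there. The
Jacobian is identified in this way without an equation for its evolution. -/
theorem abs_det_fderiv_flow (h : IsPotential σ R Φ) (t : ℝ) :
    ∀ᵐ x : Phase n, x ∈ Allowed σ n → |(fderiv ℝ (flow σ Φ t) x).det| - 1 = 0 := by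
  have hU := isOpen_allowed σ n
  have hdet : ContinuousOn (fun x : Phase n => |(fderiv ℝ (flow σ Φ t) x).det|) (Allowed σ n) :=
    (ContinuousLinearMap.continuous_det.comp_continuousOn
      ((contDiffOn_flow h t).continuousOn_fderiv_of_isOpen hU le_rfl)).abs
  refine hU.ae_eq_zero_of_integral_contDiff_smul_eq_zero
    ((hdet.sub continuousOn_const).locallyIntegrableOn hU.measurableSet) fun g hg hgc hgs => ?_
  have hg' : SmoothCompact σ g := ⟨hg.of_le (by exact_mod_cast le_top), hgc, hgs⟩
  have hder : ∀ x ∈ Allowed σ n,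
      HasFDerivWithinAt (flow σ Φ t) (fderiv ℝ (flow σ Φ t) x) (Allowed σ n) x := fun x hx =>
    (((contDiffOn_flow h t).differentiableOn one_ne_zero).differentiableAt
      (hU.mem_nhds hx)).hasFDerivAt.hasFDerivWithinAt
  have hinj : InjOn (flow σ Φ t) (Allowed σ n) := fun x _ y _ hxy => by
    rw [← flow_neg_flow h t x, hxy, flow_neg_flow h t y]
  have himg : flow σ Φ t '' Allowed σ n = Allowed σ n := by
    ext y
    refine ⟨?_, fun hy => ⟨flow σ Φ (-t) y, flow_mem h hy _, flow_flow_neg h t y⟩⟩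
    rintro ⟨x, hx, rfl⟩
    exact flow_mem h hx t
  have h1 := integral_image_eq_integral_abs_det_fderiv_smul volume hU.measurableSet hder hinj
    fun x => g (flow σ Φ (-t) x)
  have hz : ∀ {u : Phase n → ℝ}, (∀ x, x ∉ Allowed σ n → u x = 0) →
      ∫ x in Allowed σ n, u x = ∫ x, u x := fun hu =>
    setIntegral_eq_integral_of_forall_compl_eq_zero hu
  simp only [himg, flow_neg_flow h, smul_eq_mul] at h1
  rw [hz fun x hx => by rw [flow_of_notMem hx]; exact hg'.contCompact.eq_zero hx,
    hg'.integral_comp_flow h, hz fun x hx => by rw [hg'.contCompact.eq_zero hx, mul_zero]] at h1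
  simp only [smul_eq_mul, mul_sub, mul_one]
  rw [integral_sub _ hg'.contCompact.integrable, h1, sub_eq_zero]
  · simp only [mul_comm]
  · simpa only [mul_comm] using (hg'.contCompact.mul_left hdet).integrable

/-- On the allowed set the Jacobian is `1` almost everywhere; on the forbidden set the flow is the
identity. -/
theorem measurePreserving_flow (h : IsPotential σ R Φ) (n : ℕ) (t : ℝ) :
    MeasurePreserving (flow σ Φ t : Phase n → Phase n) := by
  refine ⟨measurable_flow h t, Measure.ext fun A hA => ?_⟩
  have hU := isOpen_allowed σ n
  have hpre : (flow σ Φ t : Phase n → Phase n) ⁻¹' A =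
      flow σ Φ (-t) '' (A ∩ Allowed σ n) ∪ (A \ Allowed σ n) := by
    ext x
    constructor
    · intro hx
      by_cases hxU : x ∈ Allowed σ n
      · exact Or.inl ⟨flow σ Φ t x, ⟨hx, flow_mem h hxU t⟩, flow_neg_flow h t x⟩
      · rw [mem_preimage, flow_of_notMem hxU] at hx
        exact Or.inr ⟨hx, hxU⟩
    · rintro (⟨y, ⟨hy, -⟩, rfl⟩ | ⟨hx, hxU⟩)
      · rwa [mem_preimage, flow_flow_neg h]
      · rwa [mem_preimage, flow_of_notMem hxU]
  have hdisj : Disjoint (flow σ Φ (-t) '' (A ∩ Allowed σ n)) (A \ Allowed σ n) := by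
    rw [Set.disjoint_left]
    rintro _ ⟨y, ⟨-, hy⟩, rfl⟩ ⟨-, hx⟩
    exact hx (flow_mem h hy _)
  have himg : volume (flow σ Φ (-t) '' (A ∩ Allowed σ n)) = volume (A ∩ Allowed σ n) := by
    rw [← lintegral_abs_det_fderiv_eq_addHaar_image volume (hA.inter hU.measurableSet)
      (f' := fun x => fderiv ℝ (flow σ Φ (-t)) x)
      (fun x hx => (((contDiffOn_flow h (-t)).differentiableOn one_ne_zero).differentiableAt
        (hU.mem_nhds hx.2)).hasFDerivAt.hasFDerivWithinAt)
      (fun x _ y _ hxy => by rw [← flow_flow_neg h t x, hxy, flow_flow_neg h t y])]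
    rw [← setLIntegral_one]
    refine setLIntegral_congr_fun_ae (hA.inter hU.measurableSet) ?_
    filter_upwards [abs_det_fderiv_flow (n := n) h (-t)] with x hx hxA
    rw [sub_eq_zero.1 (hx hxA.2), ENNReal.ofReal_one]
  rw [Measure.map_apply (measurable_flow h t) hA, hpre,
    measure_union hdisj (hA.diff hU.measurableSet), himg,
    measure_inter_add_sdiff _ hU.measurableSet]

end TopologicalParticles

/-! ### Separating groups of particles, and the dynamics of isolated blocks -/

namespace TopologicalParticles

open Set
open scoped NNReal ContDiff

variable {σ R : ℝ} {Φ : ℝ → ℝ} {n : ℕ}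

/-! ### Splitting the phase space -/

section Split

variable {ι κ μ : Type*}

/-- Phase points of two groups of particles, as phase points of all of them. -/
noncomputable def splitEquiv (e : ι ⊕ κ ≃ μ) : (ι → Pt) × (κ → Pt) ≃ᵐ (μ → Pt) where
  toFun p j := Sum.elim p.1 p.2 (e.symm j)
  invFun x := (fun i => x (e (Sum.inl i)), fun k => x (e (Sum.inr k)))
  left_inv p := by simp
  right_inv x := by
    funext j
    obtain ⟨i, rfl⟩ := e.surjective j
    cases i <;> simp
  measurable_toFun := by
    refine measurable_pi_lambda _ fun j => ?_
    simp only [Equiv.coe_fn_mk]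
    cases e.symm j with
    | inl i => exact (measurable_pi_apply i).comp measurable_fst
    | inr k => exact (measurable_pi_apply k).comp measurable_snd
  measurable_invFun := by
    simp only [Equiv.coe_fn_symm_mk]
    fun_prop

theorem splitEquiv_apply (e : ι ⊕ κ ≃ μ) (p : (ι → Pt) × (κ → Pt)) (j : μ) :
    splitEquiv e p j = Sum.elim p.1 p.2 (e.symm j) := rfl

theorem measurePreserving_splitEquiv [Fintype ι] [Fintype κ] [Fintype μ] (e : ι ⊕ κ ≃ μ) :
    MeasurePreserving (splitEquiv e) := by
  have h := (volume_measurePreserving_piCongrLeft (fun _ : μ => Pt) e).comp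
    (volume_measurePreserving_sumPiEquivProdPi_symm (fun _ : ι ⊕ κ => Pt))
  refine (funext fun p => funext fun j => ?_ : ⇑(splitEquiv e) = _) ▸ h
  obtain ⟨i, rfl⟩ := e.surjective j
  rw [splitEquiv_apply, Equiv.symm_apply_apply, Function.comp_apply,
    MeasurableEquiv.piCongrLeft_apply_apply, MeasurableEquiv.coe_sumPiEquivProdPi_symm]
  cases i <;> rfl

end Split

/-- `Fin.append` with a prescribed number of particles of the result. -/
def glue {a b c : ℕ} (h : a + b = c) (y : Phase a) (x : Phase b) : Phase c :=
  fun i => Fin.append y x (Fin.cast h.symm i)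

theorem glue_apply {a b c : ℕ} (h : a + b = c) (y : Phase a) (x : Phase b) (i : Fin c) :
    glue h y x i = if h1 : (i : ℕ) < a then y ⟨i, h1⟩ else x ⟨i - a, by omega⟩ := by
  subst h
  simp only [glue, Fin.append, Fin.addCases, Fin.val_cast, Fin.cast_cast]
  split_ifs with h1
  · rfl
  · simp [Fin.subNat]

/-- `glue` as an equivalence. -/
noncomputable def glueEquiv {a b c : ℕ} (h : a + b = c) : Phase a × Phase b ≃ᵐ Phase c :=
  splitEquiv (finSumFinEquiv.trans (finCongr h))

theorem glueEquiv_apply {a b c : ℕ} (h : a + b = c) (p : Phase a × Phase b) :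
    glueEquiv h p = glue h p.1 p.2 := by
  subst h
  funext i
  rw [glueEquiv, splitEquiv_apply, glue]
  refine Fin.addCases (fun i => ?_) (fun i => ?_) i <;> simp [finSumFinEquiv]

theorem measurePreserving_glueEquiv {a b c : ℕ} (h : a + b = c) :
    MeasurePreserving (glueEquiv h) := measurePreserving_splitEquiv _

section Join

variable {n₁ s₁ s₂ n₂ : ℕ}

theorem join_eq_glue (y : Phase n₁) (x : Phase (s₁ + s₂)) (z : Phase n₂) :
    join y x z = glue (by omega) (glue (c := n₁ + (s₁ + s₂)) rfl y x) z := rfl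

theorem join_apply (y : Phase n₁) (x : Phase (s₁ + s₂)) (z : Phase n₂)
    (i : Fin ((n₁ + s₁) + (s₂ + n₂))) :
    join y x z i = if h1 : (i : ℕ) < n₁ then y ⟨i, h1⟩ else
      if h2 : (i : ℕ) < n₁ + (s₁ + s₂) then x ⟨i - n₁, by omega⟩ else
        z ⟨i - (n₁ + (s₁ + s₂)), by omega⟩ := by
  rw [join_eq_glue, glue_apply]
  simp only [glue_apply]
  split_ifs <;> first | rfl | omega

/-- `join` as an equivalence. -/
noncomputable def joinEquiv (n₁ s₁ s₂ n₂ : ℕ) :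
    Phase (s₁ + s₂) × (Phase n₁ × Phase n₂) ≃ᵐ Phase ((n₁ + s₁) + (s₂ + n₂)) :=
  (MeasurableEquiv.prodAssoc.symm.trans
    ((MeasurableEquiv.prodComm.prodCongr (MeasurableEquiv.refl _)).trans
      ((glueEquiv (c := n₁ + (s₁ + s₂)) rfl).prodCongr (MeasurableEquiv.refl _)))).trans
    (glueEquiv (by omega))

theorem joinEquiv_apply (p : Phase (s₁ + s₂) × (Phase n₁ × Phase n₂)) :
    joinEquiv n₁ s₁ s₂ n₂ p = join p.2.1 p.1 p.2.2 := by
  rw [join_eq_glue, joinEquiv, MeasurableEquiv.trans_apply, glueEquiv_apply]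
  congr 1
  exact glueEquiv_apply _ _

theorem measurePreserving_joinEquiv (n₁ s₁ s₂ n₂ : ℕ) :
    MeasurePreserving (joinEquiv n₁ s₁ s₂ n₂) := by
  have h1 : MeasurePreserving (MeasurableEquiv.prodAssoc.symm :
      Phase (s₁ + s₂) × (Phase n₁ × Phase n₂) ≃ᵐ (Phase (s₁ + s₂) × Phase n₁) × Phase n₂) :=
    (volume_preserving_prodAssoc).symm _
  have h2 : MeasurePreserving
      (Prod.swap : Phase (s₁ + s₂) × Phase n₁ → Phase n₁ × Phase (s₁ + s₂)) :=
    Measure.measurePreserving_swap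
  have h3 := (h2.prod (MeasurePreserving.id (volume : Measure (Phase n₂))))
  have h4 := ((measurePreserving_glueEquiv (c := n₁ + (s₁ + s₂)) rfl).prod
    (MeasurePreserving.id (volume : Measure (Phase n₂))))
  exact (measurePreserving_glueEquiv (by omega)).comp (h4.comp (h3.comp h1))

theorem integrable_join_iff {F : Phase ((n₁ + s₁) + (s₂ + n₂)) → ℝ} :
    Integrable (fun p : Phase (s₁ + s₂) × (Phase n₁ × Phase n₂) => F (join p.2.1 p.1 p.2.2)) ↔
      Integrable F := by
  have := (measurePreserving_joinEquiv n₁ s₁ s₂ n₂).integrable_comp_emb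
    (joinEquiv n₁ s₁ s₂ n₂).measurableEmbedding (g := F)
  simpa only [Function.comp_def, joinEquiv_apply] using this

theorem integral_join_prod (F : Phase ((n₁ + s₁) + (s₂ + n₂)) → ℝ) :
    ∫ p : Phase (s₁ + s₂) × (Phase n₁ × Phase n₂), F (join p.2.1 p.1 p.2.2) = ∫ x, F x := by
  have := (measurePreserving_joinEquiv n₁ s₁ s₂ n₂).integral_comp' F
  simpa only [joinEquiv_apply] using this

theorem integral_join {F : Phase ((n₁ + s₁) + (s₂ + n₂)) → ℝ} (hF : Integrable F) :
    ∫ x : Phase (s₁ + s₂), ∫ w : Phase n₁ × Phase n₂, F (join w.1 x w.2) = ∫ x, F x := by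
  rw [← integral_join_prod]
  exact (integral_prod _ (integrable_join_iff.2 hF)).symm

theorem continuous_join : Continuous fun p : Phase (s₁ + s₂) × (Phase n₁ × Phase n₂) =>
    (join p.2.1 p.1 p.2.2 : Phase ((n₁ + s₁) + (s₂ + n₂))) := by
  refine continuous_pi fun i => ?_
  simp only [join_apply]
  split_ifs <;> fun_prop

end Join

/-! ### The dynamics of a block of particles -/

section Block

variable {m N : ℕ}

/-- The map of the phase space of `N` particles that moves the particles listed by `ι` along their
own dynamics. -/
noncomputable def blockMap (σ : ℝ) (Φ : ℝ → ℝ) (ι : Fin m ↪o Fin N) (t : ℝ) (x : Phase N) :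
    Phase N :=
  Function.extend ι (flow σ Φ t (x ∘ ι)) x

theorem blockMap_apply (ι : Fin m ↪o Fin N) (t : ℝ) (x : Phase N) (i : Fin m) :
    blockMap σ Φ ι t x (ι i) = flow σ Φ t (x ∘ ι) i := ι.injective.extend_apply _ _ _

theorem blockMap_comp (ι : Fin m ↪o Fin N) (t : ℝ) (x : Phase N) :
    blockMap σ Φ ι t x ∘ ι = flow σ Φ t (x ∘ ι) := funext fun i => blockMap_apply ι t x i

theorem blockMap_of_notMem {ι : Fin m ↪o Fin N} {j : Fin N} (hj : j ∉ range ι) (t : ℝ)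
    (x : Phase N) : blockMap σ Φ ι t x j = x j :=
  Function.extend_apply' _ _ _ fun ⟨i, hi⟩ => hj ⟨i, hi⟩

theorem blockMap_comp_of_disjoint {k : ℕ} {ι : Fin m ↪o Fin N} {κ : Fin k ↪o Fin N}
    (hd : Disjoint (range ι) (range κ)) (t : ℝ) (x : Phase N) :
    blockMap σ Φ ι t x ∘ κ = x ∘ κ := funext fun i =>
  blockMap_of_notMem (fun h => Set.disjoint_left.1 hd h ⟨i, rfl⟩) t x

theorem blockMap_comm {k : ℕ} {ι : Fin m ↪o Fin N} {κ : Fin k ↪o Fin N}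
    (hd : Disjoint (range ι) (range κ)) (t : ℝ) (x : Phase N) :
    blockMap σ Φ ι t (blockMap σ Φ κ t x) = blockMap σ Φ κ t (blockMap σ Φ ι t x) := by
  funext j
  by_cases h1 : j ∈ range ι
  · obtain ⟨i, rfl⟩ := h1
    rw [blockMap_apply, blockMap_comp_of_disjoint hd.symm,
      blockMap_of_notMem (Set.disjoint_left.1 hd ⟨i, rfl⟩), blockMap_apply]
  · rw [blockMap_of_notMem h1]
    by_cases h2 : j ∈ range κ
    · obtain ⟨i, rfl⟩ := h2
      rw [blockMap_apply, blockMap_apply, blockMap_comp_of_disjoint hd]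
    · rw [blockMap_of_notMem h2, blockMap_of_notMem h2, blockMap_of_notMem h1]

/-- In the coordinates (block, remaining particles) the map is the product of the flow of the block
and the identity. -/
theorem measurePreserving_blockMap (h : IsPotential σ R Φ) (ι : Fin m ↪o Fin N) (t : ℝ) :
    MeasurePreserving (blockMap σ Φ ι t) := by
  classical
  set e : Fin m ⊕ (↥(range ι)ᶜ) ≃ Fin N :=
    ((Equiv.ofInjective ι ι.injective).sumCongr (Equiv.refl _)).trans (Equiv.Set.sumCompl (range ι))
  have h1 := measurePreserving_splitEquiv e
  have h2 := (measurePreserving_flow h m t).prod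
    (MeasurePreserving.id (volume : Measure (↥(range ι)ᶜ → Pt)))
  have h3 := h1.comp (h2.comp (h1.symm _))
  convert h3 using 1
  funext x j
  obtain ⟨i, rfl⟩ := e.surjective j
  rw [Function.comp_apply, splitEquiv_apply, Equiv.symm_apply_apply]
  cases i with
  | inl i => exact blockMap_apply ι t x i
  | inr k => exact blockMap_of_notMem k.2 t x

theorem blockMap_neg_blockMap (h : IsPotential σ R Φ) (ι : Fin m ↪o Fin N) (t : ℝ) (x : Phase N) :
    blockMap σ Φ ι (-t) (blockMap σ Φ ι t x) = x := by
  funext j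
  by_cases h1 : j ∈ range ι
  · obtain ⟨i, rfl⟩ := h1
    rw [blockMap_apply, blockMap_comp, flow_neg_flow h, Function.comp_apply]
  · rw [blockMap_of_notMem h1, blockMap_of_notMem h1]

/-- `blockMap` as an equivalence. -/
noncomputable def blockEquiv (h : IsPotential σ R Φ) (ι : Fin m ↪o Fin N) (t : ℝ) :
    Phase N ≃ᵐ Phase N where
  toFun := blockMap σ Φ ι t
  invFun := blockMap σ Φ ι (-t)
  left_inv := blockMap_neg_blockMap h ι t
  right_inv x := by simpa using blockMap_neg_blockMap h ι (-t) x
  measurable_toFun := (measurePreserving_blockMap h ι t).measurable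
  measurable_invFun := (measurePreserving_blockMap h ι (-t)).measurable

/-- The cut-off in `groupOp` is automatic for such `f`: the flow keeps forbidden configurations of
the block forbidden, and there `f` vanishes. -/
theorem groupOp_eq (h : IsPotential σ R Φ) (ι : Fin m ↪o Fin N) (t : ℝ) {f : Phase N → ℝ}
    (hf : ∀ x, x ∘ ι ∉ Allowed σ m → f x = 0) :
    groupOp σ Φ ι t f = fun x => f (blockMap σ Φ ι (-t) x) := by
  funext x
  rw [groupOp]
  by_cases hx : x ∘ ι ∈ Allowed σ m
  · rw [indicator_of_mem (by exact hx)]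
    rfl
  · rw [indicator_of_notMem (by exact hx), hf]
    rwa [blockMap_comp, flow_mem_iff h]

/-- The composition of the maps of a list of blocks. -/
noncomputable def blocksMap (σ : ℝ) (Φ : ℝ → ℝ) (P : Composition N) (t : ℝ)
    (L : List (Fin P.length)) (x : Phase N) : Phase N :=
  L.foldl (fun y i => blockMap σ Φ (P.embedding i) t y) x

theorem blocksMap_comp_of_notMem {P : Composition N} {t : ℝ} {L : List (Fin P.length)}
    {i : Fin P.length} (hi : i ∉ L) (x : Phase N) :
    blocksMap σ Φ P t L x ∘ P.embedding i = x ∘ P.embedding i := by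
  induction L generalizing x with
  | nil => rfl
  | cons j L ih =>
    rw [List.mem_cons, not_or] at hi
    exact (ih hi.2 _).trans (blockMap_comp_of_disjoint (P.disjoint_range (Ne.symm hi.1)) t x)

theorem measurePreserving_blocksMap (h : IsPotential σ R Φ) (P : Composition N) (t : ℝ)
    (L : List (Fin P.length)) : MeasurePreserving (blocksMap σ Φ P t L) ∧
      MeasurableEmbedding (blocksMap σ Φ P t L) := by
  induction L with
  | nil => exact ⟨MeasurePreserving.id _, MeasurableEmbedding.id⟩
  | cons j L ih =>
    exact ⟨ih.1.comp (measurePreserving_blockMap h (P.embedding j) t),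
      ih.2.comp (blockEquiv h (P.embedding j) t).measurableEmbedding⟩

theorem allowed_comp (ι : Fin m ↪o Fin N) (a : ℕ) (ha : ∀ i, (ι i : ℕ) = a + i) {x : Phase N}
    (hx : x ∈ Allowed σ N) : x ∘ ι ∈ Allowed σ m := fun i j hij =>
  hx (ι i) (ι j) (by rw [ha, ha]; omega)

/-- Composition of operators reverses the composition of maps, so a right fold over operators
becomes a left fold over phase points. The cut-off of each block is redundant because the remaining
blocks in the list do not move its particles. -/
theorem prodGroupOp_eq (h : IsPotential σ R Φ) (P : Composition N) (t : ℝ) {f : Phase N → ℝ}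
    (hf : ∀ x, x ∉ Allowed σ N → f x = 0) :
    prodGroupOp σ Φ P t f = fun x => f (blocksMap σ Φ P (-t) (List.finRange P.length) x) := by
  have key : ∀ L : List (Fin P.length), L.Nodup →
      L.foldr (fun i g => groupOp σ Φ (P.embedding i) t g) f =
        fun x => f (blocksMap σ Φ P (-t) L x) := by
    intro L hL
    induction L with
    | nil => rfl
    | cons j L ih =>
      rw [List.nodup_cons] at hL
      rw [List.foldr_cons, ih hL.2, groupOp_eq h]
      · rfl
      · intro x hx
        refine hf _ fun hx' => hx ?_
        rw [← blocksMap_comp_of_notMem hL.1 x]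
        exact allowed_comp _ _ (fun i => P.coe_embedding j i) hx'
  exact key _ (List.nodup_finRange _)

end Block

end TopologicalParticles

/-! ### Combinatorics of ordered partitions: the alternating sum collapses -/

namespace TopologicalParticles

open Finset

/-! ### Partitions with a distinguished cluster -/

section Cuts

variable {N : ℕ}

/-- The places at which an ordered partition is cut, including `0` and `N`. -/
def cuts (P : Composition N) : Finset ℕ := (range (P.length + 1)).image P.sizeUpTo

theorem sizeUpTo_lt_iff (P : Composition N) {i j : ℕ} (hj : j ≤ P.length) :
    P.sizeUpTo i < P.sizeUpTo j ↔ i < j := by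
  constructor
  · intro h
    by_contra hij
    exact absurd (P.monotone_sizeUpTo (not_lt.1 hij)) (not_le.2 h)
  · intro h
    exact (P.sizeUpTo_strict_mono (h.trans_le hj)).trans_le (P.monotone_sizeUpTo h)

theorem mem_cuts_iff_boundaries (P : Composition N) {c : ℕ} (hc : c < N + 1) :
    c ∈ cuts P ↔ (⟨c, hc⟩ : Fin (N + 1)) ∈ P.boundaries := by
  simp only [cuts, mem_image, mem_range, Composition.boundaries, Finset.mem_map, mem_univ, true_and]
  constructor
  · rintro ⟨k, hk, rfl⟩
    exact ⟨⟨k, hk⟩, rfl⟩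
  · rintro ⟨k, hk⟩
    exact ⟨k, k.2, congrArg Fin.val hk⟩

theorem le_of_mem_cuts {P : Composition N} {c : ℕ} (h : c ∈ cuts P) : c ≤ N := by
  obtain ⟨k, -, rfl⟩ := mem_image.1 h
  exact P.sizeUpTo_le k

theorem zero_mem_cuts (P : Composition N) : 0 ∈ cuts P :=
  mem_image.2 ⟨0, by simp, P.sizeUpTo_zero⟩

theorem last_mem_cuts (P : Composition N) : N ∈ cuts P :=
  mem_image.2 ⟨P.length, by simp, P.sizeUpTo_length⟩

theorem cuts_injective : Function.Injective (cuts : Composition N → Finset ℕ) := by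
  intro P Q h
  apply (compositionEquiv N).injective
  apply CompositionAsSet.ext
  change P.boundaries = Q.boundaries
  ext c
  rw [← mem_cuts_iff_boundaries P c.2, ← mem_cuts_iff_boundaries Q c.2, h]

theorem card_cuts (P : Composition N) : (cuts P).card = P.length + 1 := by
  rw [cuts, card_image_of_injOn, card_range]
  intro i hi j hj hij
  simp only [coe_range, Set.mem_Iio] at hi hj
  by_contra hne
  rcases lt_or_gt_of_ne hne with h | h
  · have := (sizeUpTo_lt_iff P (by omega)).2 h
    omega
  · have := (sizeUpTo_lt_iff P (by omega)).2 h
    omega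

theorem exists_cuts_eq (B : Finset ℕ) (h0 : 0 ∈ B) (hN : N ∈ B) (hB : ∀ c ∈ B, c ≤ N) :
    ∃ P : Composition N, cuts P = B := by
  let c : CompositionAsSet N :=
    { boundaries := univ.filter fun c : Fin (N + 1) => (c : ℕ) ∈ B
      zero_mem := by simpa using h0
      getLast_mem := by simpa using hN }
  refine ⟨c.toComposition, ?_⟩
  ext k
  constructor
  · intro hk
    have := (mem_cuts_iff_boundaries _ (Nat.lt_succ_of_le (le_of_mem_cuts hk))).1 hk
    rw [CompositionAsSet.toComposition_boundaries] at this
    simpa [c] using this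
  · intro hk
    rw [mem_cuts_iff_boundaries _ (Nat.lt_succ_of_le (hB k hk)),
      CompositionAsSet.toComposition_boundaries]
    simpa [c] using hk

/-- There is no cut inside a block. -/
theorem le_or_le_of_mem_cuts {P : Composition N} (i : Fin P.length) {c : ℕ} (hc : c ∈ cuts P) :
    c ≤ P.sizeUpTo i ∨ P.sizeUpTo (i + 1) ≤ c := by
  obtain ⟨k, -, rfl⟩ := mem_image.1 hc
  rcases le_or_gt k i with h | h
  · exact Or.inl (P.monotone_sizeUpTo h)
  · exact Or.inr (P.monotone_sizeUpTo h)

theorem sizeUpTo_mem_cuts (P : Composition N) {i : ℕ} (hi : i ≤ P.length) :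
    P.sizeUpTo i ∈ cuts P := mem_image.2 ⟨i, by simpa [Nat.lt_succ_iff] using hi, rfl⟩

theorem index_eq_iff (P : Composition N) (j : Fin N) (i : Fin P.length) :
    P.index j = i ↔ P.sizeUpTo i ≤ j ∧ (j : ℕ) < P.sizeUpTo (i + 1) := by
  have h := P.mem_range_embedding_iff (j := j) (i := i)
  rw [P.mem_range_embedding_iff'] at h
  exact eq_comm.trans h

end Cuts

section Cluster

variable {n₁ s₁ s₂ n₂ : ℕ}

/-- A cut strictly inside the cluster would separate the particles at `c - 1` and `c`; without one,
the block of the first cluster particle reaches to the end of the cluster. -/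
theorem mem_clusterPartitions_iff (hs : 1 ≤ s₁ + s₂)
    (P : Composition ((n₁ + s₁) + (s₂ + n₂))) :
    P ∈ clusterPartitions n₁ s₁ s₂ n₂ ↔ ∀ c ∈ cuts P, c ≤ n₁ ∨ n₁ + (s₁ + s₂) ≤ c := by
  simp only [clusterPartitions, mem_filter, mem_univ, true_and]
  constructor
  · intro h c hc
    by_contra! hcon
    have h1 := h ⟨c - 1, by omega⟩ ⟨c, by omega⟩ (by simp only; omega) (by simp only; omega)
      (by simp only; omega) (by simp only; omega)
    have h2 := (index_eq_iff P ⟨c - 1, by omega⟩ _).1 rfl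
    have h3 := (index_eq_iff P ⟨c, by omega⟩ _).1 h1.symm
    simp only at h2 h3
    rcases le_or_le_of_mem_cuts (P.index ⟨c - 1, by omega⟩) hc with h4 | h4 <;> omega
  · intro h
    have key : ∀ i : Fin ((n₁ + s₁) + (s₂ + n₂)), n₁ ≤ (i : ℕ) → (i : ℕ) < n₁ + (s₁ + s₂) →
        P.index i = P.index ⟨n₁, by omega⟩ := by
      intro i h1 h2
      have h3 := (index_eq_iff P ⟨n₁, by omega⟩ _).1 rfl
      simp only at h3
      rw [index_eq_iff]
      refine ⟨by omega, ?_⟩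
      have h4 := h _ (sizeUpTo_mem_cuts P (i := P.index ⟨n₁, by omega⟩ + 1)
        (Nat.succ_le_of_lt (P.index ⟨n₁, by omega⟩).2))
      omega
    intro i j h1 h2 h3 h4
    rw [key i h1 h2, key j h3 h4]

/-- The cuts to the left of the cluster. -/
def leftCuts (n₁ s₁ s₂ n₂ : ℕ) (P : Composition ((n₁ + s₁) + (s₂ + n₂))) : Finset ℕ :=
  (Ioc 0 n₁).filter (· ∈ cuts P)

/-- The cuts to the right of the cluster, counted from the right end. -/
def rightCuts (n₁ s₁ s₂ n₂ : ℕ) (P : Composition ((n₁ + s₁) + (s₂ + n₂))) : Finset ℕ :=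
  (Ioc 0 n₂).filter fun c => (n₁ + s₁) + (s₂ + n₂) - c ∈ cuts P

/-- The set of cuts with given cuts to the left and to the right of the cluster. -/
def cutsOf (N : ℕ) (C D : Finset ℕ) : Finset ℕ :=
  (insert 0 C) ∪ (insert 0 D).image (N - ·)

theorem mem_cutsOf_of {C D : Finset ℕ} (hC : C ⊆ Ioc 0 n₁)
    (hD : D ⊆ Ioc 0 n₂) (hs : 1 ≤ s₁ + s₂) {c : ℕ} :
    c ∈ cutsOf ((n₁ + s₁) + (s₂ + n₂)) C D ↔ (c ≤ n₁ ∧ (c = 0 ∨ c ∈ C)) ∨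
      (n₁ + (s₁ + s₂) ≤ c ∧ c ≤ (n₁ + s₁) + (s₂ + n₂) ∧
        ((n₁ + s₁) + (s₂ + n₂) - c = 0 ∨ (n₁ + s₁) + (s₂ + n₂) - c ∈ D)) := by
  simp only [cutsOf, mem_union, mem_insert, mem_image]
  constructor
  · rintro (h | ⟨d, hd, rfl⟩)
    · left
      refine ⟨?_, h⟩
      rcases h with rfl | h
      · omega
      · exact (mem_Ioc.1 (hC h)).2
    · right
      have hd2 : d ≤ n₂ := by
        rcases hd with rfl | h
        · omega
        · exact (mem_Ioc.1 (hD h)).2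
      have e : (n₁ + s₁) + (s₂ + n₂) - ((n₁ + s₁) + (s₂ + n₂) - d) = d := by omega
      rw [e]
      exact ⟨by omega, by omega, hd⟩
  · rintro (⟨-, h⟩ | ⟨h1, h2, h3⟩)
    · exact Or.inl h
    · exact Or.inr ⟨_, h3, by omega⟩

theorem cuts_eq_cutsOf (hs : 1 ≤ s₁ + s₂) {P : Composition ((n₁ + s₁) + (s₂ + n₂))}
    (hP : P ∈ clusterPartitions n₁ s₁ s₂ n₂) :
    cuts P = cutsOf ((n₁ + s₁) + (s₂ + n₂)) (leftCuts n₁ s₁ s₂ n₂ P)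
      (rightCuts n₁ s₁ s₂ n₂ P) := by
  rw [mem_clusterPartitions_iff hs] at hP
  ext c
  rw [mem_cutsOf_of (C := leftCuts n₁ s₁ s₂ n₂ P) (D := rightCuts n₁ s₁ s₂ n₂ P)
    (filter_subset _ _) (filter_subset _ _) hs]
  simp only [leftCuts, rightCuts, mem_filter, mem_Ioc]
  constructor
  · intro hc
    have hcN := le_of_mem_cuts hc
    rcases hP c hc with h | h
    · left
      refine ⟨h, ?_⟩
      rcases Nat.eq_zero_or_pos c with h0 | h0
      · exact Or.inl h0
      · exact Or.inr ⟨⟨h0, h⟩, hc⟩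
    · right
      have e : (n₁ + s₁) + (s₂ + n₂) - ((n₁ + s₁) + (s₂ + n₂) - c) = c := by omega
      refine ⟨h, hcN, ?_⟩
      rw [e]
      rcases Nat.eq_zero_or_pos ((n₁ + s₁) + (s₂ + n₂) - c) with h0 | h0
      · exact Or.inl h0
      · exact Or.inr ⟨⟨h0, by omega⟩, hc⟩
  · rintro (⟨-, rfl | ⟨-, h⟩⟩ | ⟨h1, h2, h3 | ⟨-, h3⟩⟩)
    · exact zero_mem_cuts P
    · exact h
    · have : c = (n₁ + s₁) + (s₂ + n₂) := by omega
      rw [this]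
      exact last_mem_cuts P
    · have e : (n₁ + s₁) + (s₂ + n₂) - ((n₁ + s₁) + (s₂ + n₂) - c) = c := by omega
      rwa [e] at h3

theorem length_eq (hs : 1 ≤ s₁ + s₂) {P : Composition ((n₁ + s₁) + (s₂ + n₂))}
    (hP : P ∈ clusterPartitions n₁ s₁ s₂ n₂) :
    P.length - 1 = (leftCuts n₁ s₁ s₂ n₂ P).card + (rightCuts n₁ s₁ s₂ n₂ P).card := by
  have h := card_cuts P
  have hL : 0 ∉ leftCuts n₁ s₁ s₂ n₂ P := by simp [leftCuts]
  have hR : 0 ∉ rightCuts n₁ s₁ s₂ n₂ P := by simp [rightCuts]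
  have hR2 : ∀ c ∈ insert 0 (rightCuts n₁ s₁ s₂ n₂ P), c ≤ n₂ := by
    intro c hc
    simp only [rightCuts, mem_insert, mem_filter, mem_Ioc] at hc
    omega
  have hL2 : ∀ c ∈ insert 0 (leftCuts n₁ s₁ s₂ n₂ P), c ≤ n₁ := by
    intro c hc
    simp only [leftCuts, mem_insert, mem_filter, mem_Ioc] at hc
    omega
  rw [cuts_eq_cutsOf hs hP, cutsOf, card_union_of_disjoint, card_image_of_injOn,
    card_insert_of_notMem hL, card_insert_of_notMem hR] at h
  · omega
  · intro c hc d hd hcd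
    have h1 := hR2 c hc
    have h2 := hR2 d hd
    simp only at hcd
    omega
  · rw [Finset.disjoint_left]
    intro c hc hc'
    obtain ⟨d, hd, rfl⟩ := mem_image.1 hc'
    have h1 := hR2 d hd
    have h2 := hL2 _ hc
    omega

/-- The block that contains the cluster. -/
def clusterIndex (hs : 1 ≤ s₁ + s₂) (P : Composition ((n₁ + s₁) + (s₂ + n₂))) : Fin P.length :=
  P.index ⟨n₁, by omega⟩

theorem clusterIndex_bounds (hs : 1 ≤ s₁ + s₂) {P : Composition ((n₁ + s₁) + (s₂ + n₂))}
    (hP : P ∈ clusterPartitions n₁ s₁ s₂ n₂) :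
    P.sizeUpTo (clusterIndex hs P) ≤ n₁ ∧
      n₁ + (s₁ + s₂) ≤ P.sizeUpTo (clusterIndex hs P + 1) := by
  have h3 := (index_eq_iff P ⟨n₁, by omega⟩ (clusterIndex hs P)).1 rfl
  simp only at h3
  have h4 := (mem_clusterPartitions_iff hs P).1 hP _ (sizeUpTo_mem_cuts P
    (i := clusterIndex hs P + 1) (Nat.succ_le_of_lt (clusterIndex hs P).2))
  omega

/-- The block of the cluster extends from the last cut on its left to the first cut on its right.
The supremum of an empty set is `0`, which means that no particle on that side is left out. -/
theorem sizeUpTo_clusterIndex (hs : 1 ≤ s₁ + s₂) {P : Composition ((n₁ + s₁) + (s₂ + n₂))}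
    (hP : P ∈ clusterPartitions n₁ s₁ s₂ n₂) :
    P.sizeUpTo (clusterIndex hs P) = (leftCuts n₁ s₁ s₂ n₂ P).sup id ∧
      (n₁ + s₁) + (s₂ + n₂) - P.sizeUpTo (clusterIndex hs P + 1) =
        (rightCuts n₁ s₁ s₂ n₂ P).sup id := by
  obtain ⟨h1, h2⟩ := clusterIndex_bounds hs hP
  have hlen := (clusterIndex hs P).2
  have hc1 := sizeUpTo_mem_cuts P (i := clusterIndex hs P) hlen.le
  have hc2 := sizeUpTo_mem_cuts P (i := clusterIndex hs P + 1) hlen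
  have hle := P.sizeUpTo_le (clusterIndex hs P + 1)
  constructor
  · apply le_antisymm
    · rcases Nat.eq_zero_or_pos (P.sizeUpTo (clusterIndex hs P)) with h0 | h0
      · omega
      · exact le_sup (f := id) (mem_filter.2 ⟨mem_Ioc.2 ⟨h0, h1⟩, hc1⟩)
    · refine Finset.sup_le fun c hc => ?_
      simp only [leftCuts, mem_filter, mem_Ioc] at hc
      rcases le_or_le_of_mem_cuts (clusterIndex hs P) hc.2 with h | h
      · exact h
      · simp only [id]; omega
  · apply le_antisymm
    · rcases Nat.eq_zero_or_pos
        ((n₁ + s₁) + (s₂ + n₂) - P.sizeUpTo (clusterIndex hs P + 1)) with h0 | h0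
      · omega
      · refine le_sup (f := id) (mem_filter.2 ⟨mem_Ioc.2 ⟨h0, by omega⟩, ?_⟩)
        rwa [Nat.sub_sub_self hle]
    · refine Finset.sup_le fun c hc => ?_
      simp only [rightCuts, mem_filter, mem_Ioc] at hc
      rcases le_or_le_of_mem_cuts (clusterIndex hs P) hc.2 with h | h
      · omega
      · simp only [id]; omega

/-- The cuts on the two sides of the cluster can be chosen freely and independently, which makes
partitions the same as pairs of subsets. -/
theorem sum_clusterPartitions {M : Type*} [AddCommMonoid M] (hs : 1 ≤ s₁ + s₂)
    (φ : Finset ℕ × Finset ℕ → M) :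
    ∑ P ∈ clusterPartitions n₁ s₁ s₂ n₂, φ (leftCuts n₁ s₁ s₂ n₂ P, rightCuts n₁ s₁ s₂ n₂ P) =
      ∑ p ∈ (Ioc 0 n₁).powerset ×ˢ (Ioc 0 n₂).powerset, φ p := by
  refine sum_nbij (fun P => (leftCuts n₁ s₁ s₂ n₂ P, rightCuts n₁ s₁ s₂ n₂ P)) ?_ ?_ ?_
    fun _ _ => rfl
  · intro P _
    exact mem_product.2 ⟨mem_powerset.2 (filter_subset _ _), mem_powerset.2 (filter_subset _ _)⟩
  · intro P hP Q hQ hPQ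
    rw [Prod.mk.injEq] at hPQ
    apply cuts_injective
    rw [cuts_eq_cutsOf hs hP, cuts_eq_cutsOf hs hQ, hPQ.1, hPQ.2]
  · rintro ⟨C, D⟩ hCD
    simp only [coe_product, Set.mem_prod, mem_coe, mem_powerset] at hCD
    obtain ⟨hC, hD⟩ := hCD
    obtain ⟨P, hP⟩ := exists_cuts_eq (N := (n₁ + s₁) + (s₂ + n₂))
      (cutsOf ((n₁ + s₁) + (s₂ + n₂)) C D) (by simp [cutsOf]) (by simp [cutsOf]) (by
        intro c hc
        rw [mem_cutsOf_of hC hD hs] at hc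
        omega)
    refine ⟨P, ?_, ?_⟩
    · rw [mem_coe, mem_clusterPartitions_iff hs, hP]
      intro c hc
      rw [mem_cutsOf_of hC hD hs] at hc
      omega
    · rw [Prod.mk.injEq]
      constructor
      · ext c
        simp only [leftCuts, mem_filter, hP, mem_cutsOf_of hC hD hs, mem_Ioc]
        constructor
        · rintro ⟨⟨h1, h2⟩, (⟨-, h | h⟩ | h)⟩
          · omega
          · exact h
          · omega
        · intro h
          have := mem_Ioc.1 (hC h)
          exact ⟨this, Or.inl ⟨this.2, Or.inr h⟩⟩
      · ext c
        simp only [rightCuts, mem_filter, hP, mem_cutsOf_of hC hD hs, mem_Ioc]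
        constructor
        · rintro ⟨⟨h1, h2⟩, (h | ⟨-, h3, h | h⟩)⟩
          · omega
          · omega
          · rwa [Nat.sub_sub_self (by omega)] at h
        · intro h
          have := mem_Ioc.1 (hD h)
          refine ⟨this, Or.inr ⟨by omega, by omega, Or.inr ?_⟩⟩
          rwa [Nat.sub_sub_self (by omega)]

theorem card_clusterPartitions (hs : 1 ≤ s₁ + s₂) :
    (clusterPartitions n₁ s₁ s₂ n₂).card = 2 ^ (n₁ + n₂) := by
  have := sum_clusterPartitions (n₁ := n₁) (n₂ := n₂) hs fun _ => 1
  rw [card_eq_sum_ones, this, ← card_eq_sum_ones, card_product, card_powerset, card_powerset]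
  simp [pow_add]

/-- For a fixed maximum `l` the other elements form an arbitrary subset of `{1, …, l - 1}`, and
their signs cancel unless that set is empty. Only `C = ∅` and `C = {1}` survive, the latter being
present when `n ≥ 1`; hence the range `min n 1 + 1`. The induction adds the subsets whose maximum is
`n + 1`. -/
theorem sum_powerset_neg_one_pow_mul (h : ℕ → ℝ) (n : ℕ) :
    ∑ C ∈ (Ioc 0 n).powerset, (-1 : ℝ) ^ C.card * h (C.sup id) =
      ∑ l ∈ range (min n 1 + 1), (-1 : ℝ) ^ l * h l := by
  induction n with
  | zero => simp
  | succ n ih =>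
    have hI : Ioc 0 (n + 1) = insert (n + 1) (Ioc 0 n) := by
      ext c
      simp only [mem_insert, mem_Ioc]
      omega
    have hn : n + 1 ∉ Ioc 0 n := by simp
    rw [hI, sum_powerset_insert hn, ih]
    have h2 : ∑ C ∈ (Ioc 0 n).powerset,
        (-1 : ℝ) ^ (insert (n + 1) C).card * h ((insert (n + 1) C).sup id) =
        -((∑ C ∈ (Ioc 0 n).powerset, (-1 : ℝ) ^ C.card) * h (n + 1)) := by
      rw [sum_mul, ← sum_neg_distrib]
      refine sum_congr rfl fun C hC => ?_
      have hC' := mem_powerset.1 hC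
      rw [card_insert_of_notMem fun h => hn (hC' h), sup_insert]
      have : (n + 1) ⊔ C.sup id = n + 1 := by
        refine sup_eq_left.2 (Finset.sup_le fun c hc => ?_)
        have := (mem_Ioc.1 (hC' hc)).2
        simp only [id]
        omega
      rw [id, this]
      ring
    rw [h2]
    have h3 : (∑ C ∈ (Ioc 0 n).powerset, (-1 : ℝ) ^ C.card) = if n = 0 then 1 else 0 := by
      have := sum_powerset_neg_one_pow_card (x := Ioc 0 n)
      have h4 : (Ioc 0 n = ∅) ↔ n = 0 := by simp
      simp only [h4] at this
      have h5 := congrArg (Int.cast : ℤ → ℝ) this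
      push_cast at h5
      exact h5
    rw [h3]
    rcases Nat.eq_zero_or_pos n with rfl | hpos
    · simp [sum_range_succ]
    · have e1 : min n 1 = 1 := by omega
      have e2 : min (n + 1) 1 = 1 := by omega
      rw [e1, e2, if_neg hpos.ne']
      simp

/-- In the alternating sum over the partitions of a function of the block of the cluster, only the
blocks that leave out at most one particle on each side survive. -/
theorem sum_clusterPartitions_alternating (hs : 1 ≤ s₁ + s₂) (g : ℕ → ℕ → ℝ) :
    ∑ P ∈ clusterPartitions n₁ s₁ s₂ n₂, (-1 : ℝ) ^ (P.length - 1) *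
        g (P.sizeUpTo (clusterIndex hs P))
          ((n₁ + s₁) + (s₂ + n₂) - P.sizeUpTo (clusterIndex hs P + 1)) =
      ∑ l₁ ∈ range (min n₁ 1 + 1), ∑ l₂ ∈ range (min n₂ 1 + 1),
        (-1 : ℝ) ^ (l₁ + l₂) * g l₁ l₂ := by
  have h1 : ∀ P ∈ clusterPartitions n₁ s₁ s₂ n₂, (-1 : ℝ) ^ (P.length - 1) *
        g (P.sizeUpTo (clusterIndex hs P))
          ((n₁ + s₁) + (s₂ + n₂) - P.sizeUpTo (clusterIndex hs P + 1)) =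
      (fun p : Finset ℕ × Finset ℕ => (-1 : ℝ) ^ (p.1.card + p.2.card) *
        g (p.1.sup id) (p.2.sup id)) (leftCuts n₁ s₁ s₂ n₂ P, rightCuts n₁ s₁ s₂ n₂ P) := by
    intro P hP
    rw [length_eq hs hP, (sizeUpTo_clusterIndex hs hP).1, (sizeUpTo_clusterIndex hs hP).2]
  rw [sum_congr rfl h1, sum_clusterPartitions hs (fun p => (-1 : ℝ) ^ (p.1.card + p.2.card) *
    g (p.1.sup id) (p.2.sup id)), sum_product]
  simp only [pow_add, mul_assoc]
  have h2 : ∀ C : Finset ℕ, ∑ D ∈ (Ioc 0 n₂).powerset,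
      (-1 : ℝ) ^ C.card * ((-1 : ℝ) ^ D.card * g (C.sup id) (D.sup id)) =
      (-1 : ℝ) ^ C.card * (fun k => ∑ l₂ ∈ range (min n₂ 1 + 1), (-1 : ℝ) ^ l₂ * g k l₂)
        (C.sup id) := by
    intro C
    rw [← mul_sum, sum_powerset_neg_one_pow_mul]
  rw [sum_congr rfl fun C _ => h2 C, sum_powerset_neg_one_pow_mul
    (fun k => ∑ l₂ ∈ range (min n₂ 1 + 1), (-1 : ℝ) ^ l₂ * g k l₂)]
  simp only [mul_sum]

end Cluster

end TopologicalParticles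

/-! ### Integrating the cumulants over the additional particles -/

namespace TopologicalParticles

open Set

variable {σ R : ℝ} {Φ : ℝ → ℝ}

/-! ### Integrated cumulants -/

theorem seq_cast (F : DoubleSeq) {a b a' b' : ℕ} (ha : a = a') (hb : b = b') (x : Phase (a + b)) :
    F a b x = F a' b' (fun i => x (Fin.cast (by omega) i)) := by
  subst ha hb
  rfl

/-- Integration over `k₁` particles to the left and `k₂` particles to the right. -/
noncomputable def reduce (k₁ k₂ : ℕ) (F : DoubleSeq) : DoubleSeq := fun s₁ s₂ x =>
  ∫ w : Phase k₁ × Phase k₂, F (k₁ + s₁) (s₂ + k₂) (join w.1 x w.2)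

/-- The evolution of a sequence along the Hamiltonian dynamics. -/
noncomputable def transport (σ : ℝ) (Φ : ℝ → ℝ) (t : ℝ) (F : DoubleSeq) : DoubleSeq :=
  fun n₁ n₂ x => F n₁ n₂ (flow σ Φ (-t) x)

section Frame

variable {l₁ k₁ s₁ s₂ k₂ l₂ : ℕ}

/-- The particles `v` and `v'` around the particles `z`, with the numbers of particles on both sides
of the origin written in the order of `join (append v u) x (append u' v')`. -/
def frame (v : Phase l₁) (z : Phase ((k₁ + s₁) + (s₂ + k₂))) (v' : Phase l₂) :
    Phase (((l₁ + k₁) + s₁) + (s₂ + (k₂ + l₂))) :=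
  fun i => join v z v' (Fin.cast (by omega) i)

theorem seq_frame (F : DoubleSeq) (v : Phase l₁) (z : Phase ((k₁ + s₁) + (s₂ + k₂)))
    (v' : Phase l₂) : F ((l₁ + k₁) + s₁) (s₂ + (k₂ + l₂)) (frame v z v') =
      F (l₁ + (k₁ + s₁)) ((s₂ + k₂) + l₂) (join v z v') :=
  seq_cast F (by omega) (by omega) _

theorem join_glue (v : Phase l₁) (u : Phase k₁) (x : Phase (s₁ + s₂)) (u' : Phase k₂)
    (v' : Phase l₂) :
    (join (glue rfl v u) x (glue rfl u' v') : Phase (((l₁ + k₁) + s₁) + (s₂ + (k₂ + l₂)))) =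
      frame v (join u x u') v' := by
  funext i
  simp only [frame, join_apply, glue_apply, Fin.val_cast]
  split_ifs <;> first | omega | rfl | (congr 1; apply Fin.ext; simp only; omega)

theorem frame_apply_add (v : Phase l₁) (z : Phase ((k₁ + s₁) + (s₂ + k₂))) (v' : Phase l₂)
    (i : Fin (((l₁ + k₁) + s₁) + (s₂ + (k₂ + l₂)))) (j : Fin ((k₁ + s₁) + (s₂ + k₂)))
    (hij : (i : ℕ) = l₁ + j) : frame v z v' i = z j := by
  have := j.2
  rw [frame, join_apply, dif_neg (by simp; omega), dif_pos (by simp; omega)]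
  congr 1
  apply Fin.ext
  simp only [Fin.val_cast]
  omega

theorem blockMap_frame (ι : Fin ((k₁ + s₁) + (s₂ + k₂)) ↪o
      Fin (((l₁ + k₁) + s₁) + (s₂ + (k₂ + l₂)))) (hι : ∀ i, (ι i : ℕ) = l₁ + i) (t : ℝ)
    (v : Phase l₁) (z : Phase ((k₁ + s₁) + (s₂ + k₂))) (v' : Phase l₂) :
    blockMap σ Φ ι t (frame v z v') = frame v (flow σ Φ t z) v' := by
  have hz : frame v z v' ∘ ι = z := funext fun i => frame_apply_add v z v' _ i (hι i)
  funext j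
  by_cases hj : j ∈ range ι
  · obtain ⟨i, rfl⟩ := hj
    rw [blockMap_apply, hz, frame_apply_add v _ v' _ i (hι i)]
  · rw [blockMap_of_notMem hj]
    have h1 : (j : ℕ) < l₁ ∨ l₁ + ((k₁ + s₁) + (s₂ + k₂)) ≤ j := by
      by_contra h
      exact hj ⟨⟨j - l₁, by omega⟩, Fin.ext (by rw [hι]; simp only; omega)⟩
    simp only [frame, join_apply, Fin.val_cast]
    split_ifs <;> first | rfl | omega

/-- `glue` on both sides, as an equivalence. -/
noncomputable def glueBothEquiv (l₁ k₁ k₂ l₂ : ℕ) :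
    (Phase k₁ × Phase k₂) × (Phase l₁ × Phase l₂) ≃ᵐ Phase (l₁ + k₁) × Phase (k₂ + l₂) :=
  MeasurableEquiv.prodAssoc.trans (((MeasurableEquiv.refl _).prodCongr
    (MeasurableEquiv.prodComm.trans MeasurableEquiv.prodAssoc)).trans
    (MeasurableEquiv.prodAssoc.symm.trans
      ((MeasurableEquiv.prodComm.trans (glueEquiv rfl)).prodCongr
        (MeasurableEquiv.prodComm.trans (glueEquiv rfl)))))

theorem coe_glueBothEquiv : ⇑(glueBothEquiv l₁ k₁ k₂ l₂) =
    fun p => (glue rfl p.2.1 p.1.1, glue rfl p.1.2 p.2.2) :=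
  funext fun _ => Prod.ext (glueEquiv_apply _ _) (glueEquiv_apply _ _)

theorem measurePreserving_glueBothEquiv (l₁ k₁ k₂ l₂ : ℕ) :
    MeasurePreserving (glueBothEquiv l₁ k₁ k₂ l₂) := by
  have h1 : MeasurePreserving (MeasurableEquiv.prodAssoc :
      (Phase k₁ × Phase k₂) × (Phase l₁ × Phase l₂) ≃ᵐ _) := volume_preserving_prodAssoc
  have h2 : MeasurePreserving (MeasurableEquiv.prodAssoc :
      (Phase l₁ × Phase l₂) × Phase k₂ ≃ᵐ _) := volume_preserving_prodAssoc
  have h3 : MeasurePreserving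
      (Prod.swap : Phase k₂ × (Phase l₁ × Phase l₂) → (Phase l₁ × Phase l₂) × Phase k₂) :=
    Measure.measurePreserving_swap
  have h4 := (MeasurePreserving.id (volume : Measure (Phase k₁))).prod (h2.comp h3)
  have h5 : MeasurePreserving (MeasurableEquiv.prodAssoc.symm :
      Phase k₁ × (Phase l₁ × (Phase l₂ × Phase k₂)) ≃ᵐ _) :=
    (volume_preserving_prodAssoc).symm _
  have h6 : MeasurePreserving (Prod.swap : Phase k₁ × Phase l₁ → Phase l₁ × Phase k₁) :=
    Measure.measurePreserving_swap
  have h7 : MeasurePreserving (Prod.swap : Phase l₂ × Phase k₂ → Phase k₂ × Phase l₂) :=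
    Measure.measurePreserving_swap
  have h8 := ((measurePreserving_glueEquiv (rfl : l₁ + k₁ = _)).comp h6).prod
    ((measurePreserving_glueEquiv (rfl : k₂ + l₂ = _)).comp h7)
  exact h8.comp (h5.comp (h4.comp h1))

theorem integrable_glue_iff {g : Phase (l₁ + k₁) × Phase (k₂ + l₂) → ℝ} :
    Integrable (fun p : (Phase k₁ × Phase k₂) × (Phase l₁ × Phase l₂) =>
      g (glue rfl p.2.1 p.1.1, glue rfl p.1.2 p.2.2)) ↔ Integrable g := by
  have := (measurePreserving_glueBothEquiv l₁ k₁ k₂ l₂).integrable_comp_emb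
    (glueBothEquiv l₁ k₁ k₂ l₂).measurableEmbedding (g := g)
  rwa [coe_glueBothEquiv] at this

theorem integral_glue {g : Phase (l₁ + k₁) × Phase (k₂ + l₂) → ℝ} (hg : Integrable g) :
    ∫ w, g w = ∫ u : Phase k₁ × Phase k₂, ∫ v : Phase l₁ × Phase l₂,
      g (glue rfl v.1 u.1, glue rfl u.2 v.2) := by
  have := (measurePreserving_glueBothEquiv l₁ k₁ k₂ l₂).integral_comp' g
  rw [← this, coe_glueBothEquiv]
  exact integral_prod _ (integrable_glue_iff.2 hg)

/-- The dynamics of the block that leaves out `l₁` particles to the left and `l₂` particles to the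
right, integrated over all the additional particles. -/
theorem integral_blockMap (F : DoubleSeq) (ι : Fin ((k₁ + s₁) + (s₂ + k₂)) ↪o
      Fin (((l₁ + k₁) + s₁) + (s₂ + (k₂ + l₂)))) (hι : ∀ i, (ι i : ℕ) = l₁ + i) (t : ℝ)
    (x : Phase (s₁ + s₂))
    (hF : Integrable fun w : Phase (l₁ + k₁) × Phase (k₂ + l₂) =>
      F ((l₁ + k₁) + s₁) (s₂ + (k₂ + l₂)) (blockMap σ Φ ι (-t) (join w.1 x w.2))) :
    (∫ w : Phase (l₁ + k₁) × Phase (k₂ + l₂),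
      F ((l₁ + k₁) + s₁) (s₂ + (k₂ + l₂)) (blockMap σ Φ ι (-t) (join w.1 x w.2))) =
        reduce k₁ k₂ (transport σ Φ t (reduce l₁ l₂ F)) s₁ s₂ x ∧
    Integrable fun u : Phase k₁ × Phase k₂ =>
      transport σ Φ t (reduce l₁ l₂ F) (k₁ + s₁) (s₂ + k₂) (join u.1 x u.2) := by
  have h1 : ∀ (u : Phase k₁ × Phase k₂) (v : Phase l₁ × Phase l₂),
      F ((l₁ + k₁) + s₁) (s₂ + (k₂ + l₂))
        (blockMap σ Φ ι (-t) (join (glue rfl v.1 u.1) x (glue rfl u.2 v.2))) =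
      F (l₁ + (k₁ + s₁)) ((s₂ + k₂) + l₂) (join v.1 (flow σ Φ (-t) (join u.1 x u.2)) v.2) := by
    intro u v
    rw [join_glue, blockMap_frame ι hι, seq_frame F]
  constructor
  · rw [integral_glue hF]
    simp only [h1]
    rfl
  · have := (integrable_glue_iff.2 hF).integral_prod_left
    simp only [h1] at this
    exact this

theorem reduce_reduce (F : DoubleSeq) (x : Phase (s₁ + s₂))
    (hF : Integrable fun w : Phase (l₁ + k₁) × Phase (k₂ + l₂) =>
      F ((l₁ + k₁) + s₁) (s₂ + (k₂ + l₂)) (join w.1 x w.2)) :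
    reduce k₁ k₂ (reduce l₁ l₂ F) s₁ s₂ x = reduce (l₁ + k₁) (k₂ + l₂) F s₁ s₂ x ∧
    Integrable fun u : Phase k₁ × Phase k₂ =>
      reduce l₁ l₂ F (k₁ + s₁) (s₂ + k₂) (join u.1 x u.2) := by
  have h1 : ∀ (u : Phase k₁ × Phase k₂) (v : Phase l₁ × Phase l₂),
      F ((l₁ + k₁) + s₁) (s₂ + (k₂ + l₂)) (join (glue rfl v.1 u.1) x (glue rfl u.2 v.2)) =
      F (l₁ + (k₁ + s₁)) ((s₂ + k₂) + l₂) (join v.1 (join u.1 x u.2) v.2) := by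
    intro u v
    rw [join_glue, seq_frame F]
  constructor
  · rw [reduce, reduce, integral_glue hF]
    simp only [h1]
    rfl
  · have := (integrable_glue_iff.2 hF).integral_prod_left
    simp only [h1] at this
    exact this

end Frame

/-! ### Removing the blocks without the cluster -/

section Outer

variable {n₁ s₁ s₂ n₂ : ℕ}

/-- A block on one side of the cluster moves additional particles only, independently of `x`. So it
acts as a measure-preserving substitution in the variables of integration. -/
theorem exists_blockMap_join (h : IsPotential σ R Φ) {m : ℕ}
    (ι : Fin m ↪o Fin ((n₁ + s₁) + (s₂ + n₂)))
    (hι : (∀ i, (ι i : ℕ) < n₁) ∨ ∀ i, n₁ + (s₁ + s₂) ≤ (ι i : ℕ)) (t : ℝ) :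
    ∃ e : Phase n₁ × Phase n₂ → Phase n₁ × Phase n₂, MeasurePreserving e ∧ MeasurableEmbedding e ∧
      ∀ (w : Phase n₁ × Phase n₂) (x : Phase (s₁ + s₂)),
        blockMap σ Φ ι t (join w.1 x w.2) = join (e w).1 x (e w).2 := by
  rcases hι with hι | hι
  · let κ : Fin m ↪o Fin n₁ := OrderEmbedding.ofStrictMono (fun i => ⟨ι i, hι i⟩)
      fun i j hij => ι.strictMono hij
    have hκ : ∀ i, (κ i : ℕ) = ι i := fun i => rfl
    refine ⟨Prod.map (blockMap σ Φ κ t) id,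
      (measurePreserving_blockMap h κ t).prod (MeasurePreserving.id _),
      ((blockEquiv h κ t).prodCongr (MeasurableEquiv.refl _)).measurableEmbedding, ?_⟩
    intro w x
    have hc : (join w.1 x w.2 : Phase ((n₁ + s₁) + (s₂ + n₂))) ∘ ι = w.1 ∘ κ := by
      funext i
      rw [Function.comp_apply, join_apply, dif_pos (hι i)]
      rfl
    funext j
    rw [join_apply]
    by_cases hj : j ∈ range ι
    · obtain ⟨i, rfl⟩ := hj
      rw [blockMap_apply, hc, dif_pos (hι i)]
      exact (blockMap_apply κ t w.1 i).symm
    · rw [blockMap_of_notMem hj, join_apply]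
      split_ifs with h1 h2
      · refine (blockMap_of_notMem ?_ t w.1).symm
        rintro ⟨i, hi⟩
        exact hj ⟨i, Fin.ext (by rw [← hκ, hi])⟩
      · rfl
      · rfl
  · let κ : Fin m ↪o Fin n₂ := OrderEmbedding.ofStrictMono
      (fun i => ⟨ι i - (n₁ + (s₁ + s₂)), by have := hι i; have := (ι i).2; omega⟩)
      fun i j hij => by
        have h1 : (ι i : ℕ) < ι j := ι.strictMono hij
        have := hι i
        simp only [Fin.mk_lt_mk]
        omega
    have hκ : ∀ i, (κ i : ℕ) + (n₁ + (s₁ + s₂)) = ι i := fun i => Nat.sub_add_cancel (hι i)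
    refine ⟨Prod.map id (blockMap σ Φ κ t),
      (MeasurePreserving.id _).prod (measurePreserving_blockMap h κ t),
      ((MeasurableEquiv.refl _).prodCongr (blockEquiv h κ t)).measurableEmbedding, ?_⟩
    intro w x
    have hc : (join w.1 x w.2 : Phase ((n₁ + s₁) + (s₂ + n₂))) ∘ ι = w.2 ∘ κ := by
      funext i
      have := hι i
      rw [Function.comp_apply, join_apply, dif_neg (by omega), dif_neg (by omega)]
      rfl
    funext j
    rw [join_apply]
    by_cases hj : j ∈ range ι
    · obtain ⟨i, rfl⟩ := hj
      have := hι i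
      rw [blockMap_apply, hc, dif_neg (by omega), dif_neg (by omega)]
      exact (blockMap_apply κ t w.2 i).symm
    · rw [blockMap_of_notMem hj, join_apply]
      split_ifs with h1 h2
      · rfl
      · rfl
      · refine (blockMap_of_notMem ?_ t w.2).symm
        rintro ⟨i, hi⟩
        refine hj ⟨i, Fin.ext ?_⟩
        rw [← hκ, hi]
        simp only
        omega

theorem exists_blocksMap_join (h : IsPotential σ R Φ) (P : Composition ((n₁ + s₁) + (s₂ + n₂)))
    (t : ℝ) (L : List (Fin P.length))
    (hL : ∀ j ∈ L, P.sizeUpTo (j + 1) ≤ n₁ ∨ n₁ + (s₁ + s₂) ≤ P.sizeUpTo j) :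
    ∃ e : Phase n₁ × Phase n₂ → Phase n₁ × Phase n₂, MeasurePreserving e ∧ MeasurableEmbedding e ∧
      ∀ (w : Phase n₁ × Phase n₂) (x : Phase (s₁ + s₂)),
        blocksMap σ Φ P t L (join w.1 x w.2) = join (e w).1 x (e w).2 := by
  induction L with
  | nil => exact ⟨id, MeasurePreserving.id _, MeasurableEmbedding.id, fun w x => rfl⟩
  | cons j L ih =>
    obtain ⟨e₁, h1, h2, h3⟩ := ih fun i hi => hL i (List.mem_cons_of_mem _ hi)
    obtain ⟨e₂, h4, h5, h6⟩ := exists_blockMap_join (σ := σ) (s₁ := s₁) (s₂ := s₂) h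
      (P.embedding j) (by
        have hsz : P.sizeUpTo (j + 1) = P.sizeUpTo j + P.blocksFun j := P.sizeUpTo_succ' j
        rcases hL j List.mem_cons_self with h7 | h7
        · refine Or.inl fun i => ?_
          have := i.2
          rw [P.coe_embedding]
          omega
        · refine Or.inr fun i => ?_
          rw [P.coe_embedding]
          omega) t
    refine ⟨e₁ ∘ e₂, h1.comp h4, h2.comp h5, fun w x => ?_⟩
    rw [Function.comp_apply, ← h3, ← h6]
    rfl

/-- Disjoint blocks commute, which allows the block of the cluster to be applied last. -/
theorem blocksMap_perm {N : ℕ} (P : Composition N) (t : ℝ) {L L' : List (Fin P.length)}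
    (hL : L.Perm L') (x : Phase N) : blocksMap σ Φ P t L x = blocksMap σ Φ P t L' x := by
  refine hL.foldl_eq' (fun i _ j _ y => ?_) x
  by_cases hij : i = j
  · rw [hij]
  · exact blockMap_comm (P.disjoint_range (Ne.symm hij)) t y

/-- The blocks without the cluster do not contribute after integration over the additional
particles. -/
theorem exists_blocksMap_cluster (h : IsPotential σ R Φ) (hs : 1 ≤ s₁ + s₂)
    {P : Composition ((n₁ + s₁) + (s₂ + n₂))} (hP : P ∈ clusterPartitions n₁ s₁ s₂ n₂) (t : ℝ) :
    ∃ e : Phase n₁ × Phase n₂ → Phase n₁ × Phase n₂, MeasurePreserving e ∧ MeasurableEmbedding e ∧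
      ∀ (w : Phase n₁ × Phase n₂) (x : Phase (s₁ + s₂)),
        blocksMap σ Φ P t (List.finRange P.length) (join w.1 x w.2) =
          blockMap σ Φ (P.embedding (clusterIndex hs P)) t (join (e w).1 x (e w).2) := by
  set i := clusterIndex hs P
  have hb := clusterIndex_bounds hs hP
  obtain ⟨e, h1, h2, h3⟩ := exists_blocksMap_join (σ := σ) h P t ((List.finRange P.length).erase i)
    (fun j hj => by
      have hne : j ≠ i := ((List.nodup_finRange _).mem_erase_iff.1 hj).1
      rcases lt_or_gt_of_ne (Fin.val_ne_of_ne hne) with hlt | hlt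
      · exact Or.inl ((P.monotone_sizeUpTo hlt).trans hb.1)
      · exact Or.inr (hb.2.trans (P.monotone_sizeUpTo hlt)))
  refine ⟨e, h1, h2, fun w x => ?_⟩
  rw [← h3]
  have hp : (List.finRange P.length).Perm ((List.finRange P.length).erase i ++ [i]) :=
    (List.perm_cons_erase (List.mem_finRange i)).trans (List.perm_append_singleton _ _).symm
  rw [blocksMap_perm P t hp, blocksMap, List.foldl_append]
  rfl

/-- The substitution `e` removes all blocks but that of the cluster. The particles that this block
leaves out are integrated before the transport, the additional particles inside it afterwards. -/
theorem integral_prodGroupOp (h : IsPotential σ R Φ) (hs : 1 ≤ s₁ + s₂)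
    {P : Composition ((n₁ + s₁) + (s₂ + n₂))} (hP : P ∈ clusterPartitions n₁ s₁ s₂ n₂) (t : ℝ)
    {F : DoubleSeq} (hF : ∀ n₁ n₂, ∀ x ∉ Allowed σ (n₁ + n₂), F n₁ n₂ x = 0) (x : Phase (s₁ + s₂))
    (hI : Integrable fun w : Phase n₁ × Phase n₂ =>
      prodGroupOp σ Φ P t (F (n₁ + s₁) (s₂ + n₂)) (join w.1 x w.2)) :
    (∫ w : Phase n₁ × Phase n₂, prodGroupOp σ Φ P t (F (n₁ + s₁) (s₂ + n₂)) (join w.1 x w.2)) =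
        reduce (n₁ - P.sizeUpTo (clusterIndex hs P))
          (n₂ - ((n₁ + s₁) + (s₂ + n₂) - P.sizeUpTo (clusterIndex hs P + 1)))
          (transport σ Φ t (reduce (P.sizeUpTo (clusterIndex hs P))
            ((n₁ + s₁) + (s₂ + n₂) - P.sizeUpTo (clusterIndex hs P + 1)) F)) s₁ s₂ x := by
  obtain ⟨e, h1, h2, h3⟩ := exists_blocksMap_cluster (σ := σ) h hs hP (-t)
  have hb := clusterIndex_bounds hs hP
  have hle := P.sizeUpTo_le (clusterIndex hs P + 1)
  set i := clusterIndex hs P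
  have hsz : P.sizeUpTo (i + 1) = P.sizeUpTo i + P.blocksFun i := P.sizeUpTo_succ' i
  have hcoe := P.coe_embedding i
  rw [prodGroupOp_eq h P t (hF _ _)] at hI ⊢
  simp only [h3] at hI ⊢
  rw [h1.integral_comp h2 (fun w => F (n₁ + s₁) (s₂ + n₂)
    (blockMap σ Φ (P.embedding i) (-t) (join w.1 x w.2)))]
  replace hI := (h1.integrable_comp_emb h2 (g := fun w => F (n₁ + s₁) (s₂ + n₂)
    (blockMap σ Φ (P.embedding i) (-t) (join w.1 x w.2)))).1 hI
  -- The block is replaced by an arbitrary embedding with the same offset, so that the particle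
  -- numbers on which all types depend become variables and can be substituted.
  generalize P.embedding i = ι at hI hcoe ⊢
  generalize P.blocksFun i = m at ι hI hcoe hsz ⊢
  generalize hc : (n₁ + s₁) + (s₂ + n₂) - P.sizeUpTo (i + 1) = l₂
  generalize P.sizeUpTo (i + 1) = b at hb hle hsz hc
  generalize P.sizeUpTo i = l₁ at hb hle hsz hcoe ⊢
  clear h1 h2 h3 e hP
  clear_value i
  clear i
  clear P
  obtain ⟨k₁, rfl⟩ := Nat.exists_eq_add_of_le hb.1
  obtain ⟨k₂, rfl⟩ : ∃ k₂, n₂ = k₂ + l₂ := ⟨n₂ - l₂, by omega⟩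
  obtain rfl : m = (k₁ + s₁) + (s₂ + k₂) := by omega
  rw [Nat.add_sub_cancel_left, Nat.add_sub_cancel]
  exact (integral_blockMap F ι hcoe t x hI).1

/-- The integrated cumulant contains only the blocks that leave out at most one particle on each
side of the cluster. -/
theorem integral_seriesIntegrand (h : IsPotential σ R Φ) (hs : 1 ≤ s₁ + s₂) (t : ℝ)
    {F : DoubleSeq} (hF : ∀ n₁ n₂, ∀ x ∉ Allowed σ (n₁ + n₂), F n₁ n₂ x = 0) (x : Phase (s₁ + s₂))
    (hI : ∀ P ∈ clusterPartitions n₁ s₁ s₂ n₂, Integrable fun w : Phase n₁ × Phase n₂ =>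
      prodGroupOp σ Φ P t (F (n₁ + s₁) (s₂ + n₂)) (join w.1 x w.2)) :
    ∫ w : Phase n₁ × Phase n₂, seriesIntegrand σ Φ F t x n₁ n₂ w =
      ∑ l₁ ∈ Finset.range (min n₁ 1 + 1), ∑ l₂ ∈ Finset.range (min n₂ 1 + 1),
        (-1 : ℝ) ^ (l₁ + l₂) * reduce (n₁ - l₁) (n₂ - l₂)
          (transport σ Φ t (reduce l₁ l₂ F)) s₁ s₂ x := by
  simp only [seriesIntegrand, cumulant]
  rw [integral_finsetSum _ fun P hP => (hI P hP).const_mul _,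
    ← sum_clusterPartitions_alternating hs fun l₁ l₂ => reduce (n₁ - l₁) (n₂ - l₂)
          (transport σ Φ t (reduce l₁ l₂ F)) s₁ s₂ x]
  refine Finset.sum_congr rfl fun P hP => ?_
  rw [integral_const_mul, integral_prodGroupOp h hs hP t hF x (hI P hP)]

end Outer

/-! ### Bounds for the cumulants -/

section Bound

variable {n₁ s₁ s₂ n₂ : ℕ}

theorem integrable_prodGroupOp (h : IsPotential σ R Φ) {N : ℕ} (P : Composition N) (t : ℝ)
    {f : Phase N → ℝ} (hf : ∀ x ∉ Allowed σ N, f x = 0) (hI : Integrable f) :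
    Integrable (prodGroupOp σ Φ P t f) ∧ ∫ x, |prodGroupOp σ Φ P t f x| = ∫ x, |f x| := by
  obtain ⟨h1, h2⟩ := measurePreserving_blocksMap h P (-t) (List.finRange P.length)
  rw [prodGroupOp_eq h P t hf]
  exact ⟨(h1.integrable_comp_emb h2).2 hI, h1.integral_comp h2 fun x => |f x|⟩

/-- Each product of groups preserves the `L¹` norm, and there are `2 ^ (n₁ + n₂)` partitions, one
for every choice of cuts outside the cluster. -/
theorem integrable_cumulant (h : IsPotential σ R Φ) (hs : 1 ≤ s₁ + s₂) (t : ℝ)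
    {f : Phase ((n₁ + s₁) + (s₂ + n₂)) → ℝ} (hI : Integrable f)
    (hf : ∀ x ∉ Allowed σ ((n₁ + s₁) + (s₂ + n₂)), f x = 0) :
    Integrable (cumulant σ Φ n₁ s₁ s₂ n₂ t f) ∧
      ∫ x, |cumulant σ Φ n₁ s₁ s₂ n₂ t f x| ≤ 2 ^ (n₁ + n₂) * ∫ x, |f x| := by
  have h1 := fun P : Composition ((n₁ + s₁) + (s₂ + n₂)) => integrable_prodGroupOp h P t hf hI
  have h2 : Integrable (cumulant σ Φ n₁ s₁ s₂ n₂ t f) :=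
    integrable_finsetSum _ fun P _ => (h1 P).1.const_mul _
  refine ⟨h2, ?_⟩
  calc ∫ x, |cumulant σ Φ n₁ s₁ s₂ n₂ t f x|
      ≤ ∫ x, ∑ P ∈ clusterPartitions n₁ s₁ s₂ n₂, |prodGroupOp σ Φ P t f x| := by
        refine integral_mono h2.abs (integrable_finsetSum _ fun P _ => (h1 P).1.abs) fun x => ?_
        refine (Finset.abs_sum_le_sum_abs _ _).trans (Finset.sum_le_sum fun P _ => ?_)
        rw [abs_mul, abs_pow, abs_neg, abs_one, one_pow, one_mul]
    _ = 2 ^ (n₁ + n₂) * ∫ x, |f x| := by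
        rw [integral_finsetSum _ fun P _ => (h1 P).1.abs,
          Finset.sum_congr rfl fun P _ => (h1 P).2, Finset.sum_const, card_clusterPartitions hs,
          nsmul_eq_mul]
        norm_cast

end Bound

end TopologicalParticles

/-! ### Weighted norms, the operators `(1 - 𝔞₋)(1 - 𝔞₊)` and their inverse -/

namespace TopologicalParticles

open Set

variable {σ R α : ℝ} {Φ : ℝ → ℝ}

/-! ### Series of integrable functions -/

section Series

variable {ι Ω : Type*} [Countable ι] [MeasurableSpace Ω] {μ : Measure Ω}

theorem ae_summable_of_summable_integral {g : ι → Ω → ℝ} (hg : ∀ i, Integrable (g i) μ)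
    (hs : Summable fun i => ∫ x, |g i x| ∂μ) : ∀ᵐ x ∂μ, Summable fun i => |g i x| := by
  have h1 : ∀ i, ∫⁻ x, ENNReal.ofReal |g i x| ∂μ = ENNReal.ofReal (∫ x, |g i x| ∂μ) := fun i =>
    (ofReal_integral_eq_lintegral_ofReal (hg i).abs (ae_of_all _ fun _ => abs_nonneg _)).symm
  have hm : ∀ i, AEMeasurable (fun x => ENNReal.ofReal |g i x|) μ := fun i =>
    (hg i).abs.aemeasurable.ennreal_ofReal
  have h2 : ∫⁻ x, ∑' i, ENNReal.ofReal |g i x| ∂μ ≠ ⊤ := by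
    rw [lintegral_tsum hm, tsum_congr h1]
    exact hs.tsum_ofReal_ne_top
  filter_upwards [ae_lt_top' (AEMeasurable.tsum hm) h2] with x hx
  have := ENNReal.summable_toReal hx.ne
  simpa only [ENNReal.toReal_ofReal (abs_nonneg _)] using this

theorem integrable_tsum_of_summable_integral {g : ι → Ω → ℝ} (hg : ∀ i, Integrable (g i) μ)
    (hs : Summable fun i => ∫ x, |g i x| ∂μ) :
    Integrable (fun x => ∑' i, g i x) μ ∧
      ∫ x, |∑' i, g i x| ∂μ ≤ ∑' i, ∫ x, |g i x| ∂μ := by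
  have hae := ae_summable_of_summable_integral hg hs
  have habs : Integrable (fun x => ∑' i, |g i x|) μ := by
    refine ⟨(AEMeasurable.tsum fun i => (hg i).abs.aemeasurable).aestronglyMeasurable, ?_⟩
    have h1 : ∀ i, ∫⁻ x, ENNReal.ofReal |g i x| ∂μ = ENNReal.ofReal (∫ x, |g i x| ∂μ) := fun i =>
      (ofReal_integral_eq_lintegral_ofReal (hg i).abs (ae_of_all _ fun _ => abs_nonneg _)).symm
    have h2 : ∫⁻ x, ∑' i, ENNReal.ofReal |g i x| ∂μ ≠ ⊤ := by
      rw [lintegral_tsum fun i => (hg i).abs.aemeasurable.ennreal_ofReal, tsum_congr h1]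
      exact hs.tsum_ofReal_ne_top
    rw [hasFiniteIntegral_iff_ofReal (ae_of_all _ fun x => tsum_nonneg fun i => abs_nonneg _)]
    refine lt_of_le_of_lt (lintegral_mono_ae ?_) h2.lt_top
    filter_upwards [hae] with x hx
    rw [ENNReal.ofReal_tsum_of_nonneg (fun _ => abs_nonneg _) hx]
  have hle : ∀ᵐ x ∂μ, |∑' i, g i x| ≤ ∑' i, |g i x| := by
    filter_upwards [hae] with x hx
    exact norm_tsum_le_tsum_norm (f := fun i => g i x) hx
  have hint : Integrable (fun x => ∑' i, g i x) μ :=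
    habs.mono' (AEMeasurable.tsum fun i => (hg i).aemeasurable).aestronglyMeasurable hle
  refine ⟨hint, (integral_mono_ae hint.abs habs hle).trans_eq ?_⟩
  have h3 := integral_tsum_of_summable_integral_norm (F := fun i x => |g i x|)
    (fun i => (hg i).abs) (by simpa only [Real.norm_eq_abs, abs_abs] using hs)
  exact h3.symm

end Series

theorem abs_integral_join_le {n₁ s₁ s₂ n₂ : ℕ} {f : Phase ((n₁ + s₁) + (s₂ + n₂)) → ℝ}
    (hf : Integrable f) :
    Integrable (fun x : Phase (s₁ + s₂) => ∫ w : Phase n₁ × Phase n₂, f (join w.1 x w.2)) ∧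
      ∫ x : Phase (s₁ + s₂), |∫ w : Phase n₁ × Phase n₂, f (join w.1 x w.2)| ≤ ∫ x, |f x| := by
  have h1 : Integrable
      (fun x : Phase (s₁ + s₂) => ∫ w : Phase n₁ × Phase n₂, f (join w.1 x w.2)) :=
    (integrable_join_iff.2 hf).integral_prod_left
  refine ⟨h1, ?_⟩
  rw [← integral_join hf.abs]
  have h2 : Integrable
      (fun x : Phase (s₁ + s₂) => ∫ w : Phase n₁ × Phase n₂, |f (join w.1 x w.2)|) :=
    (integrable_join_iff.2 hf.abs).integral_prod_left
  exact integral_mono h1.abs h2 fun x => abs_integral_le_integral_abs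

theorem integral_abs_join_abs {n₁ s₁ s₂ n₂ : ℕ} {f : Phase ((n₁ + s₁) + (s₂ + n₂)) → ℝ}
    (hf : Integrable f) :
    ∫ x : Phase (s₁ + s₂), abs (∫ w : Phase n₁ × Phase n₂, |f (join w.1 x w.2)|) = ∫ x, |f x| := by
  rw [← integral_join hf.abs]
  exact integral_congr_ae (ae_of_all _ fun x => abs_of_nonneg (integral_nonneg fun _ => abs_nonneg _))

/-- Almost all fibres of a summable family of integrable functions are summable. -/
theorem ae_summable_join {ι : Type*} [Countable ι] {s₁ s₂ : ℕ} (n₁ n₂ : ι → ℕ)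
    (f : ∀ i, Phase ((n₁ i + s₁) + (s₂ + n₂ i)) → ℝ) (hf : ∀ i, Integrable (f i))
    (hs : Summable fun i => ∫ x, |f i x|) :
    ∀ᵐ x : Phase (s₁ + s₂),
      (∀ i, Integrable fun w : Phase (n₁ i) × Phase (n₂ i) => f i (join w.1 x w.2)) ∧
      Summable fun i => ∫ w : Phase (n₁ i) × Phase (n₂ i), |f i (join w.1 x w.2)| := by
  have h1 : ∀ᵐ x : Phase (s₁ + s₂), ∀ i,
      Integrable fun w : Phase (n₁ i) × Phase (n₂ i) => f i (join w.1 x w.2) :=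
    ae_all_iff.2 fun i => (integrable_join_iff.2 (hf i)).prod_right_ae
  have h2 := ae_summable_of_summable_integral (μ := (volume : Measure (Phase (s₁ + s₂))))
    (g := fun i x => ∫ w : Phase (n₁ i) × Phase (n₂ i), |f i (join w.1 x w.2)|)
    (fun i => (abs_integral_join_le (hf i).abs).1)
    (hs.congr fun i => (integral_abs_join_abs (hf i)).symm)
  filter_upwards [h1, h2] with x h1 h2
  exact ⟨h1, by simpa only [abs_of_nonneg (integral_nonneg fun _ => abs_nonneg _)] using h2⟩

theorem integrable_tsum_join {ι : Type*} [Countable ι] {s₁ s₂ : ℕ} (n₁ n₂ : ι → ℕ)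
    (f : ∀ i, Phase ((n₁ i + s₁) + (s₂ + n₂ i)) → ℝ) (hf : ∀ i, Integrable (f i))
    (hs : Summable fun i => ∫ x, |f i x|) :
    Integrable (fun x : Phase (s₁ + s₂) =>
      ∑' i, ∫ w : Phase (n₁ i) × Phase (n₂ i), f i (join w.1 x w.2)) ∧
    ∫ x : Phase (s₁ + s₂), |∑' i, ∫ w : Phase (n₁ i) × Phase (n₂ i), f i (join w.1 x w.2)| ≤
      ∑' i, ∫ x, |f i x| := by
  have h1 := fun i => abs_integral_join_le (hf i)
  have h2 : Summable fun i => ∫ x : Phase (s₁ + s₂),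
      |∫ w : Phase (n₁ i) × Phase (n₂ i), f i (join w.1 x w.2)| :=
    hs.of_nonneg_of_le (fun _ => integral_nonneg fun _ => abs_nonneg _) fun i => (h1 i).2
  have h3 := integrable_tsum_of_summable_integral (μ := (volume : Measure (Phase (s₁ + s₂))))
    (fun i => (h1 i).1) h2
  exact ⟨h3.1, h3.2.trans (h2.tsum_le_tsum (fun i => (h1 i).2) hs)⟩

/-! ### Sequences of integrable functions -/

/-- Sequences of integrable functions with finite norm. -/
structure SummableSeq (α : ℝ) (F : DoubleSeq) : Prop where
  integrable : ∀ n₁ n₂, Integrable (F n₁ n₂)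
  summable : Summable fun n : ℕ × ℕ => α ^ (n.1 + n.2) * ∫ x, |F n.1 n.2 x|

theorem MemL1.summableSeq {F : DoubleSeq} (hF : MemL1 σ α F) : SummableSeq α F :=
  ⟨hF.integrable, hF.summable⟩

/-- The weighted norm of a component. -/
noncomputable def compNorm (α : ℝ) (F : DoubleSeq) (n : ℕ × ℕ) : ℝ :=
  α ^ (n.1 + n.2) * ∫ x, |F n.1 n.2 x|

theorem compNorm_nonneg (hα : 0 ≤ α) (F : DoubleSeq) (n : ℕ × ℕ) : 0 ≤ compNorm α F n :=
  mul_nonneg (pow_nonneg hα _) (integral_nonneg fun _ => abs_nonneg _)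

theorem normL1_nonneg (hα : 0 ≤ α) (F : DoubleSeq) : 0 ≤ normL1 α F :=
  tsum_nonneg fun n => compNorm_nonneg hα F n

theorem compNorm_congr {F G : DoubleSeq} {n : ℕ × ℕ}
    (hFG : F n.1 n.2 =ᵐ[volume] G n.1 n.2) : compNorm α F n = compNorm α G n := by
  rw [compNorm, compNorm]
  congr 1
  refine integral_congr_ae ?_
  filter_upwards [hFG] with x hx
  rw [hx]

theorem SummableSeq.congr {F G : DoubleSeq} (hF : SummableSeq α F)
    (hFG : ∀ n₁ n₂, F n₁ n₂ =ᵐ[volume] G n₁ n₂) : SummableSeq α G ∧ normL1 α G = normL1 α F := by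
  have h : compNorm α F = compNorm α G := funext fun n => compNorm_congr (hFG n.1 n.2)
  have hs : Summable (compNorm α F) := hF.summable
  refine ⟨⟨fun n₁ n₂ => (hF.integrable n₁ n₂).congr (hFG n₁ n₂), ?_⟩, ?_⟩
  · rw [h] at hs
    exact hs
  · change tsum (compNorm α G) = tsum (compNorm α F)
    rw [h]

theorem normL1_congr {F G : DoubleSeq} (hFG : ∀ n₁ n₂, F n₁ n₂ =ᵐ[volume] G n₁ n₂) :
    normL1 α F = normL1 α G :=
  tsum_congr fun n => compNorm_congr (hFG n.1 n.2)

theorem SummableSeq.of_le {F : DoubleSeq} (hα : 0 ≤ α) (hF : ∀ n₁ n₂, Integrable (F n₁ n₂))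
    {c : ℕ × ℕ → ℝ} (hc : Summable c) (hle : ∀ n, compNorm α F n ≤ c n) :
    SummableSeq α F ∧ normL1 α F ≤ ∑' n, c n := by
  have : Summable (compNorm α F) := hc.of_nonneg_of_le (compNorm_nonneg hα F) hle
  exact ⟨⟨hF, this⟩, this.tsum_le_tsum hle hc⟩

theorem SummableSeq.const_mul {F : DoubleSeq} (hF : SummableSeq α F) (c : ℝ) :
    SummableSeq α (fun n₁ n₂ x => c * F n₁ n₂ x) ∧
      normL1 α (fun n₁ n₂ x => c * F n₁ n₂ x) = |c| * normL1 α F := by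
  have h : compNorm α (fun n₁ n₂ x => c * F n₁ n₂ x) = fun n => |c| * compNorm α F n := by
    funext n
    simp only [compNorm, abs_mul, integral_const_mul]
    ring
  have hs : Summable (compNorm α (fun n₁ n₂ x => c * F n₁ n₂ x)) := by
    rw [h]
    exact Summable.mul_left _ hF.summable
  refine ⟨⟨fun n₁ n₂ => (hF.integrable n₁ n₂).const_mul c, hs⟩, ?_⟩
  change tsum (compNorm α (fun n₁ n₂ x => c * F n₁ n₂ x)) = |c| * tsum (compNorm α F)
  rw [h, tsum_mul_left]

theorem SummableSeq.sum {ι : Type*} (I : Finset ι) (hα : 0 ≤ α) {F : ι → DoubleSeq}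
    (hF : ∀ i, SummableSeq α (F i)) :
    SummableSeq α (fun n₁ n₂ x => ∑ i ∈ I, F i n₁ n₂ x) ∧
      normL1 α (fun n₁ n₂ x => ∑ i ∈ I, F i n₁ n₂ x) ≤ ∑ i ∈ I, normL1 α (F i) := by
  have h := SummableSeq.of_le hα (F := fun n₁ n₂ x => ∑ i ∈ I, F i n₁ n₂ x)
    (fun n₁ n₂ => integrable_finsetSum I fun i _ => (hF i).integrable n₁ n₂)
    (c := fun n => ∑ i ∈ I, compNorm α (F i) n) (summable_sum fun i _ => (hF i).summable)
    (fun n => by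
      simp only [compNorm]
      rw [← Finset.mul_sum]
      refine mul_le_mul_of_nonneg_left ?_ (pow_nonneg hα _)
      rw [← integral_finsetSum I fun i _ => ((hF i).integrable n.1 n.2).abs]
      exact integral_mono (integrable_finsetSum I fun i _ => (hF i).integrable n.1 n.2).abs
        (integrable_finsetSum I fun i _ => ((hF i).integrable n.1 n.2).abs)
        fun x => Finset.abs_sum_le_sum_abs _ _)
  refine ⟨h.1, h.2.trans_eq ?_⟩
  exact Summable.tsum_finsetSum fun i _ => (hF i).summable

theorem SummableSeq.sub {F G : DoubleSeq} (hα : 0 ≤ α) (hF : SummableSeq α F)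
    (hG : SummableSeq α G) : SummableSeq α (F - G) ∧ normL1 α (F - G) ≤ normL1 α F + normL1 α G := by
  have h := SummableSeq.of_le hα (F := F - G)
    (fun n₁ n₂ => (hF.integrable n₁ n₂).sub (hG.integrable n₁ n₂))
    (c := fun n => compNorm α F n + compNorm α G n) (hF.summable.add hG.summable)
    (fun n => by
      simp only [compNorm]
      rw [← mul_add, ← integral_add (hF.integrable n.1 n.2).abs (hG.integrable n.1 n.2).abs]
      refine mul_le_mul_of_nonneg_left ?_ (pow_nonneg hα _)
      exact integral_mono ((hF.integrable n.1 n.2).sub (hG.integrable n.1 n.2)).abs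
        ((hF.integrable n.1 n.2).abs.add (hG.integrable n.1 n.2).abs) fun x => abs_sub _ _)
  refine ⟨h.1, h.2.trans_eq ?_⟩
  exact hF.summable.tsum_add hG.summable

theorem SummableSeq.integral_le_normL1 {F : DoubleSeq} (hα : 0 ≤ α) (hF : SummableSeq α F)
    (n : ℕ × ℕ) : compNorm α F n ≤ normL1 α F :=
  hF.summable.le_tsum n fun m _ => compNorm_nonneg hα F m

theorem add_injective (k : ℕ × ℕ) : Function.Injective fun n : ℕ × ℕ => (k.1 + n.1, n.2 + k.2) := by
  rintro ⟨a, b⟩ ⟨c, d⟩ h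
  simp only [Prod.mk.injEq] at h
  exact Prod.ext (by simp only; omega) (by simp only; omega)

theorem add_injective' (n : ℕ × ℕ) : Function.Injective fun k : ℕ × ℕ => (k.1 + n.1, n.2 + k.2) := by
  rintro ⟨a, b⟩ ⟨c, d⟩ h
  simp only [Prod.mk.injEq] at h
  exact Prod.ext (by simp only; omega) (by simp only; omega)

/-! ### Bounds for `reduce` -/

/-- Each particle integrated out lowers the power of `α` in the weight by one, so `𝔞₋` and `𝔞₊` have
norm at most `α⁻¹`. -/
theorem SummableSeq.reduce {F : DoubleSeq} (hα : 0 < α) (hF : SummableSeq α F) (k₁ k₂ : ℕ) :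
    SummableSeq α (reduce k₁ k₂ F) ∧
      normL1 α (TopologicalParticles.reduce k₁ k₂ F) ≤ (α⁻¹) ^ (k₁ + k₂) * normL1 α F := by
  have hs : Summable (compNorm α F) := hF.summable
  have hinj := add_injective (k₁, k₂)
  have h := SummableSeq.of_le hα.le (F := TopologicalParticles.reduce k₁ k₂ F)
    (fun n₁ n₂ => (abs_integral_join_le (hF.integrable _ _)).1)
    (c := fun n => (α⁻¹) ^ (k₁ + k₂) * compNorm α F (k₁ + n.1, n.2 + k₂))
    ((hs.comp_injective hinj).mul_left _)
    (fun n => by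
      have e : (α⁻¹) ^ (k₁ + k₂) * compNorm α F (k₁ + n.1, n.2 + k₂) =
          α ^ (n.1 + n.2) * ∫ x, |F (k₁ + n.1) (n.2 + k₂) x| := by
        rw [compNorm, ← mul_assoc]
        congr 1
        rw [show k₁ + n.1 + (n.2 + k₂) = (k₁ + k₂) + (n.1 + n.2) by ring, pow_add α (k₁ + k₂), ← mul_assoc,
          inv_pow, inv_mul_cancel₀ (pow_ne_zero _ hα.ne'), one_mul]
      rw [e]
      exact mul_le_mul_of_nonneg_left (abs_integral_join_le (hF.integrable _ _)).2
        (pow_nonneg hα.le _))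
  refine ⟨h.1, h.2.trans ?_⟩
  rw [tsum_mul_left]
  refine mul_le_mul_of_nonneg_left ?_ (pow_nonneg (inv_nonneg.2 hα.le) _)
  exact (hs.comp_injective hinj).tsum_le_tsum_of_inj _ hinj
    (fun n _ => compNorm_nonneg hα.le F n) (fun n => le_rfl) hs

/-- `(1 - 𝔞₋)(1 - 𝔞₊)` -/
noncomputable def reduceInv (F : DoubleSeq) : DoubleSeq := fun n₁ n₂ x =>
  ∑ l ∈ Finset.range 2 ×ˢ Finset.range 2, (-1 : ℝ) ^ (l.1 + l.2) * reduce l.1 l.2 F n₁ n₂ x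

theorem SummableSeq.reduceInv {F : DoubleSeq} (hα : 0 < α) (hF : SummableSeq α F) :
    SummableSeq α (reduceInv F) ∧
      normL1 α (TopologicalParticles.reduceInv F) ≤ (1 + α⁻¹) ^ 2 * normL1 α F := by
  have h := SummableSeq.sum (Finset.range 2 ×ˢ Finset.range 2) hα.le
    (F := fun l n₁ n₂ x => (-1 : ℝ) ^ (l.1 + l.2) *
      TopologicalParticles.reduce l.1 l.2 F n₁ n₂ x)
    fun l => ((hF.reduce hα l.1 l.2).1.const_mul _).1
  refine ⟨h.1, h.2.trans ?_⟩
  have h2 : ∀ l : ℕ × ℕ, normL1 α (fun n₁ n₂ x => (-1 : ℝ) ^ (l.1 + l.2) *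
      TopologicalParticles.reduce l.1 l.2 F n₁ n₂ x) ≤ (α⁻¹) ^ (l.1 + l.2) * normL1 α F := by
    intro l
    rw [((hF.reduce hα l.1 l.2).1.const_mul _).2, abs_pow, abs_neg, abs_one, one_pow, one_mul]
    exact (hF.reduce hα l.1 l.2).2
  refine (Finset.sum_le_sum fun l _ => h2 l).trans_eq ?_
  rw [Finset.sum_product]
  simp only [Finset.sum_range_succ, Finset.sum_range_zero]
  ring

/-- `(1 - 𝔞₋)⁻¹(1 - 𝔞₊)⁻¹` -/
noncomputable def expand (F : DoubleSeq) : DoubleSeq := fun n₁ n₂ x =>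
  ∑' k : ℕ × ℕ, reduce k.1 k.2 F n₁ n₂ x

theorem SummableSeq.summable_shift {F : DoubleSeq} (hα : 1 ≤ α) (hF : SummableSeq α F)
    (n : ℕ × ℕ) : Summable fun k : ℕ × ℕ => ∫ x, |F (k.1 + n.1) (n.2 + k.2) x| := by
  have hs : Summable (compNorm α F) := hF.summable
  refine (hs.comp_injective (add_injective' n)).of_nonneg_of_le
    (fun k => integral_nonneg fun _ => abs_nonneg _) fun k => ?_
  exact le_mul_of_one_le_left (integral_nonneg fun _ => abs_nonneg _) (one_le_pow₀ hα)

/-- By Tonelli the sum over `n` is taken first; it is at most `r ^ (k.1 + k.2) * ∑ u`, and the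
double geometric series remains. With `r = α⁻¹` this is the Neumann series bound for `expand`. -/
theorem summable_geometric_convolution {u : ℕ × ℕ → ℝ} (hu0 : ∀ n, 0 ≤ u n) (hu : Summable u)
    {r : ℝ} (hr0 : 0 ≤ r) (hr1 : r < 1) :
    (Summable fun n : ℕ × ℕ => ∑' k : ℕ × ℕ, r ^ (k.1 + k.2) * u (k.1 + n.1, n.2 + k.2)) ∧
      ∑' n : ℕ × ℕ, ∑' k : ℕ × ℕ, r ^ (k.1 + k.2) * u (k.1 + n.1, n.2 + k.2) ≤
        ((1 - r)⁻¹) ^ 2 * ∑' n, u n := by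
  have hg := hasSum_geometric_of_lt_one hr0 hr1
  have hgg : HasSum (fun k : ℕ × ℕ => r ^ (k.1 + k.2)) (((1 - r)⁻¹) ^ 2) := by
    rw [sq]
    simp only [pow_add]
    exact hg.mul hg (hg.summable.mul_of_nonneg hg.summable (fun _ => pow_nonneg hr0 _)
      (fun _ => pow_nonneg hr0 _))
  have hk : ∀ k : ℕ × ℕ, Summable fun n : ℕ × ℕ => r ^ (k.1 + k.2) * u (k.1 + n.1, n.2 + k.2) :=
    fun k => (hu.comp_injective (add_injective k)).mul_left _
  have hkle : ∀ k : ℕ × ℕ, ∑' n : ℕ × ℕ, r ^ (k.1 + k.2) * u (k.1 + n.1, n.2 + k.2) ≤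
      r ^ (k.1 + k.2) * ∑' n, u n := fun k => by
    rw [tsum_mul_left]
    refine mul_le_mul_of_nonneg_left ?_ (pow_nonneg hr0 _)
    exact tsum_comp_le_tsum_of_inj hu hu0 (add_injective k)
  have hcs : Summable fun p : (ℕ × ℕ) × (ℕ × ℕ) =>
      r ^ (p.1.1 + p.1.2) * u (p.1.1 + p.2.1, p.2.2 + p.1.2) := by
    rw [summable_prod_of_nonneg fun p => mul_nonneg (pow_nonneg hr0 _) (hu0 _)]
    exact ⟨hk, (hgg.summable.mul_right _).of_nonneg_of_le
      (fun k => tsum_nonneg fun n => mul_nonneg (pow_nonneg hr0 _) (hu0 _)) hkle⟩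
  have hsw := hcs.prod_symm
  refine ⟨hsw.prod, ?_⟩
  calc ∑' n : ℕ × ℕ, ∑' k : ℕ × ℕ, r ^ (k.1 + k.2) * u (k.1 + n.1, n.2 + k.2)
      = ∑' k : ℕ × ℕ, ∑' n : ℕ × ℕ, r ^ (k.1 + k.2) * u (k.1 + n.1, n.2 + k.2) :=
        hcs.tsum_comm
    _ ≤ ∑' k : ℕ × ℕ, r ^ (k.1 + k.2) * ∑' n, u n :=
        hcs.prod.tsum_le_tsum hkle (hgg.summable.mul_right _)
    _ = ((1 - r)⁻¹) ^ 2 * ∑' n, u n := by rw [tsum_mul_right, hgg.tsum_eq]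

theorem SummableSeq.expand {F : DoubleSeq} (hα : 1 < α) (hF : SummableSeq α F) :
    SummableSeq α (expand F) ∧
      normL1 α (TopologicalParticles.expand F) ≤ ((1 - α⁻¹)⁻¹) ^ 2 * normL1 α F := by
  have h0 : 0 < α := one_pos.trans hα
  have hs : Summable (compNorm α F) := hF.summable
  have hc := summable_geometric_convolution (compNorm_nonneg h0.le F) hs (inv_nonneg.2 h0.le)
    (inv_lt_one_of_one_lt₀ hα)
  have hJ := fun n₁ n₂ => integrable_tsum_join (s₁ := n₁) (s₂ := n₂) (fun k : ℕ × ℕ => k.1)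
    (fun k => k.2) (fun k => F (k.1 + n₁) (n₂ + k.2)) (fun k => hF.integrable _ _)
      (hF.summable_shift hα.le (n₁, n₂))
  have h := SummableSeq.of_le h0.le (F := TopologicalParticles.expand F)
    (fun n₁ n₂ => (hJ n₁ n₂).1) hc.1 fun n => by
      refine (mul_le_mul_of_nonneg_left (hJ n.1 n.2).2 (pow_nonneg h0.le _)).trans_eq ?_
      rw [← tsum_mul_left]
      refine tsum_congr fun k => ?_
      rw [compNorm, ← mul_assoc]
      congr 1
      rw [show k.1 + n.1 + (n.2 + k.2) = (k.1 + k.2) + (n.1 + n.2) by ring,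
        pow_add α (k.1 + k.2), ← mul_assoc, inv_pow, inv_mul_cancel₀ (pow_ne_zero _ h0.ne'),
        one_mul]
  exact ⟨h.1, h.2.trans hc.2⟩

/-! ### Algebra of `reduce` and `expand` on almost all fibres -/

/-- The fibre of `F` over `x` is summable. -/
structure SummableAt (F : DoubleSeq) {s₁ s₂ : ℕ} (x : Phase (s₁ + s₂)) : Prop where
  integrable : ∀ k : ℕ × ℕ, Integrable fun w : Phase k.1 × Phase k.2 =>
    F (k.1 + s₁) (s₂ + k.2) (join w.1 x w.2)
  summable : Summable fun k : ℕ × ℕ => ∫ w : Phase k.1 × Phase k.2,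
    |F (k.1 + s₁) (s₂ + k.2) (join w.1 x w.2)|

theorem SummableSeq.ae_summableAt {F : DoubleSeq} (hα : 1 ≤ α) (hF : SummableSeq α F)
    (s₁ s₂ : ℕ) : ∀ᵐ x : Phase (s₁ + s₂), SummableAt F x := by
  filter_upwards [ae_summable_join (s₁ := s₁) (s₂ := s₂) (fun k : ℕ × ℕ => k.1) (fun k => k.2)
    (fun k => F (k.1 + s₁) (s₂ + k.2)) (fun k => hF.integrable _ _)
    (hF.summable_shift hα (s₁, s₂))] with x hx
  exact ⟨hx.1, hx.2⟩

section Fibre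

variable {F : DoubleSeq} {s₁ s₂ : ℕ} {x : Phase (s₁ + s₂)}

theorem SummableAt.summable_reduce (hF : SummableAt F x) :
    Summable fun k : ℕ × ℕ => reduce k.1 k.2 F s₁ s₂ x :=
  hF.summable.of_norm_bounded fun _ => norm_integral_le_integral_norm _

theorem reduce_zero (F : DoubleSeq) (x : Phase (s₁ + s₂)) : reduce 0 0 F s₁ s₂ x = F s₁ s₂ x := by
  have h : ∀ w : Phase 0 × Phase 0, F (0 + s₁) (s₂ + 0) (join w.1 x w.2) = F s₁ s₂ x := by
    intro w
    rw [seq_cast F (Nat.zero_add s₁) (Nat.add_zero s₂)]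
    congr 1
    funext i
    rw [join_apply, dif_neg (by omega), dif_pos (by simp)]
    rfl
  rw [reduce]
  simp only [h]
  rw [integral_const]
  have : (volume : Measure (Phase 0 × Phase 0)).real univ = 1 := by
    rw [← univ_prod_univ, Measure.real, Measure.volume_eq_prod, Measure.prod_prod]
    simp [volume_pi]
  rw [this, one_smul]

theorem SummableAt.reduce_reduce (hF : SummableAt F x) (k l : ℕ × ℕ) :
    reduce k.1 k.2 (reduce l.1 l.2 F) s₁ s₂ x = reduce (l.1 + k.1) (k.2 + l.2) F s₁ s₂ x ∧
    Integrable fun u : Phase k.1 × Phase k.2 =>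
      reduce l.1 l.2 F (k.1 + s₁) (s₂ + k.2) (join u.1 x u.2) :=
  TopologicalParticles.reduce_reduce F x (hF.integrable (l.1 + k.1, k.2 + l.2))

/-- A telescoping sum in both indices: the difference of the full sum and its shift leaves a
boundary row, and then a corner. -/
theorem tsum_alternating {u : ℕ × ℕ → ℝ} (hu : Summable u) :
    ∑' k : ℕ × ℕ, ∑ l ∈ Finset.range 2 ×ˢ Finset.range 2,
      (-1 : ℝ) ^ (l.1 + l.2) * u (l.1 + k.1, k.2 + l.2) = u 0 := by
  have hsh : ∀ l : ℕ × ℕ, Summable fun k : ℕ × ℕ => u (l.1 + k.1, k.2 + l.2) := fun l =>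
    hu.comp_injective (add_injective l)
  rw [Summable.tsum_finsetSum fun l _ => (hsh l).mul_left _]
  simp only [tsum_mul_left]
  have e : ∀ c d : ℕ, ∑' k : ℕ × ℕ, u (c + k.1, k.2 + d) =
      ∑' a : ℕ, ∑' b : ℕ, u (c + a, b + d) := fun c d => (hsh (c, d)).tsum_prod
  have hrow : ∀ a, Summable fun b => u (a, b) := fun a => hu.prod_factor a
  have hcol : ∀ c : ℕ, Summable fun a => ∑' b, u (a, b + c) := fun c => by
    have := (hsh (0, c)).prod
    simpa only [zero_add] using this
  have h1 : ∀ a, (∑' b, u (a, b)) = u (a, 0) + ∑' b, u (a, b + 1) := fun a =>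
    (hrow a).tsum_eq_zero_add
  have h2 : ∀ c : ℕ, (∑' a, ∑' b, u (a, b + c)) =
      (∑' b, u (0, b + c)) + ∑' a, ∑' b, u (a + 1, b + c) := fun c => (hcol c).tsum_eq_zero_add
  rw [Finset.sum_product]
  simp only [Finset.sum_range_succ, Finset.sum_range_zero, e]
  have h3 := h2 0
  have h4 := h2 1
  have h5 := h1 0
  simp only [add_zero] at h3
  simp only [zero_add, add_zero, add_comm 1]
  rw [h3, h4, h5]
  have : u 0 = u (0, 0) := rfl
  rw [this]
  ring

theorem SummableAt.reduce_reduceInv (hF : SummableAt F x) (k : ℕ × ℕ) :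
    reduce k.1 k.2 (reduceInv F) s₁ s₂ x = ∑ l ∈ Finset.range 2 ×ˢ Finset.range 2,
      (-1 : ℝ) ^ (l.1 + l.2) * reduce (l.1 + k.1) (k.2 + l.2) F s₁ s₂ x := by
  rw [reduce]
  simp only [reduceInv]
  rw [integral_finsetSum _ fun l _ => (hF.reduce_reduce k l).2.const_mul _]
  refine Finset.sum_congr rfl fun l _ => ?_
  rw [integral_const_mul, ← (hF.reduce_reduce k l).1]
  rfl

/-- The Neumann series inverts the operators on each summable fibre separately; almost every fibre
is of this kind. -/
theorem SummableAt.expand_reduceInv (hF : SummableAt F x) :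
    expand (reduceInv F) s₁ s₂ x = F s₁ s₂ x := by
  rw [expand, tsum_congr fun k => hF.reduce_reduceInv k,
    tsum_alternating (u := fun k => reduce k.1 k.2 F s₁ s₂ x) hF.summable_reduce]
  exact reduce_zero F x

theorem SummableSeq.expand_reduceInv {F : DoubleSeq} (hα : 1 ≤ α) (hF : SummableSeq α F)
    (s₁ s₂ : ℕ) :
    TopologicalParticles.expand (TopologicalParticles.reduceInv F) s₁ s₂ =ᵐ[volume] F s₁ s₂ := by
  filter_upwards [hF.ae_summableAt hα s₁ s₂] with x hx
  exact hx.expand_reduceInv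

/-- Here an integral has to be exchanged with the infinite sum in `expand`. For almost every `x` the
absolute integrals are summable, which justifies it. -/
theorem SummableSeq.reduce_expand {F : DoubleSeq} (hα : 1 ≤ α) (hF : SummableSeq α F)
    (l : ℕ × ℕ) (s₁ s₂ : ℕ) : ∀ᵐ x : Phase (s₁ + s₂),
      TopologicalParticles.reduce l.1 l.2 (TopologicalParticles.expand F) s₁ s₂ x =
        ∑' k : ℕ × ℕ, TopologicalParticles.reduce (l.1 + k.1) (k.2 + l.2) F s₁ s₂ x := by
  have h1 : ∀ k : ℕ × ℕ, Integrable (TopologicalParticles.reduce k.1 k.2 F (l.1 + s₁) (s₂ + l.2)) ∧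
      ∫ x, |TopologicalParticles.reduce k.1 k.2 F (l.1 + s₁) (s₂ + l.2) x| ≤ _ := fun k =>
    abs_integral_join_le (hF.integrable _ _)
  have h2 := ae_summable_join (s₁ := s₁) (s₂ := s₂) (fun _ : ℕ × ℕ => l.1) (fun _ => l.2)
    (fun k => TopologicalParticles.reduce k.1 k.2 F (l.1 + s₁) (s₂ + l.2)) (fun k => (h1 k).1)
    ((hF.summable_shift hα (l.1 + s₁, s₂ + l.2)).of_nonneg_of_le
      (fun k => integral_nonneg fun _ => abs_nonneg _) fun k => (h1 k).2)
  filter_upwards [h2, hF.ae_summableAt hα s₁ s₂] with x hx hx'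
  rw [TopologicalParticles.reduce]
  simp only [TopologicalParticles.expand]
  rw [← integral_tsum_of_summable_integral_norm hx.1 hx.2]
  refine tsum_congr fun k => ?_
  rw [show TopologicalParticles.reduce (l.1 + k.1) (k.2 + l.2) F s₁ s₂ x =
    TopologicalParticles.reduce (k.1 + l.1) (l.2 + k.2) F s₁ s₂ x by
      rw [add_comm l.1, add_comm k.2]]
  exact (hx'.reduce_reduce l k).1

theorem SummableSeq.reduceInv_expand {F : DoubleSeq} (hα : 1 ≤ α) (hF : SummableSeq α F)
    (s₁ s₂ : ℕ) :
    TopologicalParticles.reduceInv (TopologicalParticles.expand F) s₁ s₂ =ᵐ[volume] F s₁ s₂ := by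
  have h : ∀ᵐ x : Phase (s₁ + s₂), ∀ l : ℕ × ℕ, _ :=
    ae_all_iff.2 fun l => hF.reduce_expand hα l s₁ s₂
  filter_upwards [h, hF.ae_summableAt hα s₁ s₂] with x hx hx'
  rw [TopologicalParticles.reduceInv, Finset.sum_congr rfl fun l _ => by rw [hx l]]
  have h3 := tsum_alternating (u := fun k => TopologicalParticles.reduce k.1 k.2 F s₁ s₂ x)
    hx'.summable_reduce
  have h4 := Summable.tsum_finsetSum (s := Finset.range 2 ×ˢ Finset.range 2)
    (f := fun (l k : ℕ × ℕ) => (-1 : ℝ) ^ (l.1 + l.2) *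
      TopologicalParticles.reduce (l.1 + k.1) (k.2 + l.2) F s₁ s₂ x)
    fun l _ => ((hx'.summable_reduce.comp_injective (add_injective l)).mul_left _)
  simp only [← tsum_mul_left]
  exact h4.symm.trans (h3.trans (reduce_zero F x))

end Fibre

end TopologicalParticles

/-! ### The cumulant series as a conjugated transport, with norm bound and continuity -/

namespace TopologicalParticles

open Set

variable {σ R α : ℝ} {Φ : ℝ → ℝ}

/-! ### The transport of sequences -/

theorem integral_comp_flow (h : IsPotential σ R Φ) {n : ℕ} (t : ℝ) (f : Phase n → ℝ) :
    ∫ x, f (flow σ Φ t x) = ∫ x, f x :=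
  (measurePreserving_flow h n t).integral_comp (flowEquiv h n t).measurableEmbedding f

theorem integrable_comp_flow (h : IsPotential σ R Φ) {n : ℕ} (t : ℝ) {f : Phase n → ℝ}
    (hf : Integrable f) : Integrable fun x => f (flow σ Φ t x) :=
  ((measurePreserving_flow h n t).integrable_comp_emb (flowEquiv h n t).measurableEmbedding).2 hf

theorem SummableSeq.transport (h : IsPotential σ R Φ) {F : DoubleSeq} (hF : SummableSeq α F)
    (t : ℝ) : SummableSeq α (transport σ Φ t F) ∧
      normL1 α (TopologicalParticles.transport σ Φ t F) = normL1 α F := by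
  have e : compNorm α (TopologicalParticles.transport σ Φ t F) = compNorm α F := by
    funext n
    rw [compNorm, compNorm]
    congr 1
    exact integral_comp_flow h (-t) fun x => |F n.1 n.2 x|
  have hs : Summable (compNorm α F) := hF.summable
  refine ⟨⟨fun n₁ n₂ => integrable_comp_flow h (-t) (hF.integrable n₁ n₂), ?_⟩, ?_⟩
  · rw [← e] at hs
    exact hs
  · change tsum (compNorm α _) = tsum (compNorm α F)
    rw [e]

theorem integral_phase_zero (g : Phase (0 + 0) → ℝ) (x : Phase (0 + 0)) : ∫ y, g y = g x := by
  have h1 : g = fun _ => g x := funext fun y => congrArg g (Subsingleton.elim (α := Phase 0) y x)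
  have h2 : (volume : Measure (Phase (0 + 0))).real univ = 1 := by
    change (volume : Measure (Phase 0)).real univ = 1
    simp [Measure.real, volume_pi]
  rw [h1, integral_const, h2, one_smul]

theorem reduce_zero_zero {F : DoubleSeq} {k : ℕ × ℕ} (hF : Integrable (F (k.1 + 0) (0 + k.2)))
    (x : Phase (0 + 0)) : reduce k.1 k.2 F 0 0 x = ∫ y, F (k.1 + 0) (0 + k.2) y := by
  rw [← integral_join hF]
  exact (integral_phase_zero (reduce k.1 k.2 F 0 0) x).symm

/-- Functions with compact support inside the allowed phase space are dense. -/
theorem exists_contCompact_integral_sub_le {n : ℕ} {f : Phase n → ℝ} (hf : Integrable f)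
    (hf0 : ∀ x ∉ Allowed σ n, f x = 0) {ε : ℝ} (hε : 0 < ε) :
    ∃ g : Phase n → ℝ, ContCompact σ g ∧ ∫ x, |f x - g x| ≤ ε := by
  have hU := isOpen_allowed σ n
  have hm := hU.measurableSet
  -- The density of compactly supported functions is applied on the allowed set as a space of its
  -- own, and extension by zero keeps the compact support inside it.
  have := hU.locallyCompactSpace
  have : IsFiniteMeasureOnCompacts
      (Measure.comap (Subtype.val : Allowed σ n → Phase n) volume) :=
    IsFiniteMeasureOnCompacts.comap' volume continuous_subtype_val
      (MeasurableEmbedding.subtype_coe hm)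
  obtain ⟨g, hgc, hg, hgcont, -⟩ := ((integrableOn_iff_comap_subtypeVal hm).1
    hf.integrableOn).exists_hasCompactSupport_integral_sub_le hε
  have hsub := hgc.tsupport_extend_zero_subset (continuous_subtype_val (p := (· ∈ Allowed σ n)))
  have hout : ∀ x ∉ Allowed σ n, Function.extend Subtype.val g 0 x = 0 := fun x hx =>
    Function.extend_apply' _ _ _ fun ⟨y, hy⟩ => hx (hy ▸ y.2)
  refine ⟨Function.extend Subtype.val g 0, ⟨hgc.continuous_extend_zero hU hgcont,
    hgc.extend_zero continuous_subtype_val, hsub.trans (Subtype.coe_image_subset _ _)⟩, ?_⟩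
  rw [← setIntegral_eq_integral_of_forall_compl_eq_zero (s := Allowed σ n) fun x hx => by
    rw [hf0 x hx, hout x hx, sub_zero, abs_zero], ← integral_subtype_comap hm]
  simpa only [Subtype.val_injective.extend_apply, Real.norm_eq_abs, Function.comp_apply] using hg

theorem continuous_comp_flow (h : IsPotential σ R Φ) {n : ℕ} {g : Phase n → ℝ} (hg : Continuous g)
    (x : Phase n) : Continuous fun t => g (flow σ Φ t x) := by
  refine hg.comp ?_
  by_cases hx : x ∈ Allowed σ n
  · exact continuous_iff_continuousAt.2 fun t => (hasDerivAt_flow h hx t).continuousAt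
  · simp only [flow_of_notMem hx]
    exact continuous_const

theorem ContCompact.tendsto_integral_comp_flow (h : IsPotential σ R Φ) {n : ℕ} {g : Phase n → ℝ}
    (hg : ContCompact σ g) (t₀ : ℝ) :
    Tendsto (fun t => ∫ x, |g (flow σ Φ t x) - g (flow σ Φ t₀ x)|) (𝓝 t₀) (𝓝 0) := by
  obtain ⟨G, hG, hGb⟩ := hg.exists_dominating h (|t₀| + 1)
  have h1 : Tendsto (fun t => ∫ x, |g (flow σ Φ t x) - g (flow σ Φ t₀ x)|) (𝓝 t₀)
      (𝓝 (∫ x : Phase n, (0 : ℝ))) := by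
    refine tendsto_integral_filter_of_dominated_convergence (fun x => G x + G x)
      (Eventually.of_forall fun t => ?_) ?_ (hG.add hG) (ae_of_all _ fun x => ?_)
    · exact ((hg.comp_flow h t).continuous.sub
        (hg.comp_flow h t₀).continuous).abs.aestronglyMeasurable
    · filter_upwards [Ioo_mem_nhds (show t₀ - 1 < t₀ by linarith) (show t₀ < t₀ + 1 by linarith)]
        with t ht
      refine ae_of_all _ fun x => ?_
      rw [Real.norm_eq_abs, abs_abs]
      refine (abs_sub _ _).trans (add_le_add (hGb t ⟨?_, ?_⟩ x) (hGb t₀ ⟨?_, ?_⟩ x))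
      · linarith [ht.1, neg_abs_le t₀]
      · linarith [ht.2, le_abs_self t₀]
      · linarith [neg_abs_le t₀]
      · linarith [le_abs_self t₀]
    · have := ((continuous_comp_flow h hg.continuous x).sub
        (continuous_const (y := g (flow σ Φ t₀ x)))).abs.tendsto t₀
      simpa using this
  simpa using h1

/-- The transport along the flow is strongly continuous. -/
theorem tendsto_integral_comp_flow (h : IsPotential σ R Φ) {n : ℕ} {f : Phase n → ℝ}
    (hf : Integrable f) (hf0 : ∀ x ∉ Allowed σ n, f x = 0) (t₀ : ℝ) :
    Tendsto (fun t => ∫ x, |f (flow σ Φ t x) - f (flow σ Φ t₀ x)|) (𝓝 t₀) (𝓝 0) := by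
  rw [Metric.tendsto_nhds]
  intro ε hε
  obtain ⟨g, hg, hfg⟩ := exists_contCompact_integral_sub_le hf hf0 (show 0 < ε / 4 by linarith)
  filter_upwards [Metric.tendsto_nhds.1 (hg.tendsto_integral_comp_flow h t₀) (ε / 2)
    (by linarith)] with t ht
  rw [Real.dist_0_eq_abs, abs_of_nonneg (integral_nonneg fun _ => abs_nonneg _)] at ht ⊢
  have hi1 : ∀ t, Integrable fun x => |f (flow σ Φ t x) - g (flow σ Φ t x)| := fun t =>
    integrable_comp_flow h t (hf.sub hg.integrable).abs
  have hi2 : Integrable fun x => |g (flow σ Φ t x) - g (flow σ Φ t₀ x)| :=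
    ((hg.comp_flow h t).integrable.sub (hg.comp_flow h t₀).integrable).abs
  have hi3 : Integrable fun x => |f (flow σ Φ t x) - g (flow σ Φ t x)| +
    |g (flow σ Φ t x) - g (flow σ Φ t₀ x)| := (hi1 t).add hi2
  have e := fun t => integral_comp_flow h t fun x => |f x - g x|
  have hle : ∫ x, |f (flow σ Φ t x) - f (flow σ Φ t₀ x)| ≤
      ∫ x, (|f (flow σ Φ t x) - g (flow σ Φ t x)| + |g (flow σ Φ t x) - g (flow σ Φ t₀ x)|
        + |f (flow σ Φ t₀ x) - g (flow σ Φ t₀ x)|) := by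
    refine integral_mono ((integrable_comp_flow h t hf).sub (integrable_comp_flow h t₀ hf)).abs
      (hi3.add (hi1 t₀)) fun x => ?_
    have h1 := abs_add_le (f (flow σ Φ t x) - g (flow σ Φ t x))
      (g (flow σ Φ t x) - g (flow σ Φ t₀ x))
    have h2 := abs_sub (f (flow σ Φ t x) - g (flow σ Φ t x) +
      (g (flow σ Φ t x) - g (flow σ Φ t₀ x))) (f (flow σ Φ t₀ x) - g (flow σ Φ t₀ x))
    have h3 : f (flow σ Φ t x) - f (flow σ Φ t₀ x) = f (flow σ Φ t x) - g (flow σ Φ t x) +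
      (g (flow σ Φ t x) - g (flow σ Φ t₀ x)) - (f (flow σ Φ t₀ x) - g (flow σ Φ t₀ x)) := by ring
    rw [h3]
    linarith
  refine hle.trans_lt ?_
  rw [integral_add hi3 (hi1 t₀), integral_add (hi1 t) hi2]
  have e1 := e t
  have e2 := e t₀
  rw [e1, e2]
  linarith

theorem SummableSeq.tendsto_transport (h : IsPotential σ R Φ) (hα : 0 ≤ α) {F : DoubleSeq}
    (hF : SummableSeq α F) (hF0 : ∀ n₁ n₂, ∀ x ∉ Allowed σ (n₁ + n₂), F n₁ n₂ x = 0) (t₀ : ℝ) :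
    Tendsto (fun t => normL1 α (TopologicalParticles.transport σ Φ t F -
      TopologicalParticles.transport σ Φ t₀ F)) (𝓝 t₀) (𝓝 0) := by
  have hs : Summable (compNorm α F) := hF.summable
  have key := tendsto_tsum_of_dominated_convergence (𝓕 := 𝓝 t₀)
    (f := fun t n => compNorm α (TopologicalParticles.transport σ Φ t F -
      TopologicalParticles.transport σ Φ t₀ F) n) (g := fun _ => (0 : ℝ))
    (hs.add hs) (fun n => ?_) (Eventually.of_forall fun t n => ?_)
  · rw [tsum_zero] at key
    exact key
  · have h1 : Tendsto (fun t : ℝ => -t) (𝓝 t₀) (𝓝 (-t₀)) := continuous_neg.tendsto t₀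
    have h2 := ((tendsto_integral_comp_flow h (hF.integrable n.1 n.2) (hF0 n.1 n.2)
      (-t₀)).comp h1).const_mul (α ^ (n.1 + n.2))
    rw [mul_zero] at h2
    exact h2
  · rw [Real.norm_of_nonneg (compNorm_nonneg hα _ _)]
    simp only [compNorm]
    rw [← mul_add]
    refine mul_le_mul_of_nonneg_left ?_ (pow_nonneg hα _)
    have hi := fun t => integrable_comp_flow h (-t) (hF.integrable n.1 n.2)
    have e := fun t => integral_comp_flow h (-t) fun x => |F n.1 n.2 x|
    refine le_of_le_of_eq ?_ (congrArg₂ (· + ·) (e t) (e t₀))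
    change _ ≤ (∫ x, |F n.1 n.2 (flow σ Φ (-t) x)|) + ∫ x, |F n.1 n.2 (flow σ Φ (-t₀) x)|
    rw [← integral_add (hi t).abs (hi t₀).abs]
    exact integral_mono ((hi t).sub (hi t₀)).abs ((hi t).abs.add (hi t₀).abs) fun x => abs_sub _ _

/-! ### Vanishing on forbidden configurations -/

theorem join_apply_mid {n₁ s₁ s₂ n₂ : ℕ} (y : Phase n₁) (x : Phase (s₁ + s₂)) (z : Phase n₂)
    {i : Fin ((n₁ + s₁) + (s₂ + n₂))} {j : Fin (s₁ + s₂)} (hij : (i : ℕ) = n₁ + j) :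
    join y x z i = x j := by
  rw [join_apply, dif_neg (by omega), dif_pos (by omega)]
  congr 1
  exact Fin.ext (by simp only; omega)

theorem mem_allowed_of_join {n₁ s₁ s₂ n₂ : ℕ} {y : Phase n₁} {x : Phase (s₁ + s₂)} {z : Phase n₂}
    (hx : join y x z ∈ Allowed σ ((n₁ + s₁) + (s₂ + n₂))) : x ∈ Allowed σ (s₁ + s₂) := by
  intro i j hij
  have h1 := hx ⟨n₁ + i, by omega⟩ ⟨n₁ + j, by omega⟩ (by simp only; omega)
  rwa [join_apply_mid y x z rfl, join_apply_mid y x z rfl] at h1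

theorem reduce_eq_zero {F : DoubleSeq} (hF : ∀ n₁ n₂, ∀ x ∉ Allowed σ (n₁ + n₂), F n₁ n₂ x = 0)
    (k₁ k₂ n₁ n₂ : ℕ) {x : Phase (n₁ + n₂)} (hx : x ∉ Allowed σ (n₁ + n₂)) :
    reduce k₁ k₂ F n₁ n₂ x = 0 := by
  rw [reduce]
  simp only [hF _ _ _ fun h => hx (mem_allowed_of_join h), integral_zero]

theorem reduceInv_eq_zero {F : DoubleSeq}
    (hF : ∀ n₁ n₂, ∀ x ∉ Allowed σ (n₁ + n₂), F n₁ n₂ x = 0) (n₁ n₂ : ℕ) :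
    ∀ x ∉ Allowed σ (n₁ + n₂), reduceInv F n₁ n₂ x = 0 := fun x hx =>
  Finset.sum_eq_zero fun l _ => by rw [reduce_eq_zero hF _ _ _ _ hx, mul_zero]

theorem expand_eq_zero {F : DoubleSeq}
    (hF : ∀ n₁ n₂, ∀ x ∉ Allowed σ (n₁ + n₂), F n₁ n₂ x = 0) (n₁ n₂ : ℕ) :
    ∀ x ∉ Allowed σ (n₁ + n₂), expand F n₁ n₂ x = 0 := fun x hx => by
  rw [expand, tsum_congr fun k => reduce_eq_zero hF _ _ _ _ hx, tsum_zero]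

theorem transport_eq_zero (h : IsPotential σ R Φ) {F : DoubleSeq}
    (hF : ∀ n₁ n₂, ∀ x ∉ Allowed σ (n₁ + n₂), F n₁ n₂ x = 0) (t : ℝ) (n₁ n₂ : ℕ) :
    ∀ x ∉ Allowed σ (n₁ + n₂), transport σ Φ t F n₁ n₂ x = 0 := fun x hx =>
  hF _ _ _ (by rwa [flow_mem_iff h])

/-- A nonzero value would require the block of the cluster to be allowed after its motion, hence
before it, and then `x` would be allowed as part of that block. So the series vanishes on forbidden
points everywhere, not only almost everywhere. -/
theorem prodGroupOp_join_eq_zero (h : IsPotential σ R Φ) {n₁ s₁ s₂ n₂ : ℕ} (hs : 1 ≤ s₁ + s₂)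
    {P : Composition ((n₁ + s₁) + (s₂ + n₂))} (hP : P ∈ clusterPartitions n₁ s₁ s₂ n₂) (t : ℝ)
    {f : Phase ((n₁ + s₁) + (s₂ + n₂)) → ℝ} (hf : ∀ x, x ∉ Allowed σ _ → f x = 0)
    {x : Phase (s₁ + s₂)} (hx : x ∉ Allowed σ (s₁ + s₂)) (w : Phase n₁ × Phase n₂) :
    prodGroupOp σ Φ P t f (join w.1 x w.2) = 0 := by
  rw [prodGroupOp_eq h P t hf]
  obtain ⟨e, -, -, he⟩ := exists_blocksMap_cluster (σ := σ) h hs hP (-t)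
  have hb := clusterIndex_bounds hs hP
  have hsz : P.sizeUpTo (clusterIndex hs P + 1) =
    P.sizeUpTo (clusterIndex hs P) + P.blocksFun (clusterIndex hs P) := P.sizeUpTo_succ' _
  refine hf _ fun hy => hx ?_
  rw [he] at hy
  have h1 := allowed_comp _ _ (fun i => P.coe_embedding (clusterIndex hs P) i) hy
  rw [blockMap_comp, flow_mem_iff h] at h1
  intro i j hij
  have h2 := h1 ⟨n₁ + i - P.sizeUpTo (clusterIndex hs P), by omega⟩
    ⟨n₁ + j - P.sizeUpTo (clusterIndex hs P), by omega⟩ (by simp only; omega)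
  rwa [Function.comp_apply, Function.comp_apply,
    join_apply_mid _ x _ (j := i) (by rw [P.coe_embedding]; simp only; omega),
    join_apply_mid _ x _ (j := j) (by rw [P.coe_embedding]; simp only; omega)] at h2

theorem series_eq_zero (h : IsPotential σ R Φ) {F : DoubleSeq}
    (hF : ∀ n₁ n₂, ∀ x ∉ Allowed σ (n₁ + n₂), F n₁ n₂ x = 0) (t : ℝ) (s₁ s₂ : ℕ) :
    ∀ x ∉ Allowed σ (s₁ + s₂), series σ Φ F t s₁ s₂ x = 0 := by
  intro x hx
  rw [series]
  split_ifs with h0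
  · exact hF _ _ _ hx
  · have : ∀ (n : ℕ × ℕ) (w : Phase n.1 × Phase n.2), seriesIntegrand σ Φ F t x n.1 n.2 w = 0 := by
      intro n w
      rw [seriesIntegrand, cumulant]
      refine Finset.sum_eq_zero fun P hP => ?_
      rw [prodGroupOp_join_eq_zero h (by omega) hP t (hF _ _) hx, mul_zero]
    simp only [this, integral_zero, tsum_zero]

/-! ### The series as the expansion of transported data -/

theorem hasSum_shift {v : ℕ × ℕ → ℝ} (hv : Summable v) (l : ℕ × ℕ) :
    HasSum (fun n : ℕ × ℕ => if l.1 ≤ n.1 ∧ l.2 ≤ n.2 then v (n.1 - l.1, n.2 - l.2) else 0)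
      (∑' k, v k) := by
  rw [← (add_injective l).hasSum_iff]
  · refine hv.hasSum.congr_fun ?_
    intro k
    simp
  · intro n hn
    rw [if_neg]
    rintro ⟨h1, h2⟩
    exact hn ⟨(n.1 - l.1, n.2 - l.2), Prod.ext (by simp only; omega) (by simp only; omega)⟩

theorem reduce_sum {ι : Type*} (I : Finset ι) (c : ι → ℝ) (G : ι → DoubleSeq) {k₁ k₂ s₁ s₂ : ℕ}
    {x : Phase (s₁ + s₂)} (hG : ∀ i ∈ I, Integrable fun w : Phase k₁ × Phase k₂ =>
      G i (k₁ + s₁) (s₂ + k₂) (join w.1 x w.2)) :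
    reduce k₁ k₂ (fun n₁ n₂ x => ∑ i ∈ I, c i * G i n₁ n₂ x) s₁ s₂ x =
      ∑ i ∈ I, c i * reduce k₁ k₂ (G i) s₁ s₂ x := by
  rw [reduce, integral_finsetSum I fun i hi => (hG i hi).const_mul _]
  exact Finset.sum_congr rfl fun i _ => integral_const_mul _ _

theorem transport_reduceInv (t : ℝ) (F : DoubleSeq) : transport σ Φ t (reduceInv F) =
    fun n₁ n₂ x => ∑ l ∈ Finset.range 2 ×ˢ Finset.range 2, (-1 : ℝ) ^ (l.1 + l.2) *
      transport σ Φ t (reduce l.1 l.2 F) n₁ n₂ x := rfl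

/-- Each choice `l` of at most one particle left out per side contributes, after the shift `k = n -
l`, the sum over all `k` of `reduce k (transport (reduce l F))`. The four signed sums add up by
linearity to the right-hand side. -/
theorem series_eq_expand (h : IsPotential σ R Φ) {F : DoubleSeq}
    (hF : ∀ n₁ n₂, ∀ x ∉ Allowed σ (n₁ + n₂), F n₁ n₂ x = 0) (t : ℝ) {s₁ s₂ : ℕ}
    (hs : 1 ≤ s₁ + s₂) {x : Phase (s₁ + s₂)}
    (hP : ∀ n₁ n₂, ∀ P ∈ clusterPartitions n₁ s₁ s₂ n₂, Integrable fun w : Phase n₁ × Phase n₂ =>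
      prodGroupOp σ Φ P t (F (n₁ + s₁) (s₂ + n₂)) (join w.1 x w.2))
    (hS : ∀ l : ℕ × ℕ, SummableAt (transport σ Φ t (reduce l.1 l.2 F)) x) :
    series σ Φ F t s₁ s₂ x = expand (transport σ Φ t (reduceInv F)) s₁ s₂ x := by
  set u : ℕ × ℕ → ℕ × ℕ → ℝ := fun l k =>
    reduce k.1 k.2 (transport σ Φ t (reduce l.1 l.2 F)) s₁ s₂ x with hu
  have hus : ∀ l, Summable (u l) := fun l => (hS l).summable_reduce
  have h1 : ∀ n : ℕ × ℕ, ∫ w : Phase n.1 × Phase n.2, seriesIntegrand σ Φ F t x n.1 n.2 w =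
      ∑ l ∈ Finset.range 2 ×ˢ Finset.range 2, (-1 : ℝ) ^ (l.1 + l.2) *
        if l.1 ≤ n.1 ∧ l.2 ≤ n.2 then u l (n.1 - l.1, n.2 - l.2) else 0 := by
    intro n
    rw [integral_seriesIntegrand h hs t hF x (hP n.1 n.2), Finset.sum_product]
    -- On `{0, 1}` the cut-off `min m 1` is the condition `l ≤ m`, the form needed for the shift of
    -- the summation index.
    have e : ∀ m : ℕ, Finset.range (min m 1 + 1) = (Finset.range 2).filter (· ≤ m) := by
      intro m
      ext a
      simp only [Finset.mem_range, Finset.mem_filter]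
      omega
    rw [e, Finset.sum_filter]
    refine Finset.sum_congr rfl fun a _ => ?_
    rw [e, Finset.sum_filter]
    split_ifs with ha
    · refine Finset.sum_congr rfl fun b _ => ?_
      simp only [ha, true_and, mul_ite, mul_zero, hu]
    · simp [ha]
  have h2 : ∀ k : ℕ × ℕ, reduce k.1 k.2 (transport σ Φ t (reduceInv F)) s₁ s₂ x =
      ∑ l ∈ Finset.range 2 ×ˢ Finset.range 2, (-1 : ℝ) ^ (l.1 + l.2) * u l k := by
    intro k
    rw [transport_reduceInv]
    exact reduce_sum _ _ _ fun l _ => (hS l).integrable k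
  rw [series, if_neg (by omega), expand, tsum_congr h1, tsum_congr h2,
    Summable.tsum_finsetSum fun l _ => ((hasSum_shift (hus l) l).summable.mul_left _),
    Summable.tsum_finsetSum fun l _ => ((hus l).mul_left _)]
  refine Finset.sum_congr rfl fun l _ => ?_
  rw [tsum_mul_left, tsum_mul_left, (hasSum_shift (hus l) l).tsum_eq]

theorem MemL1.ae_integrable_prodGroupOp (h : IsPotential σ R Φ) {F : DoubleSeq}
    (hF : MemL1 σ α F) (t : ℝ) (s₁ s₂ : ℕ) : ∀ᵐ x : Phase (s₁ + s₂), ∀ n₁ n₂,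
      ∀ P : Composition ((n₁ + s₁) + (s₂ + n₂)), Integrable fun w : Phase n₁ × Phase n₂ =>
        prodGroupOp σ Φ P t (F (n₁ + s₁) (s₂ + n₂)) (join w.1 x w.2) :=
  ae_all_iff.2 fun _ => ae_all_iff.2 fun _ => ae_all_iff.2 fun P =>
    (integrable_join_iff.2
      (integrable_prodGroupOp h P t (hF.forbidden _ _) (hF.integrable _ _)).1).prod_right_ae

theorem MemL1.series_ae_eq (h : IsPotential σ R Φ) (hα : 1 < α) {F : DoubleSeq}
    (hF : MemL1 σ α F) (t : ℝ) (s₁ s₂ : ℕ) :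
    series σ Φ F t s₁ s₂ =ᵐ[volume] expand (transport σ Φ t (reduceInv F)) s₁ s₂ := by
  have h0 := one_pos.trans hα
  by_cases hs : 1 ≤ s₁ + s₂
  · have h1 : ∀ᵐ x : Phase (s₁ + s₂), ∀ l : ℕ × ℕ,
        SummableAt (transport σ Φ t (reduce l.1 l.2 F)) x := ae_all_iff.2 fun l =>
      ((hF.summableSeq.reduce h0 l.1 l.2).1.transport h t).1.ae_summableAt hα.le s₁ s₂
    filter_upwards [h1, hF.ae_integrable_prodGroupOp h t s₁ s₂] with x h1 h2
    exact series_eq_expand h hF.forbidden t hs (fun n₁ n₂ P _ => h2 n₁ n₂ P) h1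
  -- Without particles, `expand` is a sum of total integrals, which the transport does not change.
  -- So the formula gives back the constant component.
  · obtain ⟨rfl, rfl⟩ : s₁ = 0 ∧ s₂ = 0 := by omega
    have hG := hF.summableSeq.reduceInv h0
    filter_upwards [hF.summableSeq.expand_reduceInv hα.le 0 0] with x hx
    rw [series, if_pos rfl, ← hx, expand, expand]
    refine tsum_congr fun k => ?_
    rw [reduce_zero_zero (hG.1.integrable _ _), reduce_zero_zero ((hG.1.transport h t).1.integrable _ _)]
    exact (integral_comp_flow h (-t) _).symm

theorem MemL1.ae_summable_series (h : IsPotential σ R Φ) (hα : 2 < α) {F : DoubleSeq}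
    (hF : MemL1 σ α F) (t : ℝ) (s₁ s₂ : ℕ) (hs : 1 ≤ s₁ + s₂) : ∀ᵐ x : Phase (s₁ + s₂),
      (∀ n₁ n₂, Integrable (seriesIntegrand σ Φ F t x n₁ n₂)) ∧
      Summable fun n : ℕ × ℕ =>
        ∫ w : Phase n.1 × Phase n.2, |seriesIntegrand σ Φ F t x n.1 n.2 w| := by
  have h0 : 0 < α := two_pos.trans hα
  have hC := fun n : ℕ × ℕ => integrable_cumulant (s₁ := s₁) (s₂ := s₂) (n₁ := n.1) (n₂ := n.2)
    h hs t (hF.integrable _ _) (hF.forbidden _ _)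
  have hsum : Summable (compNorm α F) := hF.summable
  -- The factor `2 ^ (n.1 + n.2)` is absorbed by the weight because `2 < α`; the additional `s₁ +
  -- s₂` powers of `α` are at least `1`.
  have hle : ∀ n : ℕ × ℕ, (2 : ℝ) ^ (n.1 + n.2) * ∫ x, |F (n.1 + s₁) (s₂ + n.2) x| ≤
      compNorm α F (n.1 + s₁, s₂ + n.2) := fun n => by
    refine mul_le_mul_of_nonneg_right ?_ (integral_nonneg fun _ => abs_nonneg _)
    exact (pow_le_pow_left₀ two_pos.le hα.le _).trans (pow_le_pow_right₀ (by linarith) (by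
      simp only; omega))
  filter_upwards [ae_summable_join (s₁ := s₁) (s₂ := s₂) (fun n : ℕ × ℕ => n.1) (fun n => n.2)
    (fun n => cumulant σ Φ n.1 s₁ s₂ n.2 t (F (n.1 + s₁) (s₂ + n.2))) (fun n => (hC n).1)
    ((hsum.comp_injective (add_injective' (s₁, s₂))).of_nonneg_of_le
      (fun n => integral_nonneg fun _ => abs_nonneg _) fun n => (hC n).2.trans (hle n))] with x hx
  exact ⟨fun n₁ n₂ => hx.1 (n₁, n₂), hx.2⟩

/-- The factorization gives the constant `((α + 1) / (α - 1)) ^ 2`: a factor `(1 + α⁻¹) ^ 2` from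
`reduceInv`, `1` from the transport and `(1 - α⁻¹)⁻¹ ^ 2` from `expand`. This is at most `(α / (α -
2)) ^ 2`, the constant claimed. -/
theorem MemL1.series (h : IsPotential σ R Φ) (hα : 2 < α) {F : DoubleSeq}
    (hF : MemL1 σ α F) (t : ℝ) : MemL1 σ α (series σ Φ F t) ∧
      normL1 α (TopologicalParticles.series σ Φ F t) ≤ ((1 - 2 / α)⁻¹) ^ 2 * normL1 α F := by
  have h0 : 0 < α := two_pos.trans hα
  have h1 : 1 < α := one_lt_two.trans hα
  have hG := hF.summableSeq.reduceInv h0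
  have hT := hG.1.transport h t
  have hE := hT.1.expand h1
  have hS := hE.1.congr fun n₁ n₂ => (hF.series_ae_eq h h1 t n₁ n₂).symm
  refine ⟨⟨hS.1.integrable, fun n₁ n₂ => series_eq_zero h hF.forbidden t n₁ n₂, hS.1.summable⟩, ?_⟩
  rw [hS.2]
  refine hE.2.trans ?_
  rw [hT.2]
  have hc0 : 0 ≤ (1 - α⁻¹)⁻¹ := inv_nonneg.2 (by
    have := inv_lt_one_of_one_lt₀ h1
    linarith)
  refine (mul_le_mul_of_nonneg_left hG.2 (sq_nonneg _)).trans ?_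
  rw [← mul_assoc, ← mul_pow]
  refine mul_le_mul_of_nonneg_right ?_ (normL1_nonneg h0.le F)
  refine pow_le_pow_left₀ (mul_nonneg hc0 (by positivity)) ?_ 2
  have e1 : (1 - α⁻¹)⁻¹ * (1 + α⁻¹) = (α + 1) / (α - 1) := by
    have : α - 1 ≠ 0 := by linarith
    field_simp
  have e2 : (1 - 2 / α)⁻¹ = α / (α - 2) := by
    have : α - 2 ≠ 0 := by linarith
    field_simp
  rw [e1, e2, div_le_div_iff₀ (by linarith) (by linarith)]
  nlinarith

theorem SummableSeq.expand_sub {F G : DoubleSeq} (hα : 1 ≤ α) (hF : SummableSeq α F)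
    (hG : SummableSeq α G) (n₁ n₂ : ℕ) : TopologicalParticles.expand (F - G) n₁ n₂ =ᵐ[volume]
      TopologicalParticles.expand F n₁ n₂ - TopologicalParticles.expand G n₁ n₂ := by
  filter_upwards [hF.ae_summableAt hα n₁ n₂, hG.ae_summableAt hα n₁ n₂] with x hx hy
  rw [Pi.sub_apply, TopologicalParticles.expand, TopologicalParticles.expand,
    TopologicalParticles.expand, ← hx.summable_reduce.tsum_sub hy.summable_reduce]
  exact tsum_congr fun k => integral_sub (hx.integrable k) (hy.integrable k)

/-- The transport is strongly continuous, and the bounded operator `expand` passes the continuity on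
to the series. -/
theorem MemL1.tendsto_series (h : IsPotential σ R Φ) (hα : 1 < α) {F : DoubleSeq}
    (hF : MemL1 σ α F) (t₀ : ℝ) :
    Tendsto (fun t => normL1 α (TopologicalParticles.series σ Φ F t -
      TopologicalParticles.series σ Φ F t₀)) (𝓝 t₀) (𝓝 0) := by
  have h0 : 0 < α := one_pos.trans hα
  have hG := (hF.summableSeq.reduceInv h0).1
  have hT := fun t => (hG.transport h t).1
  have h1 := (hG.tendsto_transport h h0.le (reduceInv_eq_zero hF.forbidden) t₀).const_mul
    (((1 - α⁻¹)⁻¹) ^ 2)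
  rw [mul_zero] at h1
  refine squeeze_zero (fun t => normL1_nonneg h0.le _) (fun t => ?_) h1
  have hsub := (hT t).sub h0.le (hT t₀)
  rw [normL1_congr (G := TopologicalParticles.expand (transport σ Φ t (reduceInv F) -
    transport σ Φ t₀ (reduceInv F)))]
  · exact (hsub.1.expand hα).2
  · intro n₁ n₂
    filter_upwards [(hT t).expand_sub hα.le (hT t₀) n₁ n₂, hF.series_ae_eq h hα t n₁ n₂,
      hF.series_ae_eq h hα t₀ n₁ n₂] with x h2 h3 h4
    exact (congrArg₂ (· - ·) h3 h4).trans h2.symm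

theorem transport_zero (h : IsPotential σ R Φ) (F : DoubleSeq) : transport σ Φ 0 F = F := by
  funext n₁ n₂ x
  rw [transport, neg_zero, flow_zero h]

theorem MemL1.series_zero (h : IsPotential σ R Φ) (hα : 1 < α) {F : DoubleSeq}
    (hF : MemL1 σ α F) (n₁ n₂ : ℕ) :
    TopologicalParticles.series σ Φ F 0 n₁ n₂ =ᵐ[volume] F n₁ n₂ := by
  refine (hF.series_ae_eq h hα 0 n₁ n₂).trans ?_
  rw [transport_zero h]
  exact hF.summableSeq.expand_reduceInv hα.le n₁ n₂

end TopologicalParticles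

/-! ### Commutators of the Liouville operator with the creation operators, and the dual intertwining
relation -/

namespace TopologicalParticles

open Set

variable {σ R α : ℝ} {Φ : ℝ → ℝ}

/-! ### The creation operators -/

section Drop

variable {n₁ n₂ : ℕ}

/-- The particles without the leftmost one. -/
def dropLeft (x : Phase ((n₁ + 1) + n₂)) : Phase (n₁ + n₂) :=
  fun i => x (Fin.cast (by omega) i.succ)

/-- The particles without the rightmost one. -/
def dropRight (x : Phase (n₁ + (n₂ + 1))) : Phase (n₁ + n₂) :=
  fun i => x (Fin.cast (by omega) i.castSucc)

theorem dropLeft_mem {x : Phase ((n₁ + 1) + n₂)} (hx : x ∈ Allowed σ ((n₁ + 1) + n₂)) :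
    dropLeft x ∈ Allowed σ (n₁ + n₂) := fun i j hij =>
  hx _ _ (by simp only [Fin.val_cast, Fin.val_succ]; omega)

theorem dropRight_mem {x : Phase (n₁ + (n₂ + 1))} (hx : x ∈ Allowed σ (n₁ + (n₂ + 1))) :
    dropRight x ∈ Allowed σ (n₁ + n₂) := fun i j hij =>
  hx _ _ (by simp only [Fin.val_cast, Fin.val_castSucc]; omega)

/-- Reindexing of the particles, as a continuous linear map. -/
def pullback {m n : ℕ} (ρ : Fin m → Fin n) : Phase n →L[ℝ] Phase m :=
  ContinuousLinearMap.pi fun i => ContinuousLinearMap.proj (ρ i)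

theorem contDiff_dropLeft : ContDiff ℝ 1 (dropLeft : Phase ((n₁ + 1) + n₂) → Phase (n₁ + n₂)) :=
  (pullback fun i => Fin.cast (by omega) i.succ).contDiff

theorem contDiff_dropRight :
    ContDiff ℝ 1 (dropRight : Phase (n₁ + (n₂ + 1)) → Phase (n₁ + n₂)) :=
  (pullback fun i => Fin.cast (by omega) i.castSucc).contDiff

theorem fderiv_comp_dropLeft {c : Phase (n₁ + n₂) → ℝ} {x : Phase ((n₁ + 1) + n₂)}
    (hc : DifferentiableAt ℝ c (dropLeft x)) (v : Phase ((n₁ + 1) + n₂)) :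
    fderiv ℝ (fun y => c (dropLeft y)) x v = fderiv ℝ c (dropLeft x) (dropLeft v) :=
  congrArg (· v) (HasFDerivAt.comp (f := (dropLeft : Phase ((n₁ + 1) + n₂) → Phase (n₁ + n₂))) x
    hc.hasFDerivAt (pullback fun i => Fin.cast (by omega) i.succ).hasFDerivAt).fderiv

theorem fderiv_comp_dropRight {c : Phase (n₁ + n₂) → ℝ} {x : Phase (n₁ + (n₂ + 1))}
    (hc : DifferentiableAt ℝ c (dropRight x)) (v : Phase (n₁ + (n₂ + 1))) :
    fderiv ℝ (fun y => c (dropRight y)) x v = fderiv ℝ c (dropRight x) (dropRight v) :=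
  congrArg (· v) (HasFDerivAt.comp (f := (dropRight : Phase (n₁ + (n₂ + 1)) → Phase (n₁ + n₂))) x
    hc.hasFDerivAt (pullback fun i => Fin.cast (by omega) i.castSucc).hasFDerivAt).fderiv

/-- The force of the leftmost particle on its neighbour. -/
noncomputable def kickLeft (Φ : ℝ → ℝ) (x : Phase ((n₁ + 1) + n₂)) : Phase (n₁ + n₂) := fun j =>
  if (j : ℕ) = 0 then (0, deriv Φ ((x (Fin.cast (by omega) j.castSucc)).1 -
    (x (Fin.cast (by omega) j.succ)).1)) else 0

/-- The force of the rightmost particle on its neighbour. -/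
noncomputable def kickRight (Φ : ℝ → ℝ) (x : Phase (n₁ + (n₂ + 1))) : Phase (n₁ + n₂) := fun j =>
  if (j : ℕ) + 1 = n₁ + n₂ then (0, -deriv Φ ((x (Fin.cast (by omega) j.castSucc)).1 -
    (x (Fin.cast (by omega) j.succ)).1)) else 0

theorem sum_force_left {n : ℕ} (x : Phase n) (j : Fin n) :
    (∑ i : Fin n, if (i : ℕ) + 1 = j then deriv Φ ((x i).1 - (x j).1) else 0) =
      if h : (j : ℕ) = 0 then 0 else deriv Φ ((x ⟨j - 1, by omega⟩).1 - (x j).1) := by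
  split_ifs with h
  · refine Finset.sum_eq_zero fun i _ => if_neg (by omega)
  · rw [Finset.sum_eq_single (⟨j - 1, by omega⟩ : Fin n), if_pos (by simp only; omega)]
    · intro i _ hi
      refine if_neg fun h2 => hi (Fin.ext ?_)
      simp only
      omega
    · simp

theorem sum_force_right {n : ℕ} (x : Phase n) (j : Fin n) :
    (∑ k : Fin n, if (j : ℕ) + 1 = k then deriv Φ ((x j).1 - (x k).1) else 0) =
      if h : (j : ℕ) + 1 < n then deriv Φ ((x j).1 - (x ⟨j + 1, h⟩).1) else 0 := by
  split_ifs with h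
  · rw [Finset.sum_eq_single (⟨j + 1, h⟩ : Fin n), if_pos rfl]
    · intro i _ hi
      exact if_neg fun h2 => hi (Fin.ext h2.symm)
    · simp
  · refine Finset.sum_eq_zero fun i _ => if_neg (by omega)

theorem hamiltonField_snd {n : ℕ} (x : Phase n) (j : Fin n) : (hamiltonField Φ x j).2 =
    (if h : (j : ℕ) = 0 then 0 else deriv Φ ((x ⟨j - 1, by omega⟩).1 - (x j).1)) -
      if h : (j : ℕ) + 1 < n then deriv Φ ((x j).1 - (x ⟨j + 1, h⟩).1) else 0 := by
  rw [← sum_force_left, ← sum_force_right]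
  rfl

/-- Forgetting the leftmost particle changes the field only by its force on the neighbour.
Consequently `[ℒ, 𝔞⁺₋]` is the derivative in the direction `kickLeft`. -/
theorem hamiltonField_dropLeft (x : Phase ((n₁ + 1) + n₂)) :
    dropLeft (hamiltonField Φ x) = hamiltonField Φ (dropLeft x) + kickLeft Φ x := by
  funext j
  refine Prod.ext ?_ ?_
  · simp only [dropLeft, hamiltonField, kickLeft, Pi.add_apply, Prod.fst_add]
    split_ifs <;> simp
  · rw [Pi.add_apply, Prod.snd_add, hamiltonField_snd, dropLeft, hamiltonField_snd]
    have h0 : (Fin.cast (by omega) j.succ : Fin ((n₁ + 1) + n₂)).val ≠ 0 := by simp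
    rw [dif_neg h0]
    have e2 : (if h : (Fin.cast (by omega) j.succ : Fin ((n₁ + 1) + n₂)).val + 1 < (n₁ + 1) + n₂ then
        deriv Φ ((x (Fin.cast (by omega) j.succ)).1 -
          (x ⟨(Fin.cast (by omega) j.succ : Fin ((n₁ + 1) + n₂)).val + 1, h⟩).1) else 0) =
        if h : (j : ℕ) + 1 < n₁ + n₂ then
          deriv Φ ((dropLeft x j).1 - (dropLeft x ⟨j + 1, h⟩).1) else 0 := by
      simp only [Fin.val_cast, Fin.val_succ]
      split_ifs <;> first | rfl | omega
    rw [e2]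
    by_cases h : (j : ℕ) = 0
    · rw [dif_pos h, kickLeft, if_pos h]
      simp only [zero_sub]
      exact sub_eq_neg_add _ _
    · rw [dif_neg h, kickLeft, if_neg h]
      simp only [Prod.snd_zero, add_zero]
      congr 3
      simp only [dropLeft]
      congr 1
      exact congrArg x (Fin.ext (by simp; omega))

theorem hamiltonField_dropRight (x : Phase (n₁ + (n₂ + 1))) :
    dropRight (hamiltonField Φ x) = hamiltonField Φ (dropRight x) + kickRight Φ x := by
  funext j
  refine Prod.ext ?_ ?_
  · simp only [dropRight, hamiltonField, kickRight, Pi.add_apply, Prod.fst_add]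
    split_ifs <;> simp
  · rw [Pi.add_apply, Prod.snd_add, hamiltonField_snd, dropRight, hamiltonField_snd]
    have h0 : (Fin.cast (by omega) j.castSucc : Fin (n₁ + (n₂ + 1))).val + 1 < n₁ + (n₂ + 1) := by
      simp only [Fin.val_cast, Fin.val_castSucc]
      omega
    rw [dif_pos h0]
    have e2 : (if h : (Fin.cast (by omega) j.castSucc : Fin (n₁ + (n₂ + 1))).val = 0 then 0 else
        deriv Φ ((x ⟨(Fin.cast (by omega) j.castSucc : Fin (n₁ + (n₂ + 1))).val - 1, by omega⟩).1 -
          (x (Fin.cast (by omega) j.castSucc)).1)) =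
        if h : (j : ℕ) = 0 then 0 else
          deriv Φ ((dropRight x ⟨j - 1, by omega⟩).1 - (dropRight x j).1) := by
      simp only [Fin.val_cast, Fin.val_castSucc]
      split_ifs <;> rfl
    rw [e2]
    by_cases h : (j : ℕ) + 1 = n₁ + n₂
    · rw [dif_neg (by omega : ¬ (j : ℕ) + 1 < n₁ + n₂), kickRight, if_pos h]
      simp only [sub_zero]
      rw [← sub_eq_add_neg]
      rfl
    · rw [dif_pos (by omega : (j : ℕ) + 1 < n₁ + n₂), kickRight, if_neg h]
      simp only [Prod.snd_zero, add_zero]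
      rfl

end Drop

/-- Sequences of continuously differentiable functions on the allowed phase space. -/
def SmoothSeq (σ : ℝ) (c : DoubleSeq) : Prop :=
  ∀ n₁ n₂, ContDiffOn ℝ 1 (c n₁ n₂) (Allowed σ (n₁ + n₂))

section Smooth

variable {c d : DoubleSeq}

theorem SmoothSeq.differentiableAt (hc : SmoothSeq σ c) {n₁ n₂ : ℕ} {x : Phase (n₁ + n₂)}
    (hx : x ∈ Allowed σ (n₁ + n₂)) : DifferentiableAt ℝ (c n₁ n₂) x :=
  ((hc n₁ n₂).differentiableOn one_ne_zero).differentiableAt ((isOpen_allowed σ _).mem_nhds hx)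

theorem SmoothSeq.sub (hc : SmoothSeq σ c) (hd : SmoothSeq σ d) : SmoothSeq σ (c - d) :=
  fun n₁ n₂ => (hc n₁ n₂).sub (hd n₁ n₂)

theorem SmoothSeq.creationLeft (hc : SmoothSeq σ c) : SmoothSeq σ (creationLeft c)
  | 0, _ => contDiffOn_const
  | n₁ + 1, n₂ => (hc n₁ n₂).comp contDiff_dropLeft.contDiffOn fun _ hx => dropLeft_mem hx

theorem SmoothSeq.creationRight (hc : SmoothSeq σ c) : SmoothSeq σ (creationRight c)
  | 0, 0 => contDiffOn_const
  | _ + 1, 0 => contDiffOn_const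
  | 0, n₂ + 1 => (hc 0 n₂).comp contDiff_dropRight.contDiffOn fun _ hx => dropRight_mem hx
  | n₁ + 1, n₂ + 1 =>
    (hc (n₁ + 1) n₂).comp contDiff_dropRight.contDiffOn fun _ hx => dropRight_mem hx

theorem creationLeft_succ (c : DoubleSeq) (n₁ n₂ : ℕ) (x : Phase ((n₁ + 1) + n₂)) :
    creationLeft c (n₁ + 1) n₂ x = c n₁ n₂ (dropLeft x) := rfl

theorem creationLeft_zero (c : DoubleSeq) (n₂ : ℕ) : creationLeft c 0 n₂ = fun _ => 0 := rfl

theorem creationRight_succ (c : DoubleSeq) (n₁ n₂ : ℕ) (x : Phase (n₁ + (n₂ + 1))) :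
    creationRight c n₁ (n₂ + 1) x = c n₁ n₂ (dropRight x) := by
  cases n₁ <;> rfl

theorem creationRight_zero (c : DoubleSeq) (n₁ : ℕ) : creationRight c n₁ 0 = fun _ => 0 := by
  cases n₁ <;> rfl

theorem creationLeft_sub (c d : DoubleSeq) :
    creationLeft (c - d) = creationLeft c - creationLeft d := by
  funext n₁ n₂ x
  cases n₁ with
  | zero => exact (sub_zero (0 : ℝ)).symm
  | succ n₁ => rfl

theorem creationRight_sub (c d : DoubleSeq) :
    creationRight (c - d) = creationRight c - creationRight d := by
  funext n₁ n₂ x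
  simp only [Pi.sub_apply]
  cases n₂ with
  | zero => simp only [creationRight_zero, sub_zero]
  | succ n₂ => simp only [creationRight_succ, Pi.sub_apply]

theorem creation_comm (c : DoubleSeq) :
    creationRight (creationLeft c) = creationLeft (creationRight c) := by
  funext n₁ n₂ x
  cases n₁ with
  | zero =>
    cases n₂ with
    | zero => rfl
    | succ n₂ => rfl
  | succ n₁ =>
    cases n₂ with
    | zero => rw [creationRight_zero, creationLeft_succ, creationRight_zero]
    | succ n₂ =>
      rw [creationRight_succ, creationLeft_succ, creationLeft_succ, creationRight_succ]
      rfl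

theorem liouville_sub (hc : SmoothSeq σ c) (hd : SmoothSeq σ d) {n₁ n₂ : ℕ} {x : Phase (n₁ + n₂)}
    (hx : x ∈ Allowed σ (n₁ + n₂)) : liouville Φ (c - d) n₁ n₂ x =
      liouville Φ c n₁ n₂ x - liouville Φ d n₁ n₂ x := by
  simp only [liouville, liouvilleStar_eq_fderiv, neg_neg]
  exact congrArg (· (hamiltonField Φ x))
    (fderiv_sub (hc.differentiableAt hx) (hd.differentiableAt hx))

/-- `[ℒ, 𝔞⁺₋]` -/
noncomputable def commLeft (Φ : ℝ → ℝ) (c : DoubleSeq) : DoubleSeq :=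
  liouville Φ (creationLeft c) - creationLeft (liouville Φ c)

/-- `[ℒ, 𝔞⁺₊]` -/
noncomputable def commRight (Φ : ℝ → ℝ) (c : DoubleSeq) : DoubleSeq :=
  liouville Φ (creationRight c) - creationRight (liouville Φ c)

theorem dualBbgky_eq (c : DoubleSeq) :
    dualBbgky Φ c = liouville Φ c + commLeft Φ c + commRight Φ c := rfl

theorem liouvilleStar_const {n : ℕ} (r : ℝ) (x : Phase n) :
    liouvilleStar Φ (fun _ => r) x = 0 := by
  rw [liouvilleStar_eq_fderiv, fderiv_fun_const]
  simp

theorem commLeft_zero (c : DoubleSeq) (n₂ : ℕ) (x : Phase (0 + n₂)) : commLeft Φ c 0 n₂ x = 0 := by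
  change -liouvilleStar Φ (fun _ : Phase (0 + n₂) => (0 : ℝ)) x - 0 = 0
  rw [liouvilleStar_const]
  simp

theorem commRight_zero (c : DoubleSeq) (n₁ : ℕ) (x : Phase (n₁ + 0)) :
    commRight Φ c n₁ 0 x = 0 := by
  simp only [commRight, Pi.sub_apply, liouville, creationRight_zero, liouvilleStar_const]
  simp

theorem commLeft_succ {c : DoubleSeq} {n₁ n₂ : ℕ} {x : Phase ((n₁ + 1) + n₂)}
    (hc : DifferentiableAt ℝ (c n₁ n₂) (dropLeft x)) :
    commLeft Φ c (n₁ + 1) n₂ x = fderiv ℝ (c n₁ n₂) (dropLeft x) (kickLeft Φ x) := by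
  change -liouvilleStar Φ (fun y => c n₁ n₂ (dropLeft y)) x - -liouvilleStar Φ (c n₁ n₂) (dropLeft x)
    = _
  rw [liouvilleStar_eq_fderiv, liouvilleStar_eq_fderiv, fderiv_comp_dropLeft hc,
    hamiltonField_dropLeft, map_add]
  ring

theorem commRight_succ {c : DoubleSeq} {n₁ n₂ : ℕ} {x : Phase (n₁ + (n₂ + 1))}
    (hc : DifferentiableAt ℝ (c n₁ n₂) (dropRight x)) :
    commRight Φ c n₁ (n₂ + 1) x = fderiv ℝ (c n₁ n₂) (dropRight x) (kickRight Φ x) := by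
  have e : creationRight c n₁ (n₂ + 1) = fun y => c n₁ n₂ (dropRight y) :=
    funext fun y => creationRight_succ c n₁ n₂ y
  rw [commRight, Pi.sub_apply, Pi.sub_apply, Pi.sub_apply, creationRight_succ, liouville, liouville,
    e, liouvilleStar_eq_fderiv, liouvilleStar_eq_fderiv, fderiv_comp_dropRight hc,
    hamiltonField_dropRight, map_add]
  ring

/-- The kick acts on the leftmost of the remaining particles, exactly the one on which `creationLeft
c` does not depend. -/
theorem commLeft_creationLeft (hc : SmoothSeq σ c) {n₁ n₂ : ℕ} {x : Phase (n₁ + n₂)}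
    (hx : x ∈ Allowed σ (n₁ + n₂)) : commLeft Φ (creationLeft c) n₁ n₂ x = 0 := by
  cases n₁ with
  | zero => exact commLeft_zero _ _ _
  | succ n₁ =>
    rw [commLeft_succ (hc.creationLeft.differentiableAt (dropLeft_mem hx))]
    cases n₁ with
    | zero =>
      rw [creationLeft_zero, fderiv_fun_const]
      rfl
    | succ n₁ =>
      refine (fderiv_comp_dropLeft (hc.differentiableAt (dropLeft_mem (dropLeft_mem hx))) _).trans ?_
      have : dropLeft (kickLeft Φ x) = 0 := by
        funext j
        simp [dropLeft, kickLeft]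
      rw [this, map_zero]

theorem commRight_creationRight (hc : SmoothSeq σ c) {n₁ n₂ : ℕ} {x : Phase (n₁ + n₂)}
    (hx : x ∈ Allowed σ (n₁ + n₂)) : commRight Φ (creationRight c) n₁ n₂ x = 0 := by
  cases n₂ with
  | zero => exact commRight_zero _ _ _
  | succ n₂ =>
    rw [commRight_succ (hc.creationRight.differentiableAt (dropRight_mem hx))]
    cases n₂ with
    | zero =>
      rw [creationRight_zero, fderiv_fun_const]
      rfl
    | succ n₂ =>
      have e : creationRight c n₁ (n₂ + 1) = fun y => c n₁ n₂ (dropRight y) :=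
        funext fun y => creationRight_succ c n₁ n₂ y
      rw [e, fderiv_comp_dropRight (hc.differentiableAt (dropRight_mem (dropRight_mem hx)))]
      have : dropRight (kickRight Φ x) = 0 := by
        funext j
        simp only [dropRight, kickRight, Fin.val_cast, Fin.val_castSucc]
        exact if_neg (by omega)
      rw [this, map_zero]

/-- The kick at the left end is not affected by forgetting the particle at the right end; if the two
ends meet, both sides vanish. -/
theorem commLeft_creationRight (hc : SmoothSeq σ c) {n₁ n₂ : ℕ} {x : Phase (n₁ + n₂)}
    (hx : x ∈ Allowed σ (n₁ + n₂)) :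
    commLeft Φ (creationRight c) n₁ n₂ x = creationRight (commLeft Φ c) n₁ n₂ x := by
  cases n₁ with
  | zero =>
    rw [commLeft_zero]
    cases n₂ with
    | zero => rfl
    | succ n₂ => rw [creationRight_succ, commLeft_zero]
  | succ n₁ =>
    rw [commLeft_succ (hc.creationRight.differentiableAt (dropLeft_mem hx))]
    cases n₂ with
    | zero =>
      rw [creationRight_zero, creationRight_zero, fderiv_fun_const]
      rfl
    | succ n₂ =>
      have e : creationRight c n₁ (n₂ + 1) = fun y => c n₁ n₂ (dropRight y) :=
        funext fun y => creationRight_succ c n₁ n₂ y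
      rw [e, fderiv_comp_dropRight (hc.differentiableAt (dropRight_mem (dropLeft_mem hx))),
        creationRight_succ,
        commLeft_succ (hc.differentiableAt (dropLeft_mem (dropRight_mem (n₁ := n₁ + 1) hx)))]
      rfl

theorem commRight_creationLeft (hc : SmoothSeq σ c) {n₁ n₂ : ℕ} {x : Phase (n₁ + n₂)}
    (hx : x ∈ Allowed σ (n₁ + n₂)) :
    commRight Φ (creationLeft c) n₁ n₂ x = creationLeft (commRight Φ c) n₁ n₂ x := by
  cases n₂ with
  | zero =>
    rw [commRight_zero]
    cases n₁ with
    | zero => rfl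
    | succ n₁ => rw [creationLeft_succ, commRight_zero]
  | succ n₂ =>
    rw [commRight_succ (hc.creationLeft.differentiableAt (dropRight_mem hx))]
    cases n₁ with
    | zero =>
      rw [creationLeft_zero, creationLeft_zero, fderiv_fun_const]
      rfl
    | succ n₁ =>
      refine (fderiv_comp_dropLeft (hc.differentiableAt
        (dropLeft_mem (dropRight_mem (n₁ := n₁ + 1) hx))) _).trans ?_
      rw [creationLeft_succ, commRight_succ (hc.differentiableAt
        (dropRight_mem (dropLeft_mem (n₂ := n₂ + 1) hx)))]
      congr 1
      funext j
      simp only [dropLeft, kickRight, Fin.val_cast, Fin.val_succ]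
      split_ifs <;> first | rfl | omega

/-- `(1 - 𝔞⁺₋)(1 - 𝔞⁺₊)` -/
def creationInv (c : DoubleSeq) : DoubleSeq :=
  (c - creationRight c) - creationLeft (c - creationRight c)

theorem SmoothSeq.creationInv (hc : SmoothSeq σ c) : SmoothSeq σ (creationInv c) :=
  (hc.sub hc.creationRight).sub (hc.sub hc.creationRight).creationLeft

theorem creationLeft_congr (hcd : ∀ n₁ n₂, ∀ x ∈ Allowed σ (n₁ + n₂), c n₁ n₂ x = d n₁ n₂ x)
    {n₁ n₂ : ℕ} {x : Phase (n₁ + n₂)} (hx : x ∈ Allowed σ (n₁ + n₂)) :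
    creationLeft c n₁ n₂ x = creationLeft d n₁ n₂ x := by
  cases n₁ with
  | zero => rfl
  | succ n₁ => exact hcd _ _ _ (dropLeft_mem hx)

theorem creationRight_congr (hcd : ∀ n₁ n₂, ∀ x ∈ Allowed σ (n₁ + n₂), c n₁ n₂ x = d n₁ n₂ x)
    {n₁ n₂ : ℕ} {x : Phase (n₁ + n₂)} (hx : x ∈ Allowed σ (n₁ + n₂)) :
    creationRight c n₁ n₂ x = creationRight d n₁ n₂ x := by
  cases n₂ with
  | zero => rw [creationRight_zero, creationRight_zero]
  | succ n₂ =>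
    rw [creationRight_succ, creationRight_succ]
    exact hcd _ _ _ (dropRight_mem hx)

theorem commLeft_sub (hc : SmoothSeq σ c) (hd : SmoothSeq σ d) {n₁ n₂ : ℕ} {x : Phase (n₁ + n₂)}
    (hx : x ∈ Allowed σ (n₁ + n₂)) : commLeft Φ (c - d) n₁ n₂ x =
      commLeft Φ c n₁ n₂ x - commLeft Φ d n₁ n₂ x := by
  have h1 := creationLeft_congr (c := liouville Φ (c - d)) (d := liouville Φ c - liouville Φ d)
    (fun n₁ n₂ x hx => liouville_sub hc hd hx) hx
  have h2 := liouville_sub (Φ := Φ) hc.creationLeft hd.creationLeft hx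
  rw [creationLeft_sub] at h1
  simp only [commLeft, creationLeft_sub, Pi.sub_apply] at h1 h2 ⊢
  rw [h1, h2]
  ring

theorem commRight_sub (hc : SmoothSeq σ c) (hd : SmoothSeq σ d) {n₁ n₂ : ℕ} {x : Phase (n₁ + n₂)}
    (hx : x ∈ Allowed σ (n₁ + n₂)) : commRight Φ (c - d) n₁ n₂ x =
      commRight Φ c n₁ n₂ x - commRight Φ d n₁ n₂ x := by
  have h1 := creationRight_congr (c := liouville Φ (c - d)) (d := liouville Φ c - liouville Φ d)
    (fun n₁ n₂ x hx => liouville_sub hc hd hx) hx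
  have h2 := liouville_sub (Φ := Φ) hc.creationRight hd.creationRight hx
  rw [creationRight_sub] at h1
  simp only [commRight, creationRight_sub, Pi.sub_apply] at h1 h2 ⊢
  rw [h1, h2]
  ring

/-- Write `A = 𝔞⁺₋`, `B = 𝔞⁺₊`. The rules `[ℒ, A] A = 0`, `[ℒ, B] B = 0`, together with the
commutation of `[ℒ, A]` with `B` and of `[ℒ, B]` with `A`, give on `(1 - A)(1 - B) c` the value `(1
- A) ℒ (1 - B) c + (1 - A)[ℒ, B] c = (1 - A)(1 - B) ℒ c`. -/
theorem dualBbgky_creationInv (hc : SmoothSeq σ c) (n₁ n₂ : ℕ) :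
    ∀ x ∈ Allowed σ (n₁ + n₂), dualBbgky Φ (creationInv c) n₁ n₂ x =
      creationInv (liouville Φ c) n₁ n₂ x := by
  intro x hx
  have hb := hc.creationRight
  have hcb := hc.sub hb
  have ha := hcb.creationLeft
  have e1 := commLeft_creationLeft (Φ := Φ) hcb hx
  have e2 := commLeft_creationRight (Φ := Φ) hc hx
  have e4 := commRight_creationLeft (Φ := Φ) hcb hx
  have e5 := creationLeft_congr (c := commRight Φ (c - creationRight c)) (d := commRight Φ c)
    (fun n₁ n₂ x hx => by
      rw [commRight_sub hc hb hx, commRight_creationRight hc hx, sub_zero]) hx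
  have e6 : commRight Φ (c - creationRight c) n₁ n₂ x = commRight Φ c n₁ n₂ x := by
    rw [commRight_sub hc hb hx, commRight_creationRight hc hx, sub_zero]
  have l1 := liouville_sub (Φ := Φ) hcb ha hx
  have l2 := liouville_sub (Φ := Φ) hc hb hx
  rw [dualBbgky_eq, creationInv]
  simp only [Pi.add_apply]
  rw [commLeft_sub hcb ha hx, commRight_sub hcb ha hx, e1, e4, e5, e6, l1, l2,
    commLeft_sub hc hb hx, e2]
  simp only [commLeft, commRight, creationInv, creationLeft_sub, creationRight_sub, Pi.sub_apply,
    creation_comm]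
  have l3 := liouville_sub (Φ := Φ) hc.creationLeft hb.creationLeft hx
  simp only [commLeft, creationRight_sub, Pi.sub_apply, creation_comm] at e2
  rw [l3]
  linarith

end Smooth

end TopologicalParticles

/-! ### Duality between sequences of bounded functions and `L¹_α`; the series is a weak solution -/

namespace TopologicalParticles

open Set

variable {σ R α C : ℝ} {Φ : ℝ → ℝ}

/-! ### Sequences of bounded functions and the pairing -/

/-- Sequences of continuous functions on the allowed phase space with a common bound. -/
structure BoundedSeq (σ C : ℝ) (c : DoubleSeq) : Prop where
  nonneg : 0 ≤ C
  continuousOn : ∀ n₁ n₂, ContinuousOn (c n₁ n₂) (Allowed σ (n₁ + n₂))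
  bound : ∀ n₁ n₂, ∀ x ∈ Allowed σ (n₁ + n₂), |c n₁ n₂ x| ≤ C

theorem integrable_mul_of_bound {n : ℕ} {c f : Phase n → ℝ}
    (hc : ContinuousOn c (Allowed σ n)) (hC : ∀ x ∈ Allowed σ n, |c x| ≤ C) (hf : Integrable f)
    (hf0 : ∀ x ∉ Allowed σ n, f x = 0) :
    Integrable (fun x => c x * f x) ∧ |∫ x, c x * f x| ≤ C * ∫ x, |f x| := by
  have hm := (isOpen_allowed σ n).measurableSet
  -- Nothing is known about `c` off the allowed set, where `f` vanishes; replacing `c` by its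
  -- indicator version gives measurability.
  have e : (fun x => c x * f x) = fun x => (Allowed σ n).indicator c x * f x := by
    funext x
    by_cases hx : x ∈ Allowed σ n
    · rw [indicator_of_mem hx]
    · rw [hf0 x hx, mul_zero, mul_zero]
  have hle : ∀ x, |c x * f x| ≤ C * |f x| := by
    intro x
    by_cases hx : x ∈ Allowed σ n
    · rw [abs_mul]
      exact mul_le_mul_of_nonneg_right (hC x hx) (abs_nonneg _)
    · simp [hf0 x hx]
  have hi : Integrable (fun x => c x * f x) := by
    refine (hf.abs.const_mul C).mono' ?_ (ae_of_all _ hle)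
    rw [e]
    exact ((aestronglyMeasurable_indicator_iff hm).2 (hc.aestronglyMeasurable hm)).mul
      hf.aestronglyMeasurable
  refine ⟨hi, ?_⟩
  rw [← integral_const_mul]
  exact abs_integral_le_integral_abs.trans (integral_mono hi.abs (hf.abs.const_mul C) hle)

section Bounded

variable {c d F G : DoubleSeq} {D : ℝ}

theorem BoundedSeq.integrable_mul (hc : BoundedSeq σ C c) (hF : MemL1 σ α F) (n : ℕ × ℕ) :
    Integrable (fun x => c n.1 n.2 x * F n.1 n.2 x) ∧
      |∫ x, c n.1 n.2 x * F n.1 n.2 x| ≤ C * ∫ x, |F n.1 n.2 x| :=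
  integrable_mul_of_bound (hc.continuousOn _ _) (hc.bound _ _) (hF.integrable _ _)
    (hF.forbidden _ _)

theorem BoundedSeq.abs_integral_le (hα : 1 ≤ α) (hc : BoundedSeq σ C c) (hF : MemL1 σ α F)
    (n : ℕ × ℕ) : |∫ x, c n.1 n.2 x * F n.1 n.2 x| ≤ C * compNorm α F n :=
  (hc.integrable_mul hF n).2.trans (mul_le_mul_of_nonneg_left
    (le_mul_of_one_le_left (integral_nonneg fun _ => abs_nonneg _) (one_le_pow₀ hα)) hc.nonneg)

theorem BoundedSeq.summable (hα : 1 ≤ α) (hc : BoundedSeq σ C c) (hF : MemL1 σ α F) :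
    Summable fun n : ℕ × ℕ => ∫ x, c n.1 n.2 x * F n.1 n.2 x :=
  Summable.of_norm_bounded (Summable.mul_left C hF.summable) (hc.abs_integral_le hα hF)

theorem BoundedSeq.abs_pairing_le (hα : 1 ≤ α) (hc : BoundedSeq σ C c) (hF : MemL1 σ α F) :
    |pairing c F| ≤ C * normL1 α F := by
  have hs : Summable (compNorm α F) := hF.summable
  exact tsum_of_norm_bounded (f := fun n : ℕ × ℕ => ∫ x, c n.1 n.2 x * F n.1 n.2 x)
    (hs.hasSum.mul_left C) (hc.abs_integral_le hα hF)

theorem pairing_congr (hcd : ∀ n₁ n₂, ∀ x ∈ Allowed σ (n₁ + n₂), c n₁ n₂ x = d n₁ n₂ x)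
    (hF0 : ∀ n₁ n₂, ∀ x ∉ Allowed σ (n₁ + n₂), F n₁ n₂ x = 0)
    (hFG : ∀ n₁ n₂, F n₁ n₂ =ᵐ[volume] G n₁ n₂) : pairing c F = pairing d G := by
  refine tsum_congr fun n => integral_congr_ae ?_
  filter_upwards [hFG n.1 n.2] with x hx
  by_cases h : x ∈ Allowed σ (n.1 + n.2)
  · rw [hcd _ _ x h, hx]
  · rw [← hx, hF0 _ _ x h, mul_zero, mul_zero]

theorem BoundedSeq.sub (hc : BoundedSeq σ C c) (hd : BoundedSeq σ D d) :
    BoundedSeq σ (C + D) (c - d) :=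
  ⟨add_nonneg hc.nonneg hd.nonneg, fun n₁ n₂ => (hc.continuousOn n₁ n₂).sub (hd.continuousOn n₁ n₂),
    fun n₁ n₂ x hx => (abs_sub _ _).trans (add_le_add (hc.bound n₁ n₂ x hx) (hd.bound n₁ n₂ x hx))⟩

theorem continuousOn_creationLeft (hc : ∀ n₁ n₂, ContinuousOn (c n₁ n₂) (Allowed σ (n₁ + n₂)))
    (n₁ n₂ : ℕ) : ContinuousOn (creationLeft c n₁ n₂) (Allowed σ (n₁ + n₂)) := by
  cases n₁ with
  | zero => exact continuousOn_const
  | succ n₁ =>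
    exact (hc n₁ n₂).comp contDiff_dropLeft.continuous.continuousOn fun _ hx => dropLeft_mem hx

theorem continuousOn_creationRight (hc : ∀ n₁ n₂, ContinuousOn (c n₁ n₂) (Allowed σ (n₁ + n₂)))
    (n₁ n₂ : ℕ) : ContinuousOn (creationRight c n₁ n₂) (Allowed σ (n₁ + n₂)) := by
  cases n₂ with
  | zero =>
    rw [creationRight_zero]
    exact continuousOn_const
  | succ n₂ =>
    have e : creationRight c n₁ (n₂ + 1) = fun y => c n₁ n₂ (dropRight y) :=
      funext fun y => creationRight_succ c n₁ n₂ y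
    rw [e]
    exact (hc n₁ n₂).comp contDiff_dropRight.continuous.continuousOn fun _ hx => dropRight_mem hx

theorem BoundedSeq.creationLeft (hc : BoundedSeq σ C c) : BoundedSeq σ C (creationLeft c) := by
  refine ⟨hc.nonneg, continuousOn_creationLeft hc.continuousOn, fun n₁ n₂ x hx => ?_⟩
  cases n₁ with
  | zero =>
    rw [creationLeft_zero, abs_zero]
    exact hc.nonneg
  | succ n₁ => exact hc.bound n₁ n₂ _ (dropLeft_mem hx)

theorem BoundedSeq.creationRight (hc : BoundedSeq σ C c) : BoundedSeq σ C (creationRight c) := by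
  refine ⟨hc.nonneg, continuousOn_creationRight hc.continuousOn, fun n₁ n₂ x hx => ?_⟩
  cases n₂ with
  | zero =>
    rw [creationRight_zero, abs_zero]
    exact hc.nonneg
  | succ n₂ =>
    rw [creationRight_succ]
    exact hc.bound n₁ n₂ _ (dropRight_mem hx)

theorem pairing_sub_left (hα : 1 ≤ α) (hc : BoundedSeq σ C c) (hd : BoundedSeq σ D d)
    (hF : MemL1 σ α F) : pairing (c - d) F = pairing c F - pairing d F := by
  rw [pairing, pairing, pairing, ← (hc.summable hα hF).tsum_sub (hd.summable hα hF)]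
  refine tsum_congr fun n => ?_
  rw [← integral_sub (hc.integrable_mul hF n).1 (hd.integrable_mul hF n).1]
  exact integral_congr_ae (ae_of_all _ fun x => sub_mul _ _ _)

theorem MemL1.sub (hα : 0 ≤ α) (hF : MemL1 σ α F) (hG : MemL1 σ α G) : MemL1 σ α (F - G) :=
  ⟨(hF.summableSeq.sub hα hG.summableSeq).1.integrable, fun n₁ n₂ x hx => by
    simp only [Pi.sub_apply, hF.forbidden n₁ n₂ x hx, hG.forbidden n₁ n₂ x hx, sub_zero],
    (hF.summableSeq.sub hα hG.summableSeq).1.summable⟩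

theorem pairing_sub_right (hα : 1 ≤ α) (hc : BoundedSeq σ C c) (hF : MemL1 σ α F)
    (hG : MemL1 σ α G) : pairing c (F - G) = pairing c F - pairing c G := by
  rw [pairing, pairing, pairing, ← (hc.summable hα hF).tsum_sub (hc.summable hα hG)]
  refine tsum_congr fun n => ?_
  rw [← integral_sub (hc.integrable_mul hF n).1 (hc.integrable_mul hG n).1]
  exact integral_congr_ae (ae_of_all _ fun x => mul_sub _ _ _)

end Bounded

/-! ### Membership -/

section Membership

variable {F : DoubleSeq}

theorem MemL1.reduce (hα : 0 < α) (hF : MemL1 σ α F) (k₁ k₂ : ℕ) : MemL1 σ α (reduce k₁ k₂ F) :=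
  have h := (hF.summableSeq.reduce hα k₁ k₂).1
  ⟨h.integrable, fun _ _ _ hx => reduce_eq_zero hF.forbidden _ _ _ _ hx, h.summable⟩

theorem MemL1.reduceInv (hα : 0 < α) (hF : MemL1 σ α F) : MemL1 σ α (reduceInv F) :=
  have h := (hF.summableSeq.reduceInv hα).1
  ⟨h.integrable, reduceInv_eq_zero hF.forbidden, h.summable⟩

theorem MemL1.expand (hα : 1 < α) (hF : MemL1 σ α F) : MemL1 σ α (expand F) :=
  have h := (hF.summableSeq.expand hα).1
  ⟨h.integrable, expand_eq_zero hF.forbidden, h.summable⟩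

theorem MemL1.transport (h : IsPotential σ R Φ) (hF : MemL1 σ α F) (t : ℝ) :
    MemL1 σ α (transport σ Φ t F) :=
  have hT := (hF.summableSeq.transport h t).1
  ⟨hT.integrable, transport_eq_zero h hF.forbidden t, hT.summable⟩

end Membership

/-! ### Adjoint operators -/

section Adjoint

variable {c F : DoubleSeq}

theorem integral_cast {m m' : ℕ} (h : m' = m) (G : Phase m → ℝ) :
    ∫ x : Phase m', G (fun i => x (Fin.cast h.symm i)) = ∫ x, G x := by
  subst h
  rfl

/-- Fubini: `g` sees only the middle particles and leaves the integral over the outer ones. -/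
theorem integral_mid_mul {k₁ s₁ s₂ k₂ : ℕ} {g : Phase (s₁ + s₂) → ℝ} {f : Phase ((k₁ + s₁) + (s₂ + k₂)) → ℝ}
    (hi : Integrable fun y : Phase ((k₁ + s₁) + (s₂ + k₂)) =>
      g (fun i => y ⟨k₁ + i, by omega⟩) * f y) :
    ∫ y : Phase ((k₁ + s₁) + (s₂ + k₂)), g (fun i => y ⟨k₁ + i, by omega⟩) * f y =
      ∫ x, g x * ∫ w : Phase k₁ × Phase k₂, f (join w.1 x w.2) := by
  rw [← integral_join hi]
  refine integral_congr_ae (ae_of_all _ fun x => ?_)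
  simp only
  rw [← integral_const_mul]
  refine integral_congr_ae (ae_of_all _ fun w => ?_)
  simp only
  congr 2
  funext i
  exact join_apply_mid _ _ _ rfl

theorem integral_dropLeft_mul {n₁ n₂ : ℕ} {g : Phase (n₁ + n₂) → ℝ}
    (hi : Integrable fun x => g (dropLeft x) * F (n₁ + 1) n₂ x) :
    ∫ x, g (dropLeft x) * F (n₁ + 1) n₂ x = ∫ x, g x * reduce 1 0 F n₁ n₂ x := by
  have e : (fun y : Phase ((1 + n₁) + (n₂ + 0)) => g (fun i => y ⟨1 + i, by omega⟩) *
      F (1 + n₁) (n₂ + 0) y) =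
      fun y => (fun x => g (dropLeft x) * F (n₁ + 1) n₂ x) (fun i => y (Fin.cast (by omega) i)) := by
    funext y
    simp only
    congr 1
    · congr 1
      funext i
      exact congrArg y (Fin.ext (by simp [add_comm]))
    · exact seq_cast F (by omega) (by omega) y
  have hN : (1 + n₁) + (n₂ + 0) = (n₁ + 1) + n₂ := by omega
  have hi' : Integrable fun y : Phase ((1 + n₁) + (n₂ + 0)) =>
      (fun x => g (dropLeft x) * F (n₁ + 1) n₂ x) (fun i => y (Fin.cast hN.symm i)) := by
    generalize (fun x => g (dropLeft x) * F (n₁ + 1) n₂ x) = H at hi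
    generalize (1 + n₁) + (n₂ + 0) = m at hN
    subst hN
    exact hi
  rw [← integral_cast hN, ← e]
  exact integral_mid_mul (by rw [e]; exact hi')

theorem integral_dropRight_mul {n₁ n₂ : ℕ} {g : Phase (n₁ + n₂) → ℝ}
    (hi : Integrable fun x => g (dropRight x) * F n₁ (n₂ + 1) x) :
    ∫ x, g (dropRight x) * F n₁ (n₂ + 1) x = ∫ x, g x * reduce 0 1 F n₁ n₂ x := by
  have e : (fun y : Phase ((0 + n₁) + (n₂ + 1)) => g (fun i => y ⟨0 + i, by omega⟩) *
      F (0 + n₁) (n₂ + 1) y) =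
      fun y => (fun x => g (dropRight x) * F n₁ (n₂ + 1) x) (fun i => y (Fin.cast (by omega) i)) := by
    funext y
    simp only
    congr 1
    · congr 1
      funext i
      exact congrArg y (Fin.ext (by simp))
    · exact seq_cast F (by omega) (by omega) y
  have hN : (0 + n₁) + (n₂ + 1) = n₁ + (n₂ + 1) := by omega
  have hi' : Integrable fun y : Phase ((0 + n₁) + (n₂ + 1)) =>
      (fun x => g (dropRight x) * F n₁ (n₂ + 1) x) (fun i => y (Fin.cast hN.symm i)) := by
    generalize (fun x => g (dropRight x) * F n₁ (n₂ + 1) x) = H at hi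
    generalize (0 + n₁) + (n₂ + 1) = m at hN
    subst hN
    exact hi
  rw [← integral_cast hN, ← e]
  exact integral_mid_mul (by rw [e]; exact hi')

theorem pairing_creationLeft (hc : BoundedSeq σ C c) (hF : MemL1 σ α F) :
    pairing (creationLeft c) F = pairing c (reduce 1 0 F) := by
  have hinj : Function.Injective fun n : ℕ × ℕ => (n.1 + 1, n.2) := by
    rintro ⟨a, b⟩ ⟨a', b'⟩ h
    simpa using h
  rw [pairing, ← hinj.tsum_eq]
  · refine tsum_congr fun n => ?_
    exact integral_dropLeft_mul (hc.creationLeft.integrable_mul hF (n.1 + 1, n.2)).1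
  · rintro ⟨n₁, n₂⟩ hn
    cases n₁ with
    | zero => exact absurd (by simp [creationLeft_zero]) hn
    | succ n₁ => exact ⟨(n₁, n₂), rfl⟩

theorem pairing_creationRight (hc : BoundedSeq σ C c) (hF : MemL1 σ α F) :
    pairing (creationRight c) F = pairing c (reduce 0 1 F) := by
  have hinj : Function.Injective fun n : ℕ × ℕ => (n.1, n.2 + 1) := by
    rintro ⟨a, b⟩ ⟨a', b'⟩ h
    simpa using h
  rw [pairing, ← hinj.tsum_eq]
  · refine tsum_congr fun n => ?_
    have h1 := (hc.creationRight.integrable_mul hF (n.1, n.2 + 1)).1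
    simp only [creationRight_succ] at h1 ⊢
    exact integral_dropRight_mul h1
  · rintro ⟨n₁, n₂⟩ hn
    cases n₂ with
    | zero => exact absurd (by simp [creationRight_zero]) hn
    | succ n₂ => exact ⟨(n₁, n₂), rfl⟩

/-- Forgetting a particle is adjoint to integrating over it, so the adjoint of `(1 - 𝔞⁺₋)(1 - 𝔞⁺₊)`
is `(1 - 𝔞₋)(1 - 𝔞₊)`. -/
theorem pairing_creationInv (hα : 1 < α) (hc : BoundedSeq σ C c) (hF : MemL1 σ α F) :
    pairing (creationInv c) F = pairing c (reduceInv F) := by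
  have h0 : 0 < α := one_pos.trans hα
  have hb := hc.creationRight
  have hF10 := hF.reduce h0 1 0
  have hF01 := hF.reduce h0 0 1
  have hF11 := hF10.reduce h0 0 1
  rw [creationInv, pairing_sub_left hα.le (hc.sub hb) (hc.sub hb).creationLeft hF,
    pairing_creationLeft (hc.sub hb) hF, pairing_sub_left hα.le hc hb hF,
    pairing_sub_left hα.le hc hb hF10, pairing_creationRight hc hF, pairing_creationRight hc hF10,
    ← pairing_sub_right hα.le hc hF hF01, ← pairing_sub_right hα.le hc hF10 hF11,
    ← pairing_sub_right hα.le hc (hF.sub h0.le hF01) (hF10.sub h0.le hF11)]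
  refine pairing_congr (σ := σ) (fun _ _ _ _ => rfl)
    ((hF.sub h0.le hF01).sub h0.le (hF10.sub h0.le hF11)).forbidden fun n₁ n₂ => ?_
  filter_upwards [hF.summableSeq.ae_summableAt hα.le n₁ n₂] with x hx
  have h1 := (hx.reduce_reduce (0, 1) (1, 0)).1
  rw [reduceInv, Finset.sum_product]
  simp only [Finset.sum_range_succ, Finset.sum_range_zero, reduce_zero, Pi.sub_apply]
  simp only at h1
  rw [h1]
  ring

end Adjoint

/-! ### Inversion of `creationInv` -/

section Inverse

variable {b c : DoubleSeq}

/-- `(1 - 𝔞⁺₋)⁻¹` -/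
def sumLeft (b : DoubleSeq) : DoubleSeq
  | 0, n₂ => b 0 n₂
  | n₁ + 1, n₂ => fun x => b (n₁ + 1) n₂ x + sumLeft b n₁ n₂ (dropLeft x)

theorem sumLeft_sub (b : DoubleSeq) : sumLeft b - creationLeft (sumLeft b) = b := by
  funext n₁ n₂ x
  cases n₁ with
  | zero => exact sub_zero _
  | succ n₁ => exact add_sub_cancel_right (b (n₁ + 1) n₂ x) _

theorem SmoothSeq.sumLeft (hb : SmoothSeq σ b) : SmoothSeq σ (sumLeft b) := by
  intro n₁
  induction n₁ with
  | zero => exact fun n₂ => hb 0 n₂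
  | succ n₁ ih =>
    exact fun n₂ => (hb (n₁ + 1) n₂).add
      ((ih n₂).comp contDiff_dropLeft.contDiffOn fun _ hx => dropLeft_mem hx)

/-- `(1 - 𝔞⁺₊)⁻¹` -/
def sumRight (b : DoubleSeq) (n₁ : ℕ) : (n₂ : ℕ) → Phase (n₁ + n₂) → ℝ
  | 0 => b n₁ 0
  | n₂ + 1 => fun x => b n₁ (n₂ + 1) x + sumRight b n₁ n₂ (dropRight x)

theorem sumRight_sub (b : DoubleSeq) : sumRight b - creationRight (sumRight b) = b := by
  funext n₁ n₂ x
  rw [Pi.sub_apply, Pi.sub_apply, Pi.sub_apply]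
  cases n₂ with
  | zero =>
    rw [creationRight_zero]
    exact sub_zero _
  | succ n₂ =>
    rw [creationRight_succ]
    exact add_sub_cancel_right (b n₁ (n₂ + 1) x) _

theorem SmoothSeq.sumRight (hb : SmoothSeq σ b) : SmoothSeq σ (sumRight b) := by
  intro n₁ n₂
  induction n₂ with
  | zero => exact hb n₁ 0
  | succ n₂ ih =>
    exact (hb n₁ (n₂ + 1)).add
      (ih.comp contDiff_dropRight.contDiffOn fun _ hx => dropRight_mem hx)

theorem exists_creationInv_eq (hb : SmoothSeq σ b) : ∃ c, SmoothSeq σ c ∧ creationInv c = b :=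
  ⟨sumRight (sumLeft b), hb.sumLeft.sumRight, by
    rw [creationInv, sumRight_sub, sumLeft_sub]⟩

/-- Inverting `creationInv` adds up values of `b` at subconfigurations, each component of `b` at
most once. The bound is therefore uniform in the particle numbers, although `c` may have infinitely
many nonzero components. -/
theorem bound_of_creationInv (hcb : ∀ n₁ n₂, ∀ x ∈ Allowed σ (n₁ + n₂),
      creationInv c n₁ n₂ x = b n₁ n₂ x) {B : ℕ × ℕ → ℝ} (hB0 : ∀ n, 0 ≤ B n) (hB : Summable B)
    (hbB : ∀ n₁ n₂, ∀ x ∈ Allowed σ (n₁ + n₂), |b n₁ n₂ x| ≤ B (n₁, n₂)) :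
    ∀ n₁ n₂, ∀ x ∈ Allowed σ (n₁ + n₂), |c n₁ n₂ x| ≤ ∑' n, B n := by
  have h1 : ∀ n₁ n₂, ∀ x ∈ Allowed σ (n₁ + n₂),
      |(c - creationRight c) n₁ n₂ x| ≤ ∑ m ∈ Finset.range (n₁ + 1), B (m, n₂) := by
    intro n₁
    induction n₁ with
    | zero =>
      intro n₂ x hx
      have h := hcb 0 n₂ x hx
      rw [creationInv, Pi.sub_apply, Pi.sub_apply, Pi.sub_apply, creationLeft_zero, sub_zero] at h
      rw [h]
      simpa using hbB 0 n₂ x hx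
    | succ n₁ ih =>
      intro n₂ x hx
      have h := hcb (n₁ + 1) n₂ x hx
      rw [creationInv, Pi.sub_apply, Pi.sub_apply, Pi.sub_apply, creationLeft_succ,
        sub_eq_iff_eq_add] at h
      rw [h, Finset.sum_range_succ, add_comm]
      exact (abs_add_le _ _).trans (add_le_add (ih n₂ _ (dropLeft_mem hx)) (hbB _ _ x hx))
  have h2 : ∀ n₁ n₂, ∀ x ∈ Allowed σ (n₁ + n₂), |c n₁ n₂ x| ≤
      ∑ k ∈ Finset.range (n₂ + 1), ∑ m ∈ Finset.range (n₁ + 1), B (m, k) := by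
    intro n₁ n₂
    induction n₂ with
    | zero =>
      intro x hx
      have h := h1 n₁ 0 x hx
      rw [Pi.sub_apply, Pi.sub_apply, Pi.sub_apply, creationRight_zero, sub_zero] at h
      simpa using h
    | succ n₂ ih =>
      intro x hx
      have h := h1 n₁ (n₂ + 1) x hx
      rw [Pi.sub_apply, Pi.sub_apply, Pi.sub_apply, creationRight_succ] at h
      rw [Finset.sum_range_succ]
      have h3 := ih _ (dropRight_mem hx)
      have h4 := abs_add_le (c n₁ n₂ (dropRight x)) (c n₁ (n₂ + 1) x - c n₁ n₂ (dropRight x))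
      rw [add_sub_cancel] at h4
      linarith
  intro n₁ n₂ x hx
  refine (h2 n₁ n₂ x hx).trans ?_
  rw [← Finset.sum_product']
  have h5 := hB.sum_le_tsum ((Finset.range (n₂ + 1) ×ˢ Finset.range (n₁ + 1)).map
    (Equiv.prodComm ℕ ℕ).toEmbedding) fun n _ => hB0 n
  rw [Finset.sum_map] at h5
  exact h5

end Inverse

/-! ### Existence of weak solutions -/

/-- Sequences with finitely many nonzero components. -/
def FiniteSeq (b : DoubleSeq) : Prop := {n : ℕ × ℕ | b n.1 n.2 ≠ 0}.Finite

section Finite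

variable {b c : DoubleSeq}

theorem FiniteSeq.sub (hb : FiniteSeq b) (hc : FiniteSeq c) : FiniteSeq (b - c) := by
  refine (hb.union hc).subset fun n hn => ?_
  by_contra h
  simp only [mem_union, mem_ofPred_eq, not_or, not_not] at h
  exact hn (by rw [Pi.sub_apply, Pi.sub_apply, h.1, h.2, sub_zero])

theorem FiniteSeq.add (hb : FiniteSeq b) (hc : FiniteSeq c) : FiniteSeq (b + c) := by
  refine (hb.union hc).subset fun n hn => ?_
  by_contra h
  simp only [mem_union, mem_ofPred_eq, not_or, not_not] at h
  exact hn (by rw [Pi.add_apply, Pi.add_apply, h.1, h.2, add_zero])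

theorem FiniteSeq.liouville (hb : FiniteSeq b) : FiniteSeq (liouville Φ b) := by
  refine hb.subset fun n hn h => hn ?_
  funext x
  rw [TopologicalParticles.liouville, h]
  exact neg_eq_zero.2 (liouvilleStar_const 0 x)

theorem FiniteSeq.creationLeft (hb : FiniteSeq b) : FiniteSeq (creationLeft b) := by
  refine (hb.image fun n => (n.1 + 1, n.2)).subset ?_
  rintro ⟨n₁, n₂⟩ hn
  cases n₁ with
  | zero => exact absurd rfl hn
  | succ n₁ =>
    refine ⟨(n₁, n₂), fun h => hn ?_, rfl⟩
    funext x
    exact congrFun h (dropLeft x)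

theorem FiniteSeq.creationRight (hb : FiniteSeq b) : FiniteSeq (creationRight b) := by
  refine (hb.image fun n => (n.1, n.2 + 1)).subset ?_
  rintro ⟨n₁, n₂⟩ hn
  cases n₂ with
  | zero => exact absurd (creationRight_zero b n₁) hn
  | succ n₂ =>
    refine ⟨(n₁, n₂), fun h => hn ?_, rfl⟩
    funext x
    exact (creationRight_succ b n₁ n₂ x).trans (congrFun h (dropRight x))

theorem FiniteSeq.creationInv (hb : FiniteSeq b) : FiniteSeq (creationInv b) :=
  (hb.sub hb.creationRight).sub (hb.sub hb.creationRight).creationLeft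

theorem FiniteSeq.dualBbgky (hb : FiniteSeq b) : FiniteSeq (dualBbgky Φ b) :=
  (hb.liouville.add (hb.creationLeft.liouville.sub hb.liouville.creationLeft)).add
    (hb.creationRight.liouville.sub hb.liouville.creationRight)

theorem FiniteSeq.exists_bound (hb : FiniteSeq b)
    (hbd : ∀ n₁ n₂, ∃ C : ℝ, ∀ x ∈ Allowed σ (n₁ + n₂), |b n₁ n₂ x| ≤ C) :
    ∃ B : ℕ × ℕ → ℝ, (∀ n, 0 ≤ B n) ∧ Summable B ∧
      ∀ n₁ n₂, ∀ x ∈ Allowed σ (n₁ + n₂), |b n₁ n₂ x| ≤ B (n₁, n₂) := by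
  classical
  choose K hK using hbd
  refine ⟨fun n => if b n.1 n.2 = 0 then 0 else |K n.1 n.2|, fun n => ?_, ?_, fun n₁ n₂ x hx => ?_⟩
  · simp only
    split_ifs
    exacts [le_rfl, abs_nonneg _]
  · exact summable_of_hasFiniteSupport (hb.subset fun n hn h => hn (if_pos h))
  · simp only
    split_ifs with h
    · rw [h]
      simp
    · exact (hK n₁ n₂ x hx).trans (le_abs_self _)

end Finite

theorem SmoothSeq.continuousOn_liouville (h : IsPotential σ R Φ) {c : DoubleSeq}
    (hc : SmoothSeq σ c) (n₁ n₂ : ℕ) : ContinuousOn (liouville Φ c n₁ n₂) (Allowed σ (n₁ + n₂)) := by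
  have e : liouville Φ c n₁ n₂ = fun x => fderiv ℝ (c n₁ n₂) x (hamiltonField Φ x) := by
    funext x
    rw [liouville, liouvilleStar_eq_fderiv, neg_neg]
  rw [e]
  exact ((hc n₁ n₂).continuousOn_fderiv_of_isOpen (isOpen_allowed σ _) le_rfl).clm_apply
    (continuousOn_hamiltonField h)

/-- The motion is put on the smooth factor `c`, since `f` is only integrable; `D * |f|` dominates
the derivative. -/
theorem hasDerivAt_integral_mul_comp_flow (h : IsPotential σ R Φ) {n : ℕ} {c f : Phase n → ℝ}
    {D : ℝ} (hc : ContDiffOn ℝ 1 c (Allowed σ n)) (hcC : ∀ x ∈ Allowed σ n, |c x| ≤ C)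
    (hL : ContinuousOn (liouvilleStar Φ c) (Allowed σ n))
    (hcD : ∀ x ∈ Allowed σ n, |liouvilleStar Φ c x| ≤ D) (hf : Integrable f)
    (hf0 : ∀ x ∉ Allowed σ n, f x = 0) (t : ℝ) :
    HasDerivAt (fun s => ∫ x, c (flow σ Φ s x) * f x)
      (∫ x, -liouvilleStar Φ c (flow σ Φ t x) * f x) t := by
  have hmaps : ∀ s, MapsTo (flow σ Φ s) (Allowed σ n) (Allowed σ n) := fun s x hx =>
    flow_mem h hx s
  refine (hasDerivAt_integral_of_dominated_loc_of_deriv_le (μ := (volume : Measure (Phase n)))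
    (F := fun s x => c (flow σ Φ s x) * f x)
    (F' := fun s x => -liouvilleStar Φ c (flow σ Φ s x) * f x) (s := univ)
    (bound := fun x => D * |f x|) univ_mem (Eventually.of_forall fun s => ?_) ?_ ?_
    (ae_of_all _ fun x s _ => ?_) (hf.abs.const_mul D) (ae_of_all _ fun x s _ => ?_)).2
  · exact (integrable_mul_of_bound (hc.continuousOn.comp (continuousOn_flow_time h s) (hmaps s))
      (fun x hx => hcC _ (hmaps s hx)) hf hf0).1.aestronglyMeasurable
  · exact (integrable_mul_of_bound (hc.continuousOn.comp (continuousOn_flow_time h t) (hmaps t))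
      (fun x hx => hcC _ (hmaps t hx)) hf hf0).1
  · exact (integrable_mul_of_bound (hL.comp (continuousOn_flow_time h t) (hmaps t)).neg
      (fun x hx => (abs_neg _).trans_le (hcD _ (hmaps t hx))) hf hf0).1.aestronglyMeasurable
  · by_cases hx : x ∈ Allowed σ n
    · rw [Real.norm_eq_abs, abs_mul, abs_neg]
      exact mul_le_mul_of_nonneg_right (hcD _ (hmaps s hx)) (abs_nonneg _)
    · simp [hf0 x hx]
  · by_cases hx : x ∈ Allowed σ n
    · exact (hasDerivAt_comp_flow h hc hx s).mul_const _
    · simpa only [hf0 x hx, mul_zero] using hasDerivAt_const s (0 : ℝ)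

theorem pairing_transport (h : IsPotential σ R Φ) (c F : DoubleSeq) (t : ℝ) :
    pairing c (transport σ Φ t F) =
      ∑' n : ℕ × ℕ, ∫ x, c n.1 n.2 (flow σ Φ t x) * F n.1 n.2 x := by
  refine tsum_congr fun n => ?_
  rw [← integral_comp_flow h t]
  simp only [transport, flow_neg_flow h]

/-- Termwise differentiation of the pairing: the derivatives are bounded by `D` times the weighted
norms of the components of `F`, uniformly in time. -/
theorem hasDerivAt_pairing_transport (h : IsPotential σ R Φ) (hα : 1 ≤ α) {c F : DoubleSeq}
    {D : ℝ} (hs : SmoothSeq σ c) (hc : BoundedSeq σ C c) (hL : BoundedSeq σ D (liouville Φ c))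
    (hF : MemL1 σ α F) (t : ℝ) :
    HasDerivAt (fun s => pairing c (transport σ Φ s F))
      (pairing (liouville Φ c) (transport σ Φ t F)) t := by
  have hsum : Summable (compNorm α F) := hF.summable
  have hLn : ∀ n₁ n₂, ∀ x ∈ Allowed σ (n₁ + n₂), |liouvilleStar Φ (c n₁ n₂) x| ≤ D := by
    intro n₁ n₂ x hx
    have := hL.bound n₁ n₂ x hx
    rwa [liouville, abs_neg] at this
  have hLc : ∀ n₁ n₂, ContinuousOn (liouvilleStar Φ (c n₁ n₂)) (Allowed σ (n₁ + n₂)) := by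
    intro n₁ n₂
    have := (hL.continuousOn n₁ n₂).neg
    refine this.congr fun x _ => ?_
    simp [liouville]
  have hmaps : ∀ s (n : ℕ), MapsTo (flow σ Φ s) (Allowed σ n) (Allowed σ n) := fun s n x hx =>
    flow_mem h hx s
  simp only [pairing_transport h]
  refine hasDerivAt_tsum (hsum.mul_left D)
    (g := fun (n : ℕ × ℕ) s => ∫ x, c n.1 n.2 (flow σ Φ s x) * F n.1 n.2 x)
    (g' := fun n s => ∫ x, liouville Φ c n.1 n.2 (flow σ Φ s x) * F n.1 n.2 x)
    (fun n s => ?_) (fun n s => ?_) (y₀ := 0) ?_ t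
  · exact hasDerivAt_integral_mul_comp_flow h (hs n.1 n.2) (hc.bound n.1 n.2) (hLc n.1 n.2)
      (hLn n.1 n.2) (hF.integrable _ _) (hF.forbidden _ _) s
  · refine (integrable_mul_of_bound ((hL.continuousOn n.1 n.2).comp (continuousOn_flow_time h s)
      (hmaps s _)) (fun x hx => hL.bound n.1 n.2 _ (hmaps s _ hx)) (hF.integrable _ _)
      (hF.forbidden _ _)).2.trans (mul_le_mul_of_nonneg_left ?_ hL.nonneg)
    exact le_mul_of_one_le_left (integral_nonneg fun _ => abs_nonneg _) (one_le_pow₀ hα)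
  · have := hc.summable hα hF
    simpa only [flow_zero h] using this

/-- The assumption that `dualBbgky Φ b` is bounded enters here: it equals `creationInv (liouville Φ
c)`, so inverting `creationInv` also bounds `liouville Φ c`. -/
theorem IsTest.exists_inverse (h : IsPotential σ R Φ) {b : DoubleSeq} (hb : IsTest σ Φ b) :
    ∃ c C D, SmoothSeq σ c ∧ BoundedSeq σ C c ∧ BoundedSeq σ D (liouville Φ c) ∧
      creationInv c = b ∧ ∀ n₁ n₂, ∀ x ∈ Allowed σ (n₁ + n₂),
        creationInv (liouville Φ c) n₁ n₂ x = dualBbgky Φ b n₁ n₂ x := by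
  obtain ⟨c, hc, rfl⟩ := exists_creationInv_eq (σ := σ) hb.smooth
  have hd := fun n₁ n₂ x hx => (dualBbgky_creationInv (Φ := Φ) hc n₁ n₂ x hx).symm
  obtain ⟨B, hB0, hB, hbB⟩ := FiniteSeq.exists_bound hb.finite hb.bounded
  obtain ⟨B', hB0', hB', hbB'⟩ := FiniteSeq.exists_bound
    (FiniteSeq.dualBbgky (Φ := Φ) hb.finite) hb.dual_bounded
  exact ⟨c, ∑' n, B n, ∑' n, B' n, hc,
    ⟨tsum_nonneg hB0, fun n₁ n₂ => (hc n₁ n₂).continuousOn,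
      bound_of_creationInv (fun _ _ _ _ => rfl) hB0 hB hbB⟩,
    ⟨tsum_nonneg hB0', hc.continuousOn_liouville h, bound_of_creationInv hd hB0' hB' hbB'⟩,
    rfl, hd⟩

/-- With `b = creationInv c` the pairing `(b, F(t))` equals `(c, D(t))` for the transported `D`. Its
derivative is `(ℒ c, D(t))`, which is `(𝓑⁺ b, F(t))` by the intertwining relation. -/
theorem MemL1.isWeakSolution (h : IsPotential σ R Φ) (hα : 2 < α) {F₀ : DoubleSeq}
    (hF : MemL1 σ α F₀) :
    IsWeakSolution σ Φ α F₀ (TopologicalParticles.series σ Φ F₀) := by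
  have h1 : 1 < α := one_lt_two.trans hα
  have h0 : 0 < α := one_pos.trans h1
  refine ⟨fun t => (hF.series h hα t).1, hF.series_zero h h1, hF.tendsto_series h h1, ?_⟩
  intro b hb t
  obtain ⟨c, C, D, hs, hc, hL, rfl, hd⟩ := hb.exists_inverse h
  have hT := fun t => (hF.reduceInv h0).transport h t
  -- The same adjunction serves twice: for `c` and `b`, and for `ℒ c` and `𝓑⁺ b`, which agrees with
  -- `creationInv (ℒ c)` only on the allowed set.
  have key : ∀ {d : DoubleSeq} {E : ℝ}, BoundedSeq σ E d → ∀ {e : DoubleSeq},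
      (∀ n₁ n₂, ∀ x ∈ Allowed σ (n₁ + n₂), creationInv d n₁ n₂ x = e n₁ n₂ x) → ∀ t,
      pairing e (TopologicalParticles.series σ Φ F₀ t) =
        pairing d (TopologicalParticles.transport σ Φ t (TopologicalParticles.reduceInv F₀)) := by
    intro d E hd e he t
    have hE := (hT t).expand h1
    rw [pairing_congr (σ := σ) (fun n₁ n₂ x hx => (he n₁ n₂ x hx).symm)
      (hF.series h hα t).1.forbidden fun n₁ n₂ => hF.series_ae_eq h h1 t n₁ n₂,
      pairing_creationInv h1 hd hE]
    exact pairing_congr (σ := σ) (fun _ _ _ _ => rfl) (hE.reduceInv h0).forbidden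
      fun n₁ n₂ => (hT t).summableSeq.reduceInv_expand h1.le n₁ n₂
  rw [funext fun s => key hc (fun _ _ _ _ => rfl) s, key hL hd t]
  exact hasDerivAt_pairing_transport h h1.le hs hc hL (hF.reduceInv h0) t

end TopologicalParticles

/-! ### Uniqueness of weak solutions -/

namespace TopologicalParticles

open Set

variable {σ R α C : ℝ} {Φ : ℝ → ℝ}

/-! ### Sequences that agree almost everywhere -/

section Congr

variable {F G : DoubleSeq}

theorem reduce_congr (hFG : ∀ n₁ n₂, F n₁ n₂ =ᵐ[volume] G n₁ n₂) (k₁ k₂ n₁ n₂ : ℕ) :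
    reduce k₁ k₂ F n₁ n₂ =ᵐ[volume] reduce k₁ k₂ G n₁ n₂ := by
  have h1 := (measurePreserving_joinEquiv k₁ n₁ n₂ k₂).quasiMeasurePreserving.ae
    (hFG (k₁ + n₁) (n₂ + k₂))
  simp only [joinEquiv_apply] at h1
  filter_upwards [Measure.ae_ae_of_ae_prod h1] with x hx
  exact integral_congr_ae hx

theorem reduceInv_congr (hFG : ∀ n₁ n₂, F n₁ n₂ =ᵐ[volume] G n₁ n₂) (n₁ n₂ : ℕ) :
    reduceInv F n₁ n₂ =ᵐ[volume] reduceInv G n₁ n₂ := by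
  have h : ∀ᵐ x, ∀ l : ℕ × ℕ, reduce l.1 l.2 F n₁ n₂ x = reduce l.1 l.2 G n₁ n₂ x :=
    ae_all_iff.2 fun l => reduce_congr hFG _ _ _ _
  filter_upwards [h] with x hx
  simp only [reduceInv, hx]

theorem expand_congr (hFG : ∀ n₁ n₂, F n₁ n₂ =ᵐ[volume] G n₁ n₂) (n₁ n₂ : ℕ) :
    expand F n₁ n₂ =ᵐ[volume] expand G n₁ n₂ := by
  have h : ∀ᵐ x, ∀ l : ℕ × ℕ, reduce l.1 l.2 F n₁ n₂ x = reduce l.1 l.2 G n₁ n₂ x :=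
    ae_all_iff.2 fun l => reduce_congr hFG _ _ _ _
  filter_upwards [h] with x hx
  simp only [expand, hx]

theorem transport_congr (h : IsPotential σ R Φ) (hFG : ∀ n₁ n₂, F n₁ n₂ =ᵐ[volume] G n₁ n₂)
    (t : ℝ) (n₁ n₂ : ℕ) : transport σ Φ t F n₁ n₂ =ᵐ[volume] transport σ Φ t G n₁ n₂ :=
  (measurePreserving_flow h (n₁ + n₂) (-t)).quasiMeasurePreserving.ae (hFG n₁ n₂)

theorem SummableSeq.reduceInv_sub (hα : 1 ≤ α) (hF : SummableSeq α F) (hG : SummableSeq α G)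
    (n₁ n₂ : ℕ) : TopologicalParticles.reduceInv (F - G) n₁ n₂ =ᵐ[volume]
      TopologicalParticles.reduceInv F n₁ n₂ - TopologicalParticles.reduceInv G n₁ n₂ := by
  filter_upwards [hF.ae_summableAt hα n₁ n₂, hG.ae_summableAt hα n₁ n₂] with x hx hy
  rw [Pi.sub_apply, TopologicalParticles.reduceInv, TopologicalParticles.reduceInv,
    TopologicalParticles.reduceInv, ← Finset.sum_sub_distrib]
  refine Finset.sum_congr rfl fun l _ => ?_
  rw [← mul_sub]
  congr 1
  exact integral_sub (hx.integrable l) (hy.integrable l)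

end Congr

/-! ### Sequences with one component -/

section Single

variable {n₁ n₂ : ℕ} {g : Phase (n₁ + n₂) → ℝ}

/-- The sequence whose only component is `g`. -/
noncomputable def single (n₁ n₂ : ℕ) (g : Phase (n₁ + n₂) → ℝ) : DoubleSeq :=
  Pi.single n₁ (Pi.single n₂ g)

theorem single_same : single n₁ n₂ g n₁ n₂ = g := by
  rw [single, Pi.single_eq_same, Pi.single_eq_same]

theorem single_of_ne {m₁ m₂ : ℕ} (h : (m₁, m₂) ≠ (n₁, n₂)) : single n₁ n₂ g m₁ m₂ = 0 := by
  rw [single]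
  by_cases h1 : m₁ = n₁
  · subst h1
    rw [Pi.single_eq_same, Pi.single_eq_of_ne fun h2 => h (by rw [h2])]
  · rw [Pi.single_eq_of_ne h1]
    rfl

theorem single_induction {p : ∀ m₁ m₂ : ℕ, (Phase (m₁ + m₂) → ℝ) → Prop} (hg : p n₁ n₂ g)
    (h0 : ∀ m₁ m₂, p m₁ m₂ 0) (m₁ m₂ : ℕ) : p m₁ m₂ (single n₁ n₂ g m₁ m₂) := by
  by_cases h : (m₁, m₂) = (n₁, n₂)
  · obtain ⟨rfl, rfl⟩ := Prod.mk.inj h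
    rwa [single_same]
  · rw [single_of_ne h]
    exact h0 m₁ m₂

theorem finiteSeq_single : FiniteSeq (single n₁ n₂ g) :=
  (Set.finite_singleton (n₁, n₂)).subset fun _ hm => by
    by_contra h
    exact hm (single_of_ne h)

theorem pairing_single (F : DoubleSeq) :
    pairing (single n₁ n₂ g) F = ∫ x, g x * F n₁ n₂ x := by
  rw [pairing, tsum_eq_single (n₁, n₂)]
  · rw [single_same]
  · intro m hm
    rw [single_of_ne hm]
    simp

theorem smoothSeq_single (hg : ContDiffOn ℝ 1 g (Allowed σ (n₁ + n₂))) :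
    SmoothSeq σ (single n₁ n₂ g) :=
  single_induction (p := fun m₁ m₂ f => ContDiffOn ℝ 1 f (Allowed σ (m₁ + m₂))) hg
    fun _ _ => contDiffOn_const

theorem boundedSeq_single (hg : ContCompact σ g) : ∃ C, BoundedSeq σ C (single n₁ n₂ g) := by
  obtain ⟨C, hC0, hC⟩ := hg.exists_bound
  exact ⟨C, hC0, single_induction (p := fun m₁ m₂ f => ContinuousOn f (Allowed σ (m₁ + m₂)))
      hg.continuous.continuousOn fun _ _ => continuousOn_const,
    single_induction (p := fun m₁ m₂ f => ∀ x ∈ Allowed σ (m₁ + m₂), |f x| ≤ C)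
      (fun x _ => hC x) fun _ _ _ _ => by simpa using hC0⟩

theorem liouville_single : liouville Φ (single n₁ n₂ g) =
    single n₁ n₂ fun x => -liouvilleStar Φ g x := by
  funext m₁ m₂
  by_cases h : (m₁, m₂) = (n₁, n₂)
  · obtain ⟨rfl, rfl⟩ := Prod.mk.inj h
    funext x
    rw [liouville, single_same, single_same]
  · funext x
    rw [liouville, single_of_ne h, single_of_ne h]
    exact neg_eq_zero.2 (liouvilleStar_const 0 x)

end Single

/-! ### Uniqueness of weak solutions -/

theorem isTest_creationInv {c : DoubleSeq} {D : ℝ} (hs : SmoothSeq σ c) (hf : FiniteSeq c)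
    (hc : BoundedSeq σ C c) (hL : BoundedSeq σ D (liouville Φ c)) : IsTest σ Φ (creationInv c) where
  finite := hf.creationInv
  smooth := hs.creationInv
  bounded n₁ n₂ := ⟨_, ((hc.sub hc.creationRight).sub (hc.sub hc.creationRight).creationLeft).bound
    n₁ n₂⟩
  dual_bounded n₁ n₂ := ⟨_, fun x hx => by
    rw [dualBbgky_creationInv hs n₁ n₂ x hx]
    exact ((hL.sub hL.creationRight).sub (hL.sub hL.creationRight).creationLeft).bound n₁ n₂ x hx⟩

/-- These test sequences isolate one component of `reduceInv F`, and the dual right-hand side then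
contains only the Liouville operator. They are the tests that decouple the hierarchy. -/
theorem isTest_single (h : IsPotential σ R Φ) {n₁ n₂ : ℕ} {g : Phase (n₁ + n₂) → ℝ}
    (hg : SmoothCompact σ g) : IsTest σ Φ (creationInv (single n₁ n₂ g)) ∧
      ∀ {α : ℝ} {F : DoubleSeq}, 1 < α → MemL1 σ α F →
        pairing (creationInv (single n₁ n₂ g)) F = ∫ x, g x * reduceInv F n₁ n₂ x ∧
        pairing (dualBbgky Φ (creationInv (single n₁ n₂ g))) F =
          -∫ x, liouvilleStar Φ g x * reduceInv F n₁ n₂ x := by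
  obtain ⟨C, hC⟩ := boundedSeq_single hg.contCompact
  have hs := smoothSeq_single (σ := σ) hg.smooth.contDiffOn
  have hneg : ContCompact σ fun x => -liouvilleStar Φ g x := by
    have := (hg.liouvilleStar h).mul_left (w := fun _ => -1) continuousOn_const
    simpa only [neg_one_mul] using this
  obtain ⟨D, hD⟩ := boundedSeq_single hneg
  rw [← liouville_single] at hD
  refine ⟨isTest_creationInv hs finiteSeq_single hC hD, fun hα hF => ⟨?_, ?_⟩⟩
  · rw [pairing_creationInv hα hC hF, pairing_single]
  · rw [pairing_congr (σ := σ) (fun n₁ n₂ x hx => dualBbgky_creationInv hs n₁ n₂ x hx)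
      hF.forbidden (fun _ _ => ae_eq_refl _), pairing_creationInv hα hD hF,
      liouville_single, pairing_single, ← integral_neg]
    simp only [neg_mul]

theorem IsWeakSolution.hasDerivAt_integral (h : IsPotential σ R Φ) (hα : 1 < α) {F₀ : DoubleSeq}
    {G : ℝ → DoubleSeq} (hG : IsWeakSolution σ Φ α F₀ G) {n₁ n₂ : ℕ} {g : Phase (n₁ + n₂) → ℝ}
    (hg : SmoothCompact σ g) (t : ℝ) :
    HasDerivAt (fun s => ∫ x, g x * reduceInv (G s) n₁ n₂ x)
      (-∫ x, liouvilleStar Φ g x * reduceInv (G t) n₁ n₂ x) t := by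
  obtain ⟨hb, hp⟩ := isTest_single h hg
  rw [← (hp hα (hG.mem t)).2]
  simp only [fun s => (hp hα (hG.mem s)).1.symm]
  exact hG.weak _ hb t

theorem IsWeakSolution.tendsto_reduceInv (hα : 1 < α) {F₀ : DoubleSeq} {G : ℝ → DoubleSeq}
    (hG : IsWeakSolution σ Φ α F₀ G) (n₁ n₂ : ℕ) (t : ℝ) :
    Tendsto (fun s => ∫ x, |reduceInv (G s) n₁ n₂ x - reduceInv (G t) n₁ n₂ x|) (𝓝 t) (𝓝 0) := by
  have h0 : 0 < α := one_pos.trans hα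
  have hc := (hG.continuous t).const_mul ((1 + α⁻¹) ^ 2)
  rw [mul_zero] at hc
  refine squeeze_zero (fun s => integral_nonneg fun x => abs_nonneg _) (fun s => ?_) hc
  have hS := (((hG.mem s).summableSeq.sub h0.le (hG.mem t).summableSeq).1.reduceInv h0)
  refine le_trans ?_ hS.2
  refine le_trans ?_ (hS.1.integral_le_normL1 h0.le (n₁, n₂))
  refine le_trans (le_of_eq (integral_congr_ae ?_))
    (le_mul_of_one_le_left (integral_nonneg fun _ => abs_nonneg _) (one_le_pow₀ hα.le))
  filter_upwards [(hG.mem s).summableSeq.reduceInv_sub hα.le (hG.mem t).summableSeq n₁ n₂]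
    with x hx
  rw [hx]
  rfl

theorem SmoothCompact.abs_comp_flow_sub_le (h : IsPotential σ R Φ) {n : ℕ} {g : Phase n → ℝ}
    (hg : SmoothCompact σ g) : ∃ K, 0 ≤ K ∧ ∀ x s t,
      |g (flow σ Φ s x) - g (flow σ Φ t x)| ≤ K * |s - t| := by
  obtain ⟨K, hK0, hK⟩ := (hg.liouvilleStar h).exists_bound
  refine ⟨K, hK0, fun x s t => ?_⟩
  exact convex_univ.norm_image_sub_le_of_norm_hasDerivWithin_le
    (f := fun s => g (flow σ Φ s x))
    (fun s _ => (hg.hasDerivAt_comp_flow h x s).hasDerivWithinAt)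
    (fun s _ => (norm_neg _).trans_le (hK _)) (mem_univ t) (mem_univ s)

/-- A product rule: with the test function frozen the weak equation gives one derivative, with the
solution frozen the flow gives the opposite one. What remains is the integral of the product of both
increments. -/
theorem IsWeakSolution.integral_comp_flow_eq (h : IsPotential σ R Φ) (hα : 1 < α) {F₀ : DoubleSeq}
    {G : ℝ → DoubleSeq} (hG : IsWeakSolution σ Φ α F₀ G) {n₁ n₂ : ℕ} {g : Phase (n₁ + n₂) → ℝ}
    (hg : SmoothCompact σ g) (t : ℝ) :
    ∫ x, g (flow σ Φ (-t) x) * reduceInv (G t) n₁ n₂ x = ∫ x, g x * reduceInv (G 0) n₁ n₂ x := by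
  have h0 : 0 < α := one_pos.trans hα
  set D : ℝ → Phase (n₁ + n₂) → ℝ := fun s => reduceInv (G s) n₁ n₂ with hD
  have hDm : ∀ s, MemL1 σ α (reduceInv (G s)) := fun s => (hG.mem s).reduceInv h0
  have hDi : ∀ s, Integrable (D s) := fun s => (hDm s).integrable n₁ n₂
  have hD0 : ∀ s, ∀ x ∉ Allowed σ (n₁ + n₂), D s x = 0 := fun s => (hDm s).forbidden n₁ n₂
  obtain ⟨K, hK0, hK⟩ := hg.abs_comp_flow_sub_le h
  have hgi : ∀ s r, Integrable fun x => g (flow σ Φ s x) * D r x := fun s r => by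
    obtain ⟨B, -, hB⟩ := (hg.contCompact.comp_flow h s).exists_bound
    exact (integrable_mul_of_bound (hg.contCompact.comp_flow h s).continuous.continuousOn
      (fun x _ => hB x) (hDi r) (hD0 r)).1
  have key : ∀ r, HasDerivAt (fun s => ∫ x, g (flow σ Φ (-s) x) * D s x) 0 r := by
    intro r
    have h1 : HasDerivAt (fun s => ∫ x, g (flow σ Φ (-r) x) * D s x)
        (-∫ x, liouvilleStar Φ g (flow σ Φ (-r) x) * D r x) r := by
      simp only [← hg.liouvilleStar_comp_flow h]
      exact hG.hasDerivAt_integral h hα (hg.comp_flow h (-r)) r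
    have h2 : HasDerivAt (fun s => ∫ x, g (flow σ Φ (-s) x) * D r x)
        (∫ x, liouvilleStar Φ g (flow σ Φ (-r) x) * D r x) r := by
      obtain ⟨B, -, hB⟩ := hg.contCompact.exists_bound
      obtain ⟨B', -, hB'⟩ := (hg.liouvilleStar h).exists_bound
      have h3 := hasDerivAt_integral_mul_comp_flow h hg.smooth.contDiffOn (fun x _ => hB x)
        (hg.liouvilleStar h).continuous.continuousOn (fun x _ => hB' x) (hDi r) (hD0 r) (-r)
      have h4 := HasDerivAt.scomp r h3 (hasDerivAt_neg r)
      refine h4.congr_deriv ?_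
      rw [neg_one_smul, ← integral_neg]
      simp only [neg_mul, neg_neg]
    -- The mixed term is of smaller order than `s - r`: the transported test function is Lipschitz
    -- in time uniformly in `x`, and the solution is continuous in norm.
    have h3 : HasDerivAt (fun s => ∫ x, (g (flow σ Φ (-s) x) - g (flow σ Φ (-r) x)) *
        (D s x - D r x)) 0 r := by
      rw [hasDerivAt_iff_isLittleO]
      simp only [sub_self, mul_zero, integral_zero, sub_zero, smul_zero]
      have hb : ∀ s, ‖∫ x, (g (flow σ Φ (-s) x) - g (flow σ Φ (-r) x)) * (D s x - D r x)‖ ≤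
          ‖(K * ∫ x, |D s x - D r x|) * (s - r)‖ := by
        intro s
        have h5 : Integrable fun x => K * |s - r| * |D s x - D r x| :=
          (((hDi s).sub (hDi r)).abs).const_mul _
        refine (norm_integral_le_of_norm_le h5 (ae_of_all _ fun x => ?_)).trans ?_
        · rw [norm_mul, Real.norm_eq_abs, Real.norm_eq_abs]
          refine mul_le_mul_of_nonneg_right ((hK x (-s) (-r)).trans_eq ?_) (abs_nonneg _)
          rw [← abs_neg]
          congr 2
          ring
        · rw [integral_const_mul, norm_mul, Real.norm_eq_abs, Real.norm_eq_abs, abs_mul,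
            abs_of_nonneg hK0, abs_of_nonneg (integral_nonneg fun x => abs_nonneg _)]
          exact le_of_eq (by ring)
      refine Asymptotics.IsBigO.trans_isLittleO (Asymptotics.IsBigO.of_norm_le hb) ?_
      have h6 : (fun s => K * ∫ x, |D s x - D r x|) =o[𝓝 r] fun _ => (1 : ℝ) := by
        rw [Asymptotics.isLittleO_one_iff]
        simpa using (hG.tendsto_reduceInv hα n₁ n₂ r).const_mul K
      have h7 := h6.mul_isBigO (Asymptotics.isBigO_refl (fun s => s - r) (𝓝 r))
      simp only [one_mul] at h7
      exact h7.norm_left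
    have h4 := ((h1.add h2).add h3).sub_const (∫ x, g (flow σ Φ (-r) x) * D r x)
    refine (h4.congr_of_eventuallyEq (Eventually.of_forall fun s => ?_)).congr_deriv ?_
    · have e : ∫ x, (g (flow σ Φ (-s) x) - g (flow σ Φ (-r) x)) * (D s x - D r x) =
          ((∫ x, g (flow σ Φ (-s) x) * D s x) - ∫ x, g (flow σ Φ (-r) x) * D s x) -
          ((∫ x, g (flow σ Φ (-s) x) * D r x) - ∫ x, g (flow σ Φ (-r) x) * D r x) := by
        have hd : ∀ k, Integrable fun x => g (flow σ Φ (-s) x) * D k x - g (flow σ Φ (-r) x) * D k x :=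
          fun k => (hgi _ _).sub (hgi _ _)
        rw [← integral_sub (hgi _ _) (hgi _ _), ← integral_sub (hgi _ _) (hgi _ _),
          ← integral_sub (hd _) (hd _)]
        refine integral_congr_ae (ae_of_all _ fun x => ?_)
        ring
      simp only [Pi.add_apply, e]
      ring
    · ring
  have := is_const_of_deriv_eq_zero (fun r => (key r).differentiableAt) (fun r => (key r).deriv) t 0
  simpa only [neg_zero, flow_zero h] using this

/-- By measure preservation the conserved pairing says that `reduceInv (G t)` along the flow and
`reduceInv (G 0)` have the same integrals against all test functions in the allowed set; on
forbidden points both vanish. -/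
theorem IsWeakSolution.reduceInv_ae_eq (h : IsPotential σ R Φ) (hα : 1 < α) {F₀ : DoubleSeq}
    {G : ℝ → DoubleSeq} (hG : IsWeakSolution σ Φ α F₀ G) (t : ℝ) (n₁ n₂ : ℕ) :
    reduceInv (G t) n₁ n₂ =ᵐ[volume] transport σ Φ t (reduceInv (G 0)) n₁ n₂ := by
  have h0 : 0 < α := one_pos.trans hα
  have hDm : ∀ s, MemL1 σ α (reduceInv (G s)) := fun s => (hG.mem s).reduceInv h0
  have h1 : Integrable fun x => reduceInv (G t) n₁ n₂ (flow σ Φ t x) - reduceInv (G 0) n₁ n₂ x :=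
    (integrable_comp_flow h t ((hDm t).integrable n₁ n₂)).sub ((hDm 0).integrable n₁ n₂)
  have h2 := (isOpen_allowed σ (n₁ + n₂)).ae_eq_zero_of_integral_contDiff_smul_eq_zero
    (h1.locallyIntegrable.locallyIntegrableOn _) fun g hg hgc hgs => by
      have hgS : SmoothCompact σ g := ⟨hg.of_le (by exact_mod_cast le_top), hgc, hgs⟩
      obtain ⟨B, -, hB⟩ := hgS.contCompact.exists_bound
      have hi := fun {f : Phase (n₁ + n₂) → ℝ} hf hf0 => (integrable_mul_of_bound (f := f) (σ := σ)
        hg.continuous.continuousOn (fun x _ => hB x) hf hf0).1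
      simp only [smul_eq_mul, mul_sub]
      rw [integral_sub (hi (integrable_comp_flow h t ((hDm t).integrable n₁ n₂)) fun x hx => by
        exact (hDm t).forbidden _ _ _ (by rwa [flow_mem_iff h]))
        (hi ((hDm 0).integrable n₁ n₂) ((hDm 0).forbidden n₁ n₂)),
        ← hG.integral_comp_flow_eq h hα hgS t,
        ← integral_comp_flow h t fun x => g (flow σ Φ (-t) x) * reduceInv (G t) n₁ n₂ x]
      simp only [flow_neg_flow h, sub_self]
  have h3 : ∀ᵐ x, reduceInv (G t) n₁ n₂ (flow σ Φ t x) = reduceInv (G 0) n₁ n₂ x := by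
    filter_upwards [h2] with x hx
    by_cases hx' : x ∈ Allowed σ (n₁ + n₂)
    · exact sub_eq_zero.1 (hx hx')
    · rw [(hDm 0).forbidden _ _ x hx', (hDm t).forbidden _ _ _ (by rwa [flow_mem_iff h])]
  filter_upwards [(measurePreserving_flow h (n₁ + n₂) (-t)).quasiMeasurePreserving.ae h3] with x hx
  rw [flow_flow_neg h] at hx
  exact hx

/-- A weak solution is recovered from `reduceInv` by `expand`, and its transported `reduceInv` is
determined by the initial data. -/
theorem IsWeakSolution.ae_eq_series (h : IsPotential σ R Φ) (hα : 1 < α) {F₀ : DoubleSeq}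
    {G : ℝ → DoubleSeq} (hF : MemL1 σ α F₀) (hG : IsWeakSolution σ Φ α F₀ G) (t : ℝ) (n₁ n₂ : ℕ) :
    G t n₁ n₂ =ᵐ[volume] series σ Φ F₀ t n₁ n₂ := by
  have h1 := fun m₁ m₂ => (hG.reduceInv_ae_eq h hα t m₁ m₂).trans
    (transport_congr h (reduceInv_congr hG.initial) t m₁ m₂)
  exact ((hG.mem t).summableSeq.expand_reduceInv hα.le n₁ n₂).symm.trans
    ((expand_congr h1 n₁ n₂).trans (hF.series_ae_eq h hα t n₁ n₂).symm)

end TopologicalParticles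

/-! ### Regularity of integrals over the outer particles -/

namespace TopologicalParticles

open Set

variable {σ R α : ℝ} {Φ : ℝ → ℝ} {n : ℕ}

/-! ### Linear combinations of functions with compact support -/

section Closure

variable {f g : Phase n → ℝ}

theorem ContCompact.of_compact {K : Set (Phase n)} (hf : Continuous f) (hK : IsCompact K)
    (hKA : K ⊆ Allowed σ n) (hfK : ∀ x ∉ K, f x = 0) : ContCompact σ f := by
  have h1 : tsupport f ⊆ K := closure_minimal (fun x hx => by
    by_contra h
    exact hx (hfK x h)) hK.isClosed
  exact ⟨hf, hK.of_isClosed_subset (isClosed_tsupport f) h1, h1.trans hKA⟩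

theorem ContCompact.zero : ContCompact σ (0 : Phase n → ℝ) :=
  .of_compact continuous_const isCompact_empty (empty_subset _) fun _ _ => rfl

theorem ContCompact.add (hf : ContCompact σ f) (hg : ContCompact σ g) :
    ContCompact σ fun x => f x + g x :=
  .of_compact (hf.continuous.add hg.continuous) (hf.compact.isCompact.union hg.compact.isCompact)
    (union_subset hf.support hg.support) fun x hx => by
      rw [mem_union, not_or] at hx
      rw [image_eq_zero_of_notMem_tsupport hx.1, image_eq_zero_of_notMem_tsupport hx.2, add_zero]

theorem ContCompact.const_mul (hf : ContCompact σ f) (c : ℝ) : ContCompact σ fun x => c * f x :=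
  hf.mul_left continuousOn_const

theorem ContCompact.sum {ι : Type*} (I : Finset ι) {F : ι → Phase n → ℝ}
    (hF : ∀ i, ContCompact σ (F i)) : ContCompact σ fun x => ∑ i ∈ I, F i x := by
  classical
  induction I using Finset.induction_on with
  | empty => exact .zero
  | insert i I hi ih =>
    simp only [Finset.sum_insert hi]
    exact (hF i).add ih

theorem SmoothCompact.of_contCompact (hs : ContDiff ℝ 1 f) (hf : ContCompact σ f) :
    SmoothCompact σ f := ⟨hs, hf.compact, hf.support⟩

theorem SmoothCompact.const_mul (hf : SmoothCompact σ f) (c : ℝ) :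
    SmoothCompact σ fun x => c * f x :=
  .of_contCompact (contDiff_const.mul hf.smooth) (hf.contCompact.const_mul c)

theorem SmoothCompact.sum {ι : Type*} (I : Finset ι) {F : ι → Phase n → ℝ}
    (hF : ∀ i, SmoothCompact σ (F i)) : SmoothCompact σ fun x => ∑ i ∈ I, F i x :=
  .of_contCompact (ContDiff.sum fun i _ => (hF i).smooth) (.sum I fun i => (hF i).contCompact)

end Closure

/-! ### Integration over the outer particles -/

section JoinIntegral

variable {n₁ s₁ s₂ n₂ : ℕ} {f : Phase ((n₁ + s₁) + (s₂ + n₂)) → ℝ}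

theorem exists_compact_outer {C : Set (Phase ((n₁ + s₁) + (s₂ + n₂)))} (hC : IsCompact C) :
    ∃ K : Set (Phase n₁ × Phase n₂), IsCompact K ∧
      ∀ (w : Phase n₁ × Phase n₂) (x : Phase (s₁ + s₂)), join w.1 x w.2 ∈ C → w ∈ K := by
  let o : Phase ((n₁ + s₁) + (s₂ + n₂)) → Phase n₁ × Phase n₂ := fun y =>
    (fun i => y ⟨i, by omega⟩, fun i => y ⟨n₁ + (s₁ + s₂) + i, by omega⟩)
  have ho : Continuous o := by fun_prop
  refine ⟨o '' C, hC.image ho, fun w x hw => ⟨_, hw, ?_⟩⟩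
  refine Prod.ext (funext fun i => ?_) (funext fun i => ?_)
  · simp only [o, join_apply]
    rw [dif_pos i.2]
  · simp only [o, join_apply]
    rw [dif_neg (by omega), dif_neg (by omega)]
    refine congrArg w.2 (Fin.ext ?_)
    simp only
    omega

theorem contDiff_join : ContDiff ℝ 1 fun p : Phase (s₁ + s₂) × (Phase n₁ × Phase n₂) =>
    (join p.2.1 p.1 p.2.2 : Phase ((n₁ + s₁) + (s₂ + n₂))) := by
  refine contDiff_pi.2 fun i => ?_
  simp only [join_apply]
  split_ifs <;> fun_prop

theorem ContCompact.integrable_join (hf : ContCompact σ f) (x : Phase (s₁ + s₂)) :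
    Integrable fun w : Phase n₁ × Phase n₂ => f (join w.1 x w.2) := by
  obtain ⟨K, hK, hKf⟩ := exists_compact_outer (s₁ := s₁) (s₂ := s₂) hf.compact.isCompact
  have hc : Continuous fun w : Phase n₁ × Phase n₂ =>
      (join w.1 x w.2 : Phase ((n₁ + s₁) + (s₂ + n₂))) :=
    continuous_join.comp (Continuous.prodMk_right x)
  refine (hf.continuous.comp hc).integrable_of_hasCompactSupport
    (HasCompactSupport.intro hK fun w hw => ?_)
  exact image_eq_zero_of_notMem_tsupport (f := f) fun h => hw (hKf w x h)

theorem ContCompact.integral_join (hf : ContCompact σ f) : ContCompact σ fun x : Phase (s₁ + s₂) =>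
    ∫ w : Phase n₁ × Phase n₂, f (join w.1 x w.2) := by
  obtain ⟨K, hK, hKf⟩ := exists_compact_outer (s₁ := s₁) (s₂ := s₂) hf.compact.isCompact
  let c : Phase ((n₁ + s₁) + (s₂ + n₂)) → Phase (s₁ + s₂) := fun y i => y ⟨n₁ + i, by omega⟩
  have hc : Continuous c := by fun_prop
  have hcj : ∀ (w : Phase n₁ × Phase n₂) x, c (join w.1 x w.2) = x := fun w x =>
    funext fun i => join_apply_mid _ _ _ rfl
  refine .of_compact (K := c '' tsupport f) ?_ (hf.compact.isCompact.image hc) ?_ fun x hx => ?_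
  · rw [← continuousOn_univ]
    refine continuousOn_integral_of_compact_support hK
      (hf.continuous.comp continuous_join).continuousOn fun x w _ hw => ?_
    exact image_eq_zero_of_notMem_tsupport fun h => hw (hKf w x h)
  · rintro _ ⟨y, hy, rfl⟩ i j hij
    exact hf.support hy ⟨n₁ + i, by omega⟩ ⟨n₁ + j, by omega⟩ (by simp only; omega)
  · have : ∀ w : Phase n₁ × Phase n₂, f (join w.1 x w.2) = 0 := fun w =>
      image_eq_zero_of_notMem_tsupport fun h => hx ⟨_, h, hcj w x⟩
    simp only [this, integral_zero]

/-- For all `x` the integrand is supported in one compact set of outer particles, so smoothness in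
the parameter passes through the integral. -/
theorem SmoothCompact.integral_join (hf : SmoothCompact σ f) :
    SmoothCompact σ fun x : Phase (s₁ + s₂) =>
      ∫ w : Phase n₁ × Phase n₂, f (join w.1 x w.2) := by
  refine .of_contCompact ?_ hf.contCompact.integral_join
  obtain ⟨K, hK, hKf⟩ := exists_compact_outer (s₁ := s₁) (s₂ := s₂) hf.compact.isCompact
  -- The parametric integral is written as a convolution with the constant `1`, evaluated at `0`;
  -- the sign in `-w` undoes the reflection in the convolution.
  have h1 := contDiffOn_convolution_right_with_param (n := 1)
    (μ := (volume : Measure (Phase n₁ × Phase n₂))) (f := fun _ => (1 : ℝ))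
    (ContinuousLinearMap.mul ℝ ℝ)
    (g := fun (x : Phase (s₁ + s₂)) w => f (join (-w).1 x (-w).2)) isOpen_univ hK.neg
    (fun x w _ hw => image_eq_zero_of_notMem_tsupport fun h => hw (hKf (-w) x h))
    (locallyIntegrable_const 1)
    (ContDiff.contDiffOn (hf.smooth.comp (contDiff_join.comp
      (contDiff_fst.prodMk contDiff_snd.neg))))
  rw [univ_prod_univ, contDiffOn_univ] at h1
  have h2 := h1.comp (contDiff_id.prodMk (contDiff_const (c := (0 : Phase n₁ × Phase n₂))))
  convert! h2 using 1
  funext x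
  simp [convolution]

theorem hasDerivAt_integral_comp_flow_join (h : IsPotential σ R Φ) (hf : SmoothCompact σ f)
    (x : Phase (s₁ + s₂)) (t : ℝ) :
    HasDerivAt (fun s => ∫ w : Phase n₁ × Phase n₂, f (flow σ Φ (-s) (join w.1 x w.2)))
      (∫ w : Phase n₁ × Phase n₂, liouvilleStar Φ f (flow σ Φ (-t) (join w.1 x w.2))) t := by
  have hL := hf.liouvilleStar h
  obtain ⟨B, hB0, hB⟩ := hL.exists_bound
  obtain ⟨C, hC, hfC⟩ := hL.exists_compact_flow h (|t| + 1)
  obtain ⟨K, hK, hKC⟩ := exists_compact_outer (s₁ := s₁) (s₂ := s₂) hC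
  refine (hasDerivAt_integral_of_dominated_loc_of_deriv_le
    (μ := (volume : Measure (Phase n₁ × Phase n₂)))
    (F := fun s w => f (flow σ Φ (-s) (join w.1 x w.2)))
    (F' := fun s w => liouvilleStar Φ f (flow σ Φ (-s) (join w.1 x w.2)))
    (bound := K.indicator fun _ => B) (Metric.ball_mem_nhds t one_pos)
    (Eventually.of_forall fun s =>
      ((hf.contCompact.comp_flow h (-s)).integrable_join x).aestronglyMeasurable)
    ((hf.contCompact.comp_flow h (-t)).integrable_join x)
    ((hL.comp_flow h (-t)).integrable_join x).aestronglyMeasurable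
    (ae_of_all _ fun w s hs => ?_) ?_ (ae_of_all _ fun w s _ => ?_)).2
  · by_cases hw : w ∈ K
    · rw [indicator_of_mem hw]
      exact hB _
    · rw [indicator_of_notMem hw, hfC (-s) ?_ _ fun h' => hw (hKC w x h'), norm_zero]
      rw [Metric.mem_ball, Real.dist_eq] at hs
      rw [mem_Icc, ← abs_le, abs_neg]
      have := abs_add_le t (s - t)
      rw [add_sub_cancel] at this
      linarith
  · rw [integrable_indicator_iff hK.measurableSet]
    exact integrableOn_const hK.measure_lt_top.ne
  · have h1 := HasDerivAt.scomp s (hf.hasDerivAt_comp_flow h (join w.1 x w.2) (-s)) (hasDerivAt_neg s)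
    exact h1.congr_deriv (by rw [neg_one_smul, neg_neg])

/-- Dominated convergence: by the mean value inequality the difference quotient is bounded by the
same function `g` that dominates the derivative, hence `2 * g`. -/
theorem tendsto_integral_slope_comp_flow (h : IsPotential σ R Φ) {f : Phase n → ℝ}
    (hf : SmoothCompact σ f) (t : ℝ) :
    Tendsto (fun s => ∫ x, |s⁻¹ * (f (flow σ Φ (-(t + s)) x) - f (flow σ Φ (-t) x)) -
      liouvilleStar Φ f (flow σ Φ (-t) x)|) (𝓝[≠] 0) (𝓝 0) := by
  have hL := hf.liouvilleStar h
  obtain ⟨g, hg, hgb⟩ := hL.exists_dominating h (|t| + 1)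
  have hd : ∀ x s, HasDerivAt (fun s => f (flow σ Φ (-s) x))
      (liouvilleStar Φ f (flow σ Φ (-s) x)) s := fun x s =>
    (HasDerivAt.scomp s (hf.hasDerivAt_comp_flow h x (-s)) (hasDerivAt_neg s)).congr_deriv
      (by rw [neg_one_smul, neg_neg])
  have hI : ∀ s ∈ Icc (-(|t| + 1)) (|t| + 1), ∀ x, |liouvilleStar Φ f (flow σ Φ (-s) x)| ≤ g x :=
    fun s hs x => hgb _ ⟨by linarith [hs.2], by linarith [hs.1]⟩ x
  have ht : t ∈ Icc (-(|t| + 1)) (|t| + 1) :=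
    ⟨by linarith [neg_abs_le t], by linarith [le_abs_self t]⟩
  have key := tendsto_integral_filter_of_dominated_convergence (μ := (volume : Measure (Phase n)))
    (l := 𝓝[≠] (0 : ℝ)) (f := fun _ => (0 : ℝ))
    (F := fun s x => |s⁻¹ * (f (flow σ Φ (-(t + s)) x) - f (flow σ Φ (-t) x)) -
      liouvilleStar Φ f (flow σ Φ (-t) x)|) (fun x => 2 * g x)
    (Eventually.of_forall fun s => ?_) ?_ (hg.const_mul 2) (ae_of_all _ fun x => ?_)
  · simpa only [integral_zero] using key
  · have h1 := (hf.contCompact.comp_flow h (-(t + s))).continuous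
    have h2 := (hf.contCompact.comp_flow h (-t)).continuous
    have h3 := (hL.comp_flow h (-t)).continuous
    exact (((h1.sub h2).const_mul _).sub h3).abs.aestronglyMeasurable
  · have hball : Metric.ball (0 : ℝ) 1 ∈ 𝓝[≠] (0 : ℝ) :=
      mem_nhdsWithin_of_mem_nhds (Metric.ball_mem_nhds 0 one_pos)
    filter_upwards [hball, self_mem_nhdsWithin] with s hs hs0
    refine ae_of_all _ fun x => ?_
    rw [Metric.mem_ball, dist_zero_right, Real.norm_eq_abs] at hs
    have hts : t + s ∈ Icc (-(|t| + 1)) (|t| + 1) := by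
      rw [mem_Icc, ← abs_le]
      exact (abs_add_le t s).trans (by linarith)
    have h1 : |f (flow σ Φ (-(t + s)) x) - f (flow σ Φ (-t) x)| ≤ g x * |t + s - t| :=
      (convex_Icc _ _).norm_image_sub_le_of_norm_hasDerivWithin_le
        (f := fun s => f (flow σ Φ (-s) x)) (fun r _ => (hd x r).hasDerivWithinAt)
        (fun r hr => hI r hr x) ht hts
    rw [add_sub_cancel_left] at h1
    rw [Real.norm_eq_abs, abs_abs, two_mul]
    refine (abs_sub _ _).trans (add_le_add ?_ (hI t ht x))
    rw [abs_mul, abs_inv, inv_mul_le_iff₀ (abs_pos.2 hs0), mul_comm]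
    exact h1
  · have h1 := (hasDerivAt_iff_tendsto_slope_zero.1 (hd x t)).sub_const
      (liouvilleStar Φ f (flow σ Φ (-t) x))
    rw [sub_self] at h1
    simpa using h1.abs

/-- For compactly supported data integrability holds for every `x`, as pointwise solutions require.
After the substitution `e` only the block of the cluster moves, and it carries the support to a
compact set. -/
theorem ContCompact.integrable_prodGroupOp (h : IsPotential σ R Φ) (hf : ContCompact σ f)
    (hs : 1 ≤ s₁ + s₂) {P : Composition ((n₁ + s₁) + (s₂ + n₂))}
    (hP : P ∈ clusterPartitions n₁ s₁ s₂ n₂) (t : ℝ) (x : Phase (s₁ + s₂)) :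
    Integrable fun w : Phase n₁ × Phase n₂ => prodGroupOp σ Φ P t f (join w.1 x w.2) := by
  obtain ⟨e, h1, h2, h3⟩ := exists_blocksMap_cluster (σ := σ) h hs hP (-t)
  rw [prodGroupOp_eq h P t fun x hx => hf.eq_zero hx]
  simp only [h3]
  set i := clusterIndex hs P
  refine (h1.integrable_comp_emb h2 (g := fun w => f
    (blockMap σ Φ (P.embedding i) (-t) (join w.1 x w.2)))).2 ?_
  have hcont : ContinuousOn (blockMap σ Φ (P.embedding i) t) (tsupport f) := by
    refine continuousOn_pi.2 fun j => ?_
    by_cases hj : j ∈ range (P.embedding i)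
    · obtain ⟨k, rfl⟩ := hj
      simp only [blockMap_apply]
      refine (continuous_apply k).comp_continuousOn ((continuousOn_flow_time h t).comp
        (Continuous.continuousOn (by fun_prop)) fun y hy => ?_)
      exact allowed_comp _ _ (fun k => P.coe_embedding i k) (hf.support hy)
    · simp only [blockMap_of_notMem hj]
      exact (continuous_apply j).continuousOn
  obtain ⟨K, hK, hKC⟩ := exists_compact_outer (s₁ := s₁) (s₂ := s₂)
    (hf.compact.isCompact.image_of_continuousOn hcont)
  obtain ⟨B, hB0, hB⟩ := hf.exists_bound
  have hm : Measurable fun w : Phase n₁ × Phase n₂ =>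
      f (blockMap σ Φ (P.embedding i) (-t) (join w.1 x w.2)) :=
    hf.continuous.measurable.comp ((measurePreserving_blockMap h _ _).measurable.comp
      (continuous_join.comp (Continuous.prodMk_right x)).measurable)
  have hi : Integrable (K.indicator fun _ : Phase n₁ × Phase n₂ => B) := by
    rw [integrable_indicator_iff hK.measurableSet]
    exact integrableOn_const hK.measure_lt_top.ne
  refine hi.mono' hm.aestronglyMeasurable (ae_of_all _ fun w => ?_)
  by_cases hw : w ∈ K
  · rw [indicator_of_mem hw]
    exact hB _
  · rw [indicator_of_notMem hw]
    refine (norm_eq_zero.2 (image_eq_zero_of_notMem_tsupport fun hy => hw (hKC w x ⟨_, hy, ?_⟩))).le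
    have := blockMap_neg_blockMap h (P.embedding i) (-t) (join w.1 x w.2)
    rwa [neg_neg] at this

end JoinIntegral

end TopologicalParticles

/-! ### Finite smooth data: all identities hold pointwise -/

namespace TopologicalParticles

open Set

variable {σ R α : ℝ} {Φ : ℝ → ℝ} {N : ℕ} {F : DoubleSeq}

/-! ### Finite sequences of functions with compact supports -/

/-- Sequences of continuous functions with compact supports in the allowed phase space, with
components only for less than `N` particles on each side. -/
structure FinCont (σ : ℝ) (N : ℕ) (F : DoubleSeq) : Prop where
  vanish : ∀ n₁ n₂, N ≤ n₁ ∨ N ≤ n₂ → F n₁ n₂ = 0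
  cont : ∀ n₁ n₂, ContCompact σ (F n₁ n₂)

/-- Sequences of continuously differentiable functions with compact supports in the allowed phase
space, with components only for less than `N` particles on each side. -/
structure FinSmooth (σ : ℝ) (N : ℕ) (F : DoubleSeq) : Prop where
  vanish : ∀ n₁ n₂, N ≤ n₁ ∨ N ≤ n₂ → F n₁ n₂ = 0
  smooth : ∀ n₁ n₂, SmoothCompact σ (F n₁ n₂)

theorem FinSmooth.finCont (hF : FinSmooth σ N F) : FinCont σ N F :=
  ⟨hF.vanish, fun n₁ n₂ => (hF.smooth n₁ n₂).contCompact⟩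

/-- Finiteness is replaced by a bound `N` on both indices, a condition that `reduce`, `expand` and
`transport` preserve with the same `N`. -/
theorem FiniteSmooth.exists_finSmooth (hF : FiniteSmooth σ F) : ∃ N, FinSmooth σ N F := by
  obtain ⟨a, ha⟩ := (hF.finite.image fun n => n.1 + n.2).bddAbove
  refine ⟨a + 1, fun n₁ n₂ hn => ?_, fun n₁ n₂ => ⟨hF.smooth _ _, hF.compact _ _, hF.support _ _⟩⟩
  by_contra hne
  have := ha ⟨(n₁, n₂), hne, rfl⟩
  simp only at this
  omega

theorem FinSmooth.finiteSmooth (hF : FinSmooth σ N F) : FiniteSmooth σ F where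
  finite := ((Finset.range N ×ˢ Finset.range N).finite_toSet).subset fun n hn => by
    by_contra h
    refine hn (hF.vanish _ _ ?_)
    simp only [Finset.coe_product, Finset.coe_range, mem_prod, mem_Iio] at h
    omega
  smooth n₁ n₂ := (hF.smooth n₁ n₂).smooth
  compact n₁ n₂ := (hF.smooth n₁ n₂).compact
  support n₁ n₂ := (hF.smooth n₁ n₂).support

theorem FinCont.eq_zero (hF : FinCont σ N F) {n : ℕ × ℕ}
    (hn : n ∉ Finset.range N ×ˢ Finset.range N) : F n.1 n.2 = 0 := by
  refine hF.vanish _ _ ?_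
  simp only [Finset.mem_product, Finset.mem_range] at hn
  omega

theorem FinCont.compNorm_eq_zero (hF : FinCont σ N F) {n : ℕ × ℕ}
    (hn : n ∉ Finset.range N ×ˢ Finset.range N) : compNorm α F n = 0 := by
  rw [compNorm, hF.eq_zero hn]
  simp

theorem FinCont.normL1_eq (hF : FinCont σ N F) :
    normL1 α F = ∑ n ∈ Finset.range N ×ˢ Finset.range N, compNorm α F n :=
  tsum_eq_sum fun _ hn => hF.compNorm_eq_zero hn

theorem FinCont.memL1 (hF : FinCont σ N F) : MemL1 σ α F where
  integrable n₁ n₂ := (hF.cont n₁ n₂).integrable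
  forbidden n₁ n₂ _ hx := (hF.cont n₁ n₂).eq_zero hx
  summable := summable_of_ne_finset_zero (s := Finset.range N ×ˢ Finset.range N)
    fun _ hn => hF.compNorm_eq_zero hn

theorem FinCont.add {G : DoubleSeq} (hF : FinCont σ N F) (hG : FinCont σ N G) :
    FinCont σ N (F + G) where
  vanish n₁ n₂ hn := by
    rw [Pi.add_apply, Pi.add_apply, hF.vanish n₁ n₂ hn, hG.vanish n₁ n₂ hn, add_zero]
  cont n₁ n₂ := (hF.cont n₁ n₂).add (hG.cont n₁ n₂)

theorem FinCont.smul (hF : FinCont σ N F) (c : ℝ) : FinCont σ N (c • F) where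
  vanish n₁ n₂ hn := by rw [Pi.smul_apply, Pi.smul_apply, hF.vanish n₁ n₂ hn, smul_zero]
  cont n₁ n₂ := (hF.cont n₁ n₂).const_mul c

theorem FinCont.sub {G : DoubleSeq} (hF : FinCont σ N F) (hG : FinCont σ N G) :
    FinCont σ N (F - G) := by
  have := hF.add (hG.smul (-1))
  rwa [neg_one_smul, ← sub_eq_add_neg] at this

theorem reduce_vanish (hF : ∀ n₁ n₂, N ≤ n₁ ∨ N ≤ n₂ → F n₁ n₂ = 0) (k₁ k₂ n₁ n₂ : ℕ)
    (hn : N ≤ k₁ + n₁ ∨ N ≤ n₂ + k₂) : reduce k₁ k₂ F n₁ n₂ = 0 := by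
  funext x
  rw [reduce, hF _ _ hn]
  simp

theorem FinCont.reduce (hF : FinCont σ N F) (k₁ k₂ : ℕ) : FinCont σ N (reduce k₁ k₂ F) :=
  ⟨fun n₁ n₂ hn => reduce_vanish hF.vanish k₁ k₂ n₁ n₂ (by omega),
    fun n₁ n₂ => (hF.cont (k₁ + n₁) (n₂ + k₂)).integral_join⟩

theorem FinSmooth.reduce (hF : FinSmooth σ N F) (k₁ k₂ : ℕ) : FinSmooth σ N (reduce k₁ k₂ F) :=
  ⟨fun n₁ n₂ hn => reduce_vanish hF.vanish k₁ k₂ n₁ n₂ (by omega),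
    fun n₁ n₂ => (hF.smooth (k₁ + n₁) (n₂ + k₂)).integral_join⟩

theorem FinSmooth.reduceInv (hF : FinSmooth σ N F) : FinSmooth σ N (reduceInv F) where
  vanish n₁ n₂ hn := by
    funext x
    refine Finset.sum_eq_zero fun l _ => ?_
    rw [(hF.reduce l.1 l.2).vanish n₁ n₂ hn, Pi.zero_apply, mul_zero]
  smooth n₁ n₂ := .sum _ fun l => ((hF.reduce l.1 l.2).smooth n₁ n₂).const_mul _

theorem expand_eq_sum (hF : ∀ n₁ n₂, N ≤ n₁ ∨ N ≤ n₂ → F n₁ n₂ = 0) (n₁ n₂ : ℕ)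
    (x : Phase (n₁ + n₂)) : expand F n₁ n₂ x =
      ∑ k ∈ Finset.range N ×ˢ Finset.range N, TopologicalParticles.reduce k.1 k.2 F n₁ n₂ x := by
  refine tsum_eq_sum fun k hk => ?_
  simp only [Finset.mem_product, Finset.mem_range] at hk
  rw [reduce_vanish hF k.1 k.2 n₁ n₂ (by omega), Pi.zero_apply]

theorem FinCont.expand (hF : FinCont σ N F) : FinCont σ N (expand F) where
  vanish n₁ n₂ hn := by
    funext x
    rw [expand_eq_sum hF.vanish]
    refine Finset.sum_eq_zero fun k _ => ?_
    rw [(hF.reduce k.1 k.2).vanish n₁ n₂ hn, Pi.zero_apply]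
  cont n₁ n₂ := by
    rw [funext (expand_eq_sum hF.vanish n₁ n₂)]
    exact .sum _ fun k => (hF.reduce k.1 k.2).cont n₁ n₂

theorem FinSmooth.expand (hF : FinSmooth σ N F) : FinSmooth σ N (expand F) where
  vanish := hF.finCont.expand.vanish
  smooth n₁ n₂ := by
    rw [funext (expand_eq_sum hF.vanish n₁ n₂)]
    exact .sum _ fun k => (hF.reduce k.1 k.2).smooth n₁ n₂

theorem transport_vanish (hF : ∀ n₁ n₂, N ≤ n₁ ∨ N ≤ n₂ → F n₁ n₂ = 0) (t : ℝ) (n₁ n₂ : ℕ)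
    (hn : N ≤ n₁ ∨ N ≤ n₂) : transport σ Φ t F n₁ n₂ = 0 := by
  funext x
  rw [transport, hF n₁ n₂ hn]
  rfl

theorem FinCont.transport (h : IsPotential σ R Φ) (hF : FinCont σ N F) (t : ℝ) :
    FinCont σ N (transport σ Φ t F) :=
  ⟨transport_vanish hF.vanish t, fun n₁ n₂ => (hF.cont n₁ n₂).comp_flow h (-t)⟩

theorem FinSmooth.transport (h : IsPotential σ R Φ) (hF : FinSmooth σ N F) (t : ℝ) :
    FinSmooth σ N (transport σ Φ t F) :=
  ⟨transport_vanish hF.vanish t, fun n₁ n₂ => (hF.smooth n₁ n₂).comp_flow h (-t)⟩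

theorem FinCont.summableAt (hF : FinCont σ N F) {s₁ s₂ : ℕ} (x : Phase (s₁ + s₂)) :
    SummableAt F x where
  integrable k := (hF.cont (k.1 + s₁) (s₂ + k.2)).integrable_join x
  summable := by
    refine summable_of_ne_finset_zero (s := Finset.range N ×ˢ Finset.range N) fun k hk => ?_
    simp only [Finset.mem_product, Finset.mem_range] at hk
    rw [hF.vanish (k.1 + s₁) (s₂ + k.2) (by omega)]
    simp

/-- The direct sum of the Liouville operators. -/
noncomputable def liouvilleSeq (Φ : ℝ → ℝ) (F : DoubleSeq) : DoubleSeq := fun n₁ n₂ =>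
  liouvilleStar Φ (F n₁ n₂)

theorem FinSmooth.liouvilleSeq (h : IsPotential σ R Φ) (hF : FinSmooth σ N F) :
    FinCont σ N (liouvilleSeq Φ F) where
  vanish n₁ n₂ hn := by
    funext x
    rw [TopologicalParticles.liouvilleSeq, hF.vanish n₁ n₂ hn]
    exact liouvilleStar_const 0 x
  cont n₁ n₂ := (hF.smooth n₁ n₂).liouvilleStar h

theorem FinSmooth.liouvilleSeq_transport (h : IsPotential σ R Φ) (hF : FinSmooth σ N F) (t : ℝ) :
    TopologicalParticles.liouvilleSeq Φ (TopologicalParticles.transport σ Φ t F) =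
      TopologicalParticles.transport σ Φ t (TopologicalParticles.liouvilleSeq Φ F) :=
  funext fun n₁ => funext fun n₂ => funext fun x =>
    (hF.smooth n₁ n₂).liouvilleStar_comp_flow h (-t) x

/-- Continuous functions that agree almost everywhere agree. This turns the almost-everywhere
identities for `expand` and `reduceInv` into exact ones. -/
theorem FinCont.eq_of_ae {G : DoubleSeq} {M : ℕ} (hF : FinCont σ N F) (hG : FinCont σ M G)
    (hFG : ∀ n₁ n₂, F n₁ n₂ =ᵐ[volume] G n₁ n₂) : F = G :=
  funext fun n₁ => funext fun n₂ =>
    ((hF.cont n₁ n₂).continuous.ae_eq_iff_eq volume (hG.cont n₁ n₂).continuous).1 (hFG n₁ n₂)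

/-! ### The series for smooth initial data -/

theorem FinSmooth.series_eq (h : IsPotential σ R Φ) (hF : FinSmooth σ N F) (t : ℝ) :
    series σ Φ F t = TopologicalParticles.expand (TopologicalParticles.transport σ Φ t
      (TopologicalParticles.reduceInv F)) := by
  have hE := ((hF.reduceInv.transport h t).expand).finCont
  funext s₁ s₂
  by_cases hs : 1 ≤ s₁ + s₂
  · funext x
    exact series_eq_expand h (hF.finCont.memL1 (α := 1)).forbidden t hs
      (fun n₁ n₂ P hP => (hF.finCont.cont (n₁ + s₁) (s₂ + n₂)).integrable_prodGroupOp h hs hP t x)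
      fun l => ((hF.reduce l.1 l.2).transport h t).finCont.summableAt x
  · have h1 : MemL1 σ 2 F := hF.finCont.memL1
    refine (Continuous.ae_eq_iff_eq volume ?_ (hE.cont s₁ s₂).continuous).1
      (h1.series_ae_eq h one_lt_two t s₁ s₂)
    have e : series σ Φ F t s₁ s₂ = F s₁ s₂ := funext fun x => by rw [series, if_pos (by omega)]
    rw [e]
    exact (hF.finCont.cont s₁ s₂).continuous

theorem FinSmooth.hasDerivAt_expand (h : IsPotential σ R Φ) (hF : FinSmooth σ N F) (t : ℝ)
    (n₁ n₂ : ℕ) (x : Phase (n₁ + n₂)) :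
    HasDerivAt (fun s => TopologicalParticles.expand (TopologicalParticles.transport σ Φ s F) n₁ n₂ x)
      (TopologicalParticles.expand (TopologicalParticles.transport σ Φ t
        (TopologicalParticles.liouvilleSeq Φ F)) n₁ n₂ x) t := by
  rw [expand_eq_sum (transport_vanish (hF.liouvilleSeq h).vanish t)]
  simp only [fun s => expand_eq_sum (transport_vanish (σ := σ) (Φ := Φ) hF.vanish s) n₁ n₂ x]
  exact HasDerivAt.fun_sum fun k _ =>
    hasDerivAt_integral_comp_flow_join h (hF.smooth (k.1 + n₁) (n₂ + k.2)) x t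

/-- The operator `expand` is linear and bounded, so the convergence of difference quotients follows
from that of the transported components, of which only finitely many are nonzero. -/
theorem FinSmooth.tendsto_expand (h : IsPotential σ R Φ) (hα : 1 < α) (hF : FinSmooth σ N F)
    (t : ℝ) :
    Tendsto (fun s : ℝ => normL1 α (s⁻¹ • (TopologicalParticles.expand
        (TopologicalParticles.transport σ Φ (t + s) F) - TopologicalParticles.expand
        (TopologicalParticles.transport σ Φ t F)) - TopologicalParticles.expand
        (TopologicalParticles.transport σ Φ t (TopologicalParticles.liouvilleSeq Φ F))))
      (𝓝[≠] 0) (𝓝 0) := by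
  have h0 : 0 < α := one_pos.trans hα
  set T := fun s => TopologicalParticles.transport σ Φ s F with hT
  set L := TopologicalParticles.transport σ Φ t (TopologicalParticles.liouvilleSeq Φ F) with hL
  have hTc : ∀ s, FinCont σ N (T s) := fun s => (hF.transport h s).finCont
  have hLc : FinCont σ N L := (hF.liouvilleSeq h).transport h t
  have hE : ∀ s : ℝ, FinCont σ N (s⁻¹ • (T (t + s) - T t) - L) := fun s =>
    (((hTc _).sub (hTc _)).smul _).sub hLc
  have hexp : ∀ s : ℝ, TopologicalParticles.expand (s⁻¹ • (T (t + s) - T t) - L) =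
      s⁻¹ • (TopologicalParticles.expand (T (t + s)) - TopologicalParticles.expand (T t)) -
        TopologicalParticles.expand L := by
    intro s
    refine (hE s).expand.eq_of_ae
      ((((hTc _).expand.sub (hTc _).expand).smul _).sub hLc.expand) fun n₁ n₂ => ae_of_all _ fun x => ?_
    have hi := fun {G : DoubleSeq} (hG : FinCont σ N G) (k : ℕ × ℕ) =>
      (hG.cont (k.1 + n₁) (n₂ + k.2)).integrable_join x
    simp only [Pi.sub_apply, Pi.smul_apply, smul_eq_mul]
    rw [expand_eq_sum (hE s).vanish, expand_eq_sum (hTc _).vanish, expand_eq_sum (hTc _).vanish,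
      expand_eq_sum hLc.vanish, ← Finset.sum_sub_distrib, Finset.mul_sum, ← Finset.sum_sub_distrib]
    refine Finset.sum_congr rfl fun k _ => ?_
    simp only [TopologicalParticles.reduce]
    rw [← integral_sub (hi (hTc _) k) (hi (hTc _) k), ← integral_const_mul]
    exact integral_sub (hi (((hTc (t + s)).sub (hTc t)).smul s⁻¹) k) (hi hLc k)
  have hlim : Tendsto (fun s : ℝ => normL1 α (s⁻¹ • (T (t + s) - T t) - L)) (𝓝[≠] 0) (𝓝 0) := by
    simp only [fun s => (hE s).normL1_eq (α := α)]
    have h1 : ∀ n : ℕ × ℕ, Tendsto (fun s : ℝ => compNorm α (s⁻¹ • (T (t + s) - T t) - L) n)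
        (𝓝[≠] 0) (𝓝 0) := fun n => by
      have := (tendsto_integral_slope_comp_flow h (hF.smooth n.1 n.2) t).const_mul (α ^ (n.1 + n.2))
      rw [mul_zero] at this
      exact this
    simpa only [Finset.sum_const_zero] using
      tendsto_finsetSum (Finset.range N ×ˢ Finset.range N) fun n _ => h1 n
  have hc := hlim.const_mul (((1 - α⁻¹)⁻¹) ^ 2)
  rw [mul_zero] at hc
  refine squeeze_zero (fun s => normL1_nonneg h0.le _) (fun s => ?_) hc
  rw [← hexp s]
  exact ((hE s).memL1.summableSeq.expand hα).2

end TopologicalParticles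

/-! ### Duality of the hierarchy with its formal adjoint -/

namespace TopologicalParticles

open Set

variable {σ R α C : ℝ} {Φ : ℝ → ℝ} {N : ℕ} {F : DoubleSeq}

/-! ### The interaction with the outermost particles -/

/-- `Φ'(q_2 - q_1) ∂F/∂p_2` for the two leftmost particles. -/
noncomputable def forceLeft (Φ : ℝ → ℝ) (F : DoubleSeq) : DoubleSeq := fun n₁ n₂ z =>
  if h : 1 < n₁ + n₂ then
    deriv Φ ((z ⟨1, h⟩).1 - (z ⟨0, by omega⟩).1) * dp ⟨1, h⟩ (F n₁ n₂) z
  else 0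

/-- `Φ'(q_{n-1} - q_n) ∂F/∂p_{n-1}` for the two rightmost particles. -/
noncomputable def forceRight (Φ : ℝ → ℝ) (F : DoubleSeq) : DoubleSeq := fun n₁ n₂ z =>
  if h : 1 < n₁ + n₂ then
    deriv Φ ((z ⟨n₁ + n₂ - 2, by omega⟩).1 - (z ⟨n₁ + n₂ - 1, by omega⟩).1) *
      dp ⟨n₁ + n₂ - 2, by omega⟩ (F n₁ n₂) z
  else 0

section Fubini

variable {n₁ n₂ : ℕ}

theorem integral_one_particle (g : Pt → ℝ) : ∫ w : Phase 1, g (w 0) = ∫ y, g y :=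
  (volume_preserving_funUnique (Fin 1) Pt).integral_comp' g

theorem volume_phase_zero : (volume : Measure (Phase 0)).real univ = 1 := by
  simp [Measure.real, volume_pi]

theorem reduce_one_zero (F : DoubleSeq) (x : Phase (n₁ + n₂)) :
    reduce 1 0 F n₁ n₂ x = ∫ y : Pt, F (n₁ + 1) n₂ (addLeft y x) := by
  have e : ∀ w : Phase 1 × Phase 0, F (1 + n₁) (n₂ + 0) (join w.1 x w.2) =
      F (n₁ + 1) n₂ (addLeft (w.1 0) x) := by
    intro w
    rw [seq_cast F (Nat.add_comm 1 n₁) (Nat.add_zero n₂)]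
    congr 1
    funext i
    rw [join_apply, addLeft]
    simp only [Fin.val_cast]
    by_cases hi : (i : ℕ) < 1
    · rw [dif_pos hi]
      have : (Fin.cast (by omega) i : Fin (n₁ + n₂ + 1)) = 0 := Fin.ext (by simpa using hi)
      rw [this, Fin.cons_zero]
      exact congrArg w.1 (Fin.ext (by simpa using hi))
    · rw [dif_neg hi, dif_pos (by omega)]
      have : (Fin.cast (by omega) i : Fin (n₁ + n₂ + 1)) = Fin.succ ⟨i - 1, by omega⟩ :=
        Fin.ext (by simp only [Fin.val_cast, Fin.val_succ]; omega)
      rw [this, Fin.cons_succ]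
  rw [reduce]
  simp only [e]
  rw [← integral_one_particle fun y => F (n₁ + 1) n₂ (addLeft y x)]
  refine (integral_fun_fst (μ := (volume : Measure (Phase 1))) (ν := (volume : Measure (Phase 0)))
    fun w => F (n₁ + 1) n₂ (addLeft (w 0) x)).trans ?_
  rw [volume_phase_zero, one_smul]

theorem reduce_zero_one (F : DoubleSeq) (x : Phase (n₁ + n₂)) :
    reduce 0 1 F n₁ n₂ x = ∫ y : Pt, F n₁ (n₂ + 1) (addRight x y) := by
  have e : ∀ w : Phase 0 × Phase 1, F (0 + n₁) (n₂ + 1) (join w.1 x w.2) =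
      F n₁ (n₂ + 1) (addRight x (w.2 0)) := by
    intro w
    rw [seq_cast F (Nat.zero_add n₁) rfl]
    congr 1
    funext i
    rw [join_apply, addRight]
    simp only [Fin.val_cast]
    rw [dif_neg (by omega)]
    by_cases hi : (i : ℕ) < 0 + (n₁ + n₂)
    · rw [dif_pos hi]
      have : (Fin.cast (by omega) i : Fin (n₁ + n₂ + 1)) = Fin.castSucc ⟨i, by omega⟩ :=
        Fin.ext (by simp)
      rw [this, Fin.snoc_castSucc]
      rfl
    · rw [dif_neg hi]
      have : (Fin.cast (by omega) i : Fin (n₁ + n₂ + 1)) = Fin.last _ :=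
        Fin.ext (by simp only [Fin.val_cast, Fin.val_last]; omega)
      rw [this, Fin.snoc_last]
      exact congrArg w.2 (Subsingleton.elim _ _)
  rw [reduce]
  simp only [e]
  rw [← integral_one_particle fun y => F n₁ (n₂ + 1) (addRight x y)]
  refine (integral_fun_snd (μ := (volume : Measure (Phase 0))) (ν := (volume : Measure (Phase 1)))
    fun w => F n₁ (n₂ + 1) (addRight x (w 0))).trans ?_
  rw [volume_phase_zero, one_smul]

/-- The added particle has position `0` and the former leftmost one position `1`. In this form the
interaction term is `𝔞₋` of a sequence, so that the adjunction with `creationLeft` applies. -/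
theorem leftTerm_eq (F : DoubleSeq) : leftTerm Φ F = reduce 1 0 (forceLeft Φ F) := by
  funext n₁ n₂ x
  rw [reduce_one_zero, leftTerm]
  by_cases hn : 0 < n₁ + n₂
  · rw [Finset.sum_eq_single (⟨0, hn⟩ : Fin (n₁ + n₂)), if_pos rfl]
    · refine integral_congr_ae (ae_of_all _ fun y => ?_)
      simp only [forceLeft]
      rw [dif_pos (by omega)]
      rfl
    · exact fun j _ hj => if_neg fun h => hj (Fin.ext h)
    · simp
  · simp only [forceLeft]
    rw [Finset.sum_eq_zero fun j _ => absurd j.2 (by omega)]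
    have : ¬ 1 < n₁ + 1 + n₂ := by omega
    simp only [this, dite_false, integral_zero]

theorem rightTerm_eq (F : DoubleSeq) : rightTerm Φ F = reduce 0 1 (forceRight Φ F) := by
  funext n₁ n₂ x
  rw [reduce_zero_one, rightTerm]
  by_cases hn : 0 < n₁ + n₂
  · rw [Finset.sum_eq_single (⟨n₁ + n₂ - 1, by omega⟩ : Fin (n₁ + n₂)),
      if_pos (by simp only; omega)]
    · refine integral_congr_ae (ae_of_all _ fun y => ?_)
      simp only [forceRight]
      rw [dif_pos (by omega)]
      have e1 : (⟨n₁ + (n₂ + 1) - 2, by omega⟩ : Fin (n₁ + (n₂ + 1))) =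
          Fin.cast (by omega) (Fin.castSucc (⟨n₁ + n₂ - 1, by omega⟩ : Fin (n₁ + n₂))) :=
        Fin.ext (by simp only [Fin.val_cast, Fin.val_castSucc]; omega)
      have e2 : addRight x y ⟨n₁ + (n₂ + 1) - 2, by omega⟩ = x ⟨n₁ + n₂ - 1, by omega⟩ := by
        rw [e1]
        exact Fin.snoc_castSucc (α := fun _ => Pt) y x ⟨n₁ + n₂ - 1, by omega⟩
      have e3 : addRight x y ⟨n₁ + (n₂ + 1) - 1, by omega⟩ = y := by
        have e4 : (⟨n₁ + (n₂ + 1) - 1, by omega⟩ : Fin (n₁ + (n₂ + 1))) =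
            Fin.cast (by omega) (Fin.last (n₁ + n₂)) :=
          Fin.ext (by simp only [Fin.val_cast, Fin.val_last]; omega)
        rw [e4]
        exact Fin.snoc_last (α := fun _ => Pt) y x
      rw [e2, e3, e1]
    · refine fun j _ hj => if_neg fun h => hj (Fin.ext ?_)
      change (j : ℕ) = n₁ + n₂ - 1
      omega
    · simp
  · simp only [forceRight]
    rw [Finset.sum_eq_zero fun j _ => absurd j.2 (by omega)]
    have : ¬ 1 < n₁ + (n₂ + 1) := by omega
    simp only [this, dite_false, integral_zero]

end Fubini

section Adjoint

variable {n : ℕ}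

theorem continuousOn_neighbourForce (h : IsPotential σ R Φ) {i j : Fin n}
    (hij : (i : ℕ) + 1 = j ∨ (j : ℕ) + 1 = i) :
    ContinuousOn (fun x : Phase n => deriv Φ ((x i).1 - (x j).1)) (Allowed σ n) := by
  rcases hij with hij | hij
  · exact continuousOn_force h hij
  · refine (continuousOn_force h hij).neg.congr fun x _ => ?_
    rw [Pi.neg_apply, ← h.deriv_neg, neg_sub]

theorem FinSmooth.forceLeft (h : IsPotential σ R Φ) (hF : FinSmooth σ N F) :
    FinCont σ N (forceLeft Φ F) where
  vanish n₁ n₂ hn := by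
    funext z
    rw [TopologicalParticles.forceLeft, hF.vanish n₁ n₂ hn]
    split_ifs
    · simp [dp]
    · rfl
  cont n₁ n₂ := by
    by_cases hn : 1 < n₁ + n₂
    · have e : TopologicalParticles.forceLeft Φ F n₁ n₂ = fun z =>
          deriv Φ ((z ⟨1, hn⟩).1 - (z ⟨0, by omega⟩).1) * dp ⟨1, hn⟩ (F n₁ n₂) z :=
        funext fun z => dif_pos hn
      rw [e]
      exact ((hF.smooth n₁ n₂).fderiv_apply _).mul_left (continuousOn_neighbourForce h (Or.inr rfl))
    · have e : TopologicalParticles.forceLeft Φ F n₁ n₂ = 0 := funext fun z => dif_neg hn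
      rw [e]
      exact .zero

theorem FinSmooth.forceRight (h : IsPotential σ R Φ) (hF : FinSmooth σ N F) :
    FinCont σ N (forceRight Φ F) where
  vanish n₁ n₂ hn := by
    funext z
    rw [TopologicalParticles.forceRight, hF.vanish n₁ n₂ hn]
    split_ifs
    · simp [dp]
    · rfl
  cont n₁ n₂ := by
    by_cases hn : 1 < n₁ + n₂
    · have e : TopologicalParticles.forceRight Φ F n₁ n₂ = fun z =>
          deriv Φ ((z ⟨n₁ + n₂ - 2, by omega⟩).1 - (z ⟨n₁ + n₂ - 1, by omega⟩).1) *
            dp ⟨n₁ + n₂ - 2, by omega⟩ (F n₁ n₂) z := funext fun z => dif_pos hn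
      rw [e]
      exact ((hF.smooth n₁ n₂).fderiv_apply _).mul_left
        (continuousOn_neighbourForce h (Or.inl (by simp only; omega)))
    · have e : TopologicalParticles.forceRight Φ F n₁ n₂ = 0 := funext fun z => dif_neg hn
      rw [e]
      exact .zero

theorem bbgky_eq (F : DoubleSeq) : bbgky Φ F =
    liouvilleSeq Φ F + reduce 1 0 (forceLeft Φ F) + reduce 0 1 (forceRight Φ F) := by
  rw [← leftTerm_eq, ← rightTerm_eq]
  rfl

theorem FinSmooth.bbgky (h : IsPotential σ R Φ) (hF : FinSmooth σ N F) : FinCont σ N (bbgky Φ F) := by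
  rw [bbgky_eq]
  exact ((hF.liouvilleSeq h).add ((hF.forceLeft h).reduce 1 0)).add ((hF.forceRight h).reduce 0 1)

/-- Integration by parts in one momentum: the force depends on positions only and is not
differentiated. -/
theorem integral_mul_force_mul_dp (h : IsPotential σ R Φ) {i j k : Fin n}
    (hij : (i : ℕ) + 1 = j ∨ (j : ℕ) + 1 = i) {c f : Phase n → ℝ}
    (hc : ContDiffOn ℝ 1 c (Allowed σ n)) (hf : SmoothCompact σ f) :
    ∫ z, c z * (deriv Φ ((z i).1 - (z j).1) * dp k f z) =
      ∫ z, -deriv Φ ((z i).1 - (z j).1) * fderiv ℝ c z (Pi.single k ((0 : ℝ), (1 : ℝ))) * f z := by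
  set v : Phase n := Pi.single k ((0 : ℝ), (1 : ℝ)) with hv
  have hw := continuousOn_neighbourForce h hij
  have hU := isOpen_allowed σ n
  have hcv : ContinuousOn (fun z => fderiv ℝ c z v) (Allowed σ n) :=
    (hc.continuousOn_fderiv_of_isOpen hU le_rfl).clm_apply continuousOn_const
  have h1 := integral_mul_fderiv_eq_zero (v := v) (hf.mul_left hc) hw fun x s => by
    have : ∀ l : Fin n, (v l).1 = 0 := fun l => by
      by_cases hl : l = k
      · rw [hv, hl, Pi.single_eq_same]
      · rw [hv, Pi.single_eq_of_ne hl]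
        rfl
    simp only [Pi.add_apply, Pi.smul_apply, Prod.fst_add, Prod.smul_fst, this, smul_zero, add_zero]
  have h2 : ∀ z, deriv Φ ((z i).1 - (z j).1) * fderiv ℝ (fun x => c x * f x) z v =
      c z * (deriv Φ ((z i).1 - (z j).1) * dp k f z) -
        -deriv Φ ((z i).1 - (z j).1) * fderiv ℝ c z v * f z := by
    intro z
    by_cases hz : z ∈ Allowed σ n
    · rw [fderiv_fun_mul ((hc.differentiableOn one_ne_zero).differentiableAt (hU.mem_nhds hz))
        (hf.smooth.differentiable one_ne_zero z)]
      simp only [add_apply, smul_apply, smul_eq_mul, dp]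
      ring
    · have h3 := ((hf.mul_left hc).fderiv_apply v).eq_zero hz
      have h4 := (hf.fderiv_apply v).eq_zero hz
      rw [h3, hf.contCompact.eq_zero hz, dp, h4]
      ring
  simp only [h2] at h1
  rw [integral_sub] at h1
  · exact sub_eq_zero.1 h1
  · exact (((hf.fderiv_apply v).mul_left hw).mul_left hc.continuousOn).integrable
  · exact (hf.contCompact.mul_left (hw.neg.mul hcv)).integrable

theorem kickLeft_eq {n₁ n₂ : ℕ} (hn : 1 < n₁ + 1 + n₂) (z : Phase (n₁ + 1 + n₂)) :
    kickLeft Φ z = deriv Φ ((z ⟨0, by omega⟩).1 - (z ⟨1, hn⟩).1) •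
      dropLeft (Pi.single ⟨1, hn⟩ ((0 : ℝ), (1 : ℝ))) := by
  funext j
  rw [kickLeft, Pi.smul_apply, dropLeft]
  split_ifs with hj
  · have e1 : (Fin.cast (by omega) j.succ : Fin (n₁ + 1 + n₂)) = ⟨1, hn⟩ :=
      Fin.ext (by simp [hj])
    have e0 : (Fin.cast (by omega) j.castSucc : Fin (n₁ + 1 + n₂)) = ⟨0, by omega⟩ :=
      Fin.ext (by simp [hj])
    rw [e1, e0, Pi.single_eq_same]
    simp
  · rw [Pi.single_eq_of_ne, smul_zero]
    intro h
    have := congrArg Fin.val h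
    simp only [Fin.val_cast, Fin.val_succ] at this
    omega

theorem kickRight_eq {n₁ n₂ : ℕ} (hn : 1 < n₁ + (n₂ + 1)) (z : Phase (n₁ + (n₂ + 1))) :
    kickRight Φ z = -deriv Φ ((z ⟨n₁ + (n₂ + 1) - 2, by omega⟩).1 -
      (z ⟨n₁ + (n₂ + 1) - 1, by omega⟩).1) •
      dropRight (Pi.single ⟨n₁ + (n₂ + 1) - 2, by omega⟩ ((0 : ℝ), (1 : ℝ))) := by
  funext j
  rw [kickRight, Pi.smul_apply, dropRight]
  split_ifs with hj
  · have e1 : (Fin.cast (by omega) j.succ : Fin (n₁ + (n₂ + 1))) =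
        ⟨n₁ + (n₂ + 1) - 1, by omega⟩ :=
      Fin.ext (by simp only [Fin.val_cast, Fin.val_succ]; omega)
    have e0 : (Fin.cast (by omega) j.castSucc : Fin (n₁ + (n₂ + 1))) =
        ⟨n₁ + (n₂ + 1) - 2, by omega⟩ :=
      Fin.ext (by simp only [Fin.val_cast, Fin.val_castSucc]; omega)
    rw [e1, e0, Pi.single_eq_same]
    simp
  · rw [Pi.single_eq_of_ne, smul_zero]
    intro h
    have := congrArg Fin.val h
    simp only [Fin.val_cast, Fin.val_castSucc] at this
    omega

variable {b : DoubleSeq}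

/-- Integration by parts moves the momentum derivative from `F` to `b`. The force times the
derivative of `b` at the second particle is the action of `kickLeft`, hence of the commutator. -/
theorem integral_creationLeft_mul (h : IsPotential σ R Φ) (hb : SmoothSeq σ b)
    (hF : FinSmooth σ N F) (n₁ n₂ : ℕ) :
    ∫ z, creationLeft b n₁ n₂ z * forceLeft Φ F n₁ n₂ z = ∫ z, commLeft Φ b n₁ n₂ z * F n₁ n₂ z := by
  cases n₁ with
  | zero => simp only [creationLeft_zero, commLeft_zero, zero_mul]
  | succ n₁ =>
    have hz : ∀ z ∉ Allowed σ (n₁ + 1 + n₂), F (n₁ + 1) n₂ z = 0 := fun z hz =>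
      (hF.smooth _ _).contCompact.eq_zero hz
    by_cases hn : 1 < n₁ + 1 + n₂
    · have h1 := integral_mul_force_mul_dp h (i := ⟨1, hn⟩) (j := ⟨0, by omega⟩) (k := ⟨1, hn⟩)
        (Or.inr rfl) (hb.creationLeft (n₁ + 1) n₂) (hF.smooth (n₁ + 1) n₂)
      simp only [forceLeft, dif_pos hn]
      rw [h1]
      refine integral_congr_ae (ae_of_all _ fun z => ?_)
      simp only
      by_cases hz' : z ∈ Allowed σ (n₁ + 1 + n₂)
      · congr 1
        have hd := hb.differentiableAt (dropLeft_mem hz')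
        rw [commLeft_succ hd, kickLeft_eq hn, map_smul, smul_eq_mul, ← h.deriv_neg, neg_sub]
        congr 1
        exact fderiv_comp_dropLeft hd _
      · rw [hz z hz', mul_zero, mul_zero]
    -- A single particle has no neighbour to act on, and both integrands vanish.
    · refine integral_congr_ae (ae_of_all _ fun z => ?_)
      simp only [forceLeft, dif_neg hn, mul_zero]
      by_cases hz' : z ∈ Allowed σ (n₁ + 1 + n₂)
      · have e : kickLeft Φ z = 0 := funext fun j => absurd j.2 (by omega)
        rw [commLeft_succ (hb.differentiableAt (dropLeft_mem hz')), e, map_zero, zero_mul]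
      · rw [hz z hz', mul_zero]

theorem integral_creationRight_mul (h : IsPotential σ R Φ) (hb : SmoothSeq σ b)
    (hF : FinSmooth σ N F) (n₁ n₂ : ℕ) :
    ∫ z, creationRight b n₁ n₂ z * forceRight Φ F n₁ n₂ z =
      ∫ z, commRight Φ b n₁ n₂ z * F n₁ n₂ z := by
  cases n₂ with
  | zero => simp only [creationRight_zero, commRight_zero, zero_mul]
  | succ n₂ =>
    have hz : ∀ z ∉ Allowed σ (n₁ + (n₂ + 1)), F n₁ (n₂ + 1) z = 0 := fun z hz =>
      (hF.smooth _ _).contCompact.eq_zero hz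
    by_cases hn : 1 < n₁ + (n₂ + 1)
    · have h1 := integral_mul_force_mul_dp h (i := ⟨n₁ + (n₂ + 1) - 2, by omega⟩)
        (j := ⟨n₁ + (n₂ + 1) - 1, by omega⟩) (k := ⟨n₁ + (n₂ + 1) - 2, by omega⟩)
        (Or.inl (by simp only; omega)) (hb.creationRight n₁ (n₂ + 1)) (hF.smooth n₁ (n₂ + 1))
      simp only [forceRight, dif_pos hn]
      rw [h1]
      refine integral_congr_ae (ae_of_all _ fun z => ?_)
      simp only
      by_cases hz' : z ∈ Allowed σ (n₁ + (n₂ + 1))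
      · congr 1
        have hd := hb.differentiableAt (dropRight_mem hz')
        rw [commRight_succ hd, kickRight_eq hn, map_smul, smul_eq_mul]
        congr 1
        rw [funext fun y => creationRight_succ b n₁ n₂ y]
        exact fderiv_comp_dropRight hd _
      · rw [hz z hz', mul_zero, mul_zero]
    · refine integral_congr_ae (ae_of_all _ fun z => ?_)
      simp only [forceRight, dif_neg hn, mul_zero]
      by_cases hz' : z ∈ Allowed σ (n₁ + (n₂ + 1))
      · have e : kickRight Φ z = 0 := funext fun j => absurd j.2 (by omega)
        rw [commRight_succ (hb.differentiableAt (dropRight_mem hz')), e, map_zero, zero_mul]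
      · rw [hz z hz', mul_zero]

theorem integral_add_add {f₁ f₂ f₃ : Phase n → ℝ} (h₁ : Integrable f₁) (h₂ : Integrable f₂)
    (h₃ : Integrable f₃) :
    ∫ x, (f₁ x + f₂ x + f₃ x) = (∫ x, f₁ x) + (∫ x, f₂ x) + ∫ x, f₃ x := by
  rw [← integral_add h₁ h₂]
  exact integral_add (h₁.add h₂) h₃

theorem FinCont.pairing_eq (hF : FinCont σ N F) (c : DoubleSeq) :
    pairing c F = ∑ n ∈ Finset.range N ×ˢ Finset.range N, ∫ x, c n.1 n.2 x * F n.1 n.2 x :=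
  tsum_eq_sum fun n hn => by
    rw [hF.eq_zero hn]
    simp

/-- The duality of `bbgky` and `dualBbgky`. -/
theorem FinSmooth.pairing_bbgky (h : IsPotential σ R Φ) (hF : FinSmooth σ N F)
    (hs : SmoothSeq σ b) (hb : BoundedSeq σ C b) :
    pairing b (TopologicalParticles.bbgky Φ F) = pairing (dualBbgky Φ b) F := by
  have hL := hF.liouvilleSeq h
  have hl := hF.forceLeft h
  have hr := hF.forceRight h
  have hFi : ∀ {c : DoubleSeq}, (∀ n₁ n₂, ContinuousOn (c n₁ n₂) (Allowed σ (n₁ + n₂))) →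
      ∀ n : ℕ × ℕ, Integrable fun x => c n.1 n.2 x * F n.1 n.2 x := fun hc n =>
    ((hF.finCont.cont n.1 n.2).mul_left (hc n.1 n.2)).integrable
  have hLb := hs.continuousOn_liouville h
  have hlb : ∀ n₁ n₂, ContinuousOn (commLeft Φ b n₁ n₂) (Allowed σ (n₁ + n₂)) := fun n₁ n₂ =>
    (hs.creationLeft.continuousOn_liouville h n₁ n₂).sub (continuousOn_creationLeft hLb n₁ n₂)
  have hrb : ∀ n₁ n₂, ContinuousOn (commRight Φ b n₁ n₂) (Allowed σ (n₁ + n₂)) := fun n₁ n₂ =>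
    (hs.creationRight.continuousOn_liouville h n₁ n₂).sub (continuousOn_creationRight hLb n₁ n₂)
  have e1 : pairing b (TopologicalParticles.bbgky Φ F) =
      pairing b (TopologicalParticles.liouvilleSeq Φ F) +
      pairing (creationLeft b) (TopologicalParticles.forceLeft Φ F) +
      pairing (creationRight b) (TopologicalParticles.forceRight Φ F) := by
    rw [pairing_creationLeft hb (hl.memL1 (α := 1)), pairing_creationRight hb (hr.memL1 (α := 1)),
      (hF.bbgky h).pairing_eq, hL.pairing_eq, (hl.reduce 1 0).pairing_eq,
      (hr.reduce 0 1).pairing_eq, ← Finset.sum_add_distrib, ← Finset.sum_add_distrib, bbgky_eq]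
    refine Finset.sum_congr rfl fun n _ => ?_
    have hi := fun {G : DoubleSeq} (hG : FinCont σ N G) =>
      (hb.integrable_mul (hG.memL1 (α := 1)) n).1
    rw [← integral_add_add (hi hL) (hi (hl.reduce 1 0)) (hi (hr.reduce 0 1))]
    refine integral_congr_ae (ae_of_all _ fun x => ?_)
    simp only [Pi.add_apply]
    ring
  have e2 : pairing (dualBbgky Φ b) F =
      pairing (liouville Φ b) F + pairing (commLeft Φ b) F + pairing (commRight Φ b) F := by
    rw [hF.finCont.pairing_eq, hF.finCont.pairing_eq, hF.finCont.pairing_eq,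
      hF.finCont.pairing_eq, ← Finset.sum_add_distrib, ← Finset.sum_add_distrib, dualBbgky_eq]
    refine Finset.sum_congr rfl fun n _ => ?_
    rw [← integral_add_add (hFi hLb n) (hFi hlb n) (hFi hrb n)]
    refine integral_congr_ae (ae_of_all _ fun x => ?_)
    simp only [Pi.add_apply]
    ring
  rw [e1, e2]
  congr 1
  · congr 1
    · refine tsum_congr fun n => ?_
      refine (integral_mul_liouvilleStar h (hs n.1 n.2) (hF.smooth n.1 n.2)).trans ?_
      rw [← integral_neg]
      simp only [liouville, neg_mul]
    · exact tsum_congr fun n => integral_creationLeft_mul h hs hF n.1 n.2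
  · exact tsum_congr fun n => integral_creationRight_mul h hs hF n.1 n.2

end Adjoint

end TopologicalParticles

/-! ### Existence and uniqueness of strong solutions -/

namespace TopologicalParticles

open Set

variable {σ R α : ℝ} {Φ : ℝ → ℝ} {N : ℕ} {F : DoubleSeq}

/-! ### Strong solutions -/

theorem IsTest.exists_boundedSeq {b : DoubleSeq} (hb : IsTest σ Φ b) : ∃ C, BoundedSeq σ C b := by
  obtain ⟨B, hB0, hB, hbB⟩ := FiniteSeq.exists_bound hb.finite hb.bounded
  exact ⟨∑' n, B n, tsum_nonneg hB0, fun n₁ n₂ => (hb.smooth n₁ n₂).continuousOn,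
    fun n₁ n₂ x hx => (hbB n₁ n₂ x hx).trans (hB.le_tsum _ fun n _ => hB0 n)⟩

theorem integral_smooth_mul_eq {n : ℕ} {f g : Phase n → ℝ} (hf : ContCompact σ f)
    (hg : ContCompact σ g) (hfg : ∀ c : Phase n → ℝ, SmoothCompact σ c →
      ∫ x, c x * f x = ∫ x, c x * g x) : f = g := by
  have h1 : Integrable fun x => f x - g x := hf.integrable.sub hg.integrable
  have h2 := (isOpen_allowed σ n).ae_eq_zero_of_integral_contDiff_smul_eq_zero
    (h1.locallyIntegrable.locallyIntegrableOn _) fun c hc hcc hcs => by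
      have hcS : SmoothCompact σ c := ⟨hc.of_le (by exact_mod_cast le_top), hcc, hcs⟩
      simp only [smul_eq_mul, mul_sub]
      rw [integral_sub (hf.mul_left hc.continuous.continuousOn).integrable
        (hg.mul_left hc.continuous.continuousOn).integrable, hfg c hcS, sub_self]
  refine (hf.continuous.ae_eq_iff_eq volume hg.continuous).1 ?_
  filter_upwards [h2] with x hx
  by_cases hx' : x ∈ Allowed σ n
  · exact sub_eq_zero.1 (hx hx')
  · rw [hf.eq_zero hx', hg.eq_zero hx']

theorem FinCont.reduceInv (hF : FinCont σ N F) : FinCont σ N (reduceInv F) where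
  vanish n₁ n₂ hn := by
    funext x
    refine Finset.sum_eq_zero fun l _ => ?_
    rw [(hF.reduce l.1 l.2).vanish n₁ n₂ hn, Pi.zero_apply, mul_zero]
  cont n₁ n₂ := .sum _ fun l => ((hF.reduce l.1 l.2).cont n₁ n₂).const_mul _

/-- The expansion intertwines the right-hand side of the BBGKY hierarchy and the Liouville
operators. -/
theorem FinSmooth.bbgky_expand (h : IsPotential σ R Φ) (hF : FinSmooth σ N F) :
    TopologicalParticles.bbgky Φ (TopologicalParticles.expand F) =
      TopologicalParticles.expand (TopologicalParticles.liouvilleSeq Φ F) := by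
  have hB := hF.expand.bbgky h
  have hL := hF.liouvilleSeq h
  have hE : MemL1 σ 2 (TopologicalParticles.expand F) := hF.expand.finCont.memL1
  -- The relation is checked after applying `reduceInv`, against smooth test functions: the duality
  -- moves the hierarchy to its adjoint, which on these tests is the Liouville operator, and
  -- antisymmetry moves that back. The weight `2` serves only as some number larger than `1`.
  have h1 : TopologicalParticles.reduceInv
      (TopologicalParticles.bbgky Φ (TopologicalParticles.expand F)) =
      TopologicalParticles.liouvilleSeq Φ F := by
    funext n₁ n₂
    refine integral_smooth_mul_eq (hB.reduceInv.cont n₁ n₂) (hL.cont n₁ n₂) fun g hg => ?_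
    obtain ⟨hb, hp⟩ := isTest_single h hg
    obtain ⟨C, hC⟩ := hb.exists_boundedSeq
    rw [← (hp one_lt_two hB.memL1).1, hF.expand.pairing_bbgky h hb.smooth hC,
      (hp one_lt_two hE).2]
    refine Eq.trans ?_ (integral_mul_liouvilleStar h hg.smooth.contDiffOn (hF.smooth n₁ n₂)).symm
    congr 1
    refine integral_congr_ae ?_
    filter_upwards [(hF.finCont.memL1 (α := 2)).summableSeq.reduceInv_expand one_le_two n₁ n₂]
      with x hx
    rw [hx]
  rw [← h1]
  exact hB.eq_of_ae hB.reduceInv.expand fun n₁ n₂ =>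
    ((hB.memL1 (α := 2)).summableSeq.expand_reduceInv one_le_two n₁ n₂).symm

theorem FiniteSmooth.isStrongSolution (h : IsPotential σ R Φ) (hα : 1 < α) {F₀ : DoubleSeq}
    (hF : FiniteSmooth σ F₀) :
    IsStrongSolution σ Φ α F₀ (series σ Φ F₀) := by
  obtain ⟨N, hF⟩ := hF.exists_finSmooth
  have hD := hF.reduceInv
  have hb : ∀ t, bbgky Φ (series σ Φ F₀ t) =
      expand (transport σ Φ t (liouvilleSeq Φ (reduceInv F₀))) := fun t => by
    rw [hF.series_eq h, (hD.transport h t).bbgky_expand h, hD.liouvilleSeq_transport h]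
  refine ⟨fun t => ?_, ?_, fun t n₁ n₂ x => ?_, fun t => ?_⟩
  · rw [hF.series_eq h]
    exact (hD.transport h t).expand.finiteSmooth
  · rw [hF.series_eq h, transport_zero h]
    exact hD.expand.finCont.eq_of_ae hF.finCont fun n₁ n₂ =>
      (hF.finCont.memL1 (α := 2)).summableSeq.expand_reduceInv one_le_two n₁ n₂
  · rw [hb]
    simp only [hF.series_eq h]
    exact hD.hasDerivAt_expand h t n₁ n₂ x
  · simp only [hb]
    simp only [hF.series_eq h]
    exact hD.tendsto_expand h hα t

theorem FiniteSmooth.memL1 (hF : FiniteSmooth σ F) : MemL1 σ α F :=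
  let ⟨_, h⟩ := hF.exists_finSmooth
  h.finCont.memL1

theorem MemL1.smul (hF : MemL1 σ α F) (c : ℝ) : MemL1 σ α (c • F) ∧
    normL1 α (c • F) = |c| * normL1 α F :=
  have h := hF.summableSeq.const_mul c
  ⟨⟨h.1.integrable, fun n₁ n₂ x hx => by
    rw [Pi.smul_apply, Pi.smul_apply, Pi.smul_apply, hF.forbidden n₁ n₂ x hx, smul_zero],
    h.1.summable⟩, h.2⟩

/-- Test sequences are bounded, so convergence of difference quotients in norm gives convergence of
their pairings, and the duality rewrites the limit. Norm differentiability also gives the required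
continuity. -/
theorem IsStrongSolution.isWeakSolution (h : IsPotential σ R Φ) (hα : 1 ≤ α) {F₀ : DoubleSeq}
    {G : ℝ → DoubleSeq} (hG : IsStrongSolution σ Φ α F₀ G) : IsWeakSolution σ Φ α F₀ G := by
  have h0 : 0 ≤ α := zero_le_one.trans hα
  have hm : ∀ t, MemL1 σ α (G t) := fun t => (hG.smooth t).memL1
  have hB : ∀ t, MemL1 σ α (bbgky Φ (G t)) := fun t =>
    let ⟨_, hN⟩ := (hG.smooth t).exists_finSmooth
    (hN.bbgky h).memL1
  have hQ : ∀ t s, MemL1 σ α (s⁻¹ • (G (t + s) - G t)) := fun t s =>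
    (((hm _).sub h0 (hm _)).smul _).1
  refine ⟨hm, fun n₁ n₂ => by rw [hG.initial], fun t₀ => ?_, fun b hb t => ?_⟩
  · have h1 : Tendsto (fun s : ℝ => normL1 α (G (t₀ + s) - G t₀)) (𝓝[≠] 0) (𝓝 0) := by
      have h2 : Tendsto (fun s : ℝ => |s| * (normL1 α (s⁻¹ • (G (t₀ + s) - G t₀) -
          bbgky Φ (G t₀)) + normL1 α (bbgky Φ (G t₀)))) (𝓝[≠] 0) (𝓝 0) := by
        have h3 : Tendsto (fun s : ℝ => |s|) (𝓝[≠] 0) (𝓝 0) := by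
          have := (continuous_abs.tendsto (0 : ℝ)).mono_left (nhdsWithin_le_nhds (s := {0}ᶜ))
          rwa [abs_zero] at this
        have := h3.mul ((hG.norm t₀).add_const (normL1 α (bbgky Φ (G t₀))))
        rwa [zero_mul] at this
      refine squeeze_zero' (Eventually.of_forall fun s => normL1_nonneg h0 _) ?_ h2
      filter_upwards [self_mem_nhdsWithin] with s hs
      have h4 := (((hQ t₀ s).sub h0 (hB t₀)).summableSeq.sub h0
        ((hB t₀).smul (-1)).1.summableSeq).2
      rw [((hB t₀).smul (-1)).2, abs_neg, abs_one, one_mul, neg_one_smul, sub_neg_eq_add,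
        sub_add_cancel] at h4
      have h5 := ((hm (t₀ + s)).sub h0 (hm t₀)).smul s⁻¹
      rw [h5.2, abs_inv, inv_mul_le_iff₀ (abs_pos.2 hs)] at h4
      exact h4
    have h2 : Tendsto (fun s : ℝ => normL1 α (G (t₀ + s) - G t₀)) (𝓝 0) (𝓝 0) := by
      rw [← nhdsNE_sup_pure (0 : ℝ), tendsto_sup, nhdsNE_sup_pure]
      refine ⟨h1, ?_⟩
      rw [tendsto_pure_left]
      intro s hs
      have : normL1 α (G (t₀ + 0) - G t₀) = 0 := by
        rw [add_zero, sub_self, normL1]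
        simp
      rw [this]
      exact mem_of_mem_nhds hs
    have h3 : Tendsto (fun t => t - t₀) (𝓝 t₀) (𝓝 0) := by
      have : Continuous fun t => t - t₀ := by fun_prop
      simpa only [sub_self] using this.tendsto t₀
    simpa only [Function.comp_def, add_sub_cancel] using h2.comp h3
  · obtain ⟨C, hC⟩ := hb.exists_boundedSeq
    obtain ⟨N, hN⟩ := (hG.smooth t).exists_finSmooth
    rw [← hN.pairing_bbgky h hb.smooth hC, hasDerivAt_iff_tendsto_slope_zero,
      tendsto_iff_norm_sub_tendsto_zero]
    have h1 := (hG.norm t).const_mul C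
    rw [mul_zero] at h1
    refine squeeze_zero (fun s => norm_nonneg _) (fun s => ?_) h1
    have h2 : s⁻¹ • (pairing b (G (t + s)) - pairing b (G t)) - pairing b (bbgky Φ (G t)) =
        pairing b (s⁻¹ • (G (t + s) - G t) - bbgky Φ (G t)) := by
      rw [pairing_sub_right hα hC (hQ t s) (hB t), ← pairing_sub_right hα hC (hm _) (hm _)]
      congr 1
      rw [pairing, pairing, smul_eq_mul, ← tsum_mul_left]
      refine tsum_congr fun n => ?_
      rw [← integral_const_mul]
      refine integral_congr_ae (ae_of_all _ fun x => ?_)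
      simp only [Pi.smul_apply, smul_eq_mul]
      ring
    rw [h2]
    exact hC.abs_pairing_le hα ((hQ t s).sub h0 (hB t))

/-- Weak uniqueness gives equality almost everywhere; continuity of the components makes it exact.
-/
theorem IsStrongSolution.eq_series (h : IsPotential σ R Φ) (hα : 1 < α) {F₀ : DoubleSeq}
    {G : ℝ → DoubleSeq} (hF : FiniteSmooth σ F₀) (hG : IsStrongSolution σ Φ α F₀ G) :
    G = series σ Φ F₀ := by
  funext t
  obtain ⟨N, hN⟩ := (hG.smooth t).exists_finSmooth
  obtain ⟨M, hM⟩ := ((hF.isStrongSolution h hα).smooth t).exists_finSmooth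
  exact hN.finCont.eq_of_ae hM.finCont
    ((hG.isWeakSolution h hα.le).ae_eq_series h hα hF.memL1 t)

end TopologicalParticles

theorem theorem2 (σ R : ℝ) (Φ : ℝ → ℝ) (hΦ : IsPotential σ R Φ) (α : ℝ) (hα : 2 < α) :
    -- the generating operators are bounded, with the bound `2 ^ (n₁ + n₂)`
    (∀ (t : ℝ) (n₁ s₁ s₂ n₂ : ℕ), 1 ≤ s₁ + s₂ →
      ∀ f : Phase ((n₁ + s₁) + (s₂ + n₂)) → ℝ, Integrable f →
        (∀ x ∉ Allowed σ ((n₁ + s₁) + (s₂ + n₂)), f x = 0) →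
        Integrable (cumulant σ Φ n₁ s₁ s₂ n₂ t f) ∧
        ∫ x, |cumulant σ Φ n₁ s₁ s₂ n₂ t f x| ≤ 2 ^ (n₁ + n₂) * ∫ x, |f x|) ∧
    -- arbitrary initial data
    (∀ F₀ : DoubleSeq, MemL1 σ α F₀ →
      -- the series converges
      (∀ (t : ℝ) (s₁ s₂ : ℕ), 1 ≤ s₁ + s₂ → ∀ᵐ x : Phase (s₁ + s₂),
        (∀ n₁ n₂, Integrable (seriesIntegrand σ Φ F₀ t x n₁ n₂)) ∧
        Summable fun n : ℕ × ℕ =>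
          ∫ w : Phase n.1 × Phase n.2, |seriesIntegrand σ Φ F₀ t x n.1 n.2 w|) ∧
      -- it satisfies the bound
      (∀ t, MemL1 σ α (series σ Φ F₀ t) ∧
        normL1 α (series σ Φ F₀ t) ≤ ((1 - 2 / α)⁻¹) ^ 2 * normL1 α F₀) ∧
      -- it is the unique weak solution
      IsWeakSolution σ Φ α F₀ (series σ Φ F₀) ∧
      (∀ G : ℝ → DoubleSeq, IsWeakSolution σ Φ α F₀ G →
        ∀ t n₁ n₂, G t n₁ n₂ =ᵐ[volume] series σ Φ F₀ t n₁ n₂)) ∧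
    -- for finite smooth initial data it is the unique strong solution
    (∀ F₀ : DoubleSeq, FiniteSmooth σ F₀ →
      IsStrongSolution σ Φ α F₀ (series σ Φ F₀) ∧
      (∀ G : ℝ → DoubleSeq, IsStrongSolution σ Φ α F₀ G → G = series σ Φ F₀)) := by
  have h1 : 1 < α := one_lt_two.trans hα
  refine ⟨fun t n₁ s₁ s₂ n₂ hs f hf hf0 => integrable_cumulant hΦ hs t hf hf0,
    fun F₀ hF => ⟨fun t s₁ s₂ hs => hF.ae_summable_series hΦ hα t s₁ s₂ hs,
      fun t => hF.series hΦ hα t, hF.isWeakSolution hΦ hα,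
      fun G hG t n₁ n₂ => hG.ae_eq_series hΦ h1 hF t n₁ n₂⟩,
    fun F₀ hF => ⟨hF.isStrongSolution hΦ h1, fun G hG => hG.eq_series hΦ h1 hF⟩⟩
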